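/- **Setting.** Consider third-order ODEs $y'''=F(x,y,y',y'')$ with $F=F(x,y,p,q)$ smooth on an open set $U$ of the space of jets $(x,y,p,q)$ and $F_{qq}\neq0$ there, up to local fiber-preserving (f.p.) transformations $\bar x=\chi(x)$, $\bar y=\eta(x,y)$, $\chi'\ne0$, $\eta_y\neq 0$. Such an ODE defines the 6-manifold $P=\{(x,y,p,q,\alpha,\gamma):(x,y,p,q)\in U,\ \alpha\ne0\}$ and on it Cartan's f.p.-invariant coframe $(\theta^1,\theta^2,\theta^3,\theta^4,\Omega^1,\Omega^2)$: with $\omega^1=dy-p\,dx$, $\omega^2=dp-q\,dx$, $\omega^3=dq-F\,dx$, $\omega^4=dx$ and $K=\frac16(F_{qx}+pF_{qy}+qF_{qp}+FF_{qq})-\frac19F_q^2-\frac12F_p$, $$\theta^1=\alpha\omega^1,\quad \theta^2=\tfrac16F_{qq}(\omega^2+\gamma\omega^1),\quad \theta^3=\tfrac{1}{36\alpha}F_{qq}^2\big(\omega^3+(\gamma-\tfrac13F_q)\omega^2+(\tfrac12\gamma^2+K)\omega^1\big),\quad \theta^4=\tfrac{6\alpha}{F_{qq}}\omega^4,$$ $$\Omega^1=\tfrac1{F_{qq}}\big(-F_{qqq}\gamma^2+(\tfrac23F_{qqq}F_q+\tfrac13F_{qq}^2+2F_{qqp})\gamma+F_{qq}K_q+2F_{qqq}K-2F_{qqy}\big)\omega^1-\gamma\,\omega^4+\tfrac1\alpha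 d\alpha,$$ $$\begin{aligned}\Omega^2={}&-\tfrac1{6\alpha}F_{qq}(\tfrac12\gamma^2+\tfrac13F_q\gamma+K)\omega^4+\tfrac1{6\alpha}\big(-\tfrac12F_{qqq}\gamma^2+(\tfrac13F_{qqq}F_q+F_{qqp})\gamma+F_{qqq}K-F_{qqy}\big)\omega^2\\&+\tfrac1{6\alpha}\big(-\tfrac12F_{qqq}\gamma^3+(\tfrac16F_{qq}^2+\tfrac13F_{qqq}F_q+F_{qqp})\gamma^2+(F_{qq}K_q-F_{qqy}+F_{qqq}K)\gamma\\&\qquad-\tfrac13F_{qq}F_{qy}-F_{qq}K_p-\tfrac13F_{qq}F_qK_q+\tfrac13F_{qq}^2K\big)\omega^1+\tfrac1{6\alpha}F_{qq}\,d\gamma.\end{aligned}$$ A *metric associated with the ODE* is a smooth field $G$ of bilinear forms on the 4-dimensional base $M$ (a coordinate domain) of a smooth fibration $\pi:W\to M$ (a surjective submersion with connected fibers) of a nonempty open set $W\subseteq P$. A family of such metrics (each with its ODE and its fibration) is *admissible* if 1. every metric $G$ of the family has split signature $(2,2)$ and satisfies $Ric(G)=-G$ on $M$; 2. the family contains a metric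 associated with $y'''=\frac32\frac{y''^2}{y'}$ (on some domain in $\{p\neq0\}$); 3. $\pi^*G=\mu_{ij}\theta^i\theta^j+\nu_{iA}\theta^i\Omega^A+\rho_{AB}\Omega^A\Omega^B$ with coefficients $\mu_{ij},\nu_{iA},\rho_{AB}$ that are constant and the same for all members of the family. For smooth $A,B,C$ on an open set of the $(x,y)$-plane, let $G_{A,B}$ be the metric $$G_{A,B}=-[t^2+2B(x,y)]\,dx^2+2\,dt\,dx+[2A(x,y)-z^2]\,dy^2+2\,dz\,dy,$$ and let $E_{A,B,C}$ be the ODE $y'''=\frac32\frac{y''^2}{y'}+A(x,y)y'^3+C(x,y)y'^2+B(x,y)y'$ on $\{p\neq0\}$, with $\pi(x,y,p,q,\alpha,\gamma)=(x,y,z,t)$, $z=\gamma/p$, $t=q/p+\gamma$. **Theorem.** (a) The family of all metrics $G_{A,B}$ associated with the ODEs $E_{A,B,C}$ through (restrictions of) this $\pi$ is admissible. For all $A,B,C$ it has a member around every point of the manifold $P$ of $E_{A,B,C}$, with $\pi^*G=2\Omega^2(2\theta^1+\theta^4)+2\theta^4(2\theta^3+\Omega^2)$. (b) For every ODE with $F_{qq}\neq0$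 and every point $u$ of its $P$: the tensor $2\Omega^2(2\theta^1+\theta^4)+2\theta^4(2\theta^3+\Omega^2)$ is, on a neighbourhood of $u$, the pullback $\pi^*G$ of a split-signature metric with $Ric(G)=-G$ if and only if the ODE is, near the jet below $u$, f.p. equivalent to some $E_{A,B,C}$. (c) The family is unique: let $\mathcal F$ be any admissible family, $G$ one of its metrics, with fibration $\pi:W\to M$, and $u\in W$. Then the ODE of $G$ is f.p. equivalent, near the jet below $u$, to some $E_{A,B,C}$; and for every f.p. transformation to some $E_{A,B,C}$ near this jet, $G$ is near $\pi(u)$ isometric to $G_{A,B}$ near a point $(\bar x,\bar y,z,t)$, where $(\bar x,\bar y)$ is the image of the point $(x,y)$ below $u$. -/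

import Mathlib

open scoped ContDiff

noncomputable section

namespace ThirdOrderODE

/-- The partial derivative `∂f/∂vᵢ` of a function of `k` real variables. -/
def pd {k : ℕ} (i : Fin k) (f : (Fin k → ℝ) → ℝ) (v : Fin k → ℝ) : ℝ :=
  fderiv ℝ f v (Pi.single i 1)

/-! ### Third-order ODEs

The second jet space has coordinates `(x, y, p, q) = (v 0, v 1, v 2, v 3)`. -/

/-- The equation `y''' = F(x, y, y', y'')` on a domain `dom` of the second jet space. -/
structure ODE where
  dom : Set (Fin 4 → ℝ)
  F : (Fin 4 → ℝ) → ℝ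

/-- `F` is a smooth function on an open set, and `F_qq` has no zero there. -/
structure ODE.Regular (E : ODE) : Prop where
  isOpen_dom : IsOpen E.dom
  smooth : ContDiffOn ℝ ∞ E.F E.dom
  Fqq_ne_zero : ∀ v ∈ E.dom, pd 3 (pd 3 E.F) v ≠ 0

/-- The point `(x, y, p, q)` of the jet space below `(x, y, p, q, α, γ)`. -/
def jet (u : Fin 6 → ℝ) : Fin 4 → ℝ := ![u 0, u 1, u 2, u 3]

/-- The six-dimensional manifold `P`, with coordinates
`(x, y, p, q, α, γ) = (u 0, u 1, u 2, u 3, u 4, u 5)`. -/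
def ODE.P (E : ODE) : Set (Fin 6 → ℝ) := {u | jet u ∈ E.dom ∧ u 4 ≠ 0}

/-- The function `K` built from `F`. -/
def Kfun (F : (Fin 4 → ℝ) → ℝ) (v : Fin 4 → ℝ) : ℝ :=
  (1 / 6) * (pd 0 (pd 3 F) v + v 2 * pd 1 (pd 3 F) v + v 3 * pd 2 (pd 3 F) v
      + F v * pd 3 (pd 3 F) v)
    - (1 / 9) * (pd 3 F v) ^ 2 - (1 / 2) * pd 2 F v

/-- The values of the invariant coframe `(θ¹, θ², θ³, θ⁴, Ω¹, Ω²)` of `y''' = F(x, y, y', y'')`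
at the point `u` of `P`, on the tangent vector `X`. -/
def coframe (F : (Fin 4 → ℝ) → ℝ) (u X : Fin 6 → ℝ) : Fin 6 → ℝ :=
  let v := jet u
  let p := u 2
  let q := u 3
  let α := u 4
  let γ := u 5
  -- derivatives of `F` and `K`
  let Fq := pd 3 F v
  let Fqq := pd 3 (pd 3 F) v
  let Fqy := pd 1 (pd 3 F) v
  let Fqqq := pd 3 (pd 3 (pd 3 F)) v
  let Fqqp := pd 2 (pd 3 (pd 3 F)) v
  let Fqqy := pd 1 (pd 3 (pd 3 F)) v
  let K := Kfun F v
  let Kq := pd 3 (Kfun F) v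
  let Kp := pd 2 (Kfun F) v
  -- `ω¹ = dy - p dx`, `ω² = dp - q dx`, `ω³ = dq - F dx`, `ω⁴ = dx`, `dα`, `dγ`
  let ω1 := X 1 - p * X 0
  let ω2 := X 2 - q * X 0
  let ω3 := X 3 - F v * X 0
  let ω4 := X 0
  let dα := X 4
  let dγ := X 5
  ![α * ω1,
    (1 / 6) * Fqq * (ω2 + γ * ω1),
    (1 / (36 * α)) * Fqq ^ 2 *
      (ω3 + (γ - (1 / 3) * Fq) * ω2 + ((1 / 2) * γ ^ 2 + K) * ω1),
    (6 * α / Fqq) * ω4,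
    (1 / Fqq) * (-Fqqq * γ ^ 2 + ((2 / 3) * Fqqq * Fq + (1 / 3) * Fqq ^ 2 + 2 * Fqqp) * γ
        + Fqq * Kq + 2 * Fqqq * K - 2 * Fqqy) * ω1
      - γ * ω4 + (1 / α) * dα,
    -(1 / (6 * α)) * Fqq * ((1 / 2) * γ ^ 2 + (1 / 3) * Fq * γ + K) * ω4
      + (1 / (6 * α)) * (-(1 / 2) * Fqqq * γ ^ 2 + ((1 / 3) * Fqqq * Fq + Fqqp) * γ
          + Fqqq * K - Fqqy) * ω2
      + (1 / (6 * α)) * (-(1 / 2) * Fqqq * γ ^ 3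
          + ((1 / 6) * Fqq ^ 2 + (1 / 3) * Fqqq * Fq + Fqqp) * γ ^ 2
          + (Fqq * Kq - Fqqy + Fqqq * K) * γ
          - (1 / 3) * Fqq * Fqy - Fqq * Kp - (1 / 3) * Fqq * Fq * Kq
          + (1 / 3) * Fqq ^ 2 * K) * ω1
      + (1 / (6 * α)) * Fqq * dγ]

/-! ### Fiber-preserving transformations -/

/-- The total derivative `∂_x + p ∂_y + q ∂_p + F ∂_q` along the solutions of `y''' = F`. -/
def totalD (F f : (Fin 4 → ℝ) → ℝ) (v : Fin 4 → ℝ) : ℝ :=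
  pd 0 f v + v 2 * pd 1 f v + v 3 * pd 2 f v + F v * pd 3 f v

/-- A (local) fiber-preserving transformation `x̄ = χ(x)`, `ȳ = η(x, y)`. -/
structure FPTransformation where
  dom : Set (ℝ × ℝ)
  χ : ℝ → ℝ
  η : ℝ × ℝ → ℝ
  isOpen_dom : IsOpen dom
  smooth_χ : ContDiffOn ℝ ∞ χ (Prod.fst '' dom)
  smooth_η : ContDiffOn ℝ ∞ η dom
  deriv_χ_ne_zero : ∀ s ∈ dom, deriv χ s.1 ≠ 0
  deriv_η_ne_zero : ∀ s ∈ dom, fderiv ℝ η s (0, 1) ≠ 0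

namespace FPTransformation

variable (φ : FPTransformation)

/-- `x̄`, as a function on the jet space. -/
def xbar (v : Fin 4 → ℝ) : ℝ := φ.χ (v 0)

/-- `ȳ`, as a function on the jet space. -/
def ybar (v : Fin 4 → ℝ) : ℝ := φ.η (v 0, v 1)

/-- `p̄ = dȳ/dx̄` along the solutions of `y''' = F`. -/
def pbar (F : (Fin 4 → ℝ) → ℝ) (v : Fin 4 → ℝ) : ℝ :=
  totalD F φ.ybar v / totalD F φ.xbar v

/-- `q̄ = d²ȳ/dx̄²` along the solutions of `y''' = F`. -/
def qbar (F : (Fin 4 → ℝ) → ℝ) (v : Fin 4 → ℝ) : ℝ :=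
  totalD F (φ.pbar F) v / totalD F φ.xbar v

/-- `d³ȳ/dx̄³` along the solutions of `y''' = F`. -/
def rbar (F : (Fin 4 → ℝ) → ℝ) (v : Fin 4 → ℝ) : ℝ :=
  totalD F (φ.qbar F) v / totalD F φ.xbar v

/-- In a neighbourhood of the jet `v₀`, the substitution `φ` brings `E'` to `E`:
`ȳ''' = F'(x̄, ȳ, ȳ', ȳ'')` along the solutions of `y''' = F(x, y, y', y'')`. -/
def Relates (E : ODE) (v₀ : Fin 4 → ℝ) (E' : ODE) : Prop :=
  ∃ N : Set (Fin 4 → ℝ), IsOpen N ∧ v₀ ∈ N ∧ N ⊆ E.dom ∧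
    ∀ v ∈ N, (v 0, v 1) ∈ φ.dom ∧
      ![φ.xbar v, φ.ybar v, φ.pbar E.F v, φ.qbar E.F v] ∈ E'.dom ∧
      E'.F ![φ.xbar v, φ.ybar v, φ.pbar E.F v, φ.qbar E.F v] = φ.rbar E.F v

end FPTransformation

/-! ### Pseudo-Riemannian metrics in four variables

A metric is given by its matrix of coefficients in the coordinates of `ℝ⁴`. -/

/-- The value `g(X, Y)` of the bilinear form with matrix `g`. -/
def pairing (g : Matrix (Fin 4) (Fin 4) ℝ) (X Y : Fin 4 → ℝ) : ℝ :=
  ∑ i, ∑ j, g i j * X i * Y j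

/-- A symmetric bilinear form of signature `(2, 2)`. -/
def IsSplit (g : Matrix (Fin 4) (Fin 4) ℝ) : Prop :=
  ∃ T : Matrix (Fin 4) (Fin 4) ℝ, T.det ≠ 0 ∧
    T.transpose * g * T = Matrix.diagonal ![1, 1, -1, -1]

/-- The Christoffel symbol `Γᵏᵢⱼ` of the Levi-Civita connection. -/
def christoffel (g : (Fin 4 → ℝ) → Matrix (Fin 4) (Fin 4) ℝ) (k i j : Fin 4)
    (z : Fin 4 → ℝ) : ℝ :=
  (1 / 2) * ∑ l, (g z)⁻¹ k l *
    (pd i (fun w => g w j l) z + pd j (fun w => g w i l) z - pd l (fun w => g w i j) z)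

/-- The Ricci tensor `Ricᵢⱼ = Rᵏᵢₖⱼ`. -/
def ricci (g : (Fin 4 → ℝ) → Matrix (Fin 4) (Fin 4) ℝ) (i j : Fin 4) (z : Fin 4 → ℝ) : ℝ :=
  ∑ k, (pd k (christoffel g k i j) z - pd j (christoffel g k i k) z
    + ∑ l, (christoffel g k k l z * christoffel g l i j z
        - christoffel g k j l z * christoffel g l i k z))

/-- Near the point `z`, the metric `g` is isometric to the metric `g'` on the set `M'` near its
point `z'`. (A smooth map that pulls back one nondegenerate metric to another one in the same
dimension is a local diffeomorphism.) -/
def LocallyIsometric (g : (Fin 4 → ℝ) → Matrix (Fin 4) (Fin 4) ℝ) (z : Fin 4 → ℝ)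
    (g' : (Fin 4 → ℝ) → Matrix (Fin 4) (Fin 4) ℝ) (M' : Set (Fin 4 → ℝ))
    (z' : Fin 4 → ℝ) : Prop :=
  ∃ (O : Set (Fin 4 → ℝ)) (ψ : (Fin 4 → ℝ) → (Fin 4 → ℝ)),
    IsOpen O ∧ z ∈ O ∧ ContDiffOn ℝ ∞ ψ O ∧ ψ z = z' ∧
    ∀ w ∈ O, ψ w ∈ M' ∧
      ∀ X Y, pairing (g w) X Y = pairing (g' (ψ w)) (fderiv ℝ ψ w X) (fderiv ℝ ψ w Y)

/-! ### Metrics associated with ODEs -/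

/-- An ODE with `F_qq ≠ 0`, a nonempty open part `W` of its manifold `P`, a fibration
`π : W → M` (a smooth submersion with connected fibers onto a four-dimensional manifold `M`, in a
coordinate domain of `M`), and a field of bilinear forms on `M`. -/
structure MetricDatum where
  ode : ODE
  regular : ode.Regular
  W : Set (Fin 6 → ℝ)
  isOpen_W : IsOpen W
  nonempty_W : W.Nonempty
  W_subset : W ⊆ ode.P
  π : (Fin 6 → ℝ) → (Fin 4 → ℝ)
  smooth_π : ContDiffOn ℝ ∞ π W
  submersion_π : ∀ u ∈ W, Function.Surjective (fderiv ℝ π u)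
  connected_fiber : ∀ u ∈ W, IsConnected {w | w ∈ W ∧ π w = π u}
  G : (Fin 4 → ℝ) → Matrix (Fin 4) (Fin 4) ℝ
  smooth_G : ∀ i j, ContDiffOn ℝ ∞ (fun z => G z i j) (π '' W)

namespace MetricDatum

/-- The base `M` of the fibration. -/
def M (m : MetricDatum) : Set (Fin 4 → ℝ) := m.π '' m.W

/-- `G` is a split-signature Einstein metric on `M` with `Ric(G) = -G`. -/
def IsSplitEinstein (m : MetricDatum) : Prop :=
  ∀ z ∈ m.M, IsSplit (m.G z) ∧ ∀ i j, ricci m.G i j z = -m.G z i j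

/-- The pullback `π^*G` has the constant coefficients `Q` in the invariant coframe: the matrix `Q`
collects `μᵢⱼ`, `νᵢ_A / 2` and `ρ_AB` in
`π^*G = μᵢⱼ θⁱ θʲ + νᵢ_A θⁱ Ω^A + ρ_AB Ω^A Ω^B`. -/
def HasCoefficients (m : MetricDatum) (Q : Matrix (Fin 6) (Fin 6) ℝ) : Prop :=
  ∀ u ∈ m.W, ∀ X Y,
    pairing (m.G (m.π u)) (fderiv ℝ m.π u X) (fderiv ℝ m.π u Y) =
      ∑ a, ∑ b, Q a b * coframe m.ode.F u X a * coframe m.ode.F u Y b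

/-- The ODE of `m` is `y''' = (3/2) y''² / y'`. -/
def IsFlatModel (m : MetricDatum) : Prop :=
  ∀ v ∈ m.ode.dom, v 2 ≠ 0 ∧ m.ode.F v = (3 / 2) * (v 3) ^ 2 / v 2

end MetricDatum

/-- The three conditions on a family of metrics associated with ODEs. -/
structure IsAdmissible (𝓕 : Set MetricDatum) : Prop where
  splitEinstein : ∀ m ∈ 𝓕, m.IsSplitEinstein
  flatModel : ∃ m ∈ 𝓕, m.IsFlatModel
  sameCoefficients : ∃ Q : Matrix (Fin 6) (Fin 6) ℝ, Q.IsSymm ∧ ∀ m ∈ 𝓕, m.HasCoefficients Q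

/-! ### The distinguished family -/

/-- Three smooth functions `A`, `B`, `C` of `(x, y)` on an open set. -/
structure NormalForm where
  D : Set (ℝ × ℝ)
  A : ℝ × ℝ → ℝ
  B : ℝ × ℝ → ℝ
  C : ℝ × ℝ → ℝ
  isOpen_D : IsOpen D
  smooth_A : ContDiffOn ℝ ∞ A D
  smooth_B : ContDiffOn ℝ ∞ B D
  smooth_C : ContDiffOn ℝ ∞ C D

namespace NormalForm

/-- The equation `y''' = (3/2) y''²/y' + A(x,y) y'³ + C(x,y) y'² + B(x,y) y'`. -/
def ode (n : NormalForm) : ODE where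
  dom := {v | (v 0, v 1) ∈ n.D ∧ v 2 ≠ 0}
  F v := (3 / 2) * (v 3) ^ 2 / v 2 + n.A (v 0, v 1) * (v 2) ^ 3 + n.C (v 0, v 1) * (v 2) ^ 2
    + n.B (v 0, v 1) * v 2

/-- The four-dimensional manifold of the points `(x, y, z, t)`. -/
def M (n : NormalForm) : Set (Fin 4 → ℝ) := {z | (z 0, z 1) ∈ n.D}

/-- The metric `-[t² + 2B(x,y)] dx² + 2 dt dx + [2A(x,y) - z²] dy² + 2 dz dy`
in the coordinates `(x, y, z, t)`. -/
def metric (n : NormalForm) (w : Fin 4 → ℝ) : Matrix (Fin 4) (Fin 4) ℝ :=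
  !![-((w 3) ^ 2 + 2 * n.B (w 0, w 1)), 0, 0, 1;
     0, 2 * n.A (w 0, w 1) - (w 2) ^ 2, 1, 0;
     0, 1, 0, 0;
     1, 0, 0, 0]

end NormalForm

/-- The projection `(x, y, p, q, α, γ) ↦ (x, y, z, t)` with `z = γ/p` and `t = q/p + γ`. -/
def stdProj (u : Fin 6 → ℝ) : Fin 4 → ℝ := ![u 0, u 1, u 5 / u 2, u 3 / u 2 + u 5]

/-- The metrics `-[t² + 2B] dx² + 2 dt dx + [2A - z²] dy² + 2 dz dy` of the equations
`y''' = (3/2) y''²/y' + A y'³ + C y'² + B y'`. -/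
def distinguishedFamily : Set MetricDatum :=
  {m | ∃ n : NormalForm, m.ode = n.ode ∧ (∀ u ∈ m.W, m.π u = stdProj u) ∧
    ∀ z ∈ m.M, m.G z = n.metric z}

/-- The coefficients of `2 Ω² (2θ¹ + θ⁴) + 2 θ⁴ (2θ³ + Ω²)` in the coframe
`(θ¹, θ², θ³, θ⁴, Ω¹, Ω²)`. -/
def distinguishedCoefficients : Matrix (Fin 6) (Fin 6) ℝ :=
  !![0, 0, 0, 0, 0, 2;
     0, 0, 0, 0, 0, 0;
     0, 0, 0, 2, 0, 0;
     0, 0, 2, 0, 0, 2;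
     0, 0, 0, 0, 0, 0;
     2, 0, 0, 2, 0, 0]

end ThirdOrderODE

end

/-!
The statement is about metrics `G` on four-dimensional bases whose pullback `π^*G` has constant
coefficients in the invariant coframe. Everything rests on one identity: `π^*G` is degenerate along
the fibers of `π` and invariant along them, so for a vertical vector `V` the contraction of the
exterior derivative of the coframe with `V` is skew for the form of the coefficients
(`PullsBack.cond`). By `coframe_lift` the coframe is invariant under fiber-preserving
transformations, so an equation may be replaced by any equivalent one.

*The coefficients* (`IsAdmissible.exists_pullsBack`). For `y''' = 3 y''² / (2 y')` the coframe,
written in the basis `slBasis`, satisfies the structure equations of `𝔰𝔩(2, ℝ) ⊕ 𝔰𝔩(2, ℝ)`. The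
identity says that the form of the coefficients is invariant under its two-dimensional kernel, which
has to be abelian (`kernel_abelian`) and spanned by one vector in each summand. The form is then a sum
of multiples of the Killing forms of the summands, each divided by its kernel vector
(`exists_quotForm`), and the metric is locally a product of two surfaces of constant curvature. Since
the Ricci tensor is natural (`IsometryOn.ricci_eq`) and known on such products (`ricci_surfaces`),
`Ric(G) = -G` fixes the two multiples and split signature fixes the causal type of the kernel
vectors: the form is `slForm A B` with unit vectors `A`, `B`. The distinguished coefficients are the
case `A = B = (0, 0, 1)`.

*The equations* (`exists_normalForm_of_pullsBack`). For an equation with a metric whose coefficients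
are `slForm A B`, the identity gives `F_qqq = 0` and `F_qqp = -F_qq² / 3` (`Fqqq_Fqqp`), hence
`F_qq = 3 / (p - s)` with `s` a function of `x` and `y`. A first integral of `y' = s(x, y)`
(`exists_first_integral`), taken as the new dependent variable, turns this into `F_qq = 3 / p`, that
is, `F = 3 q² / (2 p) + β q + σ`. The identity now gives `β = 0` (`SemiNormal.beta_eq_zero`, for which
the cases of special `A` and `B` are treated separately) and forces `σ` to be
`A p³ + C p² + B p` with functions `A`, `B`, `C` of `x` and `y`.

*The metrics.* For the normal form `E_{A,B,C}` the distinguished coefficients are the pullback of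
`G_{A,B}`, as is seen in the coordinates `(x, y, z, t)` and two fiber coordinates
(`NormalForm.bil_metric`); and `G_{A,B}` satisfies `Ric(G) = -G` (`NormalForm.ricci_metric`).
Together with the invariance of the coframe this gives the existence statements.

*The isometries* (`exists_locallyIsometric`). It remains to compare `slForm A B`, for other unit
vectors, with the distinguished case. If the first components of both vectors vanish, shifts of `z`
and `t` by multiples of the fiber coordinates turn one form into the other. Otherwise the identity
forces the coefficients of the normal form to be `C = 0`, `B = B(x)` and `A = A(y)`. Then the two
metrics are products of surfaces of constant curvature, and coordinates in which a factor looks like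
one of `G_{A,B}` are found from a Riccati equation (`exists_factorCoords`). The functions found in
either case have differentials that vanish along the fibers of `π`, so they descend to the base
(`PullsBack.exists_descent`) and give a local isometry there.
-/

noncomputable section

namespace ThirdOrderODE

open Filter Topology

/-! ### Partial derivatives of smooth functions -/

section PartialDerivatives

variable {k : ℕ} {f g : (Fin k → ℝ) → ℝ} {v : Fin k → ℝ}

/-- Smoothness at a point. -/
abbrev Smooth {E F : Type*} [NormedAddCommGroup E] [NormedSpace ℝ E] [NormedAddCommGroup F]
    [NormedSpace ℝ F] (f : E → F) (v : E) : Prop := ContDiffAt ℝ ∞ f v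

lemma Smooth.diff {E F : Type*} [NormedAddCommGroup E] [NormedSpace ℝ E] [NormedAddCommGroup F]
    [NormedSpace ℝ F] {f : E → F} {v : E} (hf : Smooth f v) : DifferentiableAt ℝ f v :=
  hf.differentiableAt (by simp)

lemma fderiv_eq_sum_pd (f : (Fin k → ℝ) → ℝ) (v X : Fin k → ℝ) :
    fderiv ℝ f v X = ∑ i, X i * pd i f v := by
  have hX : X = ∑ i, X i • (Pi.single i 1 : Fin k → ℝ) := by
    ext j
    simp [Finset.sum_apply, Pi.single_apply]
  conv_lhs => rw [hX]
  simp [pd]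

lemma Smooth.pd (hf : Smooth f v) (i : Fin k) : Smooth (pd i f) v := by
  have h : Smooth (fderiv ℝ f) v := hf.fderiv_right (by simp)
  exact h.clm_apply contDiffAt_const

lemma pd_comm (hf : Smooth f v) (i j : Fin k) :
    ThirdOrderODE.pd i (ThirdOrderODE.pd j f) v = ThirdOrderODE.pd j (ThirdOrderODE.pd i f) v := by
  have h : Smooth (fderiv ℝ f) v := hf.fderiv_right (by simp)
  have hs : IsSymmSndFDerivAt ℝ f v := hf.isSymmSndFDerivAt (by simp; exact ENat.LEInfty.out)
  have key : ∀ X Y : Fin k → ℝ, fderiv ℝ (fun w => fderiv ℝ f w X) v Y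
      = fderiv ℝ (fderiv ℝ f) v Y X := by
    intro X Y
    have h1 := (h.diff.hasFDerivAt.clm_apply (hasFDerivAt_const X v)).fderiv
    rw [h1]; simp
  unfold ThirdOrderODE.pd
  rw [key, key]
  exact hs _ _

lemma pd_congr (h : f =ᶠ[𝓝 v] g) (i : Fin k) : pd i f v = pd i g v := by
  unfold pd; rw [h.fderiv_eq]

lemma pd_eventually_congr (h : f =ᶠ[𝓝 v] g) (i : Fin k) : pd i f =ᶠ[𝓝 v] pd i g := by
  filter_upwards [h.eventuallyEq_nhds] with w hw using pd_congr hw i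

lemma pd_congr_on {N : Set (Fin k → ℝ)} (hN : IsOpen N) (h : ∀ v ∈ N, f v = g v) (i : Fin k) :
    ∀ v ∈ N, pd i f v = pd i g v := fun _ hv =>
  pd_congr (Filter.eventuallyEq_of_mem (hN.mem_nhds hv) h) i

lemma pd_add (hf : Smooth f v) (hg : Smooth g v) (i : Fin k) :
    pd i (fun w => f w + g w) v = pd i f v + pd i g v := by
  unfold pd; rw [fderiv_fun_add hf.diff hg.diff]; rfl

lemma pd_sub (hf : Smooth f v) (hg : Smooth g v) (i : Fin k) :
    pd i (fun w => f w - g w) v = pd i f v - pd i g v := by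
  unfold pd; rw [fderiv_fun_sub hf.diff hg.diff]; rfl

lemma pd_mul (hf : Smooth f v) (hg : Smooth g v) (i : Fin k) :
    pd i (fun w => f w * g w) v = f v * pd i g v + g v * pd i f v := by
  unfold pd; rw [fderiv_fun_mul hf.diff hg.diff]; simp

lemma pd_const_mul (c : ℝ) (hf : Smooth f v) (i : Fin k) :
    pd i (fun w => c * f w) v = c * pd i f v := by
  unfold pd; rw [fderiv_const_mul hf.diff]; simp

lemma pd_const (c : ℝ) (i : Fin k) : pd i (fun _ => c) v = 0 := by
  unfold pd; simp

lemma pd_coord (i j : Fin k) : pd i (fun w => w j) v = if i = j then 1 else 0 := by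
  have h : HasFDerivAt (fun w : Fin k → ℝ => w j) (ContinuousLinearMap.proj (R := ℝ) j) v :=
    hasFDerivAt_apply j v
  unfold pd; rw [h.fderiv]
  simp [Pi.single_apply, eq_comm]

lemma pd_div (hf : Smooth f v) (hg : Smooth g v) (h0 : g v ≠ 0) (i : Fin k) :
    pd i (fun w => f w / g w) v = (pd i f v * g v - f v * pd i g v) / g v ^ 2 := by
  have hd : Smooth (fun w => f w / g w) v := hf.div hg h0
  have hne : ∀ᶠ w in 𝓝 v, g w ≠ 0 := hg.continuousAt.eventually_ne h0
  have h1 : f =ᶠ[𝓝 v] fun w => (f w / g w) * g w := by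
    filter_upwards [hne] with w hw
    field_simp
  have h2 := pd_congr h1 i
  rw [pd_mul hd hg] at h2
  rw [h2]
  field_simp
  ring

lemma pd_pow (hf : Smooth f v) (n : ℕ) (i : Fin k) :
    pd i (fun w => f w ^ n) v = n * f v ^ (n - 1) * pd i f v := by
  unfold pd; rw [fderiv_fun_pow n hf.diff]; simp

lemma pd_log (hf : Smooth f v) (h0 : f v ≠ 0) (i : Fin k) :
    pd i (fun w => Real.log (f w)) v = pd i f v / f v := by
  unfold pd; rw [fderiv.log hf.diff h0]; simp; ring

lemma smooth_coord (j : Fin k) : Smooth (fun w : Fin k → ℝ => w j) v :=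
  contDiffAt_apply ℝ ℝ j v

/-- The chain rule for a real function of a vector of functions. -/
lemma pd_comp {l : ℕ} {G : (Fin l → ℝ) → ℝ} {j : (Fin k → ℝ) → (Fin l → ℝ)}
    (hG : DifferentiableAt ℝ G (j v)) (hj : ∀ a, DifferentiableAt ℝ (fun w => j w a) v) (i : Fin k) :
    pd i (fun w => G (j w)) v = ∑ a, pd i (fun w => j w a) v * pd a G (j v) := by
  have hj' : DifferentiableAt ℝ j v := differentiableAt_pi.2 hj
  unfold pd
  have h := (hG.hasFDerivAt.comp v hj'.hasFDerivAt).fderiv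
  rw [show (fun w => G (j w)) = G ∘ j from rfl, h]
  simp only [ContinuousLinearMap.comp_apply]
  rw [fderiv_eq_sum_pd]
  refine Finset.sum_congr rfl fun a _ => ?_
  congr 1
  rw [fderiv_apply (by fun_prop)]; rfl

/-- A vector-valued function is smooth if its components are. -/
lemma smooth_pi {l : ℕ} {E : Type*} [NormedAddCommGroup E] [NormedSpace ℝ E]
    {j : E → (Fin l → ℝ)} {v : E} :
    Smooth j v ↔ ∀ a, Smooth (fun w => j w a) v := contDiffAt_pi

end PartialDerivatives

/-! ### The total derivative -/

section TotalDerivative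

variable {F f g : (Fin 4 → ℝ) → ℝ} {v : Fin 4 → ℝ} {N : Set (Fin 4 → ℝ)}

lemma Smooth.totalD (hF : Smooth F v) (hf : Smooth f v) : Smooth (totalD F f) v :=
  (((hf.pd 0).add ((smooth_coord 2).mul (hf.pd 1))).add ((smooth_coord 3).mul (hf.pd 2))).add
    (hF.mul (hf.pd 3))

lemma totalD_congr_on (hN : IsOpen N) (h : ∀ v ∈ N, f v = g v) :
    ∀ v ∈ N, totalD F f v = totalD F g v := fun v hv => by
  simp only [totalD, pd_congr_on hN h _ v hv]

lemma totalD_mul (hf : Smooth f v) (hg : Smooth g v) :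
    totalD F (fun w => f w * g w) v = f v * totalD F g v + g v * totalD F f v := by
  simp only [totalD, pd_mul hf hg]; ring

lemma totalD_add (hf : Smooth f v) (hg : Smooth g v) :
    totalD F (fun w => f w + g w) v = totalD F f v + totalD F g v := by
  simp only [totalD, pd_add hf hg]; ring

lemma totalD_sub (hf : Smooth f v) (hg : Smooth g v) :
    totalD F (fun w => f w - g w) v = totalD F f v - totalD F g v := by
  simp only [totalD, pd_sub hf hg]; ring

lemma totalD_const_mul (c : ℝ) (hf : Smooth f v) :
    totalD F (fun w => c * f w) v = c * totalD F f v := by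
  simp only [totalD, pd_const_mul c hf]; ring

lemma totalD_div (hf : Smooth f v) (hg : Smooth g v) (h0 : g v ≠ 0) :
    totalD F (fun w => f w / g w) v = (totalD F f v * g v - f v * totalD F g v) / g v ^ 2 := by
  simp only [totalD, pd_div hf hg h0]; field_simp; ring

lemma totalD_log (hf : Smooth f v) (h0 : f v ≠ 0) :
    totalD F (fun w => Real.log (f w)) v = totalD F f v / f v := by
  simp only [totalD, pd_log hf h0]; field_simp

lemma totalD_zero_on (hN : IsOpen N) (h : ∀ v ∈ N, f v = 0) : ∀ v ∈ N, totalD F f v = 0 :=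
  fun v hv => by
    rw [totalD_congr_on (g := fun _ => 0) hN h v hv]
    simp [totalD, pd_const]

/-- Expansion of a partial derivative of a total derivative. -/
lemma pd_totalD (hF : Smooth F v) (hf : Smooth f v) (i : Fin 4) :
    pd i (totalD F f) v = totalD F (pd i f) v
      + (if i = 2 then pd 1 f v else 0) + (if i = 3 then pd 2 f v else 0)
      + pd i F v * pd 3 f v := by
  have s1 := (smooth_coord (v := v) 2).mul (hf.pd 1)
  have s2 := (smooth_coord (v := v) 3).mul (hf.pd 2)
  have s3 := hF.mul (hf.pd 3)
  have e : totalD F f = fun w => ((pd 0 f w + w 2 * pd 1 f w) + w 3 * pd 2 f w)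
      + F w * pd 3 f w := rfl
  rw [e, pd_add (((hf.pd 0).add s1).add s2) s3, pd_add ((hf.pd 0).add s1) s2,
    pd_add (hf.pd 0) s1, pd_mul (smooth_coord 2) (hf.pd 1), pd_mul (smooth_coord 3) (hf.pd 2),
    pd_mul hF (hf.pd 3), pd_coord, pd_coord, pd_comm hf i 0, pd_comm hf i 1, pd_comm hf i 2,
    pd_comm hf i 3]
  simp only [totalD]
  split_ifs <;> ring

lemma pd_one_totalD (hF : Smooth F v) (hf : Smooth f v) :
    pd 1 (totalD F f) v = totalD F (pd 1 f) v + pd 1 F v * pd 3 f v := by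
  rw [pd_totalD hF hf]; simp

lemma pd_two_totalD (hF : Smooth F v) (hf : Smooth f v) :
    pd 2 (totalD F f) v = totalD F (pd 2 f) v + pd 1 f v + pd 2 F v * pd 3 f v := by
  rw [pd_totalD hF hf]; simp

lemma pd_three_totalD (hF : Smooth F v) (hf : Smooth f v) :
    pd 3 (totalD F f) v = totalD F (pd 3 f) v + pd 2 f v + pd 3 F v * pd 3 f v := by
  rw [pd_totalD hF hf]; simp

lemma Kfun_eq (F : (Fin 4 → ℝ) → ℝ) (v : Fin 4 → ℝ) :
    Kfun F v = (1 / 6) * totalD F (pd 3 F) v - (1 / 9) * (pd 3 F v) ^ 2 - (1 / 2) * pd 2 F v :=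
  rfl

lemma Smooth.Kfun (hF : Smooth F v) : Smooth (Kfun F) v := by
  have h : ThirdOrderODE.Kfun F = fun v => (1 / 6) * ThirdOrderODE.totalD F
    (ThirdOrderODE.pd 3 F) v - (1 / 9) * (ThirdOrderODE.pd 3 F v) ^ 2
    - (1 / 2) * ThirdOrderODE.pd 2 F v := rfl
  rw [h]
  exact ((contDiffAt_const.mul (hF.totalD (hF.pd 3))).sub
    (contDiffAt_const.mul ((hF.pd 3).pow 2))).sub (contDiffAt_const.mul (hF.pd 2))

end TotalDerivative

/-! ### Fiber-preserving transformations and the derivatives of `F` -/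

namespace FPTransformation

variable (φ : FPTransformation)

/-- The prolongation of `φ` to the second jets of the solutions of `y''' = F`. -/
def prol (F : (Fin 4 → ℝ) → ℝ) (v : Fin 4 → ℝ) : Fin 4 → ℝ :=
  ![φ.xbar v, φ.ybar v, φ.pbar F v, φ.qbar F v]

/-- `φ` is defined on the open set `N` of jets, where `F` is smooth. -/
structure TransformsOn (F : (Fin 4 → ℝ) → ℝ) (N : Set (Fin 4 → ℝ)) : Prop where
  isOpen : IsOpen N
  smooth : ∀ v ∈ N, Smooth F v
  mem_dom : ∀ v ∈ N, (v 0, v 1) ∈ φ.dom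

/-- `φ` brings `y''' = F'` to `y''' = F` on the open set `N` of jets. -/
structure RelatesOn (F F' : (Fin 4 → ℝ) → ℝ) (N : Set (Fin 4 → ℝ)) : Prop
    extends φ.TransformsOn F N where
  smooth' : ∀ v ∈ N, Smooth F' (φ.prol F v)
  rel : ∀ v ∈ N, F' (φ.prol F v) = φ.rbar F v

/-- The logarithm of `η_y`. -/
def logEta (v : Fin 4 → ℝ) : ℝ := Real.log (pd 1 φ.ybar v)

/-- The logarithm of `χ'`. -/
def logChi (v : Fin 4 → ℝ) : ℝ := Real.log (pd 0 φ.xbar v)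

variable {φ}

namespace TransformsOn

variable {F : (Fin 4 → ℝ) → ℝ} {N : Set (Fin 4 → ℝ)}

lemma smooth_xbar' {v : Fin 4 → ℝ} (hv : (v 0, v 1) ∈ φ.dom) : Smooth φ.xbar v := by
  have h1 : IsOpen (Prod.fst '' φ.dom) := isOpenMap_fst _ φ.isOpen_dom
  have h2 : ContDiffAt ℝ ∞ φ.χ (v 0) :=
    φ.smooth_χ.contDiffAt (h1.mem_nhds ⟨_, hv, rfl⟩)
  exact ContDiffAt.comp v h2 (smooth_coord 0)

lemma smooth_ybar' {v : Fin 4 → ℝ} (hv : (v 0, v 1) ∈ φ.dom) : Smooth φ.ybar v := by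
  have h2 : ContDiffAt ℝ ∞ φ.η (v 0, v 1) :=
    φ.smooth_η.contDiffAt (φ.isOpen_dom.mem_nhds hv)
  exact ContDiffAt.comp v h2 ((smooth_coord 0).prodMk (smooth_coord 1))

lemma pd_xbar {v : Fin 4 → ℝ} (hv : (v 0, v 1) ∈ φ.dom) (i : Fin 4) :
    pd i φ.xbar v = if i = 0 then deriv φ.χ (v 0) else 0 := by
  have h1 : IsOpen (Prod.fst '' φ.dom) := isOpenMap_fst _ φ.isOpen_dom
  have h2 : ContDiffAt ℝ ∞ φ.χ (v 0) :=
    φ.smooth_χ.contDiffAt (h1.mem_nhds ⟨_, hv, rfl⟩)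
  have h3 : DifferentiableAt ℝ φ.χ (v 0) := h2.differentiableAt (by simp)
  have h4 := (h3.hasDerivAt.comp_hasFDerivAt v (hasFDerivAt_apply (𝕜 := ℝ) 0 v)).fderiv
  unfold pd
  rw [show φ.xbar = φ.χ ∘ fun w => w 0 from rfl, h4]
  simp [Pi.single_apply, eq_comm]

lemma pd_ybar {v : Fin 4 → ℝ} (hv : (v 0, v 1) ∈ φ.dom) (i : Fin 4) :
    pd i φ.ybar v = fderiv ℝ φ.η (v 0, v 1) (if i = 0 then 1 else 0, if i = 1 then 1 else 0) := by
  have h2 : ContDiffAt ℝ ∞ φ.η (v 0, v 1) :=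
    φ.smooth_η.contDiffAt (φ.isOpen_dom.mem_nhds hv)
  have h3 : DifferentiableAt ℝ φ.η (v 0, v 1) := h2.differentiableAt (by simp)
  have h4 := (h3.hasFDerivAt.comp v ((hasFDerivAt_apply (𝕜 := ℝ) (0 : Fin 4) v).prodMk
    (hasFDerivAt_apply (𝕜 := ℝ) (1 : Fin 4) v))).fderiv
  unfold pd
  rw [show φ.ybar = φ.η ∘ fun w => (w 0, w 1) from rfl, h4]
  simp [Pi.single_apply, eq_comm]

variable (h : φ.TransformsOn F N)
include h

lemma smooth_xbar : ∀ v ∈ N, Smooth φ.xbar v := fun v hv => smooth_xbar' (h.mem_dom v hv)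

lemma smooth_ybar : ∀ v ∈ N, Smooth φ.ybar v := fun v hv => smooth_ybar' (h.mem_dom v hv)

lemma pd_xbar_succ (i : Fin 4) (hi : i ≠ 0) : ∀ v ∈ N, pd i φ.xbar v = 0 := fun v hv => by
  rw [pd_xbar (h.mem_dom v hv), if_neg hi]

lemma pd_ybar_two : ∀ v ∈ N, pd 2 φ.ybar v = 0 := fun v hv => by
  rw [pd_ybar (h.mem_dom v hv)]
  exact map_zero _

lemma pd_ybar_three : ∀ v ∈ N, pd 3 φ.ybar v = 0 := fun v hv => by
  rw [pd_ybar (h.mem_dom v hv)]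
  exact map_zero _

lemma X_ne : ∀ v ∈ N, pd 0 φ.xbar v ≠ 0 := fun v hv => by
  rw [pd_xbar (h.mem_dom v hv)]; simpa using φ.deriv_χ_ne_zero _ (h.mem_dom v hv)

lemma Y_ne : ∀ v ∈ N, pd 1 φ.ybar v ≠ 0 := fun v hv => by
  rw [pd_ybar (h.mem_dom v hv)]; simpa using φ.deriv_η_ne_zero _ (h.mem_dom v hv)

/-- If a function on `N` has vanishing `i`-th derivative, so have its derivatives. -/
lemma pd_pd_zero {f : (Fin 4 → ℝ) → ℝ} (hf : ∀ v ∈ N, Smooth f v) {i : Fin 4}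
    (h0 : ∀ v ∈ N, pd i f v = 0) (j : Fin 4) : ∀ v ∈ N, pd i (pd j f) v = 0 := fun v hv => by
  rw [pd_comm (hf v hv), pd_congr_on h.isOpen (g := fun _ => 0) h0 j v hv, pd_const]

lemma totalD_xbar : ∀ v ∈ N, totalD F φ.xbar v = pd 0 φ.xbar v := fun v hv => by
  simp [totalD, h.pd_xbar_succ 1 (by decide) v hv, h.pd_xbar_succ 2 (by decide) v hv,
    h.pd_xbar_succ 3 (by decide) v hv]

lemma smooth_X : ∀ v ∈ N, Smooth (pd 0 φ.xbar) v := fun v hv => (h.smooth_xbar v hv).pd 0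

lemma smooth_Y : ∀ v ∈ N, Smooth (pd 1 φ.ybar) v := fun v hv => (h.smooth_ybar v hv).pd 1

/-- A quotient by the total derivative of `x̄`. -/
lemma smooth_div_totalD {f : (Fin 4 → ℝ) → ℝ} (hf : ∀ v ∈ N, Smooth f v) :
    ∀ v ∈ N, Smooth (fun v => totalD F f v / totalD F φ.xbar v) v := fun v hv =>
  ((h.smooth v hv).totalD (hf v hv)).div ((h.smooth v hv).totalD (h.smooth_xbar v hv))
    (by rw [h.totalD_xbar v hv]; exact h.X_ne v hv)

lemma smooth_pbar : ∀ v ∈ N, Smooth (φ.pbar F) v := h.smooth_div_totalD h.smooth_ybar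

lemma smooth_qbar : ∀ v ∈ N, Smooth (φ.qbar F) v := h.smooth_div_totalD h.smooth_pbar

lemma pbar_mul : ∀ v ∈ N, φ.pbar F v * pd 0 φ.xbar v = totalD F φ.ybar v := fun v hv => by
  have := h.X_ne v hv
  rw [FPTransformation.pbar, h.totalD_xbar v hv]; field_simp

lemma qbar_mul : ∀ v ∈ N, φ.qbar F v * pd 0 φ.xbar v = totalD F (φ.pbar F) v := fun v hv => by
  have := h.X_ne v hv
  rw [FPTransformation.qbar, h.totalD_xbar v hv]; field_simp

lemma pd_X (i : Fin 4) (hi : i ≠ 0) : ∀ v ∈ N, pd i (pd 0 φ.xbar) v = 0 :=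
  h.pd_pd_zero h.smooth_xbar (h.pd_xbar_succ i hi) 0

lemma pd_Y_two : ∀ v ∈ N, pd 2 (pd 1 φ.ybar) v = 0 := h.pd_pd_zero h.smooth_ybar h.pd_ybar_two 1

lemma pd_Y_three : ∀ v ∈ N, pd 3 (pd 1 φ.ybar) v = 0 :=
  h.pd_pd_zero h.smooth_ybar h.pd_ybar_three 1

lemma smooth_logEta : ∀ v ∈ N, Smooth φ.logEta v := fun v hv =>
  (h.smooth_Y v hv).log (h.Y_ne v hv)

lemma smooth_logChi : ∀ v ∈ N, Smooth φ.logChi v := fun v hv =>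
  (h.smooth_X v hv).log (h.X_ne v hv)

lemma pd_logEta_two : ∀ v ∈ N, pd 2 φ.logEta v = 0 := fun v hv => by
  rw [show φ.logEta = fun w => Real.log (pd 1 φ.ybar w) from rfl,
    pd_log (h.smooth_Y v hv) (h.Y_ne v hv), h.pd_Y_two v hv, zero_div]

lemma pd_logEta_three : ∀ v ∈ N, pd 3 φ.logEta v = 0 := fun v hv => by
  rw [show φ.logEta = fun w => Real.log (pd 1 φ.ybar w) from rfl,
    pd_log (h.smooth_Y v hv) (h.Y_ne v hv), h.pd_Y_three v hv, zero_div]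

lemma pd_Y_one : ∀ v ∈ N, pd 1 (pd 1 φ.ybar) v = pd 1 φ.ybar v * pd 1 φ.logEta v := fun v hv => by
  have := h.Y_ne v hv
  rw [show φ.logEta = fun w => Real.log (pd 1 φ.ybar w) from rfl,
    pd_log (h.smooth_Y v hv) (h.Y_ne v hv)]
  field_simp

lemma pd_logChi (i : Fin 4) (hi : i ≠ 0) : ∀ v ∈ N, pd i φ.logChi v = 0 := fun v hv => by
  rw [show φ.logChi = fun w => Real.log (pd 0 φ.xbar w) from rfl,
    pd_log (h.smooth_X v hv) (h.X_ne v hv), h.pd_X i hi v hv, zero_div]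

lemma totalD_Y : ∀ v ∈ N, totalD F (pd 1 φ.ybar) v = pd 1 φ.ybar v * totalD F φ.logEta v :=
  fun v hv => by
    have := h.Y_ne v hv
    rw [show φ.logEta = fun w => Real.log (pd 1 φ.ybar w) from rfl,
      totalD_log (h.smooth_Y v hv) (h.Y_ne v hv)]
    field_simp

lemma totalD_X : ∀ v ∈ N, totalD F (pd 0 φ.xbar) v = pd 0 φ.xbar v * totalD F φ.logChi v :=
  fun v hv => by
    have := h.X_ne v hv
    rw [show φ.logChi = fun w => Real.log (pd 0 φ.xbar w) from rfl,
      totalD_log (h.smooth_X v hv) (h.X_ne v hv)]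
    field_simp

/-! ### First derivatives of the prolonged coordinates -/

lemma pbar_aux (i : Fin 4) (hi : i ≠ 0) : ∀ v ∈ N,
    pd i (φ.pbar F) v * pd 0 φ.xbar v = pd i (totalD F φ.ybar) v := fun v hv => by
  rw [← pd_congr_on h.isOpen h.pbar_mul i v hv, pd_mul (h.smooth_pbar v hv) (h.smooth_X v hv),
    h.pd_X i hi v hv]
  ring

lemma qbar_aux (i : Fin 4) (hi : i ≠ 0) : ∀ v ∈ N,
    pd i (φ.qbar F) v * pd 0 φ.xbar v = pd i (totalD F (φ.pbar F)) v := fun v hv => by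
  rw [← pd_congr_on h.isOpen h.qbar_mul i v hv, pd_mul (h.smooth_qbar v hv) (h.smooth_X v hv),
    h.pd_X i hi v hv]
  ring

lemma pd_pbar_three : ∀ v ∈ N, pd 3 (φ.pbar F) v = 0 := fun v hv => by
  have e := h.pbar_aux 3 (by decide) v hv
  rw [pd_three_totalD (h.smooth v hv) (h.smooth_ybar v hv), h.pd_ybar_three v hv,
    h.pd_ybar_two v hv, totalD_zero_on h.isOpen h.pd_ybar_three v hv] at e
  simpa [h.X_ne v hv] using e

lemma pd_pbar_two : ∀ v ∈ N, pd 2 (φ.pbar F) v = pd 1 φ.ybar v / pd 0 φ.xbar v := fun v hv => by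
  have e := h.pbar_aux 2 (by decide) v hv
  rw [pd_two_totalD (h.smooth v hv) (h.smooth_ybar v hv), h.pd_ybar_three v hv,
    totalD_zero_on h.isOpen h.pd_ybar_two v hv] at e
  rw [eq_div_iff (h.X_ne v hv), e]; ring

lemma pd_pbar_one : ∀ v ∈ N, pd 1 (φ.pbar F) v
    = pd 1 φ.ybar v / pd 0 φ.xbar v * totalD F φ.logEta v := fun v hv => by
  have e := h.pbar_aux 1 (by decide) v hv
  have := h.X_ne v hv
  rw [pd_one_totalD (h.smooth v hv) (h.smooth_ybar v hv), h.pd_ybar_three v hv,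
    h.totalD_Y v hv] at e
  field_simp
  linarith

/-- Total derivative of `η_y / χ'`. -/
lemma totalD_ratio : ∀ v ∈ N, totalD F (fun v => pd 1 φ.ybar v / pd 0 φ.xbar v) v
    = pd 1 φ.ybar v / pd 0 φ.xbar v * (totalD F φ.logEta v - totalD F φ.logChi v) := fun v hv => by
  have := h.X_ne v hv
  rw [totalD_div (h.smooth_Y v hv) (h.smooth_X v hv) this, h.totalD_Y v hv, h.totalD_X v hv]
  field_simp

lemma smooth_ratio : ∀ v ∈ N, Smooth (fun v => pd 1 φ.ybar v / pd 0 φ.xbar v) v := fun v hv =>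
  (h.smooth_Y v hv).div (h.smooth_X v hv) (h.X_ne v hv)

lemma smooth_e1 : ∀ v ∈ N, Smooth (totalD F φ.logEta) v := fun v hv =>
  (h.smooth v hv).totalD (h.smooth_logEta v hv)

lemma smooth_c1 : ∀ v ∈ N, Smooth (totalD F φ.logChi) v := fun v hv =>
  (h.smooth v hv).totalD (h.smooth_logChi v hv)

lemma pd_qbar_three : ∀ v ∈ N, pd 3 (φ.qbar F) v = pd 1 φ.ybar v / pd 0 φ.xbar v ^ 2 :=
  fun v hv => by
    have e := h.qbar_aux 3 (by decide) v hv
    have := h.X_ne v hv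
    rw [pd_three_totalD (h.smooth v hv) (h.smooth_pbar v hv), h.pd_pbar_three v hv,
      h.pd_pbar_two v hv, totalD_zero_on h.isOpen h.pd_pbar_three v hv] at e
    field_simp at e ⊢
    linarith

lemma pd_qbar_two : ∀ v ∈ N, pd 2 (φ.qbar F) v = pd 1 φ.ybar v / pd 0 φ.xbar v ^ 2
    * (2 * totalD F φ.logEta v - totalD F φ.logChi v) := fun v hv => by
  have e := h.qbar_aux 2 (by decide) v hv
  have := h.X_ne v hv
  rw [pd_two_totalD (h.smooth v hv) (h.smooth_pbar v hv), h.pd_pbar_three v hv,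
    h.pd_pbar_one v hv, totalD_congr_on h.isOpen h.pd_pbar_two v hv, h.totalD_ratio v hv] at e
  field_simp at e ⊢
  linarith

lemma pd_qbar_one : ∀ v ∈ N, pd 1 (φ.qbar F) v = pd 1 φ.ybar v / pd 0 φ.xbar v ^ 2
    * ((totalD F φ.logEta v - totalD F φ.logChi v) * totalD F φ.logEta v
      + totalD F (totalD F φ.logEta) v) := fun v hv => by
  have e := h.qbar_aux 1 (by decide) v hv
  have := h.X_ne v hv
  rw [pd_one_totalD (h.smooth v hv) (h.smooth_pbar v hv), h.pd_pbar_three v hv,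
    totalD_congr_on h.isOpen h.pd_pbar_one v hv,
    totalD_mul (h.smooth_ratio v hv) (h.smooth_e1 v hv), h.totalD_ratio v hv] at e
  field_simp at e ⊢
  linarith

/-! ### The chain rule along the prolongation -/

lemma smooth_prol : ∀ v ∈ N, Smooth (φ.prol F) v := fun v hv => by
  refine smooth_pi.2 fun a => ?_
  fin_cases a
  · exact h.smooth_xbar v hv
  · exact h.smooth_ybar v hv
  · exact h.smooth_pbar v hv
  · exact h.smooth_qbar v hv

lemma pd_comp_prol {G : (Fin 4 → ℝ) → ℝ} {v : Fin 4 → ℝ} (hv : v ∈ N)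
    (hG : Smooth G (φ.prol F v)) (i : Fin 4) :
    pd i (fun w => G (φ.prol F w)) v = pd i φ.xbar v * pd 0 G (φ.prol F v)
      + pd i φ.ybar v * pd 1 G (φ.prol F v) + pd i (φ.pbar F) v * pd 2 G (φ.prol F v)
      + pd i (φ.qbar F) v * pd 3 G (φ.prol F v) := by
  rw [pd_comp hG.diff (fun a => (smooth_pi.1 (h.smooth_prol v hv) a).diff), Fin.sum_univ_four]
  rfl

lemma smooth_comp_prol {G : (Fin 4 → ℝ) → ℝ} {v : Fin 4 → ℝ} (hv : v ∈ N)
    (hG : Smooth G (φ.prol F v)) : Smooth (fun w => G (φ.prol F w)) v :=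
  ContDiffAt.comp v hG (h.smooth_prol v hv)

lemma pd_three_comp_prol {G : (Fin 4 → ℝ) → ℝ} {v : Fin 4 → ℝ} (hv : v ∈ N)
    (hG : Smooth G (φ.prol F v)) : pd 3 (fun w => G (φ.prol F w)) v
      = pd 1 φ.ybar v / pd 0 φ.xbar v ^ 2 * pd 3 G (φ.prol F v) := by
  rw [h.pd_comp_prol hv hG, h.pd_xbar_succ 3 (by decide) v hv, h.pd_ybar_three v hv,
    h.pd_pbar_three v hv, h.pd_qbar_three v hv]; ring

lemma pd_two_comp_prol {G : (Fin 4 → ℝ) → ℝ} {v : Fin 4 → ℝ} (hv : v ∈ N)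
    (hG : Smooth G (φ.prol F v)) : pd 2 (fun w => G (φ.prol F w)) v
      = pd 1 φ.ybar v / pd 0 φ.xbar v * pd 2 G (φ.prol F v)
        + pd 1 φ.ybar v / pd 0 φ.xbar v ^ 2
          * (2 * totalD F φ.logEta v - totalD F φ.logChi v) * pd 3 G (φ.prol F v) := by
  rw [h.pd_comp_prol hv hG, h.pd_xbar_succ 2 (by decide) v hv, h.pd_ybar_two v hv,
    h.pd_pbar_two v hv, h.pd_qbar_two v hv]; ring

lemma pd_one_comp_prol {G : (Fin 4 → ℝ) → ℝ} {v : Fin 4 → ℝ} (hv : v ∈ N)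
    (hG : Smooth G (φ.prol F v)) : pd 1 (fun w => G (φ.prol F w)) v
      = pd 1 φ.ybar v * pd 1 G (φ.prol F v)
        + pd 1 φ.ybar v / pd 0 φ.xbar v * totalD F φ.logEta v * pd 2 G (φ.prol F v)
        + pd 1 φ.ybar v / pd 0 φ.xbar v ^ 2
          * ((totalD F φ.logEta v - totalD F φ.logChi v) * totalD F φ.logEta v
            + totalD F (totalD F φ.logEta) v) * pd 3 G (φ.prol F v) := by
  rw [h.pd_comp_prol hv hG, h.pd_xbar_succ 1 (by decide) v hv,
    h.pd_pbar_one v hv, h.pd_qbar_one v hv]; ring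

/-! ### Derivatives of the logarithms -/

lemma pd_e1_three : ∀ v ∈ N, pd 3 (totalD F φ.logEta) v = 0 := fun v hv => by
  rw [pd_three_totalD (h.smooth v hv) (h.smooth_logEta v hv), h.pd_logEta_three v hv,
    h.pd_logEta_two v hv, totalD_zero_on h.isOpen h.pd_logEta_three v hv]; ring

lemma pd_e1_two : ∀ v ∈ N, pd 2 (totalD F φ.logEta) v = pd 1 φ.logEta v := fun v hv => by
  rw [pd_two_totalD (h.smooth v hv) (h.smooth_logEta v hv), h.pd_logEta_three v hv,
    totalD_zero_on h.isOpen h.pd_logEta_two v hv]; ring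

lemma pd_e1_one : ∀ v ∈ N, pd 1 (totalD F φ.logEta) v = totalD F (pd 1 φ.logEta) v :=
  fun v hv => by
    rw [pd_one_totalD (h.smooth v hv) (h.smooth_logEta v hv), h.pd_logEta_three v hv]; ring

lemma pd_e2_three : ∀ v ∈ N, pd 3 (totalD F (totalD F φ.logEta)) v = pd 1 φ.logEta v :=
  fun v hv => by
    rw [pd_three_totalD (h.smooth v hv) (h.smooth_e1 v hv), h.pd_e1_three v hv,
      h.pd_e1_two v hv, totalD_zero_on h.isOpen h.pd_e1_three v hv]; ring

lemma pd_e2_two : ∀ v ∈ N, pd 2 (totalD F (totalD F φ.logEta)) v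
    = 2 * totalD F (pd 1 φ.logEta) v := fun v hv => by
  rw [pd_two_totalD (h.smooth v hv) (h.smooth_e1 v hv), h.pd_e1_three v hv,
    h.pd_e1_one v hv, totalD_congr_on h.isOpen h.pd_e1_two v hv]; ring

lemma pd_c1 (i : Fin 4) (hi : i ≠ 0) : ∀ v ∈ N, pd i (totalD F φ.logChi) v = 0 := fun v hv => by
  have z : ∀ i : Fin 4, i ≠ 0 → totalD F (pd i φ.logChi) v = 0 := fun i hi =>
    totalD_zero_on h.isOpen (h.pd_logChi i hi) v hv
  rw [pd_totalD (h.smooth v hv) (h.smooth_logChi v hv), z i hi,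
    h.pd_logChi 1 (by decide) v hv, h.pd_logChi 2 (by decide) v hv,
    h.pd_logChi 3 (by decide) v hv]
  simp

lemma smooth_rbar : ∀ v ∈ N, Smooth (φ.rbar F) v := h.smooth_div_totalD h.smooth_qbar

/-- The prolongation is a local diffeomorphism. -/
lemma fderiv_prol_eq_zero {v : Fin 4 → ℝ} (hv : v ∈ N) {X : Fin 4 → ℝ}
    (hX : fderiv ℝ (φ.prol F) v X = 0) : X = 0 := by
  have hc : ∀ a, fderiv ℝ (fun w => φ.prol F w a) v X = 0 := fun a => by
    have h1 := ((hasFDerivAt_apply (𝕜 := ℝ) a (φ.prol F v)).comp v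
      (h.smooth_prol v hv).diff.hasFDerivAt).fderiv
    rw [show (fun w => φ.prol F w a) = (fun z : Fin 4 → ℝ => z a) ∘ φ.prol F from rfl, h1,
      ContinuousLinearMap.comp_apply, hX, map_zero]
  have c0 : fderiv ℝ φ.xbar v X = 0 := hc 0
  have c1 : fderiv ℝ φ.ybar v X = 0 := hc 1
  have c2 : fderiv ℝ (φ.pbar F) v X = 0 := hc 2
  have c3 : fderiv ℝ (φ.qbar F) v X = 0 := hc 3
  rw [fderiv_eq_sum_pd, Fin.sum_univ_four] at c0 c1 c2 c3
  rw [h.pd_xbar_succ 1 (by decide) v hv, h.pd_xbar_succ 2 (by decide) v hv,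
    h.pd_xbar_succ 3 (by decide) v hv] at c0
  rw [h.pd_ybar_two v hv, h.pd_ybar_three v hv] at c1
  rw [h.pd_pbar_two v hv, h.pd_pbar_three v hv] at c2
  rw [h.pd_qbar_three v hv] at c3
  have hx := h.X_ne v hv
  have hy := h.Y_ne v hv
  have e0 : X 0 = 0 := by simpa [hx] using c0
  have e1 : X 1 = 0 := by simpa [hy, e0] using c1
  have e2 : X 2 = 0 := by simpa [hx, hy, e0, e1] using c2
  have e3 : X 3 = 0 := by simpa [hx, hy, e0, e1, e2] using c3
  funext i
  fin_cases i <;> assumption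

end TransformsOn

namespace RelatesOn

variable {F F' : (Fin 4 → ℝ) → ℝ} {N : Set (Fin 4 → ℝ)} (h : φ.RelatesOn F F' N)
include h

lemma rbar_mul : ∀ v ∈ N, F' (φ.prol F v) * pd 0 φ.xbar v = totalD F (φ.qbar F) v :=
  fun v hv => by
    have := h.X_ne v hv
    rw [h.rel v hv, FPTransformation.rbar, h.totalD_xbar v hv]; field_simp

lemma totalD_comp_prol {G : (Fin 4 → ℝ) → ℝ} {v : Fin 4 → ℝ} (hv : v ∈ N)
    (hG : Smooth G (φ.prol F v)) :
    totalD F (fun w => G (φ.prol F w)) v = pd 0 φ.xbar v * totalD F' G (φ.prol F v) := by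
  have e0 := h.totalD_xbar v hv
  have e1 := h.pbar_mul v hv
  have e2 := h.qbar_mul v hv
  have e3 := h.rbar_mul v hv
  have j2 : φ.prol F v 2 = φ.pbar F v := rfl
  have j3 : φ.prol F v 3 = φ.qbar F v := rfl
  have : totalD F (fun w => G (φ.prol F w)) v = totalD F φ.xbar v * pd 0 G (φ.prol F v)
      + totalD F φ.ybar v * pd 1 G (φ.prol F v) + totalD F (φ.pbar F) v * pd 2 G (φ.prol F v)
      + totalD F (φ.qbar F) v * pd 3 G (φ.prol F v) := by
    simp only [totalD, h.pd_comp_prol hv hG]; ring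
  rw [this, e0, ← e1, ← e2, ← e3, totalD, j2, j3]; ring

end RelatesOn

end FPTransformation

namespace FPTransformation

variable {φ : FPTransformation}

namespace RelatesOn

variable {F F' : (Fin 4 → ℝ) → ℝ} {N : Set (Fin 4 → ℝ)} (h : φ.RelatesOn F F' N)
include h

/-! ### Transformation of the derivatives of `F` -/

lemma rbar_aux (i : Fin 4) (hi : i ≠ 0) : ∀ v ∈ N,
    pd i (fun v => F' (φ.prol F v)) v * pd 0 φ.xbar v = pd i (totalD F (φ.qbar F)) v :=
  fun v hv => by
    rw [← pd_congr_on h.isOpen h.rbar_mul i v hv,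
      pd_mul (h.smooth_comp_prol hv (h.smooth' v hv)) (h.smooth_X v hv), h.pd_X i hi v hv]
    ring

lemma totalD_ratio_sq : ∀ v ∈ N, totalD F (fun v => pd 1 φ.ybar v / pd 0 φ.xbar v ^ 2) v
    = pd 1 φ.ybar v / pd 0 φ.xbar v ^ 2
      * (totalD F φ.logEta v - 2 * totalD F φ.logChi v) := fun v hv => by
  have hX := h.X_ne v hv
  have e : (fun v => pd 1 φ.ybar v / pd 0 φ.xbar v ^ 2)
      = fun v => (pd 1 φ.ybar v / pd 0 φ.xbar v) / pd 0 φ.xbar v := by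
    funext w; rw [div_div, sq]
  rw [e, totalD_div (h.smooth_ratio v hv) (h.smooth_X v hv) hX, h.totalD_ratio v hv,
    h.totalD_X v hv]
  field_simp
  ring

lemma smooth_ratio_sq : ∀ v ∈ N, Smooth (fun v => pd 1 φ.ybar v / pd 0 φ.xbar v ^ 2) v :=
  fun v hv => (h.smooth_Y v hv).div ((h.smooth_X v hv).pow 2) (pow_ne_zero 2 (h.X_ne v hv))

lemma pd_three_F : ∀ v ∈ N, pd 3 F v = pd 0 φ.xbar v * pd 3 F' (φ.prol F v)
    - 3 * totalD F φ.logEta v + 3 * totalD F φ.logChi v := fun v hv => by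
  have hX := h.X_ne v hv
  have hY := h.Y_ne v hv
  have e := h.rbar_aux 3 (by decide) v hv
  rw [h.pd_three_comp_prol hv (h.smooth' v hv),
    pd_three_totalD (h.smooth v hv) (h.smooth_qbar v hv), h.pd_qbar_three v hv,
    h.pd_qbar_two v hv, totalD_congr_on h.isOpen h.pd_qbar_three v hv,
    h.totalD_ratio_sq v hv] at e
  field_simp at e
  linarith

lemma smooth_e2 : ∀ v ∈ N, Smooth (totalD F (totalD F φ.logEta)) v := fun v hv =>
  (h.smooth v hv).totalD (h.smooth_e1 v hv)

lemma pd_two_F : ∀ v ∈ N, pd 2 F v = pd 0 φ.xbar v ^ 2 * pd 2 F' (φ.prol F v)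
    + pd 0 φ.xbar v * pd 3 F' (φ.prol F v) * (2 * totalD F φ.logEta v - totalD F φ.logChi v)
    - (totalD F φ.logEta v - 2 * totalD F φ.logChi v)
      * (2 * totalD F φ.logEta v - totalD F φ.logChi v)
    - (3 * totalD F (totalD F φ.logEta) v - totalD F (totalD F φ.logChi) v)
    - (totalD F φ.logEta v - totalD F φ.logChi v) * totalD F φ.logEta v := fun v hv => by
  have hX := h.X_ne v hv
  have hY := h.Y_ne v hv
  have e := h.rbar_aux 2 (by decide) v hv
  have s1 : Smooth (fun v => 2 * totalD F φ.logEta v) v :=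
    contDiffAt_const.mul (h.smooth_e1 v hv)
  rw [h.pd_two_comp_prol hv (h.smooth' v hv),
    pd_two_totalD (h.smooth v hv) (h.smooth_qbar v hv), h.pd_qbar_three v hv,
    h.pd_qbar_one v hv, totalD_congr_on h.isOpen h.pd_qbar_two v hv,
    totalD_mul (h.smooth_ratio_sq v hv) (s1.sub (h.smooth_c1 v hv)),
    totalD_sub s1 (h.smooth_c1 v hv), totalD_const_mul _ (h.smooth_e1 v hv),
    h.totalD_ratio_sq v hv] at e
  field_simp at e
  linarith

lemma smooth_F' (i : Fin 4) : ∀ v ∈ N, Smooth (fun w => pd i F' (φ.prol F w)) v := fun v hv =>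
  h.smooth_comp_prol hv ((h.smooth' v hv).pd i)

lemma smooth_XF3 : ∀ v ∈ N, Smooth (fun v => pd 0 φ.xbar v * pd 3 F' (φ.prol F v)) v :=
  fun v hv => (h.smooth_X v hv).mul (h.smooth_F' 3 v hv)

/-- Derivatives of `F_q` from those of the terms of its transformation formula. -/
lemma pd_F3 (i : Fin 4) (hi : i ≠ 0) : ∀ v ∈ N, pd i (pd 3 F) v
    = pd 0 φ.xbar v * pd i (fun v => pd 3 F' (φ.prol F v)) v - 3 * pd i (totalD F φ.logEta) v :=
  fun v hv => by
    have s1 : Smooth (fun v => 3 * totalD F φ.logEta v) v :=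
      contDiffAt_const.mul (h.smooth_e1 v hv)
    have s2 : Smooth (fun v => 3 * totalD F φ.logChi v) v :=
      contDiffAt_const.mul (h.smooth_c1 v hv)
    rw [pd_congr_on h.isOpen h.pd_three_F i v hv, pd_add ((h.smooth_XF3 v hv).sub s1) s2,
      pd_sub (h.smooth_XF3 v hv) s1, pd_mul (h.smooth_X v hv) (h.smooth_F' 3 v hv),
      pd_const_mul _ (h.smooth_e1 v hv), pd_const_mul _ (h.smooth_c1 v hv), h.pd_X i hi v hv,
      h.pd_c1 i hi v hv]
    ring

lemma pd_three_three_F : ∀ v ∈ N, pd 3 (pd 3 F) v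
    = pd 1 φ.ybar v / pd 0 φ.xbar v * pd 3 (pd 3 F') (φ.prol F v) := fun v hv => by
  have hX := h.X_ne v hv
  rw [h.pd_F3 3 (by decide) v hv, h.pd_three_comp_prol hv ((h.smooth' v hv).pd 3),
    h.pd_e1_three v hv]
  field_simp
  ring

lemma pd_one_three_F : ∀ v ∈ N, pd 1 (pd 3 F) v
    = pd 0 φ.xbar v * (pd 1 φ.ybar v * pd 1 (pd 3 F') (φ.prol F v)
        + pd 1 φ.ybar v / pd 0 φ.xbar v * totalD F φ.logEta v * pd 2 (pd 3 F') (φ.prol F v)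
        + pd 1 φ.ybar v / pd 0 φ.xbar v ^ 2
          * ((totalD F φ.logEta v - totalD F φ.logChi v) * totalD F φ.logEta v
            + totalD F (totalD F φ.logEta) v) * pd 3 (pd 3 F') (φ.prol F v))
      - 3 * totalD F (pd 1 φ.logEta) v := fun v hv => by
  rw [h.pd_F3 1 (by decide) v hv, h.pd_one_comp_prol hv ((h.smooth' v hv).pd 3),
    h.pd_e1_one v hv]

lemma smooth_F33 : ∀ v ∈ N, Smooth (fun w => pd 3 (pd 3 F') (φ.prol F w)) v := fun v hv =>
  h.smooth_comp_prol hv (((h.smooth' v hv).pd 3).pd 3)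

lemma pd_F33 (i : Fin 4) : ∀ v ∈ N, pd i (pd 3 (pd 3 F)) v
    = pd 1 φ.ybar v / pd 0 φ.xbar v * pd i (fun v => pd 3 (pd 3 F') (φ.prol F v)) v
      + pd 3 (pd 3 F') (φ.prol F v) * pd i (fun v => pd 1 φ.ybar v / pd 0 φ.xbar v) v :=
  fun v hv => by
    rw [pd_congr_on h.isOpen h.pd_three_three_F i v hv,
      pd_mul (h.smooth_ratio v hv) (h.smooth_F33 v hv)]

lemma pd_ratio (i : Fin 4) (hi : i ≠ 0) : ∀ v ∈ N, pd i (fun v => pd 1 φ.ybar v / pd 0 φ.xbar v) v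
    = pd i (pd 1 φ.ybar) v / pd 0 φ.xbar v := fun v hv => by
  have hX := h.X_ne v hv
  rw [pd_div (h.smooth_Y v hv) (h.smooth_X v hv) hX, h.pd_X i hi v hv]
  field_simp
  ring

lemma pd_three_three_three_F : ∀ v ∈ N, pd 3 (pd 3 (pd 3 F)) v
    = pd 1 φ.ybar v / pd 0 φ.xbar v * (pd 1 φ.ybar v / pd 0 φ.xbar v ^ 2)
      * pd 3 (pd 3 (pd 3 F')) (φ.prol F v) := fun v hv => by
  rw [h.pd_F33 3 v hv, h.pd_three_comp_prol hv (((h.smooth' v hv).pd 3).pd 3),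
    h.pd_ratio 3 (by decide) v hv, h.pd_Y_three v hv]
  ring

lemma pd_two_three_three_F : ∀ v ∈ N, pd 2 (pd 3 (pd 3 F)) v
    = pd 1 φ.ybar v / pd 0 φ.xbar v
      * (pd 1 φ.ybar v / pd 0 φ.xbar v * pd 2 (pd 3 (pd 3 F')) (φ.prol F v)
        + pd 1 φ.ybar v / pd 0 φ.xbar v ^ 2
          * (2 * totalD F φ.logEta v - totalD F φ.logChi v)
          * pd 3 (pd 3 (pd 3 F')) (φ.prol F v)) := fun v hv => by
  rw [h.pd_F33 2 v hv, h.pd_two_comp_prol hv (((h.smooth' v hv).pd 3).pd 3),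
    h.pd_ratio 2 (by decide) v hv, h.pd_Y_two v hv]
  ring

lemma pd_one_three_three_F : ∀ v ∈ N, pd 1 (pd 3 (pd 3 F)) v
    = pd 1 φ.ybar v / pd 0 φ.xbar v
      * (pd 1 φ.ybar v * pd 1 (pd 3 (pd 3 F')) (φ.prol F v)
        + pd 1 φ.ybar v / pd 0 φ.xbar v * totalD F φ.logEta v
          * pd 2 (pd 3 (pd 3 F')) (φ.prol F v)
        + pd 1 φ.ybar v / pd 0 φ.xbar v ^ 2
          * ((totalD F φ.logEta v - totalD F φ.logChi v) * totalD F φ.logEta v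
            + totalD F (totalD F φ.logEta) v) * pd 3 (pd 3 (pd 3 F')) (φ.prol F v)
        + pd 1 φ.logEta v * pd 3 (pd 3 F') (φ.prol F v)) := fun v hv => by
  rw [h.pd_F33 1 v hv, h.pd_one_comp_prol hv (((h.smooth' v hv).pd 3).pd 3),
    h.pd_ratio 1 (by decide) v hv, h.pd_Y_one v hv]
  ring

/-! ### Transformation of `K` -/

lemma Kfun_F : ∀ v ∈ N, Kfun F v = pd 0 φ.xbar v ^ 2 * Kfun F' (φ.prol F v)
    - (1 / 3) * ((pd 0 φ.xbar v * pd 3 F' (φ.prol F v)) * totalD F φ.logEta v)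
    + totalD F (totalD F φ.logEta) v + (1 / 2) * totalD F φ.logEta v ^ 2
    - totalD F φ.logEta v * totalD F φ.logChi v := fun v hv => by
  have s1 : Smooth (fun v => 3 * totalD F φ.logEta v) v :=
    contDiffAt_const.mul (h.smooth_e1 v hv)
  have s2 : Smooth (fun v => 3 * totalD F φ.logChi v) v :=
    contDiffAt_const.mul (h.smooth_c1 v hv)
  rw [Kfun_eq, Kfun_eq, totalD_congr_on h.isOpen h.pd_three_F v hv,
    totalD_add ((h.smooth_XF3 v hv).sub s1) s2,
    totalD_sub (h.smooth_XF3 v hv) s1, totalD_mul (h.smooth_X v hv) (h.smooth_F' 3 v hv),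
    totalD_const_mul _ (h.smooth_e1 v hv), totalD_const_mul _ (h.smooth_c1 v hv),
    h.totalD_comp_prol hv ((h.smooth' v hv).pd 3), h.totalD_X v hv, h.pd_three_F v hv,
    h.pd_two_F v hv]
  ring

lemma pd_Kfun_F (i : Fin 4) (hi : i ≠ 0) : ∀ v ∈ N, pd i (Kfun F) v
    = pd 0 φ.xbar v ^ 2 * pd i (fun v => Kfun F' (φ.prol F v)) v
    - (1 / 3) * pd 0 φ.xbar v * (pd 3 F' (φ.prol F v) * pd i (totalD F φ.logEta) v
        + totalD F φ.logEta v * pd i (fun v => pd 3 F' (φ.prol F v)) v)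
    + pd i (totalD F (totalD F φ.logEta)) v
    + (totalD F φ.logEta v - totalD F φ.logChi v) * pd i (totalD F φ.logEta) v := fun v hv => by
  have t1 : Smooth (fun v => Kfun F' (φ.prol F v)) v :=
    h.smooth_comp_prol hv (h.smooth' v hv).Kfun
  have t2 : Smooth (fun v => pd 0 φ.xbar v ^ 2) v := (h.smooth_X v hv).pow 2
  have t3 := (h.smooth_XF3 v hv).mul (h.smooth_e1 v hv)
  have t4 : Smooth (fun v => (1 / 3) * ((pd 0 φ.xbar v * pd 3 F' (φ.prol F v))
    * totalD F φ.logEta v)) v := contDiffAt_const.mul t3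
  have t5 : Smooth (fun v => totalD F φ.logEta v ^ 2) v := (h.smooth_e1 v hv).pow 2
  have t6 : Smooth (fun v => (1 / 2) * totalD F φ.logEta v ^ 2) v := contDiffAt_const.mul t5
  have t7 := (h.smooth_e1 v hv).mul (h.smooth_c1 v hv)
  rw [pd_congr_on h.isOpen h.Kfun_F i v hv,
    pd_sub ((((t2.mul t1).sub t4).add (h.smooth_e2 v hv)).add t6) t7,
    pd_add (((t2.mul t1).sub t4).add (h.smooth_e2 v hv)) t6,
    pd_add ((t2.mul t1).sub t4) (h.smooth_e2 v hv), pd_sub (t2.mul t1) t4, pd_mul t2 t1,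
    pd_const_mul _ t3, pd_const_mul _ t5, pd_pow (h.smooth_e1 v hv), pd_pow (h.smooth_X v hv),
    pd_mul (h.smooth_XF3 v hv) (h.smooth_e1 v hv),
    pd_mul (h.smooth_X v hv) (h.smooth_F' 3 v hv), pd_mul (h.smooth_e1 v hv) (h.smooth_c1 v hv),
    h.pd_X i hi v hv, h.pd_c1 i hi v hv]
  norm_num
  ring

lemma pd_three_Kfun_F : ∀ v ∈ N, pd 3 (Kfun F) v
    = pd 1 φ.ybar v * pd 3 (Kfun F') (φ.prol F v)
    - (1 / 3) * (pd 1 φ.ybar v / pd 0 φ.xbar v) * totalD F φ.logEta v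
        * pd 3 (pd 3 F') (φ.prol F v)
    + pd 1 φ.logEta v := fun v hv => by
  have hX := h.X_ne v hv
  rw [h.pd_Kfun_F 3 (by decide) v hv, h.pd_three_comp_prol hv (h.smooth' v hv).Kfun,
    h.pd_three_comp_prol hv ((h.smooth' v hv).pd 3), h.pd_e1_three v hv, h.pd_e2_three v hv]
  field_simp
  ring

lemma pd_two_Kfun_F : ∀ v ∈ N, pd 2 (Kfun F) v
    = pd 0 φ.xbar v * pd 1 φ.ybar v * pd 2 (Kfun F') (φ.prol F v)
    + pd 1 φ.ybar v * (2 * totalD F φ.logEta v - totalD F φ.logChi v)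
        * pd 3 (Kfun F') (φ.prol F v)
    - (1 / 3) * (pd 0 φ.xbar v * pd 3 F' (φ.prol F v) * pd 1 φ.logEta v
        + totalD F φ.logEta v * (pd 1 φ.ybar v * pd 2 (pd 3 F') (φ.prol F v)
          + pd 1 φ.ybar v / pd 0 φ.xbar v * (2 * totalD F φ.logEta v - totalD F φ.logChi v)
            * pd 3 (pd 3 F') (φ.prol F v)))
    + 2 * totalD F (pd 1 φ.logEta) v
    + (totalD F φ.logEta v - totalD F φ.logChi v) * pd 1 φ.logEta v := fun v hv => by
  have hX := h.X_ne v hv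
  rw [h.pd_Kfun_F 2 (by decide) v hv, h.pd_two_comp_prol hv (h.smooth' v hv).Kfun,
    h.pd_two_comp_prol hv ((h.smooth' v hv).pd 3), h.pd_e1_two v hv, h.pd_e2_two v hv]
  field_simp

end RelatesOn

/-! ### Invariance of the coframe -/

/-- The lift of `φ` to the six-dimensional manifolds of the two equations. -/
def lift (φ : FPTransformation) (F : (Fin 4 → ℝ) → ℝ) (u : Fin 6 → ℝ) : Fin 6 → ℝ :=
  ![φ.xbar (jet u), φ.ybar (jet u), φ.pbar F (jet u), φ.qbar F (jet u),
    u 4 / pd 1 φ.ybar (jet u),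
    (u 5 - totalD F φ.logEta (jet u)) / pd 0 φ.xbar (jet u)]

end FPTransformation

lemma jet_hasFDerivAt (u : Fin 6 → ℝ) : HasFDerivAt jet
    (ContinuousLinearMap.pi ![ContinuousLinearMap.proj (R := ℝ) (φ := fun _ : Fin 6 => ℝ) 0,
      ContinuousLinearMap.proj 1, ContinuousLinearMap.proj 2, ContinuousLinearMap.proj 3]) u := by
  rw [hasFDerivAt_pi]
  intro i
  fin_cases i <;> exact hasFDerivAt_apply _ _

lemma smooth_jet (u : Fin 6 → ℝ) : Smooth jet u :=
  smooth_pi.2 fun a => by fin_cases a <;> exact smooth_coord _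

lemma smooth_comp_jet {f : (Fin 4 → ℝ) → ℝ} {u : Fin 6 → ℝ} (hf : Smooth f (jet u)) :
    Smooth (fun u => f (jet u)) u := ContDiffAt.comp u hf (smooth_jet u)

/-- The differential of a function of the jet. -/
lemma fderiv_comp_jet {f : (Fin 4 → ℝ) → ℝ} {u : Fin 6 → ℝ} (hf : DifferentiableAt ℝ f (jet u))
    (X : Fin 6 → ℝ) : fderiv ℝ (fun u => f (jet u)) u X
      = X 0 * pd 0 f (jet u) + X 1 * pd 1 f (jet u) + X 2 * pd 2 f (jet u)
        + X 3 * pd 3 f (jet u) := by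
  have h := (hf.hasFDerivAt.comp u (jet_hasFDerivAt u)).fderiv
  rw [show (fun u => f (jet u)) = f ∘ jet from rfl, h]
  simp only [ContinuousLinearMap.comp_apply]
  rw [fderiv_eq_sum_pd, Fin.sum_univ_four]
  rfl

namespace FPTransformation

variable {φ : FPTransformation}

lemma jet_lift (φ : FPTransformation) (F : (Fin 4 → ℝ) → ℝ) (u : Fin 6 → ℝ) :
    jet (φ.lift F u) = φ.prol F (jet u) := rfl

namespace RelatesOn

variable {F F' : (Fin 4 → ℝ) → ℝ} {N : Set (Fin 4 → ℝ)} (h : φ.RelatesOn F F' N)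
include h

lemma smooth_lift {u : Fin 6 → ℝ} (hu : jet u ∈ N) : Smooth (φ.lift F) u := by
  refine smooth_pi.2 fun a => ?_
  fin_cases a
  · exact smooth_comp_jet (h.smooth_xbar _ hu)
  · exact smooth_comp_jet (h.smooth_ybar _ hu)
  · exact smooth_comp_jet (h.smooth_pbar _ hu)
  · exact smooth_comp_jet (h.smooth_qbar _ hu)
  · exact (smooth_coord 4).div (smooth_comp_jet (h.smooth_Y _ hu)) (h.Y_ne _ hu)
  · exact ((smooth_coord 5).sub (smooth_comp_jet (h.smooth_e1 _ hu))).div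
      (smooth_comp_jet (h.smooth_X _ hu)) (h.X_ne _ hu)

/-- The differential of the lift, in terms of `ω¹, …, ω⁴, dα, dγ`. -/
lemma fderiv_lift {u : Fin 6 → ℝ} (hu : jet u ∈ N) (X : Fin 6 → ℝ) :
    let v := jet u
    let w1 := X 1 - u 2 * X 0
    let w2 := X 2 - u 3 * X 0
    let w3 := X 3 - F v * X 0
    let e1 := totalD F φ.logEta v
    let c1 := totalD F φ.logChi v
    let e2 := totalD F (totalD F φ.logEta) v
    let x' := pd 0 φ.xbar v
    let y' := pd 1 φ.ybar v
    fderiv ℝ (φ.lift F) u X = ![x' * X 0,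
      x' * φ.pbar F v * X 0 + y' * w1,
      x' * φ.qbar F v * X 0 + y' / x' * (w2 + e1 * w1),
      x' * F' (φ.prol F v) * X 0
        + y' / x' ^ 2 * (w3 + (2 * e1 - c1) * w2 + ((e1 - c1) * e1 + e2) * w1),
      X 4 / y' - u 4 / y' * (e1 * X 0 + pd 1 φ.logEta v * w1),
      (X 5 - e2 * X 0 - pd 1 φ.logEta v * w2 - totalD F (pd 1 φ.logEta) v * w1) / x'
        - (u 5 - e1) / x' * c1 * X 0] := by
  intro v w1 w2 w3 e1 c1 e2 x' y'
  have hX : x' ≠ 0 := h.X_ne _ hu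
  have hY : y' ≠ 0 := h.Y_ne _ hu
  have hd := (h.smooth_lift hu).diff
  have hj2 : v 2 = u 2 := rfl
  have hj3 : v 3 = u 3 := rfl
  -- total derivatives eliminate the partial derivatives in `x`
  have tot : ∀ f : (Fin 4 → ℝ) → ℝ, X 0 * pd 0 f v + X 1 * pd 1 f v + X 2 * pd 2 f v
      + X 3 * pd 3 f v
      = X 0 * totalD F f v + w1 * pd 1 f v + w2 * pd 2 f v + w3 * pd 3 f v := by
    intro f
    simp only [totalD, hj2, hj3, w1, w2, w3]; ring
  have comp : ∀ f : (Fin 4 → ℝ) → ℝ, Smooth f v → fderiv ℝ (fun u => f (jet u)) u X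
      = X 0 * totalD F f v + w1 * pd 1 f v + w2 * pd 2 f v + w3 * pd 3 f v := by
    intro f hf
    rw [fderiv_comp_jet hf.diff, tot]
  have p4 : fderiv ℝ (fun u : Fin 6 → ℝ => u 4) u X = X 4 := by
    rw [(hasFDerivAt_apply (𝕜 := ℝ) (4 : Fin 6) u).fderiv]; rfl
  have p5 : fderiv ℝ (fun u : Fin 6 → ℝ => u 5) u X = X 5 := by
    rw [(hasFDerivAt_apply (𝕜 := ℝ) (5 : Fin 6) u).fderiv]; rfl
  have quot : ∀ f g : (Fin 6 → ℝ) → ℝ, Smooth f u → Smooth g u → g u ≠ 0 →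
      fderiv ℝ (fun u => f u / g u) u X
        = (fderiv ℝ f u X * g u - f u * fderiv ℝ g u X) / g u ^ 2 := by
    intro f g hf hg h0
    rw [fderiv_eq_sum_pd, fderiv_eq_sum_pd, fderiv_eq_sum_pd, Finset.sum_mul, Finset.mul_sum,
      ← Finset.sum_sub_distrib, Finset.sum_div]
    refine Finset.sum_congr rfl fun i _ => ?_
    rw [pd_div hf hg h0]; ring
  have sX := smooth_comp_jet (h.smooth_X _ hu)
  have sY := smooth_comp_jet (h.smooth_Y _ hu)
  have sE := smooth_comp_jet (h.smooth_e1 _ hu)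
  funext a
  have ha : fderiv ℝ (φ.lift F) u X a = fderiv ℝ (fun u => φ.lift F u a) u X := by
    rw [fderiv_apply hd]; rfl
  rw [ha]
  fin_cases a
  · change fderiv ℝ (fun u => φ.xbar (jet u)) u X = _
    rw [comp _ (h.smooth_xbar _ hu), h.totalD_xbar _ hu, h.pd_xbar_succ 1 (by decide) _ hu,
      h.pd_xbar_succ 2 (by decide) _ hu, h.pd_xbar_succ 3 (by decide) _ hu]
    simp [x', v]; ring
  · change fderiv ℝ (fun u => φ.ybar (jet u)) u X = _
    rw [comp _ (h.smooth_ybar _ hu), ← h.pbar_mul _ hu, h.pd_ybar_two _ hu, h.pd_ybar_three _ hu]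
    simp [x', y', v]; ring
  · change fderiv ℝ (fun u => φ.pbar F (jet u)) u X = _
    rw [comp _ (h.smooth_pbar _ hu), ← h.qbar_mul _ hu, h.pd_pbar_one _ hu, h.pd_pbar_two _ hu,
      h.pd_pbar_three _ hu]
    simp [x', y', v, e1]; ring
  · change fderiv ℝ (fun u => φ.qbar F (jet u)) u X = _
    rw [comp _ (h.smooth_qbar _ hu), ← h.rbar_mul _ hu, h.pd_qbar_one _ hu, h.pd_qbar_two _ hu,
      h.pd_qbar_three _ hu]
    simp [x', y', v, e1, e2, c1]; ring
  · change fderiv ℝ (fun u => u 4 / pd 1 φ.ybar (jet u)) u X = _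
    rw [quot _ _ (smooth_coord 4) sY hY, p4, comp _ (h.smooth_Y _ hu), h.totalD_Y _ hu,
      h.pd_Y_one _ hu, h.pd_Y_two _ hu, h.pd_Y_three _ hu]
    simp only [Fin.reduceFinMk, Matrix.cons_val]
    change (X 4 * y' - u 4 * (X 0 * (y' * e1) + w1 * (y' * pd 1 φ.logEta v) + w2 * 0 + w3 * 0))
      / y' ^ 2 = _
    field_simp
    ring
  · change fderiv ℝ (fun u => (u 5 - totalD F φ.logEta (jet u)) / pd 0 φ.xbar (jet u)) u X = _
    rw [quot _ _ ((smooth_coord 5).sub sE) sX hX,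
      fderiv_fun_sub (smooth_coord 5).diff sE.diff, sub_apply, p5,
      comp _ (h.smooth_e1 _ hu), comp _ (h.smooth_X _ hu), h.totalD_X _ hu,
      h.pd_X 1 (by decide) _ hu, h.pd_X 2 (by decide) _ hu, h.pd_X 3 (by decide) _ hu,
      h.pd_e1_three _ hu, h.pd_e1_two _ hu, h.pd_e1_one _ hu]
    simp only [Fin.reduceFinMk, Matrix.cons_val]
    change ((X 5 - (X 0 * e2 + w1 * totalD F (pd 1 φ.logEta) v + w2 * pd 1 φ.logEta v + w3 * 0)) * x'
      - (u 5 - e1) * (X 0 * (x' * c1) + w1 * 0 + w2 * 0 + w3 * 0)) / x' ^ 2 = _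
    field_simp
    ring

/-- The lift of a fiber-preserving transformation respects the invariant coframes. -/
theorem coframe_lift {u : Fin 6 → ℝ} (hu : jet u ∈ N) (h4 : u 4 ≠ 0)
    (hqq : pd 3 (pd 3 F) (jet u) ≠ 0) (X : Fin 6 → ℝ) :
    coframe F u X = coframe F' (φ.lift F u) (fderiv ℝ (φ.lift F) u X) := by
  have hX := h.X_ne _ hu
  have hY := h.Y_ne _ hu
  have e33 := h.pd_three_three_F _ hu
  have hqq' : pd 3 (pd 3 F') (φ.prol F (jet u)) ≠ 0 := by
    intro h0; rw [h0, mul_zero] at e33; exact hqq e33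
  rw [h.fderiv_lift hu]
  simp only [coframe, jet_lift, e33, h.pd_three_F _ hu, h.pd_one_three_F _ hu,
    h.pd_three_three_three_F _ hu, h.pd_two_three_three_F _ hu, h.pd_one_three_three_F _ hu,
    h.Kfun_F _ hu, h.pd_three_Kfun_F _ hu, h.pd_two_Kfun_F _ hu]
  simp only [lift, Matrix.cons_val]
  generalize pd 0 φ.xbar (jet u) = x' at *
  generalize pd 1 φ.ybar (jet u) = y' at *
  generalize pd 3 (pd 3 F') (φ.prol F (jet u)) = Fqq at *
  generalize totalD F φ.logEta (jet u) = e1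
  generalize totalD F φ.logChi (jet u) = c1
  generalize totalD F (totalD F φ.logEta) (jet u) = e2
  generalize totalD F (pd 1 φ.logEta) (jet u) = ey1
  generalize pd 1 φ.logEta (jet u) = ey
  generalize pd 3 F' (φ.prol F (jet u)) = Fq
  generalize pd 3 (pd 3 (pd 3 F')) (φ.prol F (jet u)) = Fqqq
  generalize pd 2 (pd 3 (pd 3 F')) (φ.prol F (jet u)) = Fqqp
  generalize pd 1 (pd 3 (pd 3 F')) (φ.prol F (jet u)) = Fqqy
  generalize pd 1 (pd 3 F') (φ.prol F (jet u)) = Fqy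
  generalize pd 2 (pd 3 F') (φ.prol F (jet u)) = Fqp
  generalize pd 3 (Kfun F') (φ.prol F (jet u)) = Kq
  generalize pd 2 (Kfun F') (φ.prol F (jet u)) = Kp
  generalize Kfun F' (φ.prol F (jet u)) = K
  generalize φ.pbar F (jet u) = pb
  generalize φ.qbar F (jet u) = qb
  generalize F' (φ.prol F (jet u)) = rb
  generalize X 1 - u 2 * X 0 = w1
  generalize X 2 - u 3 * X 0 = w2
  generalize X 3 - F (jet u) * X 0 = w3
  generalize u 4 = α at *
  generalize u 5 = γ at *
  funext a
  fin_cases a <;> simp only [Fin.reduceFinMk, Fin.zero_eta, Fin.mk_one, Matrix.cons_val] <;>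
    field_simp <;> ring

end RelatesOn

end FPTransformation

/-! ### Vector-valued one-forms and their exterior derivatives -/

/-- The bilinear form with matrix `Q`. -/
def bil {n : ℕ} (Q : Matrix (Fin n) (Fin n) ℝ) (X Y : Fin n → ℝ) : ℝ :=
  ∑ a, ∑ b, Q a b * X a * Y b

section bil

variable {n : ℕ} (Q : Matrix (Fin n) (Fin n) ℝ)

lemma bil_add_left (X X' Y : Fin n → ℝ) : bil Q (X + X') Y = bil Q X Y + bil Q X' Y := by
  simp only [bil, ← Finset.sum_add_distrib, Pi.add_apply]
  exact Finset.sum_congr rfl fun a _ => Finset.sum_congr rfl fun b _ => by ring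

lemma bil_add_right (X Y Y' : Fin n → ℝ) : bil Q X (Y + Y') = bil Q X Y + bil Q X Y' := by
  simp only [bil, ← Finset.sum_add_distrib, Pi.add_apply]
  exact Finset.sum_congr rfl fun a _ => Finset.sum_congr rfl fun b _ => by ring

lemma bil_sub_left (X X' Y : Fin n → ℝ) : bil Q (X - X') Y = bil Q X Y - bil Q X' Y := by
  simp only [bil, ← Finset.sum_sub_distrib, Pi.sub_apply]
  exact Finset.sum_congr rfl fun a _ => Finset.sum_congr rfl fun b _ => by ring

lemma bil_sub_right (X Y Y' : Fin n → ℝ) : bil Q X (Y - Y') = bil Q X Y - bil Q X Y' := by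
  simp only [bil, ← Finset.sum_sub_distrib, Pi.sub_apply]
  exact Finset.sum_congr rfl fun a _ => Finset.sum_congr rfl fun b _ => by ring

lemma bil_smul_left (c : ℝ) (X Y : Fin n → ℝ) : bil Q (c • X) Y = c * bil Q X Y := by
  simp only [bil, Finset.mul_sum, Pi.smul_apply, smul_eq_mul]
  exact Finset.sum_congr rfl fun a _ => Finset.sum_congr rfl fun b _ => by ring

lemma bil_comm {Q : Matrix (Fin n) (Fin n) ℝ} (hQ : Q.IsSymm) (X Y : Fin n → ℝ) :
    bil Q X Y = bil Q Y X := by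
  unfold bil
  rw [Finset.sum_comm]
  refine Finset.sum_congr rfl fun a _ => Finset.sum_congr rfl fun b _ => ?_
  rw [← hQ.apply a b]; ring

lemma bil_zero_left (Y : Fin n → ℝ) : bil Q 0 Y = 0 := by simp [bil]

end bil

/-- The exterior derivative of a vector-valued one-form `θ`, on a pair of tangent vectors; the
vectors are extended to constant fields. -/
def dForm {m n : ℕ} (θ : (Fin m → ℝ) → (Fin m → ℝ) → (Fin n → ℝ)) (u X Y : Fin m → ℝ) :
    Fin n → ℝ :=
  fun a => fderiv ℝ (fun w => θ w Y a) u X - fderiv ℝ (fun w => θ w X a) u Y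

section Directional

variable {m : ℕ} {f g : (Fin m → ℝ) → ℝ} {u : Fin m → ℝ}

lemma fderiv_mul_apply (hf : Smooth f u) (hg : Smooth g u) (X : Fin m → ℝ) :
    fderiv ℝ (fun w => f w * g w) u X = f u * fderiv ℝ g u X + g u * fderiv ℝ f u X := by
  rw [fderiv_fun_mul hf.diff hg.diff]; simp

lemma fderiv_sum_apply {ι : Type*} (s : Finset ι) {f : ι → (Fin m → ℝ) → ℝ}
    (hf : ∀ i ∈ s, Smooth (f i) u) (X : Fin m → ℝ) :
    fderiv ℝ (fun w => ∑ i ∈ s, f i w) u X = ∑ i ∈ s, fderiv ℝ (f i) u X := by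
  rw [fderiv_fun_sum fun i hi => (hf i hi).diff]; simp

lemma fderiv_bil_apply {n : ℕ} (Q : Matrix (Fin n) (Fin n) ℝ) {f g : (Fin m → ℝ) → (Fin n → ℝ)}
    (hf : ∀ a, Smooth (fun w => f w a) u) (hg : ∀ a, Smooth (fun w => g w a) u)
    (X : Fin m → ℝ) : fderiv ℝ (fun w => bil Q (f w) (g w)) u X
      = bil Q (fun a => fderiv ℝ (fun w => f w a) u X) (g u)
        + bil Q (f u) (fun a => fderiv ℝ (fun w => g w a) u X) := by
  have s1 : ∀ a b, Smooth (fun w => Q a b * f w a) u := fun a b => contDiffAt_const.mul (hf a)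
  have s2 : ∀ a b, Smooth (fun w => Q a b * f w a * g w b) u := fun a b => (s1 a b).mul (hg b)
  have s3 : ∀ a, Smooth (fun w => ∑ b, Q a b * f w a * g w b) u := fun a =>
    ContDiffAt.sum fun b _ => s2 a b
  unfold bil
  rw [fderiv_sum_apply _ fun a _ => s3 a, ← Finset.sum_add_distrib]
  refine Finset.sum_congr rfl fun a _ => ?_
  rw [fderiv_sum_apply _ fun b _ => s2 a b, ← Finset.sum_add_distrib]
  refine Finset.sum_congr rfl fun b _ => ?_
  rw [fderiv_mul_apply (s1 a b) (hg b), fderiv_const_mul (hf a).diff]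
  simp
  ring

/-- Symmetry of the second derivative of a vector-valued function. -/
lemma fderiv_fderiv_comm {n : ℕ} {Ψ : (Fin m → ℝ) → (Fin n → ℝ)} (hΨ : Smooth Ψ u)
    (X Y : Fin m → ℝ) (i : Fin n) :
    fderiv ℝ (fun w => fderiv ℝ Ψ w Y i) u X = fderiv ℝ (fun w => fderiv ℝ Ψ w X i) u Y := by
  have h : Smooth (fderiv ℝ Ψ) u := hΨ.fderiv_right (by simp)
  have hs : IsSymmSndFDerivAt ℝ Ψ u :=
    hΨ.isSymmSndFDerivAt (by simp; exact ENat.LEInfty.out)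
  have key : ∀ X Y : Fin m → ℝ, fderiv ℝ (fun w => fderiv ℝ Ψ w Y i) u X
      = fderiv ℝ (fderiv ℝ Ψ) u X Y i := by
    intro X Y
    have h1 := h.diff.hasFDerivAt.clm_apply (hasFDerivAt_const Y u)
    have h2 := (hasFDerivAt_pi'.1 h1 i).fderiv
    rw [h2]; simp
  rw [key, key, hs X Y]

lemma smooth_fderiv_apply {n : ℕ} {Ψ : (Fin m → ℝ) → (Fin n → ℝ)} (hΨ : Smooth Ψ u)
    (X : Fin m → ℝ) (i : Fin n) : Smooth (fun w => fderiv ℝ Ψ w X i) u := by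
  have h : Smooth (fderiv ℝ Ψ) u := hΨ.fderiv_right (by simp)
  exact smooth_pi.1 (h.clm_apply contDiffAt_const) i

end Directional

/-- **Invariance along the fibers.** If the pullback of `G` by `π` has constant coefficients `Q` in
the frame of one-forms `θ`, then contraction of `dθ` with a vector tangent to the fibers of `π` is
skew with respect to `Q`. This is the vanishing of the Lie derivative of `π^*G` along the fibers,
written without extending the vertical vector to a vertical field. -/
theorem bil_dForm_vertical {m n k : ℕ} {θ : (Fin m → ℝ) → (Fin m → ℝ) → (Fin n → ℝ)}
    {Q : Matrix (Fin n) (Fin n) ℝ} (hQ : Q.IsSymm) {π : (Fin m → ℝ) → (Fin k → ℝ)}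
    {G : (Fin k → ℝ) → Matrix (Fin k) (Fin k) ℝ} {u : Fin m → ℝ} (hπ : Smooth π u)
    (hG : ∀ i j, Smooth (fun z => G z i j) (π u))
    (hθ : ∀ X a, Smooth (fun w => θ w X a) u)
    (h : ∀ᶠ w in 𝓝 u, ∀ X Y,
      bil (G (π w)) (fderiv ℝ π w X) (fderiv ℝ π w Y) = bil Q (θ w X) (θ w Y))
    {V : Fin m → ℝ} (hV : fderiv ℝ π u V = 0) (hVQ : ∀ Z, bil Q (θ u V) Z = 0)
    (X Y : Fin m → ℝ) :
    bil Q (dForm θ u V X) (θ u Y) + bil Q (θ u X) (dForm θ u V Y) = 0 := by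
  -- derivative of the coefficients of the pullback, computed on the base
  have base : ∀ X Y Z : Fin m → ℝ, fderiv ℝ (fun w => bil Q (θ w X) (θ w Y)) u Z
      = ∑ i, ∑ j, (fderiv ℝ (fun z => G z i j) (π u) (fderiv ℝ π u Z) * fderiv ℝ π u X i
            * fderiv ℝ π u Y j
          + G (π u) i j * fderiv ℝ (fun w => fderiv ℝ π w X i) u Z * fderiv ℝ π u Y j
          + G (π u) i j * fderiv ℝ π u X i * fderiv ℝ (fun w => fderiv ℝ π w Y j) u Z) := by
    intro X Y Z
    have e1 : (fun w => bil Q (θ w X) (θ w Y)) =ᶠ[𝓝 u]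
        fun w => ∑ i, ∑ j, G (π w) i j * fderiv ℝ π w X i * fderiv ℝ π w Y j := by
      filter_upwards [h] with w hw
      rw [← hw]; rfl
    have s0 : ∀ i j, Smooth (fun w => G (π w) i j) u := fun i j => ContDiffAt.comp u (hG i j) hπ
    have s1 : ∀ i j, Smooth (fun w => G (π w) i j * fderiv ℝ π w X i) u := fun i j =>
      (s0 i j).mul (smooth_fderiv_apply hπ X i)
    have s2 : ∀ i j, Smooth (fun w => G (π w) i j * fderiv ℝ π w X i * fderiv ℝ π w Y j) u :=
      fun i j => (s1 i j).mul (smooth_fderiv_apply hπ Y j)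
    rw [e1.fderiv_eq, fderiv_sum_apply _ fun i _ => ContDiffAt.sum fun j _ => s2 i j]
    refine Finset.sum_congr rfl fun i _ => ?_
    rw [fderiv_sum_apply _ fun j _ => s2 i j]
    refine Finset.sum_congr rfl fun j _ => ?_
    rw [fderiv_mul_apply (s1 i j) (smooth_fderiv_apply hπ Y j),
      fderiv_mul_apply (s0 i j) (smooth_fderiv_apply hπ X i)]
    have e3 := ((hG i j).diff.hasFDerivAt.comp u hπ.diff.hasFDerivAt).fderiv
    rw [show (fun w => G (π w) i j) = (fun z => G z i j) ∘ π from rfl, e3]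
    simp
    ring
  have e := base X Y V
  have eX := base V Y X
  have eY := base X V Y
  have comb : fderiv ℝ (fun w => bil Q (θ w X) (θ w Y)) u V
      = fderiv ℝ (fun w => bil Q (θ w V) (θ w Y)) u X
        + fderiv ℝ (fun w => bil Q (θ w X) (θ w V)) u Y := by
    rw [e, eX, eY, ← Finset.sum_add_distrib]
    refine Finset.sum_congr rfl fun i _ => ?_
    rw [← Finset.sum_add_distrib]
    refine Finset.sum_congr rfl fun j _ => ?_
    rw [hV, fderiv_fderiv_comm hπ X V i, fderiv_fderiv_comm hπ Y V j]
    simp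
  have sθ := fun X a => hθ X a
  rw [fderiv_bil_apply Q (sθ X) (sθ Y), fderiv_bil_apply Q (sθ V) (sθ Y),
    fderiv_bil_apply Q (sθ X) (sθ V), hVQ, bil_comm hQ _ (θ u V), hVQ] at comb
  have d1 : dForm θ u V X = (fun a => fderiv ℝ (fun w => θ w X a) u V)
      - (fun a => fderiv ℝ (fun w => θ w V a) u X) := rfl
  have d2 : dForm θ u V Y = (fun a => fderiv ℝ (fun w => θ w Y a) u V)
      - (fun a => fderiv ℝ (fun w => θ w V a) u Y) := rfl
  rw [d1, d2, bil_sub_left, bil_sub_right]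
  linarith

/-! ### The coframe as a frame of one-forms -/

lemma coframe_linear (F : (Fin 4 → ℝ) → ℝ) (u X : Fin 6 → ℝ) (a : Fin 6) :
    coframe F u X a = ∑ i, X i * coframe F u (Pi.single i 1) a := by
  rw [Fin.sum_univ_six]
  fin_cases a <;> simp [coframe] <;> ring

lemma smooth_coframe {F : (Fin 4 → ℝ) → ℝ} {u : Fin 6 → ℝ} (hF : Smooth F (jet u))
    (h4 : u 4 ≠ 0) (hqq : pd 3 (pd 3 F) (jet u) ≠ 0) (X : Fin 6 → ℝ) (a : Fin 6) :
    Smooth (fun w => coframe F w X a) u := by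
  have cj : ∀ {f : (Fin 4 → ℝ) → ℝ}, Smooth f (jet u) → Smooth (fun w => f (jet w)) u :=
    fun hf => ContDiffAt.comp u hf (smooth_jet u)
  have sj := smooth_jet u
  have s3 := cj (hF.pd 3)
  have s33 := cj ((hF.pd 3).pd 3)
  have s13 := cj ((hF.pd 3).pd 1)
  have s333 := cj (((hF.pd 3).pd 3).pd 3)
  have s233 := cj (((hF.pd 3).pd 3).pd 2)
  have s133 := cj (((hF.pd 3).pd 3).pd 1)
  have sK := cj hF.Kfun
  have sKq := cj (hF.Kfun.pd 3)
  have sKp := cj (hF.Kfun.pd 2)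
  have c : ∀ i : Fin 6, Smooth (fun w : Fin 6 → ℝ => w i) u := fun i => smooth_coord i
  have h6 : 6 * u 4 ≠ 0 := by positivity
  have h36 : 36 * u 4 ≠ 0 := by positivity
  fin_cases a <;>
    simp only [Smooth, coframe, Fin.reduceFinMk, Fin.zero_eta, Fin.mk_one, Matrix.cons_val] at * <;>
    fun_prop (disch := assumption)

/-! ### Local inverses and metrics pulled back from a frame of one-forms -/

/-- The inverse function theorem, with a smooth inverse on the whole target. -/
lemma exists_local_inverse_of_equiv {E : Type*} [NormedAddCommGroup E] [NormedSpace ℝ E]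
    [CompleteSpace E] {Ψ : E → E} {N : Set E} (hN : IsOpen N) {u : E} (hu : u ∈ N)
    (hΨ : ∀ w ∈ N, Smooth Ψ w) (e' : E ≃L[ℝ] E) (hd : HasFDerivAt Ψ (e' : E →L[ℝ] E) u) :
    ∃ e : OpenPartialHomeomorph E E, u ∈ e.source ∧ e.source ⊆ N ∧
      (⇑e = Ψ) ∧ (∀ z ∈ e.target, Smooth e.symm z) := by
  have hu' := hΨ u hu
  let e0 := hu'.toOpenPartialHomeomorph Ψ hd (by simp)
  have hopen : IsOpen (N ∩ fderiv ℝ Ψ ⁻¹' Set.range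
      ((↑) : (E ≃L[ℝ] E) → (E →L[ℝ] E))) := by
    refine ContinuousOn.isOpen_inter_preimage ?_ hN ContinuousLinearEquiv.isOpen
    intro w hw
    exact ((hΨ w hw).fderiv_right (m := ∞) (by simp)).continuousAt.continuousWithinAt
  refine ⟨e0.restrOpen _ hopen, ⟨hu'.mem_toOpenPartialHomeomorph_source hd (by simp),
    hu, ⟨e', hd.fderiv.symm⟩⟩, fun w hw => hw.2.1, rfl, ?_⟩
  intro z hz
  have hz1 := (e0.restrOpen _ hopen).map_target hz
  obtain ⟨f', hf'⟩ := hz1.2.2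
  refine OpenPartialHomeomorph.contDiffAt_symm _ (f₀' := f') hz ?_ (hΨ _ hz1.2.1)
  have := (hΨ _ hz1.2.1).diff.hasFDerivAt
  change HasFDerivAt Ψ (f' : E →L[ℝ] E) _
  rw [hf']
  exact this

lemma exists_local_inverse {m : ℕ} {Ψ : (Fin m → ℝ) → (Fin m → ℝ)} {N : Set (Fin m → ℝ)}
    (hN : IsOpen N) {u : Fin m → ℝ} (hu : u ∈ N) (hΨ : ∀ w ∈ N, Smooth Ψ w)
    (hinj : ∀ X, fderiv ℝ Ψ u X = 0 → X = 0) :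
    ∃ e : OpenPartialHomeomorph (Fin m → ℝ) (Fin m → ℝ), u ∈ e.source ∧ e.source ⊆ N ∧
      (⇑e = Ψ) ∧ (∀ z ∈ e.target, Smooth e.symm z) := by
  have hi : Function.Injective (fderiv ℝ Ψ u : (Fin m → ℝ) →ₗ[ℝ] (Fin m → ℝ)) :=
    (injective_iff_map_eq_zero _).2 hinj
  refine exists_local_inverse_of_equiv hN hu hΨ
    (LinearEquiv.ofInjectiveEndo _ hi).toContinuousLinearEquiv ?_
  exact (hΨ u hu).diff.hasFDerivAt

/-- The differential of the local inverse. -/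
lemma fderiv_local_inverse {m : ℕ} {e : OpenPartialHomeomorph (Fin m → ℝ) (Fin m → ℝ)}
    {z : Fin m → ℝ} (hz : z ∈ e.target) (h : Smooth e (e.symm z)) (hs : Smooth e.symm z)
    (X : Fin m → ℝ) : fderiv ℝ e (e.symm z) (fderiv ℝ e.symm z X) = X := by
  have h1 : (fun w => e (e.symm w)) =ᶠ[𝓝 z] id := by
    filter_upwards [e.open_target.mem_nhds hz] with w hw using e.right_inv hw
  have h2 := (h.diff.hasFDerivAt.comp z hs.diff.hasFDerivAt).fderiv
  have h3 := h1.fderiv_eq (𝕜 := ℝ)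
  rw [show (fun w => e (e.symm w)) = e ∘ e.symm from rfl, h2, fderiv_id] at h3
  exact congrArg (fun L : (Fin m → ℝ) →L[ℝ] (Fin m → ℝ) => L X) h3

/-- On the open set `S`, the pullback of the nondegenerate metric `G` by the submersion `π` has the
constant coefficients `Q` in the frame of one-forms `θ`. -/
structure PullsBack {n : ℕ} (Q : Matrix (Fin n) (Fin n) ℝ)
    (θ : (Fin 6 → ℝ) → (Fin 6 → ℝ) → (Fin n → ℝ))
    (S : Set (Fin 6 → ℝ)) (π : (Fin 6 → ℝ) → (Fin 4 → ℝ))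
    (G : (Fin 4 → ℝ) → Matrix (Fin 4) (Fin 4) ℝ) : Prop where
  isOpen : IsOpen S
  smooth : ∀ w ∈ S, Smooth π w
  smoothG : ∀ w ∈ S, ∀ i j, Smooth (fun z => G z i j) (π w)
  surj : ∀ w ∈ S, Function.Surjective (fderiv ℝ π w)
  nondeg : ∀ w ∈ S, ∀ X, (∀ Y, bil (G (π w)) X Y = 0) → X = 0
  pull : ∀ w ∈ S, ∀ X Y,
    bil (G (π w)) (fderiv ℝ π w X) (fderiv ℝ π w Y) = bil Q (θ w X) (θ w Y)

namespace PullsBack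

variable {n : ℕ} {Q : Matrix (Fin n) (Fin n) ℝ} {θ : (Fin 6 → ℝ) → (Fin 6 → ℝ) → (Fin n → ℝ)}
  {S : Set (Fin 6 → ℝ)} {π : (Fin 6 → ℝ) → (Fin 4 → ℝ)}
  {G : (Fin 4 → ℝ) → Matrix (Fin 4) (Fin 4) ℝ}

lemma mono (h : PullsBack Q θ S π G) {S' : Set (Fin 6 → ℝ)} (hS' : IsOpen S') (hs : S' ⊆ S) :
    PullsBack Q θ S' π G :=
  ⟨hS', fun w hw => h.smooth w (hs hw), fun w hw => h.smoothG w (hs hw),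
    fun w hw => h.surj w (hs hw), fun w hw => h.nondeg w (hs hw), fun w hw => h.pull w (hs hw)⟩

/-- Change of coordinates on the total space. -/
lemma comp (h : PullsBack Q θ S π G) {θ' : (Fin 6 → ℝ) → (Fin 6 → ℝ) → (Fin n → ℝ)}
    {S' : Set (Fin 6 → ℝ)} (hS' : IsOpen S') {Λ : (Fin 6 → ℝ) → (Fin 6 → ℝ)}
    (hΛ : ∀ w ∈ S', Smooth Λ w) (hmap : ∀ w ∈ S', Λ w ∈ S)
    (hsurj : ∀ w ∈ S', Function.Surjective (fderiv ℝ Λ w))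
    (hθ : ∀ w ∈ S', ∀ X, θ' w X = θ (Λ w) (fderiv ℝ Λ w X)) :
    PullsBack Q θ' S' (π ∘ Λ) G := by
  have hd : ∀ w ∈ S', fderiv ℝ (π ∘ Λ) w = (fderiv ℝ π (Λ w)).comp (fderiv ℝ Λ w) :=
    fun w hw => ((h.smooth _ (hmap w hw)).diff.hasFDerivAt.comp w
      (hΛ w hw).diff.hasFDerivAt).fderiv
  refine ⟨hS', fun w hw => ContDiffAt.comp w (h.smooth _ (hmap w hw)) (hΛ w hw),
    fun w hw => h.smoothG _ (hmap w hw), fun w hw => ?_, fun w hw => h.nondeg _ (hmap w hw),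
    fun w hw X Y => ?_⟩
  · rw [hd w hw]
    exact (h.surj _ (hmap w hw)).comp (hsurj w hw)
  · rw [hd w hw, hθ w hw, hθ w hw, ← h.pull _ (hmap w hw)]
    rfl

/-- Vectors in the kernel of the pullback are tangent to the fibers. -/
lemma vertical (h : PullsBack Q θ S π G) {w : Fin 6 → ℝ} (hw : w ∈ S) {V : Fin 6 → ℝ}
    (hV : ∀ Z, bil Q (θ w V) (θ w Z) = 0) : fderiv ℝ π w V = 0 := by
  refine h.nondeg w hw _ fun Y => ?_
  obtain ⟨Z, rfl⟩ := h.surj w hw Y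
  rw [h.pull w hw, hV]

/-- The contraction of `dθ` with a vertical vector is skew with respect to `Q`. -/
lemma cond (h : PullsBack Q θ S π G) (hQ : Q.IsSymm)
    (hθ : ∀ w ∈ S, ∀ X a, Smooth (fun w => θ w X a) w) {w : Fin 6 → ℝ} (hw : w ∈ S) {V : Fin 6 → ℝ} (hV : ∀ Z, bil Q (θ w V) Z = 0)
    (X Y : Fin 6 → ℝ) :
    bil Q (dForm θ w V X) (θ w Y) + bil Q (θ w X) (dForm θ w V Y) = 0 :=
  bil_dForm_vertical hQ (h.smooth w hw) (h.smoothG w hw) (hθ w hw)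
    (by filter_upwards [h.isOpen.mem_nhds hw] with z hz using h.pull z hz)
    (h.vertical hw fun _ => hV _) hV X Y

end PullsBack

/-! ### Nondegeneracy of the coframe and of the metrics -/

lemma coframe_eq_zero {F : (Fin 4 → ℝ) → ℝ} {u : Fin 6 → ℝ} (h4 : u 4 ≠ 0)
    (hqq : pd 3 (pd 3 F) (jet u) ≠ 0) {X : Fin 6 → ℝ} (h : coframe F u X = 0) : X = 0 := by
  have c := fun a => congrFun h a
  have c0 := c 0
  have c1 := c 1
  have c2 := c 2
  have c3 := c 3
  have c4 := c 4
  have c5 := c 5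
  simp only [coframe, Matrix.cons_val, Pi.zero_apply] at c0 c1 c2 c3 c4 c5
  have e0 : X 0 = 0 := by
    rcases mul_eq_zero.1 c3 with h | h
    · exact absurd h (by positivity)
    · exact h
  rw [e0] at c0 c1 c2 c4 c5
  have e1 : X 1 = 0 := by
    rcases mul_eq_zero.1 c0 with h | h
    · exact absurd h h4
    · simpa using h
  rw [e1] at c1 c2 c4 c5
  have e2 : X 2 = 0 := by
    rcases mul_eq_zero.1 c1 with h | h
    · exact absurd h (by positivity)
    · simpa using h
  rw [e2] at c2 c5
  have e3 : X 3 = 0 := by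
    rcases mul_eq_zero.1 c2 with h | h
    · exact absurd h (by positivity)
    · simpa using h
  have e4 : X 4 = 0 := by
    have : (1 / u 4) * X 4 = 0 := by linarith
    rcases mul_eq_zero.1 this with h | h
    · exact absurd h (by positivity)
    · exact h
  have e5 : X 5 = 0 := by
    have : (1 / (6 * u 4)) * pd 3 (pd 3 F) (jet u) * X 5 = 0 := by linarith
    rcases mul_eq_zero.1 this with h | h
    · exact absurd h (by positivity)
    · exact h
  funext a
  fin_cases a <;> assumption

lemma coframe_add (F : (Fin 4 → ℝ) → ℝ) (u X Y : Fin 6 → ℝ) :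
    coframe F u (X + Y) = coframe F u X + coframe F u Y := by
  funext a
  simp only [Pi.add_apply]
  rw [coframe_linear, coframe_linear F u X, coframe_linear F u Y, ← Finset.sum_add_distrib]
  exact Finset.sum_congr rfl fun i _ => by simp only [Pi.add_apply]; ring

lemma coframe_smul (F : (Fin 4 → ℝ) → ℝ) (u : Fin 6 → ℝ) (c : ℝ) (X : Fin 6 → ℝ) :
    coframe F u (c • X) = c • coframe F u X := by
  funext a
  simp only [Pi.smul_apply, smul_eq_mul]
  rw [coframe_linear, coframe_linear F u X, Finset.mul_sum]
  exact Finset.sum_congr rfl fun i _ => by simp only [Pi.smul_apply, smul_eq_mul]; ring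

/-- The coframe identifies the tangent space with `ℝ⁶`. -/
lemma coframe_surjective {F : (Fin 4 → ℝ) → ℝ} {u : Fin 6 → ℝ} (h4 : u 4 ≠ 0)
    (hqq : pd 3 (pd 3 F) (jet u) ≠ 0) (t : Fin 6 → ℝ) : ∃ X, coframe F u X = t := by
  let L : (Fin 6 → ℝ) →ₗ[ℝ] (Fin 6 → ℝ) :=
    { toFun := coframe F u, map_add' := coframe_add F u, map_smul' := coframe_smul F u }
  have hi : Function.Injective L := (injective_iff_map_eq_zero L).2 fun X hX =>
    coframe_eq_zero h4 hqq hX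
  exact (LinearMap.injective_iff_surjective.1 hi) t

lemma IsSplit.nondeg {g : Matrix (Fin 4) (Fin 4) ℝ} (hg : IsSplit g) {X : Fin 4 → ℝ}
    (h : ∀ Y, bil g X Y = 0) : X = 0 := by
  obtain ⟨T, hT, e⟩ := hg
  have hdet : g.det ≠ 0 := by
    intro h0
    have := congrArg Matrix.det e
    rw [Matrix.det_mul, Matrix.det_mul, h0, Matrix.det_diagonal] at this
    simp [Fin.prod_univ_four] at this
  have h1 : Matrix.vecMul X g = 0 := by
    funext j
    have := h (Pi.single j 1)
    simp only [bil, Pi.single_apply, mul_ite, mul_one, mul_zero, Finset.sum_ite_eq',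
      Finset.mem_univ, if_true] at this
    simp only [Matrix.vecMul, dotProduct, Pi.zero_apply]
    rw [← this]
    exact Finset.sum_congr rfl fun i _ => mul_comm _ _
  exact Matrix.eq_zero_of_vecMul_eq_zero hdet h1

namespace ODE.Regular

variable {E : ODE} (hE : E.Regular)
include hE

lemma smooth_F {v : Fin 4 → ℝ} (hv : v ∈ E.dom) : Smooth E.F v :=
  hE.smooth.contDiffAt (hE.isOpen_dom.mem_nhds hv)

lemma isOpen_P : IsOpen E.P := by
  have h1 : Continuous jet := continuous_iff_continuousAt.2 fun u => (smooth_jet u).continuousAt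
  exact (hE.isOpen_dom.preimage h1).inter (isOpen_ne_fun (continuous_apply 4) continuous_const)

end ODE.Regular

namespace MetricDatum

variable (m : MetricDatum)

lemma smooth_π_at {u : Fin 6 → ℝ} (hu : u ∈ m.W) : Smooth m.π u :=
  m.smooth_π.contDiffAt (m.isOpen_W.mem_nhds hu)

lemma isOpen_M : IsOpen (m.π '' m.W) := by
  rw [isOpen_iff_mem_nhds]
  rintro _ ⟨u, hu, rfl⟩
  have hs : HasStrictFDerivAt m.π (fderiv ℝ m.π u) u :=
    (m.smooth_π_at hu).hasStrictFDerivAt (by simp)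
  rw [← hs.map_nhds_eq_of_surj (LinearMap.range_eq_top.2 (m.submersion_π u hu))]
  exact image_mem_map (m.isOpen_W.mem_nhds hu)

lemma pullsBack (hm : m.IsSplitEinstein) {Q : Matrix (Fin 6) (Fin 6) ℝ}
    (hQ : m.HasCoefficients Q) : PullsBack Q (coframe m.ode.F) m.W m.π m.G where
  isOpen := m.isOpen_W
  smooth _ hw := m.smooth_π_at hw
  smoothG w hw i j := (m.smooth_G i j).contDiffAt (m.isOpen_M.mem_nhds ⟨w, hw, rfl⟩)
  surj := m.submersion_π
  nondeg _ hw _ hX := (hm _ ⟨_, hw, rfl⟩).1.nondeg hX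
  pull := hQ

end MetricDatum

/-! ### The two three-dimensional Lie algebras of the flat model -/

/-- Change of basis from `(θ¹, …, θ⁴, Ω¹, Ω²)` to the basis
`(θ⁴, 2θ³ + Ω², Ω¹ + 2θ²; 2θ¹ + θ⁴, Ω², Ω¹)`, in which the structure equations of the flat model are
those of the direct sum of two copies of `𝔰𝔩(2, ℝ)`. -/
def slBasis (s : Fin 6 → ℝ) : Fin 6 → ℝ :=
  ![s 3, 2 * s 2 + s 5, s 4 + 2 * s 1, 2 * s 0 + s 3, s 5, s 4]

/-- The product of the vector `a` with `s` in the Killing form `2 φ¹ φ² + φ³ φ³` of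
`𝔰𝔩(2, ℝ)`. -/
def killing (a s : Fin 3 → ℝ) : ℝ := a 0 * s 1 + a 1 * s 0 + a 2 * s 2

/-- The components in the first copy of `𝔰𝔩(2, ℝ)`. -/
def fstPart (s : Fin 6 → ℝ) : Fin 3 → ℝ := ![s 0, s 1, s 2]

/-- The components in the second copy of `𝔰𝔩(2, ℝ)`. -/
def sndPart (s : Fin 6 → ℝ) : Fin 3 → ℝ := ![s 3, s 4, s 5]

/-- The sum of the Killing forms of the two copies, with the squares of the forms dual to `A` and `B`
removed; it is degenerate in the directions `A` and `B` when these are unit vectors. -/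
def slForm (A B : Fin 3 → ℝ) (s t : Fin 6 → ℝ) : ℝ :=
  killing (fstPart s) (fstPart t) - killing A (fstPart s) * killing A (fstPart t)
    + (killing (sndPart s) (sndPart t) - killing B (sndPart s) * killing B (sndPart t))

/-- The matrix of `slForm` in the basis of its definition. -/
def slMatrix (A B : Fin 3 → ℝ) : Matrix (Fin 6) (Fin 6) ℝ :=
  Matrix.of fun i j => slForm A B (Pi.single i 1) (Pi.single j 1)

lemma slMatrix_isSymm (A B : Fin 3 → ℝ) : (slMatrix A B).IsSymm := by
  ext i j
  simp only [slMatrix, Matrix.transpose_apply, Matrix.of_apply, slForm, killing]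
  ring

lemma bil_slMatrix (A B : Fin 3 → ℝ) (s t : Fin 6 → ℝ) :
    bil (slMatrix A B) s t = slForm A B s t := by
  simp only [bil, slMatrix, Matrix.of_apply, slForm, killing, fstPart, sndPart, Matrix.cons_val,
    Fin.sum_univ_six]
  simp
  ring

lemma slForm_ker_fst {A : Fin 3 → ℝ} (hA : killing A A = 1) (B : Fin 3 → ℝ) {s : Fin 6 → ℝ}
    (hs : fstPart s = A) (hs' : sndPart s = 0) (t : Fin 6 → ℝ) : slForm A B s t = 0 := by
  simp only [slForm, hs, hs', hA]
  simp [killing]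

lemma slForm_ker_snd (A : Fin 3 → ℝ) {B : Fin 3 → ℝ} (hB : killing B B = 1) {s : Fin 6 → ℝ}
    (hs : fstPart s = 0) (hs' : sndPart s = B) (t : Fin 6 → ℝ) : slForm A B s t = 0 := by
  simp only [slForm, hs, hs', hB]
  simp [killing]

/-- The coframe in the basis of the two copies of `𝔰𝔩(2, ℝ)`. -/
def slframe (F : (Fin 4 → ℝ) → ℝ) (u X : Fin 6 → ℝ) : Fin 6 → ℝ := slBasis (coframe F u X)

lemma smooth_slframe {F : (Fin 4 → ℝ) → ℝ} {u : Fin 6 → ℝ} (hF : Smooth F (jet u))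
    (h4 : u 4 ≠ 0) (hqq : pd 3 (pd 3 F) (jet u) ≠ 0) (X : Fin 6 → ℝ) (a : Fin 6) :
    Smooth (fun w => slframe F w X a) u := by
  have s := smooth_coframe hF h4 hqq X
  have c : ∀ f : (Fin 6 → ℝ) → ℝ, Smooth f u → Smooth (fun w => 2 * f w) u := fun f hf =>
    contDiffAt_const.mul hf
  fin_cases a
  · exact s 3
  · exact (c _ (s 2)).add (s 5)
  · exact (s 4).add (c _ (s 1))
  · exact (c _ (s 0)).add (s 3)
  · exact s 5
  · exact s 4

lemma slframe_surjective {F : (Fin 4 → ℝ) → ℝ} {u : Fin 6 → ℝ} (h4 : u 4 ≠ 0)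
    (hqq : pd 3 (pd 3 F) (jet u) ≠ 0) (s : Fin 6 → ℝ) : ∃ X, slframe F u X = s := by
  obtain ⟨X, hX⟩ := coframe_surjective h4 hqq
    ![(s 3 - s 0) / 2, (s 2 - s 5) / 2, (s 1 - s 4) / 2, s 0, s 5, s 4]
  refine ⟨X, ?_⟩
  rw [slframe, hX]
  funext a
  fin_cases a <;> simp [slBasis] <;> ring

/-! ### Equations that are quadratic in `q` with leading coefficient `3 / (2 p)` -/

section Directional

variable {m : ℕ} {f g : (Fin m → ℝ) → ℝ} {u V : Fin m → ℝ}

lemma D_add (hf : DifferentiableAt ℝ f u) (hg : DifferentiableAt ℝ g u) :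
    fderiv ℝ (fun w => f w + g w) u V = fderiv ℝ f u V + fderiv ℝ g u V := by
  rw [fderiv_fun_add hf hg]; simp

lemma D_sub (hf : DifferentiableAt ℝ f u) (hg : DifferentiableAt ℝ g u) :
    fderiv ℝ (fun w => f w - g w) u V = fderiv ℝ f u V - fderiv ℝ g u V := by
  rw [fderiv_fun_sub hf hg]; simp

lemma D_neg : fderiv ℝ (fun w => -f w) u V = -fderiv ℝ f u V := by
  rw [fderiv_fun_neg]; simp

lemma D_mul (hf : DifferentiableAt ℝ f u) (hg : DifferentiableAt ℝ g u) :
    fderiv ℝ (fun w => f w * g w) u V = f u * fderiv ℝ g u V + g u * fderiv ℝ f u V := by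
  rw [fderiv_fun_mul hf hg]; simp

lemma D_const (c : ℝ) : fderiv ℝ (fun _ : Fin m → ℝ => c) u V = 0 := by simp

lemma D_coord (i : Fin m) : fderiv ℝ (fun w : Fin m → ℝ => w i) u V = V i := by
  rw [(hasFDerivAt_apply i u).fderiv]; rfl

lemma D_inv (hg : DifferentiableAt ℝ g u) (h0 : g u ≠ 0) :
    fderiv ℝ (fun w => (g w)⁻¹) u V = -fderiv ℝ g u V / g u ^ 2 := by
  have h := (hasFDerivAt_inv h0).comp u hg.hasFDerivAt
  rw [show (fun w => (g w)⁻¹) = (fun x => x⁻¹) ∘ g from rfl, h.fderiv]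
  simp
  field_simp

lemma D_div (hf : DifferentiableAt ℝ f u) (hg : DifferentiableAt ℝ g u) (h0 : g u ≠ 0) :
    fderiv ℝ (fun w => f w / g w) u V
      = (fderiv ℝ f u V * g u - f u * fderiv ℝ g u V) / g u ^ 2 := by
  have hi : DifferentiableAt ℝ (fun w => (g w)⁻¹) u := hg.inv h0
  simp only [div_eq_mul_inv]
  rw [D_mul hf hi, D_inv hg h0]
  field_simp
  ring

lemma D_pow (hf : DifferentiableAt ℝ f u) (n : ℕ) :
    fderiv ℝ (fun w => f w ^ n) u V = n * f u ^ (n - 1) * fderiv ℝ f u V := by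
  rw [(hf.hasFDerivAt.pow n).fderiv]; simp

end Directional

/-- The shape of the coframe of an equation with `F_qq = 3 / p`, in the basis of the two copies of
`𝔰𝔩(2, ℝ)`. The arguments are functions on the six-dimensional space, of which `β = F_q - 3 q / p` and
`k = K_q` come from the space of jets. -/
def semiframe (β k p₀ p₁ r₀ r₁ : (Fin 6 → ℝ) → ℝ) (w X : Fin 6 → ℝ) : Fin 6 → ℝ :=
  ![2 * w 4 * w 2 * X 0,
    (X 3 / w 2 - w 3 / w 2 ^ 2 * X 2 + X 5 - β w / (3 * w 2) * X 2 + p₀ w * X 0 + p₁ w * X 1)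
      / (2 * w 4 * w 2),
    X 4 / w 4 + X 2 / w 2 - (w 3 / w 2 + w 5) * X 0 + k w * (X 1 - w 2 * X 0),
    2 * w 4 * X 1,
    (X 5 / w 2 - w 5 / w 2 ^ 2 * X 2 + r₀ w * X 0 + r₁ w * X 1) / (2 * w 4),
    X 4 / w 4 - w 5 / w 2 * X 1 + k w * (X 1 - w 2 * X 0)]

/-- An equation with `F_qq = 3 / p`, on an open set of jets where `p` has no zero. -/
structure SemiNormal (F : (Fin 4 → ℝ) → ℝ) (N : Set (Fin 4 → ℝ)) : Prop where
  isOpen : IsOpen N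
  smooth : ∀ v ∈ N, Smooth F v
  p_ne : ∀ v ∈ N, v 2 ≠ 0
  Fqq : ∀ v ∈ N, pd 3 (pd 3 F) v = 3 / v 2

/-- The part of `F_q` that does not depend on `q`, when `F_qq = 3 / p`. -/
def betaOf (F : (Fin 4 → ℝ) → ℝ) (v : Fin 4 → ℝ) : ℝ := pd 3 F v - 3 * v 3 / v 2

/-- The coefficient `σ` of the coframe of an equation with `F_qq = 3 / p`. -/
def sigmaOf (F : (Fin 4 → ℝ) → ℝ) (v : Fin 4 → ℝ) : ℝ :=
  (-(pd 1 (betaOf F) v / 3) - pd 2 (Kfun F) v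
    - (v 3 / v 2 + betaOf F v / 3) * pd 3 (Kfun F) v + Kfun F v / v 2) / v 2

/-- The coefficient of `dx` in the second one-form of `semiframe`. -/
def coefPx (F : (Fin 4 → ℝ) → ℝ) (u : Fin 6 → ℝ) : ℝ :=
  -(F (jet u) / u 2) - (u 5 - u 3 / u 2 - betaOf F (jet u) / 3) * (u 3 / u 2) - u 5 ^ 2 / 2
    - 2 * Kfun F (jet u) - betaOf F (jet u) * u 5 / 3 - u 2 * pd 3 (Kfun F) (jet u) * u 5
    - u 2 ^ 2 * sigmaOf F (jet u)

/-- The coefficient of `dy` in the second one-form of `semiframe`. -/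
def coefPy (F : (Fin 4 → ℝ) → ℝ) (u : Fin 6 → ℝ) : ℝ :=
  Kfun F (jet u) / u 2 + pd 3 (Kfun F) (jet u) * u 5 + u 2 * sigmaOf F (jet u)

/-- The coefficient of `dx` in the fifth one-form of `semiframe`. -/
def coefRx (F : (Fin 4 → ℝ) → ℝ) (u : Fin 6 → ℝ) : ℝ :=
  -(betaOf F (jet u) * u 5 / (3 * u 2) + Kfun F (jet u) / u 2)
    - (pd 3 (Kfun F) (jet u) * u 5 + u 2 * sigmaOf F (jet u))

/-- The coefficient of `dy` in the fifth one-form of `semiframe`. -/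
def coefRy (F : (Fin 4 → ℝ) → ℝ) (u : Fin 6 → ℝ) : ℝ :=
  -(u 5 ^ 2 / (2 * u 2 ^ 2)) + pd 3 (Kfun F) (jet u) * u 5 / u 2 + sigmaOf F (jet u)

namespace SemiNormal

variable {F : (Fin 4 → ℝ) → ℝ} {N : Set (Fin 4 → ℝ)} (h : SemiNormal F N)
include h

lemma smooth_ratio : ∀ v ∈ N, Smooth (fun v : Fin 4 → ℝ => 3 * v 3 / v 2) v := fun v hv =>
  (contDiffAt_const.mul (smooth_coord 3)).div (smooth_coord 2) (h.p_ne v hv)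

lemma smooth_beta : ∀ v ∈ N, Smooth (betaOf F) v := fun v hv =>
  ((h.smooth v hv).pd 3).sub (h.smooth_ratio v hv)

lemma smooth_sigma : ∀ v ∈ N, Smooth (sigmaOf F) v := fun v hv => by
  have hF := h.smooth v hv
  have hb := h.smooth_beta v hv
  have hK := hF.Kfun
  refine ContDiffAt.div ?_ (smooth_coord 2) (h.p_ne v hv)
  refine ContDiffAt.add (ContDiffAt.sub (ContDiffAt.sub ?_ (hK.pd 2)) (ContDiffAt.mul ?_ (hK.pd 3)))
    (hK.div (smooth_coord 2) (h.p_ne v hv))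
  · exact ((hb.pd 1).div contDiffAt_const (by norm_num)).neg
  · exact ((smooth_coord 3).div (smooth_coord 2) (h.p_ne v hv)).add
      (hb.div contDiffAt_const (by norm_num))

lemma pd_ratio (i : Fin 4) : ∀ v ∈ N, pd i (fun v : Fin 4 → ℝ => 3 * v 3 / v 2) v
    = (3 * (if i = 3 then 1 else 0) * v 2 - 3 * v 3 * (if i = 2 then 1 else 0)) / v 2 ^ 2 :=
  fun v hv => by
    rw [pd_div (contDiffAt_const.mul (smooth_coord 3)) (smooth_coord 2) (h.p_ne v hv),
      pd_const_mul 3 (smooth_coord 3), pd_coord, pd_coord]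

lemma pd_beta (i : Fin 4) : ∀ v ∈ N, pd i (betaOf F) v = pd i (pd 3 F) v
    - (3 * (if i = 3 then 1 else 0) * v 2 - 3 * v 3 * (if i = 2 then 1 else 0)) / v 2 ^ 2 :=
  fun v hv => by
    rw [← h.pd_ratio i v hv, ← pd_sub ((h.smooth v hv).pd 3) (h.smooth_ratio v hv)]
    rfl

lemma pd_beta_three : ∀ v ∈ N, pd 3 (betaOf F) v = 0 := fun v hv => by
  have hp := h.p_ne v hv
  rw [h.pd_beta 3 v hv, h.Fqq v hv]
  simp
  field_simp
  ring

lemma Fqqi (i : Fin 4) : ∀ v ∈ N, pd i (pd 3 (pd 3 F)) v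
    = -(3 * (if i = 2 then 1 else 0)) / v 2 ^ 2 := fun v hv => by
  rw [pd_congr_on h.isOpen h.Fqq i v hv, pd_div contDiffAt_const (smooth_coord 2) (h.p_ne v hv),
    pd_const, pd_coord]
  ring

lemma Kq : ∀ v ∈ N, pd 3 (Kfun F) v = -(pd 2 (betaOf F) v / 3) - betaOf F v / (6 * v 2) :=
  fun v hv => by
    have hp := h.p_ne v hv
    have hF := h.smooth v hv
    have e : Kfun F = fun v => (1 / 6) * totalD F (pd 3 F) v - (1 / 9) * (pd 3 F v) ^ 2
        - (1 / 2) * pd 2 F v := funext fun v => Kfun_eq F v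
    have s1 : Smooth (totalD F (pd 3 F)) v := hF.totalD (hF.pd 3)
    rw [e, pd_sub ((contDiffAt_const.mul s1).sub (contDiffAt_const.mul ((hF.pd 3).pow 2)))
      (contDiffAt_const.mul (hF.pd 2)), pd_sub (contDiffAt_const.mul s1)
      (contDiffAt_const.mul ((hF.pd 3).pow 2)), pd_const_mul _ s1,
      pd_const_mul _ ((hF.pd 3).pow 2), pd_const_mul _ (hF.pd 2), pd_pow (hF.pd 3),
      pd_three_totalD hF (hF.pd 3), pd_comm hF 3 2, h.pd_beta 2 v hv]
    simp only [totalD, h.Fqqi _ v hv, h.Fqq v hv, betaOf]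
    simp
    field_simp
    ring

lemma pd_Kq_three : ∀ v ∈ N, pd 3 (pd 3 (Kfun F)) v = 0 := fun v hv => by
  have hb := h.smooth_beta v hv
  have h6 : (6 : ℝ) * v 2 ≠ 0 := mul_ne_zero (by norm_num) (h.p_ne v hv)
  have s1 : Smooth (fun v => -(pd 2 (betaOf F) v / 3)) v :=
    ((hb.pd 2).div contDiffAt_const (by norm_num)).neg
  have s2 : Smooth (fun v => betaOf F v / (6 * v 2)) v :=
    hb.div (contDiffAt_const.mul (smooth_coord 2)) h6
  rw [pd_congr_on h.isOpen h.Kq 3 v hv, pd_sub s1 s2, pd_div hb (contDiffAt_const.mul (smooth_coord 2)) h6, h.pd_beta_three v hv,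
    pd_const_mul _ (smooth_coord 2), pd_coord]
  have e : (fun v => -(pd 2 (betaOf F) v / 3)) = fun v => (-(1 / 3)) * pd 2 (betaOf F) v := by
    funext v; ring
  rw [e, pd_const_mul _ (hb.pd 2), pd_comm hb 3 2,
    pd_congr_on h.isOpen h.pd_beta_three 2 v hv, pd_const]
  simp

lemma pd_sigma_three : ∀ v ∈ N, pd 3 (sigmaOf F) v = -(pd 2 (pd 3 (Kfun F)) v / v 2) :=
  fun v hv => by
    have hp := h.p_ne v hv
    have hF := h.smooth v hv
    have hb := h.smooth_beta v hv
    have hK := hF.Kfun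
    have s1 : Smooth (fun v => -(pd 1 (betaOf F) v / 3)) v :=
      ((hb.pd 1).div contDiffAt_const (by norm_num)).neg
    have s2 : Smooth (fun v => v 3 / v 2) v := (smooth_coord 3).div (smooth_coord 2) hp
    have s2b : Smooth (fun v => betaOf F v / 3) v := hb.div contDiffAt_const (by norm_num)
    have s3 : Smooth (fun v => (v 3 / v 2 + betaOf F v / 3) * pd 3 (Kfun F) v) v :=
      (s2.add s2b).mul (hK.pd 3)
    have s4 : Smooth (fun v => Kfun F v / v 2) v := hK.div (smooth_coord 2) hp
    have e1 : pd 3 (fun v => -(pd 1 (betaOf F) v / 3)) v = 0 := by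
      have e : (fun v => -(pd 1 (betaOf F) v / 3)) = fun v => (-(1 / 3)) * pd 1 (betaOf F) v := by
        funext v; ring
      rw [e, pd_const_mul _ (hb.pd 1), pd_comm hb 3 1,
        pd_congr_on h.isOpen h.pd_beta_three 1 v hv, pd_const, mul_zero]
    have e2 : pd 3 (fun v => betaOf F v / 3) v = 0 := by
      rw [pd_div hb contDiffAt_const (by norm_num), h.pd_beta_three v hv, pd_const]
      simp
    have e3 : pd 3 (fun v : Fin 4 → ℝ => v 3 / v 2) v = 1 / v 2 := by
      rw [pd_div (smooth_coord 3) (smooth_coord 2) hp, pd_coord, pd_coord]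
      simp
      field_simp
    have e4 : pd 3 (fun v => Kfun F v / v 2) v = pd 3 (Kfun F) v / v 2 := by
      rw [pd_div hK (smooth_coord 2) hp, pd_coord]
      simp
      field_simp
    unfold sigmaOf
    rw [pd_div (((s1.sub (hK.pd 2)).sub s3).add s4) (smooth_coord 2) hp,
      pd_add ((s1.sub (hK.pd 2)).sub s3) s4, pd_sub (s1.sub (hK.pd 2)) s3, pd_sub s1 (hK.pd 2),
      pd_mul (s2.add s2b) (hK.pd 3), pd_add s2 s2b, e1, e2, e3, e4, h.pd_Kq_three v hv, pd_coord,
      pd_comm hK 3 2]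
    simp
    field_simp
    ring

/-- The coframe in terms of `β`, `K`, `k`, `σ` and `F`. -/
lemma slframe_eq {u : Fin 6 → ℝ} (hu : jet u ∈ N) (h4 : u 4 ≠ 0) (X : Fin 6 → ℝ) :
    slframe F u X = semiframe (fun u => betaOf F (jet u)) (fun u => pd 3 (Kfun F) (jet u))
      (coefPx F) (coefPy F) (coefRx F) (coefRy F) u X := by
  have hp : u 2 ≠ 0 := h.p_ne _ hu
  have e1 : pd 3 F (jet u) = betaOf F (jet u) + 3 * u 3 / u 2 := by
    simp [betaOf, jet]
  have e2 := h.Fqq _ hu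
  have e3 : pd 1 (pd 3 F) (jet u) = pd 1 (betaOf F) (jet u) := by
    rw [h.pd_beta 1 _ hu]; simp
  have e4 : pd 3 (pd 3 (pd 3 F)) (jet u) = 0 := by rw [h.Fqqi 3 _ hu]; simp
  have e5 : pd 2 (pd 3 (pd 3 F)) (jet u) = -3 / u 2 ^ 2 := by
    rw [h.Fqqi 2 _ hu]; simp [jet]
  have e6 : pd 1 (pd 3 (pd 3 F)) (jet u) = 0 := by rw [h.Fqqi 1 _ hu]; simp
  have e7 : sigmaOf F (jet u) = (-(pd 1 (betaOf F) (jet u) / 3) - pd 2 (Kfun F) (jet u)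
    - (u 3 / u 2 + betaOf F (jet u) / 3) * pd 3 (Kfun F) (jet u) + Kfun F (jet u) / u 2) / u 2 :=
    rfl
  have hj : (jet u) 2 = u 2 := rfl
  rw [hj] at e2
  funext a
  fin_cases a <;>
    simp only [slframe, slBasis, coframe, semiframe, coefPx, coefPy, coefRx, coefRy, Fin.reduceFinMk, Fin.zero_eta, Fin.mk_one,
      Matrix.cons_val, e1, e2, e3, e4, e5, e6, e7] <;>
    field_simp <;> ring

end SemiNormal

/-! ### The derivatives of the coframe of an equation with `F_qq = 3 / p` -/

lemma diff_div {m : ℕ} {f g : (Fin m → ℝ) → ℝ} {u : Fin m → ℝ} (hf : DifferentiableAt ℝ f u)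
    (hg : DifferentiableAt ℝ g u) (h0 : g u ≠ 0) : DifferentiableAt ℝ (fun w => f w / g w) u :=
  by simpa only [div_eq_mul_inv] using hf.fun_mul (hg.fun_inv h0)

section semiframe

variable {β k p₀ p₁ r₀ r₁ : (Fin 6 → ℝ) → ℝ} {w : Fin 6 → ℝ} (V X : Fin 6 → ℝ)

lemma D_semiframe_zero : fderiv ℝ (fun w => semiframe β k p₀ p₁ r₀ r₁ w X 0) w V
    = 2 * (V 4 * w 2 + w 4 * V 2) * X 0 := by
  simp only [semiframe, Matrix.cons_val]
  simp (disch := fun_prop) only [D_mul, D_const, D_coord]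
  ring

lemma D_semiframe_three : fderiv ℝ (fun w => semiframe β k p₀ p₁ r₀ r₁ w X 3) w V
    = 2 * V 4 * X 1 := by
  simp only [semiframe, Matrix.cons_val]
  simp (disch := fun_prop) only [D_mul, D_const, D_coord]
  ring

lemma D_semiframe_two (hp : w 2 ≠ 0) (h4 : w 4 ≠ 0) (hk : DifferentiableAt ℝ k w) :
    fderiv ℝ (fun w => semiframe β k p₀ p₁ r₀ r₁ w X 2) w V
    = -(X 4 * V 4 / w 4 ^ 2) - X 2 * V 2 / w 2 ^ 2 - (V 3 / w 2 - w 3 * V 2 / w 2 ^ 2 + V 5) * X 0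
      + fderiv ℝ k w V * (X 1 - w 2 * X 0) - k w * V 2 * X 0 := by
  simp only [semiframe, Matrix.cons_val]
  simp (disch := first | assumption | fun_prop (disch := assumption)) only
    [D_mul, D_const, D_coord, D_add, D_sub, D_div]
  field_simp
  ring

lemma D_semiframe_five (hp : w 2 ≠ 0) (h4 : w 4 ≠ 0) (hk : DifferentiableAt ℝ k w) :
    fderiv ℝ (fun w => semiframe β k p₀ p₁ r₀ r₁ w X 5) w V
    = -(X 4 * V 4 / w 4 ^ 2) - (V 5 / w 2 - w 5 * V 2 / w 2 ^ 2) * X 1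
      + fderiv ℝ k w V * (X 1 - w 2 * X 0) - k w * V 2 * X 0 := by
  simp only [semiframe, Matrix.cons_val]
  simp (disch := first | assumption | fun_prop (disch := assumption)) only
    [D_mul, D_const, D_coord, D_add, D_sub, D_div]
  field_simp
  ring

lemma D_semiframe_four (hp : w 2 ≠ 0) (h4 : w 4 ≠ 0) (hr₀ : DifferentiableAt ℝ r₀ w)
    (hr₁ : DifferentiableAt ℝ r₁ w) :
    fderiv ℝ (fun w => semiframe β k p₀ p₁ r₀ r₁ w X 4) w V
    = (-(X 5 * V 2 / w 2 ^ 2) - (V 5 / w 2 ^ 2 - 2 * w 5 * V 2 / w 2 ^ 3) * X 2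
        + fderiv ℝ r₀ w V * X 0 + fderiv ℝ r₁ w V * X 1) / (2 * w 4)
      - semiframe β k p₀ p₁ r₀ r₁ w X 4 * V 4 / w 4 := by
  simp only [semiframe, Matrix.cons_val]
  have h2 : w 2 ^ 2 ≠ 0 := pow_ne_zero 2 hp
  have h24 : 2 * w 4 ≠ 0 := mul_ne_zero two_ne_zero h4
  simp (disch := first | assumption | fun_prop (disch := assumption)) only
    [D_mul, D_const, D_coord, D_add, D_sub, D_div, D_pow]
  field_simp
  ring

lemma D_semiframe_one (hp : w 2 ≠ 0) (h4 : w 4 ≠ 0) (hb : DifferentiableAt ℝ β w)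
    (hp₀ : DifferentiableAt ℝ p₀ w) (hp₁ : DifferentiableAt ℝ p₁ w) :
    fderiv ℝ (fun w => semiframe β k p₀ p₁ r₀ r₁ w X 1) w V
    = (-(X 3 * V 2 / w 2 ^ 2) - (V 3 / w 2 ^ 2 - 2 * w 3 * V 2 / w 2 ^ 3) * X 2
        - (fderiv ℝ β w V / (3 * w 2) - β w * V 2 / (3 * w 2 ^ 2)) * X 2
        + fderiv ℝ p₀ w V * X 0 + fderiv ℝ p₁ w V * X 1) / (2 * w 4 * w 2)
      - semiframe β k p₀ p₁ r₀ r₁ w X 1 * (V 4 / w 4 + V 2 / w 2) := by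
  simp only [semiframe, Matrix.cons_val]
  have h2 : w 2 ^ 2 ≠ 0 := pow_ne_zero 2 hp
  have h32 : 3 * w 2 ≠ 0 := mul_ne_zero three_ne_zero hp
  have h24 : 2 * w 4 * w 2 ≠ 0 := mul_ne_zero (mul_ne_zero two_ne_zero h4) hp
  simp (disch := first | assumption | fun_prop (disch := assumption)) only
    [D_mul, D_const, D_coord, D_add, D_sub, D_div, D_pow]
  field_simp
  ring

end semiframe

namespace SemiNormal

lemma diff_comp_jet {N : Set (Fin 4 → ℝ)} {f : (Fin 4 → ℝ) → ℝ} (hf : ∀ v ∈ N, Smooth f v) {u : Fin 6 → ℝ}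
    (hu : jet u ∈ N) : DifferentiableAt ℝ (fun u => f (jet u)) u :=
  Smooth.diff (ContDiffAt.comp u (hf _ hu) (smooth_jet u))

variable {F : (Fin 4 → ℝ) → ℝ} {N : Set (Fin 4 → ℝ)} (h : SemiNormal F N)
include h

variable {u : Fin 6 → ℝ} (hu : jet u ∈ N) (V : Fin 6 → ℝ)
include hu

lemma diff_F : DifferentiableAt ℝ (fun u => F (jet u)) u := diff_comp_jet h.smooth hu

lemma diff_K : DifferentiableAt ℝ (fun u => Kfun F (jet u)) u :=
  diff_comp_jet (fun v hv => (h.smooth v hv).Kfun) hu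

lemma diff_Kq : DifferentiableAt ℝ (fun u => pd 3 (Kfun F) (jet u)) u :=
  diff_comp_jet (fun v hv => (h.smooth v hv).Kfun.pd 3) hu

lemma diff_beta : DifferentiableAt ℝ (fun u => betaOf F (jet u)) u :=
  diff_comp_jet h.smooth_beta hu

lemma diff_sigma : DifferentiableAt ℝ (fun u => sigmaOf F (jet u)) u :=
  diff_comp_jet h.smooth_sigma hu

lemma u2_ne : u 2 ≠ 0 := h.p_ne _ hu

lemma D_coefPx : fderiv ℝ (coefPx F) u V
    = -(fderiv ℝ (fun u => F (jet u)) u V / u 2) + F (jet u) * V 2 / u 2 ^ 2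
      - (V 5 - V 3 / u 2 + u 3 * V 2 / u 2 ^ 2 - fderiv ℝ (fun u => betaOf F (jet u)) u V / 3)
          * (u 3 / u 2)
      - (u 5 - u 3 / u 2 - betaOf F (jet u) / 3) * (V 3 / u 2 - u 3 * V 2 / u 2 ^ 2)
      - u 5 * V 5 - 2 * fderiv ℝ (fun u => Kfun F (jet u)) u V
      - (fderiv ℝ (fun u => betaOf F (jet u)) u V * u 5 + betaOf F (jet u) * V 5) / 3
      - V 2 * pd 3 (Kfun F) (jet u) * u 5
      - u 2 * fderiv ℝ (fun u => pd 3 (Kfun F) (jet u)) u V * u 5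
      - u 2 * pd 3 (Kfun F) (jet u) * V 5
      - 2 * u 2 * V 2 * sigmaOf F (jet u)
      - u 2 ^ 2 * fderiv ℝ (fun u => sigmaOf F (jet u)) u V := by
  have hp := h.u2_ne hu
  have hF := h.diff_F hu
  have hK := h.diff_K hu
  have hKq := h.diff_Kq hu
  have hb := h.diff_beta hu
  have hs := h.diff_sigma hu
  have h3 : (3 : ℝ) ≠ 0 := three_ne_zero
  have h2 : (2 : ℝ) ≠ 0 := two_ne_zero
  unfold coefPx
  revert hF hK hKq hb hs
  generalize e1 : (fun u => F (jet u)) = f1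
  generalize e2 : (fun u => Kfun F (jet u)) = f2
  generalize e3 : (fun u => pd 3 (Kfun F) (jet u)) = f3
  generalize e4 : (fun u => betaOf F (jet u)) = f4
  generalize e5 : (fun u => sigmaOf F (jet u)) = f5
  intro hF hK hKq hb hs
  have g1 : ∀ u, F (jet u) = f1 u := fun u => congrFun e1 u
  have g2 : ∀ u, Kfun F (jet u) = f2 u := fun u => congrFun e2 u
  have g3 : ∀ u, pd 3 (Kfun F) (jet u) = f3 u := fun u => congrFun e3 u
  have g4 : ∀ u, betaOf F (jet u) = f4 u := fun u => congrFun e4 u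
  have g5 : ∀ u, sigmaOf F (jet u) = f5 u := fun u => congrFun e5 u
  simp only [g1, g2, g3, g4, g5]
  simp (disch := first | assumption | fun_prop (disch := assumption)) only
    [D_mul, D_const, D_coord, D_sub, D_neg, D_div, D_pow]
  field_simp
  ring

lemma D_coefRx : fderiv ℝ (coefRx F) u V
    = -((fderiv ℝ (fun u => betaOf F (jet u)) u V * u 5 + betaOf F (jet u) * V 5) / (3 * u 2))
      + betaOf F (jet u) * u 5 * V 2 / (3 * u 2 ^ 2)
      - fderiv ℝ (fun u => Kfun F (jet u)) u V / u 2 + Kfun F (jet u) * V 2 / u 2 ^ 2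
      - fderiv ℝ (fun u => pd 3 (Kfun F) (jet u)) u V * u 5 - pd 3 (Kfun F) (jet u) * V 5
      - V 2 * sigmaOf F (jet u) - u 2 * fderiv ℝ (fun u => sigmaOf F (jet u)) u V := by
  have hp := h.u2_ne hu
  have hK := h.diff_K hu
  have hKq := h.diff_Kq hu
  have hb := h.diff_beta hu
  have hs := h.diff_sigma hu
  have h3 : (3 : ℝ) ≠ 0 := three_ne_zero
  have h2 : (2 : ℝ) ≠ 0 := two_ne_zero
  unfold coefRx
  revert hK hKq hb hs
  generalize e2 : (fun u => Kfun F (jet u)) = f2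
  generalize e3 : (fun u => pd 3 (Kfun F) (jet u)) = f3
  generalize e4 : (fun u => betaOf F (jet u)) = f4
  generalize e5 : (fun u => sigmaOf F (jet u)) = f5
  intro hK hKq hb hs
  have g2 : ∀ u, Kfun F (jet u) = f2 u := fun u => congrFun e2 u
  have g3 : ∀ u, pd 3 (Kfun F) (jet u) = f3 u := fun u => congrFun e3 u
  have g4 : ∀ u, betaOf F (jet u) = f4 u := fun u => congrFun e4 u
  have g5 : ∀ u, sigmaOf F (jet u) = f5 u := fun u => congrFun e5 u
  simp only [g2, g3, g4, g5]
  have h32 : 3 * u 2 ≠ 0 := mul_ne_zero three_ne_zero hp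
  simp (disch := first | assumption | fun_prop (disch := assumption)) only
    [D_mul, D_const, D_coord, D_add, D_sub, D_neg, D_div]
  field_simp
  ring

lemma D_coefRy : fderiv ℝ (coefRy F) u V
    = -(u 5 / u 2) * (V 5 / u 2 - u 5 * V 2 / u 2 ^ 2)
      + fderiv ℝ (fun u => pd 3 (Kfun F) (jet u)) u V * u 5 / u 2
      + pd 3 (Kfun F) (jet u) * (V 5 / u 2 - u 5 * V 2 / u 2 ^ 2)
      + fderiv ℝ (fun u => sigmaOf F (jet u)) u V := by
  have hp := h.u2_ne hu
  have hKq := h.diff_Kq hu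
  have hs := h.diff_sigma hu
  have h2 : (2 : ℝ) ≠ 0 := two_ne_zero
  unfold coefRy
  revert hKq hs
  generalize e3 : (fun u => pd 3 (Kfun F) (jet u)) = f3
  generalize e5 : (fun u => sigmaOf F (jet u)) = f5
  intro hKq hs
  have g3 : ∀ u, pd 3 (Kfun F) (jet u) = f3 u := fun u => congrFun e3 u
  have g5 : ∀ u, sigmaOf F (jet u) = f5 u := fun u => congrFun e5 u
  simp only [g3, g5]
  have h22 : 2 * u 2 ^ 2 ≠ 0 := mul_ne_zero two_ne_zero (pow_ne_zero 2 hp)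
  simp (disch := first | assumption | fun_prop (disch := assumption)) only
    [D_mul, D_const, D_coord, D_add, D_neg, D_div, D_pow]
  field_simp
  ring

lemma diff_coefPx : DifferentiableAt ℝ (coefPx F) u := by
  have hp := h.u2_ne hu
  have hF := h.diff_F hu
  have hK := h.diff_K hu
  have hKq := h.diff_Kq hu
  have hb := h.diff_beta hu
  have hs := h.diff_sigma hu
  have c : ∀ i : Fin 6, DifferentiableAt ℝ (fun u : Fin 6 → ℝ => u i) u := fun i => by fun_prop
  have s32 : DifferentiableAt ℝ (fun u : Fin 6 → ℝ => u 3 / u 2) u := diff_div (c 3) (c 2) hp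
  have sF : DifferentiableAt ℝ (fun u : Fin 6 → ℝ => F (jet u) / u 2) u := diff_div hF (c 2) hp
  have s7 : DifferentiableAt ℝ (fun u : Fin 6 → ℝ => betaOf F (jet u) * u 5 / 3) u :=
    diff_div (hb.mul (c 5)) (by fun_prop) three_ne_zero
  have s8 : DifferentiableAt ℝ (fun u : Fin 6 → ℝ => u 5 ^ 2 / 2) u := by fun_prop
  have s9 : DifferentiableAt ℝ (fun u : Fin 6 → ℝ => betaOf F (jet u) / 3) u :=
    diff_div hb (by fun_prop) three_ne_zero
  exact (((((((sF.neg.sub ((((c 5).sub s32).sub s9).mul s32)).sub s8).sub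
    (hK.const_mul 2)).sub s7).sub (((c 2).mul hKq).mul (c 5))).sub (((c 2).pow 2).mul hs)))

lemma diff_K_div : DifferentiableAt ℝ (fun u : Fin 6 → ℝ => Kfun F (jet u) / u 2) u :=
  diff_div (h.diff_K hu) (by fun_prop) (h.u2_ne hu)

lemma diff_coefPy : DifferentiableAt ℝ (coefPy F) u := by
  have c : ∀ i : Fin 6, DifferentiableAt ℝ (fun u : Fin 6 → ℝ => u i) u := fun i => by fun_prop
  exact ((h.diff_K_div hu).add ((h.diff_Kq hu).mul (c 5))).add ((c 2).mul (h.diff_sigma hu))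

lemma diff_coefRx : DifferentiableAt ℝ (coefRx F) u := by
  have hp := h.u2_ne hu
  have c : ∀ i : Fin 6, DifferentiableAt ℝ (fun u : Fin 6 → ℝ => u i) u := fun i => by fun_prop
  have s1 : DifferentiableAt ℝ (fun u : Fin 6 → ℝ => betaOf F (jet u) * u 5 / (3 * u 2)) u :=
    diff_div ((h.diff_beta hu).mul (c 5)) ((c 2).const_mul 3) (mul_ne_zero three_ne_zero hp)
  exact (s1.add (h.diff_K_div hu)).neg.sub
    (((h.diff_Kq hu).mul (c 5)).add ((c 2).mul (h.diff_sigma hu)))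

lemma diff_coefRy : DifferentiableAt ℝ (coefRy F) u := by
  have hp := h.u2_ne hu
  have c : ∀ i : Fin 6, DifferentiableAt ℝ (fun u : Fin 6 → ℝ => u i) u := fun i => by fun_prop
  have s1 : DifferentiableAt ℝ (fun u : Fin 6 → ℝ => u 5 ^ 2 / (2 * u 2 ^ 2)) u :=
    diff_div ((c 5).pow 2) (((c 2).pow 2).const_mul 2)
      (mul_ne_zero two_ne_zero (pow_ne_zero 2 hp))
  have s2 : DifferentiableAt ℝ (fun u : Fin 6 → ℝ => pd 3 (Kfun F) (jet u) * u 5 / u 2) u :=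
    diff_div ((h.diff_Kq hu).mul (c 5)) (c 2) hp
  exact (s1.neg.add s2).add (h.diff_sigma hu)

/-- The exterior derivatives of the coframe only depend on the germ of the coframe. -/
lemma dForm_eq (h4 : u 4 ≠ 0) (X : Fin 6 → ℝ) (a : Fin 6) : dForm (slframe F) u V X a
    = fderiv ℝ (fun u => semiframe (fun u => betaOf F (jet u)) (fun u => pd 3 (Kfun F) (jet u))
        (coefPx F) (coefPy F) (coefRx F) (coefRy F) u X a) u V
      - fderiv ℝ (fun u => semiframe (fun u => betaOf F (jet u)) (fun u => pd 3 (Kfun F) (jet u))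
        (coefPx F) (coefPy F) (coefRx F) (coefRy F) u V a) u X := by
  have hev : ∀ᶠ z in 𝓝 u, jet z ∈ N ∧ z 4 ≠ 0 :=
    ((smooth_jet u).continuousAt.eventually (h.isOpen.mem_nhds hu)).and
      ((continuous_apply 4).continuousAt.eventually_ne h4)
  have e : ∀ X, (fun u => slframe F u X a) =ᶠ[𝓝 u] fun u => semiframe
      (fun u => betaOf F (jet u)) (fun u => pd 3 (Kfun F) (jet u))
        (coefPx F) (coefPy F) (coefRx F) (coefRy F) u X a := fun X => by
    filter_upwards [hev] with z hz
    rw [h.slframe_eq hz.1 hz.2]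
  unfold dForm
  rw [(e X).fderiv_eq, (e V).fderiv_eq]

/-- The exterior derivatives of the coframe of an equation with `F_qq = 3 / p`. -/
lemma dForm_slframe (h4 : u 4 ≠ 0) (X : Fin 6 → ℝ) :
    let b := betaOf F (jet u)
    let k := pd 3 (Kfun F) (jet u)
    let Db := fderiv ℝ (fun u => betaOf F (jet u)) u
    let Dk := fderiv ℝ (fun u => pd 3 (Kfun F) (jet u)) u
    let Z := fun V X : Fin 6 → ℝ => (-(X 3 * V 2 / u 2 ^ 2)
      - (V 3 / u 2 ^ 2 - 2 * u 3 * V 2 / u 2 ^ 3) * X 2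
      - (Db V / (3 * u 2) - b * V 2 / (3 * u 2 ^ 2)) * X 2
      + fderiv ℝ (coefPx F) u V * X 0 + fderiv ℝ (coefPy F) u V * X 1) / (2 * u 4 * u 2)
      - slframe F u X 1 * (V 4 / u 4 + V 2 / u 2)
    let Y := fun V X : Fin 6 → ℝ => (-(X 5 * V 2 / u 2 ^ 2)
      - (V 5 / u 2 ^ 2 - 2 * u 5 * V 2 / u 2 ^ 3) * X 2
      + fderiv ℝ (coefRx F) u V * X 0 + fderiv ℝ (coefRy F) u V * X 1) / (2 * u 4)
      - slframe F u X 4 * V 4 / u 4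
    dForm (slframe F) u V X =
      ![2 * (V 4 * u 2 + u 4 * V 2) * X 0 - 2 * (X 4 * u 2 + u 4 * X 2) * V 0,
        Z V X - Z X V,
        -((V 3 / u 2 - u 3 * V 2 / u 2 ^ 2 + V 5) * X 0) + Dk V * (X 1 - u 2 * X 0) - k * V 2 * X 0
          + (X 3 / u 2 - u 3 * X 2 / u 2 ^ 2 + X 5) * V 0 - Dk X * (V 1 - u 2 * V 0)
          + k * X 2 * V 0,
        2 * V 4 * X 1 - 2 * X 4 * V 1,
        Y V X - Y X V,
        -((V 5 / u 2 - u 5 * V 2 / u 2 ^ 2) * X 1) + Dk V * (X 1 - u 2 * X 0) - k * V 2 * X 0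
          + (X 5 / u 2 - u 5 * X 2 / u 2 ^ 2) * V 1 - Dk X * (V 1 - u 2 * V 0)
          + k * X 2 * V 0] := by
  intro b k Db Dk Z Y
  have hp := h.u2_ne hu
  funext a
  rw [h.dForm_eq hu V h4 X a]
  fin_cases a
  · simp only [Fin.zero_eta, D_semiframe_zero, Matrix.cons_val]
  · simp only [Fin.mk_one, D_semiframe_one _ _ hp h4 (h.diff_beta hu) (h.diff_coefPx hu)
      (h.diff_coefPy hu), Matrix.cons_val, Z]
    rw [h.slframe_eq hu h4 X, h.slframe_eq hu h4 V]
  · simp only [Fin.reduceFinMk, D_semiframe_two _ _ hp h4 (h.diff_Kq hu), Matrix.cons_val]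
    ring
  · simp only [Fin.reduceFinMk, D_semiframe_three, Matrix.cons_val]
  · simp only [Fin.reduceFinMk, D_semiframe_four _ _ hp h4 (h.diff_coefRx hu) (h.diff_coefRy hu),
      Matrix.cons_val, Y]
    rw [h.slframe_eq hu h4 X, h.slframe_eq hu h4 V]
  · simp only [Fin.reduceFinMk, D_semiframe_five _ _ hp h4 (h.diff_Kq hu), Matrix.cons_val]
    ring

end SemiNormal

/-! ### Metrics of equations with `F_qq = 3 / p`: the part of `F` linear in `q` -/

/-- The vector with components `a` and `b` in the two copies of `𝔰𝔩(2, ℝ)`. -/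
def slPair (a b : Fin 3 → ℝ) : Fin 6 → ℝ := ![a 0, a 1, a 2, b 0, b 1, b 2]

lemma fstPart_slPair (a b : Fin 3 → ℝ) : fstPart (slPair a b) = a := by
  funext i; fin_cases i <;> rfl

lemma sndPart_slPair (a b : Fin 3 → ℝ) : sndPart (slPair a b) = b := by
  funext i; fin_cases i <;> rfl

/-- The derivatives of functions of the jet along a vector tangent to the fibers. -/
lemma D_vert {N : Set (Fin 4 → ℝ)} {w : Fin 6 → ℝ} {f : (Fin 4 → ℝ) → ℝ} (hw : jet w ∈ N)
    (hf : ∀ v ∈ N, Smooth f v) {V : Fin 6 → ℝ} (h0 : V 0 = 0) (h1 : V 1 = 0) :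
    fderiv ℝ (fun u => f (jet u)) w V = V 2 * pd 2 f (jet w) + V 3 * pd 3 f (jet w) := by
  rw [fderiv_comp_jet (hf _ hw).diff, h0, h1]; ring

/-- The coordinate `γ` can be varied while the jet stays fixed. -/
lemma exists_shift {S : Set (Fin 6 → ℝ)} (hS : IsOpen S) {w : Fin 6 → ℝ} (hw : w ∈ S) :
    ∃ w' ∈ S, jet w' = jet w ∧ w' 4 = w 4 ∧ w' 5 ≠ w 5 := by
  have hc : Continuous (fun ε : ℝ => w + ε • (Pi.single 5 1 : Fin 6 → ℝ)) := by fun_prop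
  have hev : ∀ᶠ ε in 𝓝 (0 : ℝ), w + ε • (Pi.single 5 1 : Fin 6 → ℝ) ∈ S := by
    refine hc.continuousAt.eventually ?_
    simpa using hS.mem_nhds hw
  obtain ⟨ε, hε, h0⟩ := ((hev.filter_mono nhdsWithin_le_nhds).and
    (self_mem_nhdsWithin : {(0 : ℝ)}ᶜ ∈ 𝓝[≠] (0 : ℝ))).exists
  refine ⟨_, hε, ?_, by simp, by simpa using h0⟩
  funext i
  fin_cases i <;> simp [jet]

/-- A property of the jets of an open set holds in a neighbourhood of each of these jets. -/
lemma eventually_jet {S : Set (Fin 6 → ℝ)} (hS : IsOpen S) {w : Fin 6 → ℝ} (hw : w ∈ S)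
    {p : (Fin 4 → ℝ) → Prop} (hp : ∀ w ∈ S, p (jet w)) : ∀ᶠ v in 𝓝 (jet w), p v := by
  have hc : Continuous (fun v : Fin 4 → ℝ => (![v 0, v 1, v 2, v 3, w 4, w 5] : Fin 6 → ℝ)) := by
    refine continuous_pi fun i => ?_
    fin_cases i <;> simp <;> fun_prop
  have e : (![jet w 0, jet w 1, jet w 2, jet w 3, w 4, w 5] : Fin 6 → ℝ) = w := by
    funext i; fin_cases i <;> rfl
  have hev : ∀ᶠ v in 𝓝 (jet w), (![v 0, v 1, v 2, v 3, w 4, w 5] : Fin 6 → ℝ) ∈ S :=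
    hc.continuousAt.eventually (hS.mem_nhds (by
      show (![jet w 0, jet w 1, jet w 2, jet w 3, w 4, w 5] : Fin 6 → ℝ) ∈ S
      rw [e]; exact hw))
  filter_upwards [hev] with v hv
  have := hp _ hv
  rwa [show jet ![v 0, v 1, v 2, v 3, w 4, w 5] = v by funext i; fin_cases i <;> rfl] at this

namespace SemiNormal

variable {F : (Fin 4 → ℝ) → ℝ} {N : Set (Fin 4 → ℝ)} (h : SemiNormal F N)
include h

lemma Fqq_ne {v : Fin 4 → ℝ} (hv : v ∈ N) : pd 3 (pd 3 F) v ≠ 0 := by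
  rw [h.Fqq v hv]; exact div_ne_zero three_ne_zero (h.p_ne v hv)

variable {A B : Fin 3 → ℝ} {S : Set (Fin 6 → ℝ)} {π : (Fin 6 → ℝ) → (Fin 4 → ℝ)}
  {G : (Fin 4 → ℝ) → Matrix (Fin 4) (Fin 4) ℝ}

lemma cond_fst (hP : PullsBack (slMatrix A B) (slframe F) S π G) (hA : killing A A = 1)
    (hS : ∀ w ∈ S, jet w ∈ N ∧ w 4 ≠ 0) {w : Fin 6 → ℝ} (hw : w ∈ S) {V : Fin 6 → ℝ}
    (hV : slframe F w V = slPair A 0) (X Y : Fin 6 → ℝ) :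
    slForm A B (dForm (slframe F) w V X) (slframe F w Y)
      + slForm A B (slframe F w X) (dForm (slframe F) w V Y) = 0 := by
  rw [← bil_slMatrix, ← bil_slMatrix]
  refine hP.cond (slMatrix_isSymm A B) (fun w hw X a => smooth_slframe (h.smooth _ (hS w hw).1)
    (hS w hw).2 (h.Fqq_ne (hS w hw).1) X a) hw (fun Z => ?_) X Y
  rw [bil_slMatrix, hV]
  exact slForm_ker_fst hA B (fstPart_slPair A 0) (sndPart_slPair A 0) _

lemma cond_snd (hP : PullsBack (slMatrix A B) (slframe F) S π G) (hB : killing B B = 1)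
    (hS : ∀ w ∈ S, jet w ∈ N ∧ w 4 ≠ 0) {w : Fin 6 → ℝ} (hw : w ∈ S) {V : Fin 6 → ℝ}
    (hV : slframe F w V = slPair 0 B) (X Y : Fin 6 → ℝ) :
    slForm A B (dForm (slframe F) w V X) (slframe F w Y)
      + slForm A B (slframe F w X) (dForm (slframe F) w V Y) = 0 := by
  rw [← bil_slMatrix, ← bil_slMatrix]
  refine hP.cond (slMatrix_isSymm A B) (fun w hw X a => smooth_slframe (h.smooth _ (hS w hw).1)
    (hS w hw).2 (h.Fqq_ne (hS w hw).1) X a) hw (fun Z => ?_) X Y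
  rw [bil_slMatrix, hV]
  exact slForm_ker_snd A hB (fstPart_slPair 0 B) (sndPart_slPair 0 B) _

lemma exists_slframe {w : Fin 6 → ℝ} (hw : jet w ∈ N ∧ w 4 ≠ 0) (s : Fin 6 → ℝ) :
    ∃ V, slframe F w V = s := slframe_surjective hw.2 (h.Fqq_ne hw.1) s

/-- The components of the coframe, one by one. -/
lemma slframe_apply {w : Fin 6 → ℝ} (hw : jet w ∈ N ∧ w 4 ≠ 0) (X : Fin 6 → ℝ) :
    slframe F w X = ![2 * w 4 * w 2 * X 0,
      (X 3 / w 2 - w 3 / w 2 ^ 2 * X 2 + X 5 - betaOf F (jet w) / (3 * w 2) * X 2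
        + coefPx F w * X 0 + coefPy F w * X 1) / (2 * w 4 * w 2),
      X 4 / w 4 + X 2 / w 2 - (w 3 / w 2 + w 5) * X 0
        + pd 3 (Kfun F) (jet w) * (X 1 - w 2 * X 0),
      2 * w 4 * X 1,
      (X 5 / w 2 - w 5 / w 2 ^ 2 * X 2 + coefRx F w * X 0 + coefRy F w * X 1) / (2 * w 4),
      X 4 / w 4 - w 5 / w 2 * X 1 + pd 3 (Kfun F) (jet w) * (X 1 - w 2 * X 0)] :=
  h.slframe_eq hw.1 hw.2 X

/-- If `A 0 ≠ 0`, the invariance along `A` determines `β`. -/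
lemma beta_eq_zero_of_ne (hP : PullsBack (slMatrix A B) (slframe F) S π G)
    (hA : killing A A = 1) (hS : ∀ w ∈ S, jet w ∈ N ∧ w 4 ≠ 0) (hA0 : A 0 ≠ 0)
    {w : Fin 6 → ℝ} (hw : w ∈ S) : betaOf F (jet w) = 0 := by
  obtain ⟨V, hV⟩ := h.exists_slframe (hS w hw) (slPair A 0)
  have hj := (hS w hw).1
  have h4 := (hS w hw).2
  have hp := h.u2_ne hj
  have c := h.cond_fst hP hA hS hw hV (Pi.single 5 1) (Pi.single 5 1)
  have hV' := hV
  rw [h.slframe_apply (hS w hw)] at hV'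
  have e0 := congrFun hV' 0
  have e2 := congrFun hV' 2
  have e3 := congrFun hV' 3
  have e5 := congrFun hV' 5
  simp only [slPair, Matrix.cons_val, Pi.zero_apply] at e0 e2 e3 e5
  have hV1 : V 1 = 0 := by
    rcases mul_eq_zero.1 e3 with h' | h'
    · exact absurd h' (by positivity)
    · exact h'
  have jz : ∀ f : (Fin 4 → ℝ) → ℝ, (∀ v ∈ N, Smooth f v) →
      fderiv ℝ (fun u => f (jet u)) w (Pi.single 5 1) = 0 := fun f hf => by
    rw [fderiv_comp_jet (hf _ hj).diff]; simp
  have hd := h.dForm_slframe hj V h4 (Pi.single 5 1)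
  have zF := jz _ h.smooth
  have zK := jz _ (fun v hv => (h.smooth v hv).Kfun)
  have zk := jz _ (fun v hv => (h.smooth v hv).Kfun.pd 3)
  have zb := jz _ h.smooth_beta
  have zs := jz _ h.smooth_sigma
  have zP := h.D_coefPx hj (Pi.single 5 1)
  have zR := h.D_coefRx hj (Pi.single 5 1)
  rw [zF, zb, zK, zk, zs] at zP
  rw [zb, zK, zk, zs] at zR
  simp at zP zR
  dsimp only at hd
  rw [hV] at hd
  simp only [h.slframe_apply (hS w hw), hd] at c
  simp [slForm, killing, fstPart, sndPart, slPair, zP, zR, hV1, zb, zk] at c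
  rw [hV1] at e2 e5
  have hV4 : V 4 = w 4 * (pd 3 (Kfun F) (jet w) * w 2 * V 0) := by
    have e5' : V 4 / w 4 = pd 3 (Kfun F) (jet w) * w 2 * V 0 := by linarith
    rw [← e5', mul_div_cancel₀ _ h4]
  have hV0 : V 0 = A 0 / (2 * w 4 * w 2) := by
    field_simp; linarith
  have hV2 : V 2 = w 2 * (A 2 + (w 3 / w 2 + w 5) * V 0) := by
    have e2' : V 2 / w 2 = A 2 + (w 3 / w 2 + w 5) * V 0 := by
      rw [hV4, mul_div_cancel_left₀ _ h4] at e2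
      linarith
    rw [← e2', mul_div_cancel₀ _ hp]
  rw [hV4, hV2, hV0] at c
  have key : betaOf F (jet w) * (A 0 * (A 0 ^ 2 + B 0 ^ 2)) = 0 := by
    field_simp at c
    clear hd jz hV' zF zK zk zb zs zP zR
    refine mul_left_cancel₀ hp ?_
    linear_combination -(1 / 2) * c
  rcases mul_eq_zero.1 key with h' | h'
  · exact h'
  · exact absurd h' (mul_ne_zero hA0 (by positivity))

lemma vert_fst {w : Fin 6 → ℝ} (hw : jet w ∈ N ∧ w 4 ≠ 0) {V : Fin 6 → ℝ}
    (hV : slframe F w V = slPair A 0) (hA0 : A 0 = 0) :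
    V 0 = 0 ∧ V 1 = 0 ∧ V 4 = 0 ∧ V 2 = w 2 * A 2 ∧ V 5 = w 5 * A 2 := by
  have h4 := hw.2
  have hp := h.u2_ne hw.1
  rw [h.slframe_apply hw] at hV
  have e0 := congrFun hV 0
  have e2 := congrFun hV 2
  have e3 := congrFun hV 3
  have e4 := congrFun hV 4
  have e5 := congrFun hV 5
  simp only [slPair, Matrix.cons_val, Pi.zero_apply, hA0] at e0 e2 e3 e4 e5
  have hV0 : V 0 = 0 := by simpa [hp, h4] using e0
  have hV1 : V 1 = 0 := by simpa [hp, h4] using e3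
  simp only [hV0, hV1, mul_zero, sub_zero, add_zero] at e2 e4 e5
  have hV4 : V 4 = 0 := by simpa [h4] using e5
  rw [hV4] at e2
  have hV2 : V 2 = w 2 * A 2 := by
    rw [zero_div, zero_add] at e2
    rw [← e2, mul_div_cancel₀ _ hp]
  refine ⟨hV0, hV1, hV4, hV2, ?_⟩
  rw [hV2] at e4
  field_simp at e4
  linarith

/-- The case `A 0 = 0`, `B 0 ≠ 0`: the invariance along `A`. -/
lemma Kq_eq_zero_aux (hP : PullsBack (slMatrix A B) (slframe F) S π G)
    (hA : killing A A = 1) (hS : ∀ w ∈ S, jet w ∈ N ∧ w 4 ≠ 0) (hA0 : A 0 = 0) (hB0 : B 0 ≠ 0)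
    {w : Fin 6 → ℝ} (hw : w ∈ S) {V : Fin 6 → ℝ} (hV : slframe F w V = slPair A 0) :
    pd 3 (Kfun F) (jet w) = 0 ∧ pd 2 (pd 3 (Kfun F)) (jet w) = 0 ∧
      fderiv ℝ (coefRx F) w V = 0 := by
  have hj := (hS w hw).1
  have h4 := (hS w hw).2
  have hp := h.u2_ne hj
  have hA2 : A 2 ≠ 0 := by rintro h'; simp [killing, hA0, h'] at hA
  have c1 := h.cond_fst hP hA hS hw hV (Pi.single 5 1) (Pi.single 1 1)
  have c2 := h.cond_fst hP hA hS hw hV (Pi.single 4 1) (Pi.single 1 1)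
  have c3 := h.cond_fst hP hA hS hw hV (Pi.single 5 1) (Pi.single 0 1)
  have c4 := h.cond_fst hP hA hS hw hV (Pi.single 4 1) (Pi.single 0 1)
  obtain ⟨v0, v1, v4, v2, v5⟩ := h.vert_fst (hS w hw) hV hA0
  have dk := D_vert (f := pd 3 (Kfun F)) hj (fun v hv => (h.smooth v hv).Kfun.pd 3) v0 v1
  have zb5 : fderiv ℝ (fun u => betaOf F (jet u)) w (Pi.single 5 1) = 0 := by
    rw [fderiv_comp_jet (h.smooth_beta _ hj).diff]; simp
  have zb4 : fderiv ℝ (fun u => betaOf F (jet u)) w (Pi.single 4 1) = 0 := by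
    rw [fderiv_comp_jet (h.smooth_beta _ hj).diff]; simp
  rw [h.pd_Kq_three _ hj, v2] at dk
  have hd := h.dForm_slframe hj V h4
  dsimp only at hd
  rw [hV] at hd
  simp only [h.slframe_apply (hS w hw), hd] at c1 c2 c3 c4
  have hA' : A 2 * A 2 = 1 := by simpa [killing, hA0] using hA
  simp [slForm, killing, fstPart, sndPart, slPair, v0, v1, v4, v2, v5, hA0, zb5, zb4]
    at c1 c2 c3 c4
  generalize fderiv ℝ (coefRx F) w V = x1 at *
  generalize fderiv ℝ (coefRy F) w V = x2 at *
  generalize fderiv ℝ (fun u => pd 3 (Kfun F) (jet u)) w V = x3 at *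
  field_simp at c1 c2 c3 c4
  clear hd
  have e1 : B 0 * x2 + 2 * w 4 * B 2 * x3 = 0 := by
    refine (mul_eq_zero.1 (?_ : w 2 * B 0 * (B 0 * x2 + 2 * w 4 * B 2 * x3) = 0)).resolve_left
      (by positivity)
    linear_combination -c1
  have e2 : x3 = 0 := by
    refine (mul_eq_zero.1 (?_ : 2 * w 2 * w 4 * x3 = 0)).resolve_left (by positivity)
    linear_combination c2 + B 2 * w 2 * e1 + 2 * w 2 * w 4 * x3 * hA'
  have e3 : B 0 * x1 - 2 * w 2 * w 4 * B 2 * A 2 * pd 3 (Kfun F) (jet w) = 0 := by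
    refine (mul_eq_zero.1 (?_ : B 0 *
      (B 0 * x1 - 2 * w 2 * w 4 * B 2 * A 2 * pd 3 (Kfun F) (jet w)) = 0)).resolve_left
      (by positivity)
    rw [e2] at c3
    linear_combination -c3
  have e4 : pd 3 (Kfun F) (jet w) = 0 := by
    refine (mul_eq_zero.1 (?_ : 2 * w 2 ^ 2 * w 4 * A 2 * pd 3 (Kfun F) (jet w) = 0)).resolve_left
      (by positivity)
    rw [e2] at c4
    linear_combination -c4 - w 2 * B 2 * e3 - (4 * w 2 ^ 2 * w 4 ^ 2 * A 1 + 2 * w 4 *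
      (-(w 2 * A 2 * w 5) + A 2 * w 3 - V 3 - w 2 ^ 2 * A 2 * pd 3 (Kfun F) (jet w))) * hA'
  rw [e4] at e3
  refine ⟨e4, ?_, ?_⟩
  · rw [e2] at dk
    have : w 2 * A 2 * pd 2 (pd 3 (Kfun F)) (jet w) = 0 := by linarith
    exact (mul_eq_zero.1 this).resolve_left (by positivity)
  · have : B 0 * x1 = 0 := by linarith
    exact (mul_eq_zero.1 this).resolve_left hB0

lemma beta_eq_zero_of_pd {v : Fin 4 → ℝ} (hv : v ∈ N) (h1 : pd 3 (Kfun F) v = 0)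
    (h2 : pd 2 (betaOf F) v = 0) : betaOf F v = 0 := by
  have hp := h.p_ne v hv
  have e := h.Kq v hv
  rw [h1, h2] at e
  field_simp at e
  linarith

/-- In the case `A 0 = 0`, `B 0 ≠ 0`, the invariance along `A` is an equation that is linear in `γ`,
with leading coefficient `β_p`. -/
lemma beta_eq_zero_of_ne_snd (hP : PullsBack (slMatrix A B) (slframe F) S π G)
    (hA : killing A A = 1) (hS : ∀ w ∈ S, jet w ∈ N ∧ w 4 ≠ 0) (hA0 : A 0 = 0) (hB0 : B 0 ≠ 0)
    {w : Fin 6 → ℝ} (hw : w ∈ S) : betaOf F (jet w) = 0 := by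
  have hA2 : A 2 ≠ 0 := by rintro h'; simp [killing, hA0, h'] at hA
  have key : ∀ w ∈ S, pd 2 (betaOf F) (jet w) * w 5 / 3 + pd 2 (Kfun F) (jet w)
      - Kfun F (jet w) / w 2 + w 2 * sigmaOf F (jet w)
      + w 2 ^ 2 * pd 2 (sigmaOf F) (jet w) = 0 := by
    intro w hw
    obtain ⟨V, hV⟩ := h.exists_slframe (hS w hw) (slPair A 0)
    obtain ⟨k1, k2, k3⟩ := h.Kq_eq_zero_aux hP hA hS hA0 hB0 hw hV
    obtain ⟨v0, v1, v4, v2, v5⟩ := h.vert_fst (hS w hw) hV hA0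
    have hj := (hS w hw).1
    have hp := h.u2_ne hj
    rw [h.D_coefRx hj, D_vert hj h.smooth_beta v0 v1, D_vert hj h.smooth_sigma v0 v1,
      D_vert hj (fun v hv => (h.smooth v hv).Kfun) v0 v1,
      D_vert hj (fun v hv => (h.smooth v hv).Kfun.pd 3) v0 v1, h.pd_beta_three _ hj,
      h.pd_Kq_three _ hj, h.pd_sigma_three _ hj, k1, k2, v2, v5] at k3
    rw [show jet w 2 = w 2 from rfl] at k3
    field_simp at k3 ⊢
    refine mul_left_cancel₀ hA2 ?_
    linear_combination -k3
  obtain ⟨w', hw', hj', h4', h5'⟩ := exists_shift hP.isOpen hw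
  have e1 := key w hw
  have e2 := key w' hw'
  have h2' : w' 2 = w 2 := congrFun hj' 2
  rw [hj', h2'] at e2
  obtain ⟨V, hV⟩ := h.exists_slframe (hS w hw) (slPair A 0)
  refine h.beta_eq_zero_of_pd (hS w hw).1 (h.Kq_eq_zero_aux hP hA hS hA0 hB0 hw hV).1 ?_
  refine (mul_eq_zero.1 (?_ : (w' 5 - w 5) * pd 2 (betaOf F) (jet w) = 0)).resolve_left
    (sub_ne_zero.2 h5')
  linear_combination 3 * e2 - 3 * e1

lemma vert_fst_three {w : Fin 6 → ℝ} (hw : jet w ∈ N ∧ w 4 ≠ 0) {V : Fin 6 → ℝ}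
    (hV : slframe F w V = slPair A 0) (hA0 : A 0 = 0) :
    V 3 = w 3 * A 2 - w 2 * w 5 * A 2 + betaOf F (jet w) * w 2 * A 2 / 3
      + 2 * w 4 * w 2 ^ 2 * A 1 := by
  obtain ⟨v0, v1, v4, v2, v5⟩ := h.vert_fst hw hV hA0
  have h4 := hw.2
  have hp := h.u2_ne hw.1
  rw [h.slframe_apply hw] at hV
  have e1 := congrFun hV 1
  simp only [slPair, Matrix.cons_val, v0, v1, v2, v5] at e1
  field_simp at e1
  linear_combination (1 / 3) * e1

/-- In the case `A 0 = B 0 = 0`, the invariance along `A` is an equation that is linear in `γ`, with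
leading coefficient `K_qp`. -/
lemma pd_Kq_eq_zero (hP : PullsBack (slMatrix A B) (slframe F) S π G)
    (hA : killing A A = 1) (hB : killing B B = 1) (hS : ∀ w ∈ S, jet w ∈ N ∧ w 4 ≠ 0)
    (hA0 : A 0 = 0) (hB0 : B 0 = 0) {w : Fin 6 → ℝ} (hw : w ∈ S) :
    pd 2 (pd 3 (Kfun F)) (jet w) = 0 := by
  have hA2 : A 2 ≠ 0 := by rintro h'; simp [killing, hA0, h'] at hA
  have hA' : A 2 * A 2 = 1 := by simpa [killing, hA0] using hA
  have hB' : B 2 * B 2 = 1 := by simpa [killing, hB0] using hB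
  have key : ∀ w ∈ S, pd 2 (pd 3 (Kfun F)) (jet w) * A 2 * (2 * w 5 - w 3 / w 2
      - betaOf F (jet w) / 3) + A 2 * w 2 * pd 2 (sigmaOf F) (jet w)
      - 2 * w 4 * w 2 * pd 2 (pd 3 (Kfun F)) (jet w) * (A 1 + B 1 * B 2 * A 2) = 0 := by
    intro w hw
    obtain ⟨V, hV⟩ := h.exists_slframe (hS w hw) (slPair A 0)
    obtain ⟨v0, v1, v4, v2, v5⟩ := h.vert_fst (hS w hw) hV hA0
    have v3 := h.vert_fst_three (hS w hw) hV hA0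
    have hj := (hS w hw).1
    have h4 := (hS w hw).2
    have hp := h.u2_ne hj
    have c := h.cond_fst hP hA hS hw hV (Pi.single 1 1) (Pi.single 1 1)
    have hd := h.dForm_slframe hj V h4
    dsimp only at hd
    rw [hV] at hd
    simp only [h.slframe_apply (hS w hw), hd] at c
    simp [slForm, killing, fstPart, sndPart, slPair, v0, v1, v4, v2, v5, hA0, hB0] at c
    have e1 := h.D_coefRy hj V
    rw [D_vert hj h.smooth_sigma v0 v1,
      D_vert hj (fun v hv => (h.smooth v hv).Kfun.pd 3) v0 v1,
      h.pd_Kq_three _ hj, h.pd_sigma_three _ hj, v2, v5, v3] at e1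
    rw [D_vert hj (fun v hv => (h.smooth v hv).Kfun.pd 3) v0 v1,
      h.pd_Kq_three _ hj, e1, v2] at c
    clear hd e1
    rw [show jet w 2 = w 2 from rfl] at c
    field_simp at c ⊢
    refine mul_left_cancel₀ hp ?_
    linear_combination (1 / 2) * c
      + 3 * w 2 ^ 3 * A 2 * pd 2 (pd 3 (Kfun F)) (jet w) * pd 3 (Kfun F) (jet w) * hA'
      + 3 * w 2 ^ 2 * A 2 * pd 2 (pd 3 (Kfun F)) (jet w)
        * (-w 5 + w 2 * pd 3 (Kfun F) (jet w)) * hB'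
  obtain ⟨w', hw', hj', h4', h5'⟩ := exists_shift hP.isOpen hw
  have e1 := key w hw
  have e2 := key w' hw'
  have h2' : w' 2 = w 2 := congrFun hj' 2
  have h3' : w' 3 = w 3 := congrFun hj' 3
  rw [hj', h2', h3', h4'] at e2
  refine (mul_eq_zero.1 (?_ : A 2 * (w' 5 - w 5) * pd 2 (pd 3 (Kfun F)) (jet w)
    = 0)).resolve_left (mul_ne_zero hA2 (sub_ne_zero.2 h5'))
  linear_combination (1 / 2) * e2 - (1 / 2) * e1

lemma vert_snd {w : Fin 6 → ℝ} (hw : jet w ∈ N ∧ w 4 ≠ 0) {V : Fin 6 → ℝ}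
    (hV : slframe F w V = slPair 0 B) (hB0 : B 0 = 0) :
    V 0 = 0 ∧ V 1 = 0 ∧ V 4 = w 4 * B 2 ∧ V 2 = -(w 2 * B 2) ∧
      V 5 = -(w 5 * B 2) + 2 * w 2 * w 4 * B 1 ∧
      V 3 = -(w 3 * B 2) - w 2 * (-(w 5 * B 2) + 2 * w 2 * w 4 * B 1)
        - betaOf F (jet w) * w 2 * B 2 / 3 := by
  have h4 := hw.2
  have hp := h.u2_ne hw.1
  rw [h.slframe_apply hw] at hV
  have e0 := congrFun hV 0
  have e1 := congrFun hV 1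
  have e2 := congrFun hV 2
  have e3 := congrFun hV 3
  have e4 := congrFun hV 4
  have e5 := congrFun hV 5
  simp only [slPair, Matrix.cons_val, Pi.zero_apply, hB0] at e0 e1 e2 e3 e4 e5
  have hV0 : V 0 = 0 := by simpa [hp, h4] using e0
  have hV1 : V 1 = 0 := by simpa [hp, h4] using e3
  simp only [hV0, hV1, mul_zero, sub_zero, add_zero] at e1 e2 e4 e5
  have hV4 : V 4 = w 4 * B 2 := by rw [← e5, mul_div_cancel₀ _ h4]
  have hV2 : V 2 = -(w 2 * B 2) := by
    rw [e5] at e2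
    have : V 2 / w 2 = -B 2 := by linarith
    rw [← mul_neg, ← this, mul_div_cancel₀ _ hp]
  have hV5 : V 5 = -(w 5 * B 2) + 2 * w 2 * w 4 * B 1 := by
    rw [hV2] at e4; field_simp at e4; linear_combination e4
  refine ⟨hV0, hV1, hV4, hV2, hV5, ?_⟩
  rw [hV2, hV5] at e1
  field_simp at e1
  linear_combination (1 / 3) * e1

/-- In the case `A 0 = B 0 = 0`, the invariance along `B` is an equation that is linear in `γ`, with
leading coefficient `β_p`. -/
lemma pd_beta_eq_zero (hP : PullsBack (slMatrix A B) (slframe F) S π G)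
    (hA : killing A A = 1) (hB : killing B B = 1) (hS : ∀ w ∈ S, jet w ∈ N ∧ w 4 ≠ 0)
    (hA0 : A 0 = 0) (hB0 : B 0 = 0) {w : Fin 6 → ℝ} (hw : w ∈ S) :
    pd 2 (betaOf F) (jet w) = 0 := by
  have hA' : A 2 * A 2 = 1 := by simpa [killing, hA0] using hA
  have hB' : B 2 * B 2 = 1 := by simpa [killing, hB0] using hB
  have hB2 : B 2 ≠ 0 := by rintro h'; simp [killing, hB0, h'] at hB
  have key : ∀ w ∈ S, ∃ V : Fin 6 → ℝ, V 0 = 0 ∧ V 1 = 0 ∧ V 2 = -(w 2 * B 2) ∧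
      V 5 = -(w 5 * B 2) + 2 * w 2 * w 4 * B 1 ∧
      V 3 = -(w 3 * B 2) - w 2 * (-(w 5 * B 2) + 2 * w 2 * w 4 * B 1)
        - betaOf F (jet w) * w 2 * B 2 / 3 ∧
      fderiv ℝ (coefPx F) w V - pd 0 (betaOf F) (jet w) * B 2 / 3
        = 2 * w 4 * w 2 * A 1 * A 2 * B 2
          * (betaOf F (jet w) / 3 + pd 3 (Kfun F) (jet w) * w 2) := by
    intro w hw
    obtain ⟨V, hV⟩ := h.exists_slframe (hS w hw) (slPair 0 B)
    obtain ⟨v0, v1, v4, v2, v5, v3⟩ := h.vert_snd (hS w hw) hV hB0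
    refine ⟨V, v0, v1, v2, v5, v3, ?_⟩
    have hj := (hS w hw).1
    have h4 := (hS w hw).2
    have hp := h.u2_ne hj
    have c := h.cond_snd hP hB hS hw hV (Pi.single 0 1) (Pi.single 0 1)
    have hd := h.dForm_slframe hj V h4
    have zb : fderiv ℝ (fun u => betaOf F (jet u)) w (Pi.single 0 1) = pd 0 (betaOf F) (jet w) := by
      rw [fderiv_comp_jet (h.smooth_beta _ hj).diff]; simp
    dsimp only at hd
    rw [hV] at hd
    simp only [h.slframe_apply (hS w hw), hd] at c
    have ek := h.pd_Kq_eq_zero hP hA hB hS hA0 hB0 hw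
    have ek' := h.pd_Kq_three _ hj
    simp [slForm, killing, fstPart, sndPart, slPair, v0, v1, v4, v2, v5, v3, hA0, hB0, zb,
      D_vert hj (fun v hv => (h.smooth v hv).Kfun.pd 3) v0 v1, ek, ek'] at c
    clear hd
    generalize fderiv ℝ (coefPx F) w V = x1 at *
    field_simp at c ⊢
    refine mul_left_cancel₀ (pow_ne_zero 2 hp) ?_
    linear_combination (1 / 2) * c + (B 2 * w 2 * betaOf F (jet w)
      + 3 * B 2 * w 2 ^ 2 * pd 3 (Kfun F) (jet w))
        * (-(w 2 * w 5) - w 3 - w 2 ^ 2 * pd 3 (Kfun F) (jet w)) * hA'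
      - 3 * B 2 * w 2 ^ 4 * pd 3 (Kfun F) (jet w) ^ 2 * hB'
  have key2 : ∀ w ∈ S, pd 3 F (jet w) = betaOf F (jet w) + 3 * w 3 / w 2 := fun w _ => by
    simp [betaOf, jet]
  obtain ⟨w', hw', hj', h4', h5'⟩ := exists_shift hP.isOpen hw
  obtain ⟨V, v0, v1, v2, v5, v3, e1⟩ := key w hw
  obtain ⟨V', v0', v1', v2', v5', v3', e2⟩ := key w' hw'
  have h2' : w' 2 = w 2 := congrFun hj' 2
  have h3' : w' 3 = w 3 := congrFun hj' 3
  have hj := (hS w hw).1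
  have hp := h.u2_ne hj
  have ek := h.pd_Kq_eq_zero hP hA hB hS hA0 hB0 hw
  have expand : ∀ w ∈ S, ∀ V : Fin 6 → ℝ, V 0 = 0 → V 1 = 0 → fderiv ℝ (coefPx F) w V
      = -((V 2 * pd 2 F (jet w) + V 3 * (betaOf F (jet w) + 3 * w 3 / w 2)) / w 2)
      + F (jet w) * V 2 / w 2 ^ 2
      - (V 5 - V 3 / w 2 + w 3 * V 2 / w 2 ^ 2 - V 2 * pd 2 (betaOf F) (jet w) / 3)
          * (w 3 / w 2)
      - (w 5 - w 3 / w 2 - betaOf F (jet w) / 3) * (V 3 / w 2 - w 3 * V 2 / w 2 ^ 2)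
      - w 5 * V 5 - 2 * (V 2 * pd 2 (Kfun F) (jet w) + V 3 * pd 3 (Kfun F) (jet w))
      - (V 2 * pd 2 (betaOf F) (jet w) * w 5 + betaOf F (jet w) * V 5) / 3
      - V 2 * pd 3 (Kfun F) (jet w) * w 5 - w 2 * pd 3 (Kfun F) (jet w) * V 5
      - 2 * w 2 * V 2 * sigmaOf F (jet w) - w 2 ^ 2 * (V 2 * pd 2 (sigmaOf F) (jet w)) := by
    intro w hw V v0 v1
    have hj := (hS w hw).1
    rw [h.D_coefPx hj, D_vert hj h.smooth_beta v0 v1, D_vert hj h.smooth_sigma v0 v1,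
      D_vert hj (fun v hv => (h.smooth v hv).Kfun) v0 v1, D_vert hj h.smooth v0 v1,
      D_vert hj (fun v hv => (h.smooth v hv).Kfun.pd 3) v0 v1, h.pd_beta_three _ hj,
      h.pd_Kq_three _ hj, h.pd_sigma_three _ hj, h.pd_Kq_eq_zero hP hA hB hS hA0 hB0 hw,
      key2 w hw]
    ring
  rw [expand w hw V v0 v1, v2, v5, v3] at e1
  rw [expand w' hw' V' v0' v1', v2', v5', v3', hj', h2', h3', h4'] at e2
  refine (mul_eq_zero.1 (?_ : B 2 * (w' 5 - w 5) * pd 2 (betaOf F) (jet w)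
    = 0)).resolve_left (mul_ne_zero hB2 (sub_ne_zero.2 h5'))
  field_simp at e1 e2
  refine mul_left_cancel₀ (pow_ne_zero 3 hp) ?_
  linear_combination (1 / 3) * (e2 - e1)

lemma beta_eq_zero_of_eq (hP : PullsBack (slMatrix A B) (slframe F) S π G)
    (hA : killing A A = 1) (hB : killing B B = 1) (hS : ∀ w ∈ S, jet w ∈ N ∧ w 4 ≠ 0)
    (hA0 : A 0 = 0) (hB0 : B 0 = 0) {w : Fin 6 → ℝ} (hw : w ∈ S) : betaOf F (jet w) = 0 := by
  have hj := (hS w hw).1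
  have hp := h.p_ne _ hj
  have hb := h.smooth_beta _ hj
  have s : Smooth (fun v => betaOf F v / v 2) (jet w) := hb.div (smooth_coord 2) hp
  have e1 : pd 3 (Kfun F) =ᶠ[𝓝 (jet w)] fun v => (-(1 / 6)) * (betaOf F v / v 2) := by
    filter_upwards [eventually_jet (p := fun v => v ∈ N ∧ pd 2 (betaOf F) v = 0) hP.isOpen hw
      fun w hw => ⟨(hS w hw).1, h.pd_beta_eq_zero hP hA hB hS hA0 hB0 hw⟩] with v hv
    rw [h.Kq v hv.1, hv.2]
    have := h.p_ne v hv.1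
    field_simp
    ring
  have e2 := h.pd_Kq_eq_zero hP hA hB hS hA0 hB0 hw
  rw [pd_congr e1, pd_const_mul _ s, pd_div hb (smooth_coord 2) hp,
    h.pd_beta_eq_zero hP hA hB hS hA0 hB0 hw, pd_coord] at e2
  simp at e2
  exact e2.resolve_right hp

/-- **Vanishing of `β`.** If the equation has a metric with the coefficients `slForm A B`, then the
part of `F` that is linear in `q` vanishes. -/
theorem beta_eq_zero (hP : PullsBack (slMatrix A B) (slframe F) S π G)
    (hA : killing A A = 1) (hB : killing B B = 1) (hS : ∀ w ∈ S, jet w ∈ N ∧ w 4 ≠ 0)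
    {w : Fin 6 → ℝ} (hw : w ∈ S) : betaOf F (jet w) = 0 := by
  by_cases hA0 : A 0 = 0
  · by_cases hB0 : B 0 = 0
    · exact h.beta_eq_zero_of_eq hP hA hB hS hA0 hB0 hw
    · exact h.beta_eq_zero_of_ne_snd hP hA hS hA0 hB0 hw
  · exact h.beta_eq_zero_of_ne hP hA hS hA0 hw

end SemiNormal

/-! ### The normal form of the equations with a metric -/

lemma isOpen_image_jet {S : Set (Fin 6 → ℝ)} (hS : IsOpen S) : IsOpen (jet '' S) := by
  rw [isOpen_iff_mem_nhds]
  rintro _ ⟨w, hw, rfl⟩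
  exact eventually_jet (p := fun v => v ∈ jet '' S) hS hw fun w hw => ⟨w, hw, rfl⟩

lemma SemiNormal.mono {F : (Fin 4 → ℝ) → ℝ} {N N' : Set (Fin 4 → ℝ)} (h : SemiNormal F N)
    (hN : IsOpen N') (hs : N' ⊆ N) : SemiNormal F N' :=
  ⟨hN, fun v hv => h.smooth v (hs hv), fun v hv => h.p_ne v (hs hv), fun v hv => h.Fqq v (hs hv)⟩

namespace SemiNormal

variable {F : (Fin 4 → ℝ) → ℝ} {N : Set (Fin 4 → ℝ)} (h : SemiNormal F N)
  (hb : ∀ v ∈ N, betaOf F v = 0)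
include h hb

omit h in
lemma F_three : ∀ v ∈ N, pd 3 F v = 3 * v 3 / v 2 := fun v hv => by
  have := hb v hv
  unfold betaOf at this
  linarith

lemma pd_beta_zero (i : Fin 4) : ∀ v ∈ N, pd i (betaOf F) v = 0 := fun v hv => by
  rw [pd_congr_on h.isOpen hb i v hv, pd_const]

lemma Kq_zero : ∀ v ∈ N, pd 3 (Kfun F) v = 0 := fun v hv => by
  rw [h.Kq v hv, h.pd_beta_zero hb 2 v hv, hb v hv]; simp

lemma pd_Kq_zero (i : Fin 4) : ∀ v ∈ N, pd i (pd 3 (Kfun F)) v = 0 := fun v hv => by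
  rw [pd_congr_on h.isOpen (h.Kq_zero hb) i v hv, pd_const]

lemma sigma_three : ∀ v ∈ N, pd 3 (sigmaOf F) v = 0 := fun v hv => by
  rw [h.pd_sigma_three v hv, h.pd_Kq_zero hb 2 v hv]; simp

lemma K_two : ∀ v ∈ N, pd 2 (Kfun F) v = Kfun F v / v 2 - v 2 * sigmaOf F v := fun v hv => by
  have hp := h.p_ne v hv
  have e : sigmaOf F v = (-(pd 1 (betaOf F) v / 3) - pd 2 (Kfun F) v
    - (v 3 / v 2 + betaOf F v / 3) * pd 3 (Kfun F) v + Kfun F v / v 2) / v 2 := rfl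
  rw [h.pd_beta_zero hb 1 v hv, h.Kq_zero hb v hv] at e
  rw [e]
  field_simp
  ring

lemma F_two : ∀ v ∈ N, pd 2 F v = F v / v 2 - 3 * v 3 ^ 2 / v 2 ^ 2 - 2 * Kfun F v :=
  fun v hv => by
    have hp := h.p_ne v hv
    have e := Kfun_eq F v
    have e' : totalD F (pd 3 F) v = -(3 * v 3 ^ 2) / v 2 ^ 2 + 3 * F v / v 2 := by
      unfold totalD
      rw [pd_congr_on h.isOpen (F_three hb) 0 v hv, pd_congr_on h.isOpen (F_three hb) 1 v hv,
        pd_congr_on h.isOpen (F_three hb) 2 v hv, pd_congr_on h.isOpen (F_three hb) 3 v hv,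
        h.pd_ratio 0 v hv, h.pd_ratio 1 v hv, h.pd_ratio 2 v hv, h.pd_ratio 3 v hv]
      simp
      field_simp
    rw [e', F_three hb v hv] at e
    rw [e]
    field_simp
    ring

/-- The structure equations on vectors annihilated by `dy`. -/
lemma dForm_slframe_of_beta {u : Fin 6 → ℝ} (hu : jet u ∈ N) (h4 : u 4 ≠ 0) {V X : Fin 6 → ℝ}
    (hV : V 1 = 0) (hX : X 1 = 0) :
    let s := slframe F u V
    let t := slframe F u X
    let Z := u 2 * pd 2 (sigmaOf F) (jet u) / (4 * u 4 ^ 2)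
      * ((t 2 - t 5) * s 0 - (s 2 - s 5) * t 0)
    dForm (slframe F) u V X = ![s 2 * t 0 - s 0 * t 2, s 1 * t 2 - s 2 * t 1 + Z,
      s 0 * t 1 - s 1 * t 0, 0, s 4 * t 5 - s 5 * t 4 + Z, 0] := by
  intro s t Z
  have hp := h.u2_ne hu
  have jF := fun X => fderiv_comp_jet (h.smooth _ hu).diff X
  have jK := fun X => fderiv_comp_jet (h.smooth _ hu).Kfun.diff X
  have jk : ∀ X, fderiv ℝ (fun u => pd 3 (Kfun F) (jet u)) u X = 0 := fun X => by
    rw [fderiv_comp_jet ((h.smooth _ hu).Kfun.pd 3).diff X]; simp [h.pd_Kq_zero hb _ _ hu]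
  have jb : ∀ X, fderiv ℝ (fun u => betaOf F (jet u)) u X = 0 := fun X => by
    rw [fderiv_comp_jet (h.smooth_beta _ hu).diff X]; simp [h.pd_beta_zero hb _ _ hu]
  have js := fun X => fderiv_comp_jet (h.smooth_sigma _ hu).diff X
  have hd := h.dForm_slframe hu V h4 X
  dsimp only at hd
  rw [hd]
  simp only [h.D_coefPx hu, h.D_coefRx hu, jF, jK, jk, jb, js, hV, hX, hb _ hu,
    h.Kq_zero hb _ hu, h.sigma_three hb _ hu, h.K_two hb _ hu, F_three hb _ hu, h.F_two hb _ hu,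
    h.slframe_apply ⟨hu, h4⟩, s, t, Z, coefPx, coefRx]
  simp only [show jet u 2 = u 2 from rfl, show jet u 3 = u 3 from rfl]
  funext a
  fin_cases a <;> simp only [Fin.reduceFinMk, Fin.zero_eta, Fin.mk_one, Matrix.cons_val] <;>
    field_simp <;> ring

variable {A B : Fin 3 → ℝ} {S : Set (Fin 6 → ℝ)} {π : (Fin 6 → ℝ) → (Fin 4 → ℝ)}
  {G : (Fin 4 → ℝ) → Matrix (Fin 4) (Fin 4) ℝ}

omit hb in
lemma slframe_y_eq_zero {w : Fin 6 → ℝ} (hw : jet w ∈ N ∧ w 4 ≠ 0) {X : Fin 6 → ℝ}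
    (hX : slframe F w X 3 = 0) : X 1 = 0 := by
  rw [h.slframe_apply hw] at hX
  simpa [hw.2] using hX

/-- The invariance along `A` shows that `σ` is a function of `x` and `y` only. -/
lemma sigma_two (hP : PullsBack (slMatrix A B) (slframe F) S π G)
    (hA : killing A A = 1) (hS : ∀ w ∈ S, jet w ∈ N ∧ w 4 ≠ 0)
    {w : Fin 6 → ℝ} (hw : w ∈ S) : pd 2 (sigmaOf F) (jet w) = 0 := by
  have hj := (hS w hw).1
  have h4 := (hS w hw).2
  have hp := h.u2_ne hj
  obtain ⟨V, hV⟩ := h.exists_slframe (hS w hw) (slPair A 0)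
  have hV1 := h.slframe_y_eq_zero (hS w hw) (X := V) (by rw [hV]; rfl)
  have key : w 2 * pd 2 (sigmaOf F) (jet w) / (4 * w 4 ^ 2) = 0 := by
    by_cases hA0 : A 0 = 0
    · have hA2 : A 2 ≠ 0 := by rintro h'; simp [killing, hA0, h'] at hA
      obtain ⟨X, hX⟩ := h.exists_slframe (hS w hw) (slPair ![1, 0, 0] 0)
      have c := h.cond_fst hP hA hS hw hV X X
      rw [h.dForm_slframe_of_beta hb hj h4 hV1
        (h.slframe_y_eq_zero (hS w hw) (X := X) (by rw [hX]; rfl)), hV, hX] at c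
      simp only [killing] at hA
      simp [slForm, killing, fstPart, sndPart, slPair, hA0] at c hA ⊢
      clear hb hS
      grind
    · obtain ⟨X, hX⟩ := h.exists_slframe (hS w hw) (slPair ![0, (1 - A 2) / A 0, 1] 0)
      have c := h.cond_fst hP hA hS hw hV X X
      rw [h.dForm_slframe_of_beta hb hj h4 hV1
        (h.slframe_y_eq_zero (hS w hw) (X := X) (by rw [hX]; rfl)), hV, hX] at c
      generalize w 2 * pd 2 (sigmaOf F) (jet w) / (4 * w 4 ^ 2) = L at *
      simp only [killing] at hA
      simp [slForm, killing, fstPart, sndPart, slPair] at c hA ⊢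
      have : A 0 ^ 2 * L = 0 := by
        field_simp at c
        linear_combination -(1 / 2) * c
      simpa [hA0] using this
  have h0 : w 2 ≠ 0 ∧ (4 * w 4 ^ 2) ≠ 0 := ⟨hp, by positivity⟩
  rcases div_eq_zero_iff.1 key with h' | h'
  · exact (mul_eq_zero.1 h').resolve_left hp
  · exact absurd h' h0.2

end SemiNormal

/-- On a ball, a function with vanishing partial derivative does not depend on this variable. -/
lemma eq_update_of_pd_eq_zero {k : ℕ} {f : (Fin k → ℝ) → ℝ} {v₀ : Fin k → ℝ} {r : ℝ} {i : Fin k}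
    (hf : ∀ v ∈ Metric.ball v₀ r, Smooth f v) (h0 : ∀ v ∈ Metric.ball v₀ r, pd i f v = 0)
    {v : Fin k → ℝ} (hv : v ∈ Metric.ball v₀ r) : f v = f (Function.update v i (v₀ i)) := by
  have hr : 0 < r := dist_nonneg.trans_lt hv
  have hmem : ∀ s ∈ Metric.ball (v₀ i) r, Function.update v i s ∈ Metric.ball v₀ r := by
    intro s hs
    rw [Metric.mem_ball, dist_pi_lt_iff hr] at hv ⊢
    intro j
    by_cases hj : j = i
    · subst hj; simpa using hs
    · simpa [hj] using hv j
  have hd : ∀ s ∈ Metric.ball (v₀ i) r,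
      HasDerivAt (fun s => f (Function.update v i s)) 0 s := by
    intro s hs
    have h1 := (hf _ (hmem s hs)).diff.hasFDerivAt.comp_hasDerivAt s (hasDerivAt_update v i s)
    have h2 := h0 _ (hmem s hs)
    rw [pd] at h2
    rwa [h2] at h1
  have e := Metric.isOpen_ball.is_const_of_deriv_eq_zero
    (convex_ball (v₀ i) r).isPreconnected
    (fun s hs => (hd s hs).differentiableAt.differentiableWithinAt)
    (fun s hs => (hd s hs).deriv) (x := v i) (y := v₀ i)
    ((dist_pi_lt_iff hr).1 hv i) (Metric.mem_ball_self hr)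
  simpa using e

/-- On a ball in the space of jets, a function whose derivatives in `p` and `q` vanish is a function
of `x` and `y`. -/
lemma eq_of_pd_two_three {f : (Fin 4 → ℝ) → ℝ} {v₀ : Fin 4 → ℝ} {r : ℝ}
    (hf : ∀ v ∈ Metric.ball v₀ r, Smooth f v) (h2 : ∀ v ∈ Metric.ball v₀ r, pd 2 f v = 0)
    (h3 : ∀ v ∈ Metric.ball v₀ r, pd 3 f v = 0) {v : Fin 4 → ℝ} (hv : v ∈ Metric.ball v₀ r) :
    f v = f ![v 0, v 1, v₀ 2, v₀ 3] := by
  have hr : 0 < r := dist_nonneg.trans_lt hv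
  have hv' : Function.update v 2 (v₀ 2) ∈ Metric.ball v₀ r := by
    rw [Metric.mem_ball, dist_pi_lt_iff hr] at hv ⊢
    intro j
    by_cases hj : j = 2
    · subst hj; simpa using hr
    · simpa [hj] using hv j
  rw [eq_update_of_pd_eq_zero hf h2 hv, eq_update_of_pd_eq_zero hf h3 hv']
  congr 1
  funext j
  fin_cases j <;> simp

namespace SemiNormal

variable {F : (Fin 4 → ℝ) → ℝ} {N : Set (Fin 4 → ℝ)} (h : SemiNormal F N)
  (hb : ∀ v ∈ N, betaOf F v = 0) (hσ : ∀ v ∈ N, pd 2 (sigmaOf F) v = 0)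
include h

/-- The equation without its leading term, divided by `p`. -/
lemma smooth_reduced : ∀ v ∈ N, Smooth (fun v => F v / v 2 - (3 / 2) * v 3 ^ 2 / v 2 ^ 2) v :=
  fun v hv => ((h.smooth v hv).div (smooth_coord 2) (h.p_ne v hv)).sub
    ((contDiffAt_const.mul ((smooth_coord 3).pow 2)).div ((smooth_coord 2).pow 2)
      (pow_ne_zero 2 (h.p_ne v hv)))

lemma pd_reduced (i : Fin 4) : ∀ v ∈ N,
    pd i (fun v => F v / v 2 - (3 / 2) * v 3 ^ 2 / v 2 ^ 2) v
      = (pd i F v * v 2 - F v * (if i = 2 then 1 else 0)) / v 2 ^ 2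
        - (3 * v 3 * (if i = 3 then 1 else 0)) / v 2 ^ 2
        + 3 * v 3 ^ 2 * (if i = 2 then 1 else 0) / v 2 ^ 3 := fun v hv => by
  have hp := h.p_ne v hv
  have s1 : Smooth (fun v : Fin 4 → ℝ => v 3 ^ 2) v := (smooth_coord 3).pow 2
  have s2 : Smooth (fun v : Fin 4 → ℝ => v 2 ^ 2) v := (smooth_coord 2).pow 2
  have s3 : Smooth (fun v : Fin 4 → ℝ => (3 / 2) * v 3 ^ 2) v := contDiffAt_const.mul s1
  have t1 : Smooth (fun v => F v / v 2) v := (h.smooth v hv).div (smooth_coord 2) hp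
  have t2 : Smooth (fun v : Fin 4 → ℝ => (3 / 2) * v 3 ^ 2 / v 2 ^ 2) v :=
    s3.div s2 (pow_ne_zero 2 hp)
  rw [pd_sub t1 t2,
    pd_div (h.smooth v hv) (smooth_coord 2) hp, pd_div s3 s2 (pow_ne_zero 2 hp),
    pd_const_mul _ s1, pd_pow (smooth_coord 3), pd_pow (smooth_coord 2), pd_coord, pd_coord]
  field_simp
  ring

include hb hσ

/-- An equation with `β = 0` and `σ = σ(x, y)` has the normal form
`F = (3 / 2) q² / p + A p³ + C p² + B p`, with `A = σ`. -/
theorem exists_normalForm {v₀ : Fin 4 → ℝ} (hv₀ : v₀ ∈ N) :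
    ∃ (n : NormalForm) (N' : Set (Fin 4 → ℝ)), IsOpen N' ∧ v₀ ∈ N' ∧ N' ⊆ N ∧
      ∀ v ∈ N', v ∈ n.ode.dom ∧ n.ode.F v = F v := by
  obtain ⟨r, hr, hball⟩ := Metric.isOpen_iff.1 h.isOpen v₀ hv₀
  set g : (Fin 4 → ℝ) → ℝ := fun v => F v / v 2 - (3 / 2) * v 3 ^ 2 / v 2 ^ 2 with hg
  have sg := h.smooth_reduced
  have ss := h.smooth_sigma
  have g3 : ∀ v ∈ N, pd 3 g v = 0 := fun v hv => by
    have hp := h.p_ne v hv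
    rw [h.pd_reduced 3 v hv, F_three hb v hv]
    simp
    field_simp
    ring
  have g2 : ∀ v ∈ N, pd 2 g v = -2 * Kfun F v / v 2 := fun v hv => by
    have hp := h.p_ne v hv
    rw [h.pd_reduced 2 v hv, h.F_two hb v hv]
    simp
    field_simp
    ring
  have g22 : ∀ v ∈ N, pd 2 (pd 2 g) v = 2 * sigmaOf F v := fun v hv => by
    have hp := h.p_ne v hv
    have sK := (h.smooth v hv).Kfun
    rw [pd_congr_on h.isOpen g2 2 v hv, pd_div (contDiffAt_const.mul sK) (smooth_coord 2) hp,
      pd_const_mul _ sK, h.K_two hb v hv, pd_coord]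
    simp
    field_simp
    ring
  have g32 : ∀ v ∈ N, pd 3 (pd 2 g) v = 0 := fun v hv => by
    rw [pd_comm (sg v hv), pd_congr_on h.isOpen g3 2 v hv, pd_const]
  have s3 := h.sigma_three hb
  have sc : ∀ v ∈ N, Smooth (fun v => pd 2 g v - 2 * (sigmaOf F v * v 2)) v := fun v hv =>
    ((sg v hv).pd 2).sub (contDiffAt_const.mul ((ss v hv).mul (smooth_coord 2)))
  have sb : ∀ v ∈ N, Smooth (fun v => g v - pd 2 g v * v 2 + sigmaOf F v * v 2 ^ 2) v :=
    fun v hv => ((sg v hv).sub (((sg v hv).pd 2).mul (smooth_coord 2))).add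
      ((ss v hv).mul ((smooth_coord 2).pow 2))
  have dc : ∀ i, ∀ v ∈ N, pd i (fun v => pd 2 g v - 2 * (sigmaOf F v * v 2)) v
      = pd i (pd 2 g) v - 2 * (sigmaOf F v * (if i = 2 then 1 else 0)
        + v 2 * pd i (sigmaOf F) v) := fun i v hv => by
    rw [pd_sub ((sg v hv).pd 2) (contDiffAt_const.mul ((ss v hv).mul (smooth_coord 2))),
      pd_const_mul _ ((ss v hv).mul (smooth_coord 2)), pd_mul (ss v hv) (smooth_coord 2), pd_coord]
  have db : ∀ i, ∀ v ∈ N, pd i (fun v => g v - pd 2 g v * v 2 + sigmaOf F v * v 2 ^ 2) v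
      = pd i g v - (pd 2 g v * (if i = 2 then 1 else 0) + v 2 * pd i (pd 2 g) v)
        + (sigmaOf F v * (2 * v 2 * (if i = 2 then 1 else 0)) + v 2 ^ 2 * pd i (sigmaOf F) v) :=
    fun i v hv => by
      have s2 : Smooth (fun v : Fin 4 → ℝ => v 2 ^ 2) v := (smooth_coord 2).pow 2
      have sm : Smooth (fun v : Fin 4 → ℝ => pd 2 g v * v 2) v :=
        ((sg v hv).pd 2).mul (smooth_coord 2)
      rw [pd_add ((sg v hv).sub sm) ((ss v hv).mul s2), pd_sub (sg v hv) sm,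
        pd_mul ((sg v hv).pd 2) (smooth_coord 2), pd_mul (ss v hv) s2, pd_pow (smooth_coord 2),
        pd_coord]
      simp [hg]
  let ι : ℝ × ℝ → (Fin 4 → ℝ) := fun s => ![s.1, s.2, v₀ 2, v₀ 3]
  have hι : ∀ s, Smooth ι s := fun s => smooth_pi.2 fun a => by
    fin_cases a
    · exact contDiffAt_fst
    · exact contDiffAt_snd
    · exact contDiffAt_const
    · exact contDiffAt_const
  have hcι : Continuous ι := continuous_iff_continuousAt.2 fun s => (hι s).continuousAt
  let n : NormalForm :=
    { D := ι ⁻¹' Metric.ball v₀ r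
      A := fun s => sigmaOf F (ι s)
      B := fun s => (fun v => g v - pd 2 g v * v 2 + sigmaOf F v * v 2 ^ 2) (ι s)
      C := fun s => (fun v => pd 2 g v - 2 * (sigmaOf F v * v 2)) (ι s)
      isOpen_D := Metric.isOpen_ball.preimage hcι
      smooth_A := fun s hs => (ContDiffAt.comp s (ss _ (hball hs)) (hι s)).contDiffWithinAt
      smooth_B := fun s hs => (ContDiffAt.comp s (sb _ (hball hs)) (hι s)).contDiffWithinAt
      smooth_C := fun s hs => (ContDiffAt.comp s (sc _ (hball hs)) (hι s)).contDiffWithinAt }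
  refine ⟨n, Metric.ball v₀ r, Metric.isOpen_ball, Metric.mem_ball_self hr, hball, ?_⟩
  intro v hv
  have hp := h.p_ne v (hball hv)
  have hvι : ι (v 0, v 1) ∈ Metric.ball v₀ r := by
    rw [Metric.mem_ball, dist_pi_lt_iff hr] at hv ⊢
    intro j
    fin_cases j
    · exact hv 0
    · exact hv 1
    · simpa [ι] using hr
    · simpa [ι] using hr
  refine ⟨⟨hvι, hp⟩, ?_⟩
  have eA := eq_of_pd_two_three (fun v hv => ss v (hball hv)) (fun v hv => hσ v (hball hv))
    (fun v hv => s3 v (hball hv)) hv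
  have eC := eq_of_pd_two_three (fun v hv => sc v (hball hv))
    (fun v hv => by
      rw [dc 2 v (hball hv), g22 v (hball hv), hσ v (hball hv)]; simp)
    (fun v hv => by
      rw [dc 3 v (hball hv), g32 v (hball hv), s3 v (hball hv)]; simp) hv
  have eB := eq_of_pd_two_three (fun v hv => sb v (hball hv))
    (fun v hv => by
      rw [db 2 v (hball hv), g22 v (hball hv), hσ v (hball hv)]; simp; ring)
    (fun v hv => by
      rw [db 3 v (hball hv), g32 v (hball hv), g3 v (hball hv), s3 v (hball hv)]; simp) hv
  have fA : n.A (v 0, v 1) = sigmaOf F v := eA.symm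
  have fB : n.B (v 0, v 1) = g v - pd 2 g v * v 2 + sigmaOf F v * v 2 ^ 2 := eB.symm
  have fC : n.C (v 0, v 1) = pd 2 g v - 2 * (sigmaOf F v * v 2) := eC.symm
  show (3 / 2) * (v 3) ^ 2 / v 2 + n.A (v 0, v 1) * (v 2) ^ 3 + n.C (v 0, v 1) * (v 2) ^ 2
    + n.B (v 0, v 1) * v 2 = F v
  rw [fA, fB, fC, hg]
  simp only
  field_simp
  ring

end SemiNormal

/-- An equation with `F_qq = 3 / p` that has a metric with the coefficients `slForm A B` has the
normal form. -/
theorem SemiNormal.exists_normalForm_of_pullsBack {F : (Fin 4 → ℝ) → ℝ} {N : Set (Fin 4 → ℝ)}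
    (h : SemiNormal F N) {A B : Fin 3 → ℝ} {S : Set (Fin 6 → ℝ)} {π : (Fin 6 → ℝ) → (Fin 4 → ℝ)}
    {G : (Fin 4 → ℝ) → Matrix (Fin 4) (Fin 4) ℝ}
    (hP : PullsBack (slMatrix A B) (slframe F) S π G) (hA : killing A A = 1) (hB : killing B B = 1)
    (hS : ∀ w ∈ S, jet w ∈ N ∧ w 4 ≠ 0) {w : Fin 6 → ℝ} (hw : w ∈ S) :
    ∃ (n : NormalForm) (N' : Set (Fin 4 → ℝ)), IsOpen N' ∧ jet w ∈ N' ∧ N' ⊆ N ∧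
      ∀ v ∈ N', v ∈ n.ode.dom ∧ n.ode.F v = F v := by
  have h' : SemiNormal F (jet '' S) := h.mono (isOpen_image_jet hP.isOpen) (by
    rintro _ ⟨w, hw, rfl⟩; exact (hS w hw).1)
  have hS' : ∀ w ∈ S, jet w ∈ jet '' S ∧ w 4 ≠ 0 := fun w hw => ⟨⟨w, hw, rfl⟩, (hS w hw).2⟩
  have hb : ∀ v ∈ jet '' S, betaOf F v = 0 := by
    rintro _ ⟨w, hw, rfl⟩; exact h.beta_eq_zero hP hA hB hS hw
  have hσ : ∀ v ∈ jet '' S, pd 2 (sigmaOf F) v = 0 := by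
    rintro _ ⟨w, hw, rfl⟩; exact h'.sigma_two hb hP hA hS' hw
  obtain ⟨n, N', h1, h2, h3, h4⟩ := h'.exists_normalForm hb hσ ⟨w, hw, rfl⟩
  refine ⟨n, N', h1, h2, h3.trans ?_, h4⟩
  rintro _ ⟨w, hw, rfl⟩; exact (hS w hw).1

/-! ### The structure equations in the directions `α`, `γ` and `q` -/

section

variable {m : ℕ} {f : (Fin m → ℝ) → ℝ} {u V : Fin m → ℝ}

lemma fderiv_eq_of_hasDerivAt {d : ℝ} (hf : DifferentiableAt ℝ f u)
    (h : HasDerivAt (fun s : ℝ => f (u + s • V)) d 0) : fderiv ℝ f u V = d := by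
  have h1 : HasDerivAt (fun s : ℝ => u + s • V) V 0 := by
    simpa using ((hasDerivAt_id (0 : ℝ)).smul_const V).const_add u
  have h2 := (show HasFDerivAt f (fderiv ℝ f u) (u + (0 : ℝ) • V) by
    simpa using hf.hasFDerivAt).comp_hasDerivAt (0 : ℝ) h1
  exact h2.unique h

/-- The derivative of a function that is a cubic polynomial on a line. -/
lemma fderiv_of_cubic (hf : DifferentiableAt ℝ f u) {a b c d : ℝ}
    (h : ∀ s : ℝ, f (u + s • V) = a + b * s + c * s ^ 2 + d * s ^ 3) : fderiv ℝ f u V = b := by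
  refine fderiv_eq_of_hasDerivAt hf ?_
  simp only [h]
  have : HasDerivAt (fun s : ℝ => a + b * s + c * s ^ 2 + d * s ^ 3) _ 0 :=
    ((((hasDerivAt_id (0 : ℝ)).const_mul b).const_add a).add
      (((hasDerivAt_id (0 : ℝ)).pow 2).const_mul c)).add
      (((hasDerivAt_id (0 : ℝ)).pow 3).const_mul d)
  simpa using this

/-- The derivative of a function that is a sum of powers of degree `0`, `1` and `-1` on a line. -/
lemma fderiv_of_laurent (hf : DifferentiableAt ℝ f u) {a b c x : ℝ} (hx : x ≠ 0)
    (h : ∀ s : ℝ, f (u + s • V) = a + b * s + c / (x + s)) :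
    fderiv ℝ f u V = b - c / x ^ 2 := by
  refine fderiv_eq_of_hasDerivAt hf ?_
  simp only [h]
  have h1 : HasDerivAt (fun s : ℝ => x + s) 1 0 := (hasDerivAt_id (0 : ℝ)).const_add x
  have h2 : HasDerivAt (fun s : ℝ => a + b * s + c / (x + s)) _ 0 :=
    (((hasDerivAt_id (0 : ℝ)).const_mul b).const_add a).add
      ((hasDerivAt_const (0 : ℝ) c).div h1 (by simpa using hx))
  simpa [sub_eq_add_neg, neg_div] using h2

end

lemma dForm_slframe_eq {F : (Fin 4 → ℝ) → ℝ} {u : Fin 6 → ℝ} (hF : Smooth F (jet u))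
    (h4 : u 4 ≠ 0) (hqq : pd 3 (pd 3 F) (jet u) ≠ 0) (V X : Fin 6 → ℝ) :
    dForm (slframe F) u V X = slBasis (dForm (coframe F) u V X) := by
  have s := fun X a => (smooth_coframe hF h4 hqq X a).diff
  have c2 : ∀ X a, DifferentiableAt ℝ (fun w => 2 * coframe F w X a) u := fun X a =>
    (s X a).const_mul 2
  have d2 : ∀ X a V, fderiv ℝ (fun w => 2 * coframe F w X a) u V
      = 2 * fderiv ℝ (fun w => coframe F w X a) u V := fun X a V => by
    rw [D_mul (differentiableAt_const _) (s X a), D_const]; ring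
  funext i
  fin_cases i <;> simp only [dForm, slframe, slBasis, Fin.reduceFinMk, Fin.zero_eta, Fin.mk_one,
    Matrix.cons_val]
  · rw [D_add (c2 _ _) (s _ _), D_add (c2 _ _) (s _ _), d2, d2]; ring
  · rw [D_add (s _ _) (c2 _ _), D_add (s _ _) (c2 _ _), d2, d2]; ring
  · rw [D_add (c2 _ _) (s _ _), D_add (c2 _ _) (s _ _), d2, d2]; ring

/-- The first of three functions of the jet, of `α` and of `γ` that describe how the coframe deviates
from the one of the equation `y''' = (3/2) y''² / y'`. -/
def invA (F : (Fin 4 → ℝ) → ℝ) (u : Fin 6 → ℝ) : ℝ :=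
  36 * u 4 * pd 3 (pd 3 (pd 3 F)) (jet u) / pd 3 (pd 3 F) (jet u) ^ 3

/-- The second of these functions. -/
def invB (F : (Fin 4 → ℝ) → ℝ) (u : Fin 6 → ℝ) : ℝ :=
  (totalD F (pd 3 (pd 3 F)) (jet u) + pd 3 F (jet u) * pd 3 (pd 3 F) (jet u) / 3) / (6 * u 4)

/-- The third of these functions. It vanishes identically in `γ` exactly when `F_qqq = 0` and
`F_qqp = -F_qq² / 3`. -/
def invC (F : (Fin 4 → ℝ) → ℝ) (u : Fin 6 → ℝ) : ℝ :=
  (pd 2 (pd 3 (pd 3 F)) (jet u) + pd 3 F (jet u) * pd 3 (pd 3 (pd 3 F)) (jet u) / 3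
    - u 5 * pd 3 (pd 3 (pd 3 F)) (jet u)) / pd 3 (pd 3 F) (jet u) ^ 2 + 1 / 3

section

variable {F : (Fin 4 → ℝ) → ℝ} {u : Fin 6 → ℝ} (hF : Smooth F (jet u))
    (h4 : u 4 ≠ 0) (hqq : pd 3 (pd 3 F) (jet u) ≠ 0) (V : Fin 6 → ℝ)

lemma jet_add_alpha (u : Fin 6 → ℝ) (s : ℝ) :
    jet (u + s • (Pi.single 4 1 : Fin 6 → ℝ)) = jet u := by
  funext i; fin_cases i <;> simp [jet]

lemma jet_add_gamma (u : Fin 6 → ℝ) (s : ℝ) :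
    jet (u + s • (Pi.single 5 1 : Fin 6 → ℝ)) = jet u := by
  funext i; fin_cases i <;> simp [jet]

lemma coframe_alpha (u : Fin 6 → ℝ) :
    coframe F u (Pi.single 4 1) = ![0, 0, 0, 0, 1 / u 4, 0] := by
  funext i; fin_cases i <;> simp [coframe]

lemma coframe_gamma (u : Fin 6 → ℝ) :
    coframe F u (Pi.single 5 1) = ![0, 0, 0, 0, 0, pd 3 (pd 3 F) (jet u) / (6 * u 4)] := by
  funext i; fin_cases i <;> simp [coframe]; ring

lemma coframe_q (u : Fin 6 → ℝ) :
    coframe F u (Pi.single 3 1) = ![0, 0, pd 3 (pd 3 F) (jet u) ^ 2 / (36 * u 4), 0, 0, 0] := by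
  funext i; fin_cases i <;> simp [coframe]; ring

include hF h4 hqq

lemma dForm_coframe_alpha :
    let t := coframe F u V
    dForm (coframe F) u V (Pi.single 4 1)
      = (1 / u 4) • ![-t 0, 0, t 2, -t 3, 0, t 5] := by
  intro t
  have s := fun a => (smooth_coframe hF h4 hqq V a).diff
  have e := coframe_alpha (F := F)
  have d4 : fderiv ℝ (fun w : Fin 6 → ℝ => (w 4)⁻¹) u V = -V 4 / u 4 ^ 2 := by
    rw [D_inv (by fun_prop) h4, D_coord]
  funext a
  simp only [dForm, e]
  fin_cases a
  · rw [fderiv_of_cubic (a := t 0) (b := t 0 / u 4) (c := 0) (d := 0) (s _)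
        (fun r => by simp [coframe, t]; field_simp)]
    simp; ring
  · rw [fderiv_of_cubic (a := t 1) (b := 0) (c := 0) (d := 0) (s _)
        (fun r => by simp [coframe, jet_add_alpha, t])]
    simp
  · rw [fderiv_of_laurent (a := 0) (b := 0) (c := u 4 * t 2) (x := u 4) (s _) h4
        (fun r => by simp [coframe, jet_add_alpha, t]; field_simp)]
    simp; field_simp
  · rw [fderiv_of_cubic (a := t 3) (b := t 3 / u 4) (c := 0) (d := 0) (s _)
        (fun r => by simp [coframe, jet_add_alpha, t]; field_simp)]
    simp; ring
  · rw [fderiv_of_laurent (a := t 4 - V 4 / u 4) (b := 0) (c := V 4) (x := u 4) (s _) h4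
        (fun r => by simp [coframe, jet_add_alpha, t]; ring)]
    simp [d4]; ring
  · rw [fderiv_of_laurent (a := 0) (b := 0) (c := u 4 * t 5) (x := u 4) (s _) h4
        (fun r => by simp [coframe, jet_add_alpha, t]; field_simp)]
    simp; field_simp

lemma dForm_coframe_gamma :
    let t := coframe F u V
    dForm (coframe F) u V (Pi.single 5 1)
      = (pd 3 (pd 3 F) (jet u) / (6 * u 4)) • ![0, -t 0, -t 1, 0, (2 - 12 * invC F u) * t 0 + t 3,
        invA F u * t 2 + invB F u * t 3 - t 4] := by
  intro t
  have s := fun a => (smooth_coframe hF h4 hqq V a).diff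
  have e := coframe_gamma (F := F)
  have d5 : fderiv ℝ (fun w : Fin 6 → ℝ => pd 3 (pd 3 F) (jet w) / (6 * w 4)) u V
      = (V 0 * pd 0 (pd 3 (pd 3 F)) (jet u) + V 1 * pd 1 (pd 3 (pd 3 F)) (jet u)
        + V 2 * pd 2 (pd 3 (pd 3 F)) (jet u) + V 3 * pd 3 (pd 3 (pd 3 F)) (jet u)) / (6 * u 4)
        - pd 3 (pd 3 F) (jet u) * V 4 / (6 * u 4 ^ 2) := by
    have sj := ((hF.pd 3).pd 3)
    have hd : DifferentiableAt ℝ (fun w => pd 3 (pd 3 F) (jet w)) u :=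
      Smooth.diff (ContDiffAt.comp u sj (smooth_jet u))
    rw [D_div hd (by fun_prop) (mul_ne_zero (by norm_num) h4), fderiv_comp_jet sj.diff,
      D_mul (differentiableAt_const _) (by fun_prop), D_const, D_coord]
    field_simp
    ring
  have hw : ∀ r : ℝ, (u + r • (Pi.single 5 1 : Fin 6 → ℝ)) 0 = u 0 := fun r => by simp
  funext a
  simp only [dForm, e]
  fin_cases a
  · rw [fderiv_of_cubic (a := t 0) (b := 0) (c := 0) (d := 0) (s _)
        (fun r => by simp [coframe, t])]
    simp
  · rw [fderiv_of_cubic (a := t 1) (b := pd 3 (pd 3 F) (jet u) / 6 * (V 1 - u 2 * V 0)) (c := 0)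
        (d := 0) (s _) (fun r => by simp [coframe, jet_add_gamma, t]; ring)]
    simp [t, coframe]; field_simp
  · rw [fderiv_of_cubic (a := t 2) (b := pd 3 (pd 3 F) (jet u) ^ 2 / (36 * u 4) *
      (V 2 - u 3 * V 0 + u 5 * (V 1 - u 2 * V 0)))
      (c := pd 3 (pd 3 F) (jet u) ^ 2 / (72 * u 4) * (V 1 - u 2 * V 0))
        (d := 0) (s _) (fun r => by simp [coframe, jet_add_gamma, t]; ring)]
    simp [t, coframe]; field_simp; ring
  · rw [fderiv_of_cubic (a := t 3) (b := 0) (c := 0) (d := 0) (s _)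
        (fun r => by simp [coframe, jet_add_gamma, t])]
    simp
  · rw [fderiv_of_cubic (a := t 4) (b := 1 / pd 3 (pd 3 F) (jet u) *
        (-2 * pd 3 (pd 3 (pd 3 F)) (jet u) * u 5 + ((2 / 3) * pd 3 (pd 3 (pd 3 F)) (jet u)
          * pd 3 F (jet u) + (1 / 3) * pd 3 (pd 3 F) (jet u) ^ 2
          + 2 * pd 2 (pd 3 (pd 3 F)) (jet u))) * (V 1 - u 2 * V 0) - V 0)
        (c := - 1 / pd 3 (pd 3 F) (jet u) * pd 3 (pd 3 (pd 3 F)) (jet u) * (V 1 - u 2 * V 0))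
        (d := 0) (s _)
        (fun r => by simp [coframe, jet_add_gamma, t]; ring)]
    simp [t, coframe, invC]; field_simp; ring
  · rw [fderiv_of_cubic (a := t 5)
        (b := -(1 / (6 * u 4)) * pd 3 (pd 3 F) (jet u) * (u 5 + (1 / 3) * pd 3 F (jet u)) * V 0
          + (1 / (6 * u 4)) * (-u 5 * pd 3 (pd 3 (pd 3 F)) (jet u)
            + (1 / 3) * pd 3 (pd 3 (pd 3 F)) (jet u) * pd 3 F (jet u)
            + pd 2 (pd 3 (pd 3 F)) (jet u)) * (V 2 - u 3 * V 0)
          + (1 / (6 * u 4)) * (-(3 / 2) * pd 3 (pd 3 (pd 3 F)) (jet u) * u 5 ^ 2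
            + 2 * u 5 * ((1 / 6) * pd 3 (pd 3 F) (jet u) ^ 2 + (1 / 3) * pd 3 (pd 3 (pd 3 F)) (jet u)
              * pd 3 F (jet u) + pd 2 (pd 3 (pd 3 F)) (jet u))
            + (pd 3 (pd 3 F) (jet u) * pd 3 (Kfun F) (jet u) - pd 1 (pd 3 (pd 3 F)) (jet u)
              + pd 3 (pd 3 (pd 3 F)) (jet u) * Kfun F (jet u))) * (V 1 - u 2 * V 0))
        (c := -(1 / (6 * u 4)) * pd 3 (pd 3 F) (jet u) * (1 / 2) * V 0
          + (1 / (6 * u 4)) * (-(1 / 2) * pd 3 (pd 3 (pd 3 F)) (jet u)) * (V 2 - u 3 * V 0)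
          + (1 / (6 * u 4)) * (-(3 / 2) * pd 3 (pd 3 (pd 3 F)) (jet u) * u 5
            + ((1 / 6) * pd 3 (pd 3 F) (jet u) ^ 2 + (1 / 3) * pd 3 (pd 3 (pd 3 F)) (jet u)
              * pd 3 F (jet u) + pd 2 (pd 3 (pd 3 F)) (jet u))) * (V 1 - u 2 * V 0))
        (d := (1 / (6 * u 4)) * (-(1 / 2) * pd 3 (pd 3 (pd 3 F)) (jet u)) * (V 1 - u 2 * V 0)) (s _)
        (fun r => by simp [coframe, jet_add_gamma, t]; ring)]
    simp [t, coframe, invA, invB, totalD, d5, show jet u 2 = u 2 from rfl,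
      show jet u 3 = u 3 from rfl]
    field_simp
    ring

/-- The first four structure equations in the direction of `q`. -/
lemma dForm_coframe_q :
    let t := coframe F u V
    let d := dForm (coframe F) u V (Pi.single 3 1)
    let r := pd 3 (pd 3 F) (jet u) ^ 2 / (36 * u 4)
    d 0 = 0 ∧ d 1 = r * (-invA F u * t 1 + t 3) ∧
      d 2 = r * ((-2 + 12 * invC F u) * t 1 + 2 * invB F u * t 3 - t 4) ∧
      d 3 = r * (invA F u * t 3) := by
  intro t d r
  have s := fun a => (smooth_coframe hF h4 hqq V a).diff
  have e := coframe_q (F := F)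
  have sj := (hF.pd 3).pd 3
  have hd : DifferentiableAt ℝ (fun w => pd 3 (pd 3 F) (jet w)) u :=
    Smooth.diff (ContDiffAt.comp u sj (smooth_jet u))
  have hd1 : DifferentiableAt ℝ (fun w => pd 3 F (jet w)) u :=
    Smooth.diff (ContDiffAt.comp u (hF.pd 3) (smooth_jet u))
  have hd2 : DifferentiableAt ℝ (fun w => Kfun F (jet w)) u :=
    Smooth.diff (ContDiffAt.comp u hF.Kfun (smooth_jet u))
  have hd3 : DifferentiableAt ℝ (fun w => F (jet w)) u :=
    Smooth.diff (ContDiffAt.comp u hF (smooth_jet u))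
  have j0 := fun X => fderiv_comp_jet sj.diff X
  have j1 := fun X => fderiv_comp_jet (hF.pd 3).diff X
  have j2 := fun X => fderiv_comp_jet hF.Kfun.diff X
  have j3 := fun X => fderiv_comp_jet hF.diff X
  have d5 : fderiv ℝ (fun w : Fin 6 → ℝ => pd 3 (pd 3 F) (jet w) ^ 2 / (36 * w 4)) u V
      = pd 3 (pd 3 F) (jet u) * (V 0 * pd 0 (pd 3 (pd 3 F)) (jet u)
        + V 1 * pd 1 (pd 3 (pd 3 F)) (jet u)
        + V 2 * pd 2 (pd 3 (pd 3 F)) (jet u) + V 3 * pd 3 (pd 3 (pd 3 F)) (jet u)) / (18 * u 4)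
        - pd 3 (pd 3 F) (jet u) ^ 2 * V 4 / (36 * u 4 ^ 2) := by
    have hp2 : DifferentiableAt ℝ (fun w => pd 3 (pd 3 F) (jet w) ^ 2) u := hd.pow 2
    rw [D_div hp2 (by fun_prop) (mul_ne_zero (by norm_num) h4), D_pow hd, j0,
      D_mul (differentiableAt_const _) (by fun_prop), D_const, D_coord]
    field_simp
    ring
  refine ⟨?_, ?_, ?_, ?_⟩ <;> simp only [d, dForm, e, Matrix.cons_val, d5, D_const]
  · rw [fderiv_of_cubic (a := t 0) (b := 0) (c := 0) (d := 0) (s _)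
        (fun r => by simp [coframe, t])]
    simp
  · have : fderiv ℝ (fun w => coframe F w V 1) u (Pi.single 3 1)
        = (1 / 6) * pd 3 (pd 3 (pd 3 F)) (jet u) * (V 2 - u 3 * V 0 + u 5 * (V 1 - u 2 * V 0))
          - (1 / 6) * pd 3 (pd 3 F) (jet u) * V 0 := by
      simp only [coframe, Matrix.cons_val]
      rw [D_mul (hd.const_mul _) (by fun_prop), D_mul (differentiableAt_const _) hd, j0]
      simp (disch := fun_prop) [D_mul, D_sub, D_add, D_coord, Pi.single_apply]
      ring
    rw [this]
    simp [t, r, coframe, invA]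
    field_simp
    ring
  · have : fderiv ℝ (fun w => coframe F w V 2) u (Pi.single 3 1)
        = (1 / (18 * u 4)) * pd 3 (pd 3 F) (jet u) * pd 3 (pd 3 (pd 3 F)) (jet u) *
          ((V 3 - F (jet u) * V 0) + (u 5 - (1 / 3) * pd 3 F (jet u)) * (V 2 - u 3 * V 0)
            + ((1 / 2) * u 5 ^ 2 + Kfun F (jet u)) * (V 1 - u 2 * V 0))
          + (1 / (36 * u 4)) * pd 3 (pd 3 F) (jet u) ^ 2 *
          (-(pd 3 F (jet u) * V 0) - (1 / 3) * pd 3 (pd 3 F) (jet u) * (V 2 - u 3 * V 0)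
            - (u 5 - (1 / 3) * pd 3 F (jet u)) * V 0
            + pd 3 (Kfun F) (jet u) * (V 1 - u 2 * V 0)) := by
      simp only [coframe, Matrix.cons_val]
      have h36 : DifferentiableAt ℝ (fun w : Fin 6 → ℝ => 1 / (36 * w 4)) u :=
        diff_div (by fun_prop) (by fun_prop) (mul_ne_zero (by norm_num) h4)
      have e36 : fderiv ℝ (fun w : Fin 6 → ℝ => 1 / (36 * w 4)) u (Pi.single 3 1) = 0 := by
        rw [D_div (differentiableAt_const _) (by fun_prop) (mul_ne_zero (by norm_num) h4),
          D_mul (differentiableAt_const _) (by fun_prop), D_const, D_coord]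
        simp
      have z1 : DifferentiableAt ℝ (fun w : Fin 6 → ℝ => V 3 - F (jet w) * V 0) u :=
        (hd3.mul_const _).const_sub _
      have z2 : DifferentiableAt ℝ (fun w : Fin 6 → ℝ => w 5 - (1 / 3) * pd 3 F (jet w)) u :=
        (show DifferentiableAt ℝ (fun w : Fin 6 → ℝ => w 5) u by fun_prop).sub (hd1.const_mul _)
      have z3 : DifferentiableAt ℝ (fun w : Fin 6 → ℝ => V 2 - w 3 * V 0) u := by fun_prop
      have z4 : DifferentiableAt ℝ (fun w : Fin 6 → ℝ => (1 / 2) * w 5 ^ 2 + Kfun F (jet w)) u :=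
        (show DifferentiableAt ℝ (fun w : Fin 6 → ℝ => (1 / 2) * w 5 ^ 2) u by fun_prop).add hd2
      have z5 : DifferentiableAt ℝ (fun w : Fin 6 → ℝ => V 1 - w 2 * V 0) u := by fun_prop
      have hp2 : DifferentiableAt ℝ (fun w => pd 3 (pd 3 F) (jet w) ^ 2) u := hd.pow 2
      have m1 : DifferentiableAt ℝ (fun w => 1 / (36 * w 4) * pd 3 (pd 3 F) (jet w) ^ 2) u :=
        h36.mul hp2
      have m2 : DifferentiableAt ℝ (fun w => (w 5 - (1 / 3) * pd 3 F (jet w))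
          * (V 2 - w 3 * V 0)) u := z2.mul z3
      have m3 : DifferentiableAt ℝ (fun w => ((1 / 2) * w 5 ^ 2 + Kfun F (jet w))
          * (V 1 - w 2 * V 0)) u := z4.mul z5
      have m4 : DifferentiableAt ℝ (fun w => V 3 - F (jet w) * V 0 +
          (w 5 - (1 / 3) * pd 3 F (jet w)) * (V 2 - w 3 * V 0)) u := z1.add m2
      have m5 : DifferentiableAt ℝ (fun w => V 3 - F (jet w) * V 0 +
          (w 5 - (1 / 3) * pd 3 F (jet w)) * (V 2 - w 3 * V 0)
          + ((1 / 2) * w 5 ^ 2 + Kfun F (jet w)) * (V 1 - w 2 * V 0)) u := m4.add m3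
      have c : ∀ i : Fin 6, DifferentiableAt ℝ (fun w : Fin 6 → ℝ => w i) u := fun i => by fun_prop
      have c5 : DifferentiableAt ℝ (fun w : Fin 6 → ℝ => w 5 ^ 2) u := (c 5).pow 2
      rw [D_mul m1 m5, D_mul h36 hp2, e36, D_pow hd, D_add m4 m3, D_add z1 m2, D_mul z2 z3,
        D_mul z4 z5, D_sub (differentiableAt_const _) (hd3.mul_const _),
        D_mul hd3 (differentiableAt_const _), D_sub (c 5) (hd1.const_mul _),
        D_mul (differentiableAt_const _) hd1, D_add (c5.const_mul _) hd2,
        D_mul (differentiableAt_const _) c5, D_pow (c 5),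
        D_sub (differentiableAt_const _) ((c 2).mul_const _),
        D_sub (differentiableAt_const _) ((c 3).mul_const _),
        D_mul (c 2) (differentiableAt_const _), D_mul (c 3) (differentiableAt_const _),
        j0, j1, j2, j3]
      simp only [D_const, D_coord]
      simp
      field_simp
      ring
    rw [this]
    simp [t, r, coframe, invB, invC, totalD, show jet u 2 = u 2 from rfl,
      show jet u 3 = u 3 from rfl]
    field_simp
    ring
  · have : fderiv ℝ (fun w => coframe F w V 3) u (Pi.single 3 1)
        = -(6 * u 4 * pd 3 (pd 3 (pd 3 F)) (jet u) / pd 3 (pd 3 F) (jet u) ^ 2) * V 0 := by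
      simp only [coframe, Matrix.cons_val]
      rw [D_mul (diff_div (by fun_prop) hd hqq) (by fun_prop), D_const,
        D_div (by fun_prop) hd hqq, j0, D_mul (differentiableAt_const _) (by fun_prop), D_coord]
      simp
      ring
    rw [this]
    simp [t, r, coframe, invA]
    field_simp

end

/-! ### The third derivatives of `F` for an equation with a metric -/

/-- The coordinate `α` can be varied while the other coordinates stay fixed. -/
lemma exists_scale {S : Set (Fin 6 → ℝ)} (hS : IsOpen S) {w : Fin 6 → ℝ} (hw : w ∈ S) :
    ∃ ε : ℝ, ε ≠ 0 ∧ w + ε • (Pi.single 4 1 : Fin 6 → ℝ) ∈ S ∧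
      w + (-ε) • (Pi.single 4 1 : Fin 6 → ℝ) ∈ S := by
  have hc : Continuous (fun ε : ℝ => w + ε • (Pi.single 4 1 : Fin 6 → ℝ)) := by fun_prop
  have hc' : Continuous (fun ε : ℝ => w + (-ε) • (Pi.single 4 1 : Fin 6 → ℝ)) := by fun_prop
  have hev : ∀ᶠ ε in 𝓝 (0 : ℝ), w + ε • (Pi.single 4 1 : Fin 6 → ℝ) ∈ S ∧
      w + (-ε) • (Pi.single 4 1 : Fin 6 → ℝ) ∈ S :=
    (hc.continuousAt.eventually (by simpa using hS.mem_nhds hw)).and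
      (hc'.continuousAt.eventually (by simpa using hS.mem_nhds hw))
  obtain ⟨ε, hε, h0⟩ := ((hev.filter_mono nhdsWithin_le_nhds).and
    (self_mem_nhdsWithin : {(0 : ℝ)}ᶜ ∈ 𝓝[≠] (0 : ℝ))).exists
  exact ⟨ε, h0, hε.1, hε.2⟩

lemma eq_zero_of_quadratic {c₀ c₁ c₂ x e : ℝ} (he : e ≠ 0) (hx : x ≠ 0) (h1 : x + e ≠ 0)
    (h2 : x + -e ≠ 0) (h : ∀ y ∈ ({x, x + e, x + -e} : Set ℝ), c₀ + c₁ * y + c₂ / y = 0) :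
    c₀ = 0 := by
  have e0 := h x (by simp)
  have e1 := h (x + e) (by simp)
  have e2 := h (x + -e) (by simp)
  field_simp at e0 e1 e2
  -- the quadratic polynomial `c₂ + c₀ y + c₁ y²` has three zeros
  have k1 : c₁ * (2 * e ^ 2) = 0 := by linear_combination e1 + e2 - 2 * e0
  have k1' : c₁ = 0 := by simpa [he] using k1
  rw [k1'] at e1 e2
  have k2 : c₀ * (2 * e) = 0 := by linear_combination e1 - e2
  simpa [he] using k2

section

variable {F : (Fin 4 → ℝ) → ℝ} {A B : Fin 3 → ℝ} {S : Set (Fin 6 → ℝ)}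
  {π : (Fin 6 → ℝ) → (Fin 4 → ℝ)} {G : (Fin 4 → ℝ) → Matrix (Fin 4) (Fin 4) ℝ}
  (hP : PullsBack (slMatrix A B) (slframe F) S π G) (hA : killing A A = 1) (hB : killing B B = 1)
  (hS : ∀ w ∈ S, Smooth F (jet w) ∧ w 4 ≠ 0 ∧ pd 3 (pd 3 F) (jet w) ≠ 0)
include hP hS

lemma cond_slframe {w : Fin 6 → ℝ} (hw : w ∈ S) {V : Fin 6 → ℝ}
    (hV : ∀ t, slForm A B (slBasis (coframe F w V)) t = 0) (X Y : Fin 6 → ℝ) :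
    slForm A B (slBasis (dForm (coframe F) w V X)) (slBasis (coframe F w Y))
      + slForm A B (slBasis (coframe F w X)) (slBasis (dForm (coframe F) w V Y)) = 0 := by
  obtain ⟨hF, h4, hqq⟩ := hS w hw
  rw [← dForm_slframe_eq hF h4 hqq, ← dForm_slframe_eq hF h4 hqq, ← bil_slMatrix, ← bil_slMatrix]
  refine hP.cond (slMatrix_isSymm A B) (fun w hw X a => smooth_slframe (hS w hw).1
    (hS w hw).2.1 (hS w hw).2.2 X a) hw (fun Z => ?_) X Y
  rw [bil_slMatrix]
  exact hV Z

include hA in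
lemma cond_of_fst {w : Fin 6 → ℝ} (hw : w ∈ S) : ∃ V,
    coframe F w V = ![-(A 0) / 2, A 2 / 2, A 1 / 2, A 0, 0, 0] ∧ ∀ X Y,
    slForm A B (slBasis (dForm (coframe F) w V X)) (slBasis (coframe F w Y))
      + slForm A B (slBasis (coframe F w X)) (slBasis (dForm (coframe F) w V Y)) = 0 := by
  obtain ⟨V, hV⟩ := coframe_surjective (hS w hw).2.1 (hS w hw).2.2
    ![-(A 0) / 2, A 2 / 2, A 1 / 2, A 0, 0, 0]
  refine ⟨V, hV, cond_slframe hP hS hw (slForm_ker_fst hA B ?_ ?_)⟩ <;> rw [hV] <;> funext i <;>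
    fin_cases i <;> simp [fstPart, sndPart, slBasis] <;> ring

include hB in
lemma cond_of_snd {w : Fin 6 → ℝ} (hw : w ∈ S) : ∃ V,
    coframe F w V = ![B 0 / 2, -(B 2) / 2, -(B 1) / 2, 0, B 2, B 1] ∧ ∀ X Y,
    slForm A B (slBasis (dForm (coframe F) w V X)) (slBasis (coframe F w Y))
      + slForm A B (slBasis (coframe F w X)) (slBasis (dForm (coframe F) w V Y)) = 0 := by
  obtain ⟨V, hV⟩ := coframe_surjective (hS w hw).2.1 (hS w hw).2.2
    ![B 0 / 2, -(B 2) / 2, -(B 1) / 2, 0, B 2, B 1]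
  refine ⟨V, hV, cond_slframe hP hS hw (slForm_ker_snd A hB ?_ ?_)⟩ <;> rw [hV] <;> funext i <;>
    fin_cases i <;> simp [fstPart, sndPart, slBasis] <;> ring

include hA in
/-- The conditions along `A` in the directions `α` and `γ`. -/
lemma invC_fst {w : Fin 6 → ℝ} (hw : w ∈ S) :
    6 * invC F w * A 0 * (A 2 * A 0 + B 2 * B 0)
        + (invA F w * A 1 / 2 + invB F w * A 0) * (A 0 ^ 2 + B 0 ^ 2) = 0 ∧
    6 * invC F w * A 0 * (2 - A 2 ^ 2 - B 2 ^ 2)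
        - (invA F w * A 1 / 2 + invB F w * A 0) * (A 2 * A 0 + B 2 * B 0) = 0 := by
  obtain ⟨V, hV, c⟩ := cond_of_fst hP hA hS hw
  obtain ⟨hF, h4, hqq⟩ := hS w hw
  have c1 := c (Pi.single 5 1) (Pi.single 5 1)
  have c2 := c (Pi.single 4 1) (Pi.single 5 1)
  rw [dForm_coframe_gamma hF h4 hqq, hV, coframe_gamma] at c1
  rw [dForm_coframe_gamma hF h4 hqq, dForm_coframe_alpha hF h4 hqq, hV, coframe_gamma,
    coframe_alpha] at c2
  generalize invA F w = a at *
  generalize invB F w = b at *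
  generalize invC F w = c at *
  simp only [killing] at hA
  simp [slForm, slBasis, fstPart, sndPart, killing] at c1 c2
  field_simp at c1 c2
  constructor
  · refine mul_left_cancel₀ (mul_ne_zero four_ne_zero (pow_ne_zero 2 hqq)) ?_
    linear_combination -c1
  · refine mul_left_cancel₀ (mul_ne_zero two_ne_zero hqq) ?_
    linear_combination c2

include hB in
/-- The conditions along `B` in the directions `α` and `γ`. -/
lemma invC_snd {w : Fin 6 → ℝ} (hw : w ∈ S) :
    6 * invC F w * B 0 * (A 2 * A 0 + B 2 * B 0)
        + (invA F w * B 1 / 2) * (A 0 ^ 2 + B 0 ^ 2) = 0 ∧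
    6 * invC F w * B 0 * (2 - A 2 ^ 2 - B 2 ^ 2)
        - (invA F w * B 1 / 2) * (A 2 * A 0 + B 2 * B 0) = 0 := by
  obtain ⟨V, hV, c⟩ := cond_of_snd hP hB hS hw
  obtain ⟨hF, h4, hqq⟩ := hS w hw
  have c1 := c (Pi.single 5 1) (Pi.single 5 1)
  have c2 := c (Pi.single 4 1) (Pi.single 5 1)
  rw [dForm_coframe_gamma hF h4 hqq, hV, coframe_gamma] at c1
  rw [dForm_coframe_gamma hF h4 hqq, dForm_coframe_alpha hF h4 hqq, hV, coframe_gamma,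
    coframe_alpha] at c2
  generalize invA F w = a at *
  generalize invB F w = b at *
  generalize invC F w = c at *
  simp only [killing] at hB
  simp [slForm, slBasis, fstPart, sndPart, killing] at c1 c2
  field_simp at c1 c2
  constructor
  · refine mul_left_cancel₀ (mul_ne_zero four_ne_zero (pow_ne_zero 2 hqq)) ?_
    linear_combination c1
  · refine mul_left_cancel₀ (mul_ne_zero two_ne_zero hqq) ?_
    linear_combination -c2

include hB in
/-- The condition along `B` in the directions `α` and `q`, when the form is degenerate in the
direction `α`. -/
lemma invC_q {w : Fin 6 → ℝ} (hw : w ∈ S) (h11 : A 2 ^ 2 + B 2 ^ 2 = 2)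
    (h12 : A 2 * A 0 + B 2 * B 0 = 0) :
    (1 - A 2 ^ 2) * invA F w * B 2 + 12 * A 2 * A 0 * invC F w * B 2 = 0 := by
  obtain ⟨V, hV, c⟩ := cond_of_snd hP hB hS hw
  obtain ⟨hF, h4, hqq⟩ := hS w hw
  have c1 := c (Pi.single 4 1) (Pi.single 3 1)
  obtain ⟨d0, d1, d2, d3⟩ := dForm_coframe_q hF h4 hqq V
  rw [dForm_coframe_alpha hF h4 hqq, hV, coframe_alpha, coframe_q] at c1
  simp only [hV, Matrix.cons_val] at d1 d2 d3
  generalize invA F w = a at *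
  generalize invB F w = b at *
  generalize invC F w = c at *
  simp only [killing] at hB
  simp [slForm, slBasis, fstPart, sndPart, killing, d0, d1, d2, d3] at c1
  generalize dForm (coframe F) w V (Pi.single 3 1) 4 = z1 at *
  generalize dForm (coframe F) w V (Pi.single 3 1) 5 = z2 at *
  field_simp at c1
  refine mul_left_cancel₀ (pow_ne_zero 2 hqq) ?_
  linear_combination c1 + 36 * w 4 * z1 * h11 + 36 * w 4 * z2 * h12

include hA in
/-- The conditions along `A` when the form is degenerate in the direction `γ`. -/
lemma invC_degenerate {w : Fin 6 → ℝ} (hw : w ∈ S) (hA0 : A 0 = 0) (hB0 : B 0 = 0) :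
    invC F w = 0 := by
  obtain ⟨V, hV, c⟩ := cond_of_fst hP hA hS hw
  obtain ⟨hF, h4, hqq⟩ := hS w hw
  have hA2 : A 2 ≠ 0 := by rintro h'; simp [killing, hA0, h'] at hA
  have e0 := congrFun hV 0
  have e1 := congrFun hV 1
  have e2 := congrFun hV 2
  have e3 := congrFun hV 3
  have e4 := congrFun hV 4
  simp only [coframe, Matrix.cons_val, hA0, mul_eq_zero, div_eq_zero_iff, hqq, h4, neg_zero,
    zero_div] at e0 e3
  have v0 : V 0 = 0 := by simpa using e3
  have v1 : V 1 = 0 := by simpa [v0] using e0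
  simp only [coframe, Matrix.cons_val, v0, v1, mul_zero, sub_zero, add_zero, zero_add] at e1 e2 e4
  have v4 : V 4 = 0 := by simpa [h4] using e4
  have v2 : V 2 = 3 * A 2 / pd 3 (pd 3 F) (jet w) := by field_simp; linarith
  have v3 : V 3 = 18 * w 4 * A 1 / pd 3 (pd 3 F) (jet w) ^ 2
      - (w 5 - (1 / 3) * pd 3 F (jet w)) * V 2 := by
    field_simp at e2 ⊢
    linear_combination (1 / 2) * e2
  have sj := (hF.pd 3).pd 3
  have hd : DifferentiableAt ℝ (fun w => pd 3 (pd 3 F) (jet w)) w :=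
    Smooth.diff (ContDiffAt.comp w sj (smooth_jet w))
  -- the first and the fourth structure equation
  have dt0 : ∀ Y, dForm (coframe F) w V Y 0 = -(w 4 * V 2 * Y 0) := fun Y => by
    have z : (fun w => coframe F w V 0) = fun _ => 0 := by
      funext w; simp [coframe, v0, v1]
    simp only [dForm, z, D_const]
    simp only [coframe, Matrix.cons_val]
    have c : ∀ i : Fin 6, DifferentiableAt ℝ (fun w : Fin 6 → ℝ => w i) w := fun i => by fun_prop
    rw [D_mul (c 4) (by fun_prop), D_sub (by fun_prop) (by fun_prop), D_const,
      D_mul (c 2) (by fun_prop), D_coord, D_coord, D_const, v4]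
    ring
  have dt3 : ∀ Y, dForm (coframe F) w V Y 3 = -(6 * w 4 / pd 3 (pd 3 F) (jet w) ^ 2
      * (V 2 * pd 2 (pd 3 (pd 3 F)) (jet w) + V 3 * pd 3 (pd 3 (pd 3 F)) (jet w)) * Y 0) :=
    fun Y => by
      have z : (fun w => coframe F w V 3) = fun _ => 0 := by
        funext w; simp [coframe, v0]
      simp only [dForm, z, D_const]
      simp only [coframe, Matrix.cons_val]
      rw [D_mul (diff_div (by fun_prop) hd hqq) (by fun_prop), D_const,
        D_div (by fun_prop) hd hqq, fderiv_comp_jet sj.diff,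
        D_mul (differentiableAt_const _) (by fun_prop), D_coord, D_const, v0, v1, v4]
      field_simp
      ring
  have c1 := c (Pi.single 5 1) (Pi.single 1 1)
  have c2 := c (Pi.single 5 1) (Pi.single 0 1)
  rw [dForm_coframe_gamma hF h4 hqq, hV, coframe_gamma] at c1 c2
  simp [slForm, slBasis, fstPart, sndPart, killing, dt0, dt3, hA0, hB0] at c1 c2
  have f10 : coframe F w (Pi.single 1 1) 0 = w 4 := by simp [coframe]
  have f13 : coframe F w (Pi.single 1 1) 3 = 0 := by simp [coframe]
  have f00 : coframe F w (Pi.single 0 1) 0 = -(w 4 * w 2) := by simp [coframe]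
  have f03 : coframe F w (Pi.single 0 1) 3 = 6 * w 4 / pd 3 (pd 3 F) (jet w) := by simp [coframe]
  rw [f10, f13] at c1
  rw [f00, f03, v3, v2] at c2
  have k1 : pd 3 (pd 3 (pd 3 F)) (jet w) * A 1 = 0 := by
    simp only [invA] at c1
    field_simp at c1
    refine (mul_eq_zero.1 (?_ : 72 * w 4 ^ 2 * (pd 3 (pd 3 (pd 3 F)) (jet w) * A 1)
      = 0)).resolve_left (by positivity)
    linear_combination c1
  simp only [invA] at c2
  field_simp at c2
  unfold invC
  field_simp
  refine mul_left_cancel₀ (mul_ne_zero (mul_ne_zero (by norm_num : (24 : ℝ) ≠ 0) hqq) hA2) ?_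
  linear_combination -c2 - 72 * pd 3 (pd 3 F) (jet w) * w 4 * w 2 * k1

include hA hB in
/-- Along a line in the direction `α`, the conditions on `invA`, `invB` and `invC` are polynomial in
`α`, so that each of their coefficients vanishes; if `invC` were not zero, this would contradict
`killing A A = killing B B = 1`. -/
lemma invC_eq_zero {w : Fin 6 → ℝ} (hw : w ∈ S) : invC F w = 0 := by
  by_contra hc
  obtain ⟨ε, hε, h1, h2⟩ := exists_scale hP.isOpen hw
  have h4 := (hS w hw).2.1
  have h41 : w 4 + ε ≠ 0 := by simpa using (hS _ h1).2.1
  have h42 : w 4 + -ε ≠ 0 := by simpa using (hS _ h2).2.1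
  -- the dependence on `α`
  have key : ∀ r : ℝ, invC F (w + r • Pi.single 4 1) = invC F w ∧
      invA F (w + r • Pi.single 4 1) = 36 * pd 3 (pd 3 (pd 3 F)) (jet w)
        / pd 3 (pd 3 F) (jet w) ^ 3 * (w 4 + r) ∧
      invB F (w + r • Pi.single 4 1) = ((totalD F (pd 3 (pd 3 F)) (jet w) + pd 3 F (jet w)
        * pd 3 (pd 3 F) (jet w) / 3) / 6) / (w 4 + r) := fun r => by
    simp only [invA, invB, invC, jet_add_alpha]
    simp only [Pi.add_apply, Pi.smul_apply, Pi.single_eq_same, smul_eq_mul, mul_one]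
    refine ⟨?_, by ring, by rw [div_div]⟩
    simp
  generalize 36 * pd 3 (pd 3 (pd 3 F)) (jet w) / pd 3 (pd 3 F) (jet w) ^ 3 = a at key
  generalize ((totalD F (pd 3 (pd 3 F)) (jet w) + pd 3 F (jet w)
        * pd 3 (pd 3 F) (jet w) / 3) / 6) = b at key
  have mem : ∀ y ∈ ({w 4, w 4 + ε, w 4 + -ε} : Set ℝ), ∃ w' ∈ S, invC F w' = invC F w ∧
      invA F w' = a * y ∧ invB F w' = b / y := by
    rintro y (rfl | rfl | rfl)
    · have := key 0
      rw [zero_smul, add_zero, add_zero] at this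
      exact ⟨w, hw, this⟩
    · exact ⟨_, h1, key ε⟩
    · exact ⟨_, h2, key (-ε)⟩
  have quad := fun c₀ c₁ c₂ => eq_zero_of_quadratic (c₀ := c₀) (c₁ := c₁) (c₂ := c₂) hε h4 h41 h42
  have q1 : A 0 * (A 2 * A 0 + B 2 * B 0) = 0 := by
    have := quad (6 * invC F w * A 0 * (A 2 * A 0 + B 2 * B 0)) (a * A 1 / 2 * (A 0 ^ 2 + B 0 ^ 2))
      (b * A 0 * (A 0 ^ 2 + B 0 ^ 2)) fun y hy => by
        obtain ⟨w', hw', e1, e2, e3⟩ := mem y hy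
        have := (invC_fst hP hA hS hw').1
        rw [e1, e2, e3] at this
        linear_combination this
    simpa [hc, mul_assoc] using this
  have q2 : A 0 * (2 - A 2 ^ 2 - B 2 ^ 2) = 0 := by
    have := quad (6 * invC F w * A 0 * (2 - A 2 ^ 2 - B 2 ^ 2))
      (-(a * A 1 / 2 * (A 2 * A 0 + B 2 * B 0)))
      (-(b * A 0 * (A 2 * A 0 + B 2 * B 0))) fun y hy => by
        obtain ⟨w', hw', e1, e2, e3⟩ := mem y hy
        have := (invC_fst hP hA hS hw').2
        rw [e1, e2, e3] at this
        linear_combination this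
    simpa [hc, mul_assoc] using this
  have q3 : B 0 * (A 2 * A 0 + B 2 * B 0) = 0 := by
    have := quad (6 * invC F w * B 0 * (A 2 * A 0 + B 2 * B 0)) (a * B 1 / 2 * (A 0 ^ 2 + B 0 ^ 2))
      0 fun y hy => by
        obtain ⟨w', hw', e1, e2, e3⟩ := mem y hy
        have := (invC_snd hP hB hS hw').1
        rw [e1, e2] at this
        linear_combination this
    simpa [hc, mul_assoc] using this
  have q4 : B 0 * (2 - A 2 ^ 2 - B 2 ^ 2) = 0 := by
    have := quad (6 * invC F w * B 0 * (2 - A 2 ^ 2 - B 2 ^ 2))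
      (-(a * B 1 / 2 * (A 2 * A 0 + B 2 * B 0))) 0 fun y hy => by
        obtain ⟨w', hw', e1, e2, e3⟩ := mem y hy
        have := (invC_snd hP hB hS hw').2
        rw [e1, e2] at this
        linear_combination this
    simpa [hc, mul_assoc] using this
  by_cases hAB : A 0 = 0 ∧ B 0 = 0
  · exact hc (invC_degenerate hP hA hS hw hAB.1 hAB.2)
  have h11 : A 2 ^ 2 + B 2 ^ 2 = 2 := by
    by_contra h'
    have h'' : 2 - A 2 ^ 2 - B 2 ^ 2 ≠ 0 := fun h0 => h' (by linarith)
    exact hAB ⟨(mul_eq_zero.1 q2).resolve_right h'', (mul_eq_zero.1 q4).resolve_right h''⟩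
  have h12 : A 2 * A 0 + B 2 * B 0 = 0 := by
    by_contra h'
    exact hAB ⟨(mul_eq_zero.1 q1).resolve_right h', (mul_eq_zero.1 q3).resolve_right h'⟩
  have q5 : A 2 * A 0 * B 2 = 0 := by
    have := quad (12 * A 2 * A 0 * invC F w * B 2) ((1 - A 2 ^ 2) * a * B 2) 0 fun y hy => by
        obtain ⟨w', hw', e1, e2, e3⟩ := mem y hy
        have := invC_q hP hB hS hw' h11 h12
        rw [e1, e2] at this
        linear_combination this
    have h' : invC F w * (A 2 * A 0 * B 2) = 0 := by linarith
    exact (mul_eq_zero.1 h').resolve_left hc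
  simp only [killing] at hA hB
  rcases mul_eq_zero.1 q5 with h' | h'
  · have b0 : B 2 * B 0 = 0 := by linarith
    rcases mul_eq_zero.1 b0 with h2 | h2
    · rw [h2] at h11
      have : A 0 = 0 := by
        rcases mul_eq_zero.1 h' with h3 | h3
        · rw [h3] at h11; norm_num at h11
        · exact h3
      rw [this] at hA
      nlinarith
    · rw [h2] at hB
      have : A 0 = 0 := by
        rcases mul_eq_zero.1 h' with h3 | h3
        · rw [h3] at h11; nlinarith
        · exact h3
      exact hAB ⟨this, h2⟩
  · rw [h'] at h11 h12
    have : A 0 = 0 := by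
      rcases mul_eq_zero.1 (show A 2 * A 0 = 0 by linarith) with h3 | h3
      · rw [h3] at h11; norm_num at h11
      · exact h3
    rw [this] at hA
    nlinarith

include hA hB in
/-- The third derivatives of `F` for an equation with a metric; `invC = 0` is linear in `γ`. -/
theorem Fqqq_Fqqp {w : Fin 6 → ℝ} (hw : w ∈ S) : pd 3 (pd 3 (pd 3 F)) (jet w) = 0 ∧
    pd 2 (pd 3 (pd 3 F)) (jet w) = -(pd 3 (pd 3 F) (jet w) ^ 2 / 3) := by
  obtain ⟨w', hw', hj', h4', h5'⟩ := exists_shift hP.isOpen hw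
  have hqq := (hS w hw).2.2
  have e1 := invC_eq_zero hP hA hB hS hw
  have e2 := invC_eq_zero hP hA hB hS hw'
  simp only [invC, hj'] at e1 e2
  have e3 : pd 3 (pd 3 (pd 3 F)) (jet w) = 0 := by
    refine (mul_eq_zero.1 (?_ : (w' 5 - w 5) * pd 3 (pd 3 (pd 3 F)) (jet w) = 0)).resolve_left
      (sub_ne_zero.2 h5')
    field_simp at e1 e2
    linear_combination (1 / 3) * (e1 - e2)
  refine ⟨e3, ?_⟩
  rw [e3] at e1
  field_simp at e1 ⊢
  linarith

end

/-! ### First integrals of first-order equations -/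

section Nemytskii

variable {T : Type*} [TopologicalSpace T] [CompactSpace T] {E F : Type} [NormedAddCommGroup E]
  [NormedSpace ℝ E] [NormedAddCommGroup F] [NormedSpace ℝ F]

/-- The pointwise application of a continuous family of linear maps. -/
def pointwiseApply (T E F : Type*) [TopologicalSpace T] [CompactSpace T] [NormedAddCommGroup E]
    [NormedSpace ℝ E] [NormedAddCommGroup F] [NormedSpace ℝ F] :
    C(T, E →L[ℝ] F) →L[ℝ] C(T, E) →L[ℝ] C(T, F) :=
  LinearMap.mkContinuous₂
    (LinearMap.mk₂ ℝ (fun (A : C(T, E →L[ℝ] F)) (h : C(T, E)) =>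
        (⟨fun t => A t (h t), A.continuous.clm_apply h.continuous⟩ : C(T, F)))
      (fun A A' h => by ext; simp) (fun c A h => by ext; simp)
      (fun A h h' => by ext; simp) (fun c A h => by ext; simp)) 1
    (fun A h => by
      rw [one_mul, ContinuousMap.norm_le _ (by positivity)]
      exact fun t => (A t).le_of_opNorm_le_of_le (A.norm_coe_le_norm t) (h.norm_coe_le_norm t))

/-- Composition with a function `g` of class `C¹` is a differentiable operator on the space of
continuous functions. -/
lemma hasFDerivAt_postcomp {g : C(E, F)} {g' : C(E, E →L[ℝ] F)}
    (h : ∀ x, HasFDerivAt g (g' x) x) (f : C(T, E)) :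
    HasFDerivAt (fun f : C(T, E) => g.comp f) (pointwiseApply T E F (g'.comp f)) f := by
  rw [hasFDerivAt_iff_isLittleO_nhds_zero, Asymptotics.isLittleO_iff]
  intro c hc
  have hcont : Continuous (fun f : C(T, E) => g'.comp f) := ContinuousMap.continuous_postcomp g'
  obtain ⟨δ, hδ, hball⟩ := (Metric.continuous_iff (α := C(T, E)) (β := C(T, E →L[ℝ] F))).1 hcont f c hc
  filter_upwards [Metric.ball_mem_nhds (0 : C(T, E)) hδ] with k hk
  rw [ContinuousMap.norm_le _ (by positivity)]
  intro t
  have hseg : ∀ x ∈ segment ℝ (f t) (f t + k t), ‖fderiv ℝ g x - g' (f t)‖ ≤ c := by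
    intro x hx
    rw [segment_eq_image'] at hx
    obtain ⟨θ, hθ, rfl⟩ := hx
    have h1 : dist (f + θ • k) f < δ := by
      rw [dist_eq_norm, add_sub_cancel_left, norm_smul, Real.norm_of_nonneg hθ.1]
      rw [mem_ball_zero_iff] at hk
      exact (mul_le_of_le_one_left (norm_nonneg _) hθ.2).trans_lt hk
    have h2 := hball _ h1
    have h3 := (ContinuousMap.dist_apply_le_dist (f := g'.comp (f + θ • k))
      (g := g'.comp f) t).trans h2.le
    rw [dist_eq_norm] at h3
    rw [(h _).fderiv]
    simpa using h3
  have := (convex_segment (f t) (f t + k t)).norm_image_sub_le_of_norm_fderiv_le'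
    (fun x _ => (h x).differentiableAt) hseg (left_mem_segment _ _ _) (right_mem_segment _ _ _)
  rw [add_sub_cancel_left] at this
  exact this.trans (mul_le_mul_of_nonneg_left (k.norm_coe_le_norm t) hc.le)

/-- Composition with a smooth function is a smooth operator on the space of continuous
functions. -/
theorem contDiff_postcomp {g : C(E, F)} (hg : ContDiff ℝ ∞ g) :
    ContDiff ℝ ∞ (fun f : C(T, E) => g.comp f) := by
  rw [contDiff_infty]
  intro n
  induction n generalizing F with
  | zero => exact contDiff_zero.2 (ContinuousMap.continuous_postcomp g)
  | succ n ih =>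
    have hg' : ContDiff ℝ ∞ (fderiv ℝ g) := (contDiff_infty_iff_fderiv.1 hg).2
    have hd := hasFDerivAt_postcomp (T := T) (g := g) (g' := ⟨fderiv ℝ g, hg'.continuous⟩)
      fun x => (hg.differentiable (by simp) x).hasFDerivAt
    rw [Nat.cast_succ, contDiff_succ_iff_fderiv]
    refine ⟨fun f => (hd f).differentiableAt, by simp, ?_⟩
    rw [show fderiv ℝ (fun f : C(T, E) => g.comp f) = fun f => pointwiseApply T E F
      ((⟨fderiv ℝ g, hg'.continuous⟩ : C(E, E →L[ℝ] F)).comp f) from funext fun f => (hd f).fderiv]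
    exact (pointwiseApply T E F).contDiff.comp (ih (g := ⟨fderiv ℝ g, hg'.continuous⟩) hg')

end Nemytskii

section FirstIntegral

open unitInterval

/-- Integration from `0`, as an operator on the space of continuous functions on `[0, 1]`. -/
def primitive : C(I, ℝ) →L[ℝ] C(I, ℝ) :=
  LinearMap.mkContinuous
    { toFun := fun f => ⟨fun τ => ∫ ρ in (0 : ℝ)..τ, Set.IccExtend zero_le_one f ρ, by
        have h : Continuous (Set.IccExtend (zero_le_one (α := ℝ)) f) := f.continuous.Icc_extend'
        exact (intervalIntegral.continuous_primitive (fun a b => h.intervalIntegrable a b) 0).comp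
          continuous_subtype_val⟩
      map_add' := fun f g => by
        have h : ∀ f : C(I, ℝ), Continuous (Set.IccExtend (zero_le_one (α := ℝ)) f) :=
          fun f => f.continuous.Icc_extend'
        ext τ
        exact intervalIntegral.integral_add ((h f).intervalIntegrable _ _)
          ((h g).intervalIntegrable _ _)
      map_smul' := fun c f => by
        ext τ
        exact intervalIntegral.integral_const_mul _ _ } 1
    (fun f => by
      rw [one_mul, ContinuousMap.norm_le _ (norm_nonneg _)]
      intro τ
      have := intervalIntegral.norm_integral_le_of_norm_le_const (a := (0 : ℝ)) (b := τ)
        (f := Set.IccExtend (zero_le_one (α := ℝ)) f) (C := ‖f‖)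
        fun x _ => f.norm_coe_le_norm _
      refine this.trans (mul_le_of_le_one_right (norm_nonneg _) ?_)
      rw [sub_zero, abs_of_nonneg τ.2.1]
      exact τ.2.2)

lemma primitive_apply (f : C(I, ℝ)) (τ : I) :
    primitive f τ = ∫ ρ in (0 : ℝ)..τ, Set.IccExtend zero_le_one f ρ := rfl

/-- The inclusion of `[0, 1]` in the real line. -/
def inclI : C(I, ℝ) := ⟨fun τ => τ, continuous_subtype_val⟩

/-- The curve `τ ↦ (x + τ (x₀ - x), Y τ)`. -/
def graphCurve (x₀ : ℝ) (z : (ℝ × ℝ) × C(I, ℝ)) : C(I, ℝ × ℝ) :=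
  (ContinuousLinearMap.inl ℝ ℝ ℝ).compLeftContinuous ℝ I
      (z.1.1 • (1 : C(I, ℝ)) + (x₀ - z.1.1) • inclI)
    + (ContinuousLinearMap.inr ℝ ℝ ℝ).compLeftContinuous ℝ I z.2

lemma graphCurve_apply (x₀ : ℝ) (z : (ℝ × ℝ) × C(I, ℝ)) (τ : I) :
    graphCurve x₀ z τ = (z.1.1 + (x₀ - z.1.1) * τ, z.2 τ) := by
  simp [graphCurve, inclI]

/-- The integral equation of the solution of `y' = s(x, y)` through the point `z.1`, on the interval
from `z.1.1` to `x₀`, parametrized by `[0, 1]`. -/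
def solutionEquation (s : C(ℝ × ℝ, ℝ)) (x₀ : ℝ) (z : (ℝ × ℝ) × C(I, ℝ)) : C(I, ℝ) :=
  z.2 - z.1.2 • (1 : C(I, ℝ)) - (x₀ - z.1.1) • primitive (s.comp (graphCurve x₀ z))

lemma contDiff_rhs {s : C(ℝ × ℝ, ℝ)} (hs : ContDiff ℝ ∞ s) (x₀ : ℝ) :
    ContDiff ℝ ∞ fun z => primitive (s.comp (graphCurve x₀ z)) := by
  have h1 : ContDiff ℝ ∞ (graphCurve x₀) := by
    have l1 := ((ContinuousLinearMap.inl ℝ ℝ ℝ).compLeftContinuous ℝ I).contDiff (n := ∞)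
    have l2 := ((ContinuousLinearMap.inr ℝ ℝ ℝ).compLeftContinuous ℝ I).contDiff (n := ∞)
    refine ContDiff.add (l1.comp ?_) (l2.comp contDiff_snd)
    exact (contDiff_fst.fst.smul contDiff_const).add
      ((contDiff_const.sub contDiff_fst.fst).smul contDiff_const)
  exact primitive.contDiff.comp ((contDiff_postcomp hs).comp h1)

lemma contDiff_solutionEquation {s : C(ℝ × ℝ, ℝ)} (hs : ContDiff ℝ ∞ s) (x₀ : ℝ) :
    ContDiff ℝ ∞ (solutionEquation s x₀) :=
  (contDiff_snd.sub (contDiff_fst.snd.smul contDiff_const)).sub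
    ((contDiff_const.sub contDiff_fst.fst).smul (contDiff_rhs hs x₀))

lemma solutionEquation_eq_zero_iff (s : C(ℝ × ℝ, ℝ)) (x₀ : ℝ) (z : (ℝ × ℝ) × C(I, ℝ)) :
    solutionEquation s x₀ z = 0 ↔ ∀ τ : I, z.2 τ = z.1.2 + (x₀ - z.1.1) *
      ∫ ρ in (0 : ℝ)..τ, Set.IccExtend zero_le_one (s.comp (graphCurve x₀ z)) ρ := by
  rw [ContinuousMap.ext_iff]
  refine forall_congr' fun τ => ?_
  simp only [solutionEquation, ContinuousMap.sub_apply, ContinuousMap.smul_apply,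
    ContinuousMap.one_apply, primitive_apply, ContinuousMap.zero_apply, smul_eq_mul, mul_one]
  constructor <;> intro h <;> linarith

/-- Restarting a solution at one of its points gives a solution. -/
lemma solutionEquation_restart {s : C(ℝ × ℝ, ℝ)} {x₀ : ℝ} {a : ℝ × ℝ} {Y : C(I, ℝ)}
    (h : solutionEquation s x₀ (a, Y) = 0) (κ : I) {Y' : C(I, ℝ)}
    (hY' : ∀ τ : I, ∃ h' : (κ + τ * (1 - κ) : ℝ) ∈ I, Y' τ = Y ⟨κ + τ * (1 - κ), h'⟩) :
    solutionEquation s x₀ ((a.1 + (x₀ - a.1) * κ, Y κ), Y') = 0 := by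
  rw [solutionEquation_eq_zero_iff] at h ⊢
  intro τ
  set f := Set.IccExtend (zero_le_one (α := ℝ)) (s.comp (graphCurve x₀ (a, Y))) with hf
  have hfc : Continuous f := (s.comp (graphCurve x₀ (a, Y))).continuous.Icc_extend'
  obtain ⟨h1, h2⟩ := hY' τ
  have e1 : ∫ ρ in (0 : ℝ)..τ, Set.IccExtend (zero_le_one (α := ℝ))
      (s.comp (graphCurve x₀ ((a.1 + (x₀ - a.1) * κ, Y κ), Y'))) ρ
      = ∫ ρ in (0 : ℝ)..τ, f (κ + (1 - κ) * ρ) := by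
    refine intervalIntegral.integral_congr fun ρ hρ => ?_
    rw [Set.uIcc_of_le τ.2.1] at hρ
    have hρI : ρ ∈ I := ⟨hρ.1, hρ.2.trans τ.2.2⟩
    obtain ⟨h3, h4⟩ := hY' ⟨ρ, hρI⟩
    have h5 : (κ + (1 - κ) * ρ : ℝ) ∈ I := by
      rw [mul_comm]; exact h3
    simp only [hf]
    rw [Set.IccExtend_of_mem _ _ hρI, Set.IccExtend_of_mem _ _ h5]
    simp only [ContinuousMap.comp_apply, graphCurve_apply, h4]
    congr 2
    · ring
    · congr 2; ring
  have e2 : (1 - κ : ℝ) * ∫ ρ in (0 : ℝ)..τ, f (κ + (1 - κ) * ρ)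
      = ∫ ρ in (κ : ℝ)..(κ + τ * (1 - κ)), f ρ := by
    have := intervalIntegral.smul_integral_comp_add_mul (a := (0 : ℝ)) (b := τ) f (1 - κ : ℝ) κ
    rw [smul_eq_mul] at this
    rw [this]
    congr 1 <;> ring
  have e3 := intervalIntegral.integral_add_adjacent_intervals (μ := MeasureTheory.volume)
    (hfc.intervalIntegrable 0 κ) (hfc.intervalIntegrable κ (κ + τ * (1 - κ)))
  have e4 := h κ
  have e5 := h ⟨_, h1⟩
  simp only at e4 e5 ⊢
  rw [e1, h2, e5, e4, ← e3, ← e2]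
  ring

/-- A smooth direction field in the plane has a local first integral. It assigns to a point `(x, y)`
near `a₀` the value at `a₀.1` of the solution through `(x, y)`; its smoothness comes from the
inverse function theorem in the Banach space of continuous functions. -/
theorem exists_first_integral_of_contDiff {s : ℝ × ℝ → ℝ} (hs : ContDiff ℝ ∞ s) (a₀ : ℝ × ℝ) :
    ∃ (η : ℝ × ℝ → ℝ) (D : Set (ℝ × ℝ)), IsOpen D ∧ a₀ ∈ D ∧ (∀ a ∈ D, Smooth η a) ∧
      ∀ a ∈ D, fderiv ℝ η a (0, 1) ≠ 0 ∧ fderiv ℝ η a (1, 0) + s a * fderiv ℝ η a (0, 1) = 0 := by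
  let S : C(ℝ × ℝ, ℝ) := ⟨s, hs.continuous⟩
  let Θ : (ℝ × ℝ) × C(I, ℝ) → (ℝ × ℝ) × C(I, ℝ) := fun z => (z.1, solutionEquation S a₀.1 z)
  let p₀ : (ℝ × ℝ) × C(I, ℝ) := (a₀, a₀.2 • 1)
  have hΘ : ContDiff ℝ ∞ Θ := contDiff_fst.prodMk (contDiff_solutionEquation (s := S) hs a₀.1)
  -- the derivative of `Θ` at the constant function is triangular with identities on the diagonal
  let c := primitive (S.comp (graphCurve a₀.1 p₀))
  let L : (ℝ × ℝ) →L[ℝ] C(I, ℝ) := (ContinuousLinearMap.fst ℝ ℝ ℝ).smulRight c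
    - (ContinuousLinearMap.snd ℝ ℝ ℝ).smulRight (1 : C(I, ℝ))
  let e' : ((ℝ × ℝ) × C(I, ℝ)) ≃L[ℝ] ((ℝ × ℝ) × C(I, ℝ)) :=
    (ContinuousLinearEquiv.refl ℝ (ℝ × ℝ)).skewProd (ContinuousLinearEquiv.refl ℝ C(I, ℝ)) L
  have hd : HasFDerivAt Θ (e' : ((ℝ × ℝ) × C(I, ℝ)) →L[ℝ] ((ℝ × ℝ) × C(I, ℝ))) p₀ := by
    have h11 : HasFDerivAt (fun z : (ℝ × ℝ) × C(I, ℝ) => z.1.1)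
      ((ContinuousLinearMap.fst ℝ ℝ ℝ).comp (ContinuousLinearMap.fst ℝ (ℝ × ℝ) C(I, ℝ))) p₀ :=
      hasFDerivAt_fst.fst
    have h12 : HasFDerivAt (fun z : (ℝ × ℝ) × C(I, ℝ) => z.1.2)
      ((ContinuousLinearMap.snd ℝ ℝ ℝ).comp (ContinuousLinearMap.fst ℝ (ℝ × ℝ) C(I, ℝ))) p₀ :=
      hasFDerivAt_fst.snd
    have hR := (((contDiff_rhs (s := S) hs a₀.1).differentiable (by simp)) p₀).hasFDerivAt
    have h := (hasFDerivAt_fst (𝕜 := ℝ) (p := p₀)).prodMk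
      (((hasFDerivAt_snd (𝕜 := ℝ) (p := p₀)).sub (h12.smul_const (1 : C(I, ℝ)))).sub
        ((h11.const_sub a₀.1).smul hR))
    refine h.congr_fderiv ?_
    refine ContinuousLinearMap.ext fun z => Prod.ext rfl ?_
    simp [e', L, p₀, c, ContinuousLinearEquiv.skewProd]
    abel
  obtain ⟨e, he0, -, heΘ, hes⟩ := exists_local_inverse_of_equiv isOpen_univ (Set.mem_univ p₀)
    (fun w _ => hΘ.contDiffAt) e' hd
  have hΘp : Θ p₀ = (a₀, 0) := by
    simp [Θ, p₀, solutionEquation]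
  have hsymm0 : e.symm (a₀, 0) = p₀ := by
    rw [← hΘp, ← heΘ]; exact e.left_inv he0
  let ι : ℝ × ℝ → (ℝ × ℝ) × C(I, ℝ) := fun a => (a, 0)
  have hι : ContDiff ℝ ∞ ι := contDiff_id.prodMk contDiff_const
  obtain ⟨r, hr, hball⟩ := Metric.isOpen_iff.1 e.open_source p₀ he0
  let η : ℝ × ℝ → ℝ := fun a => (e.symm (ι a)).2 1
  let V : Set (ℝ × ℝ) := ι ⁻¹' (e.target ∩ e.symm ⁻¹' Metric.ball p₀ r)
  have hV : IsOpen V := (e.symm.isOpen_inter_preimage Metric.isOpen_ball).preimage hι.continuous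
  have haV : a₀ ∈ V := by
    refine ⟨?_, ?_⟩
    · show (a₀, 0) ∈ e.target
      rw [← hΘp, ← heΘ]
      exact e.map_source he0
    · show e.symm (a₀, 0) ∈ Metric.ball p₀ r
      rw [hsymm0]
      exact Metric.mem_ball_self hr
  have hev1 : ContDiff ℝ ∞ fun z : (ℝ × ℝ) × C(I, ℝ) => z.2 1 :=
    (ContinuousMap.evalCLM (R := ℝ) (M := ℝ) (1 : I)).contDiff.comp contDiff_snd
  have hsm : ∀ a ∈ V, Smooth η a := fun a ha =>
    hev1.contDiffAt.comp a (ContDiffAt.comp (g := e.symm) (f := ι) a (hes _ ha.1) hι.contDiffAt)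
  have hsol : ∀ a ∈ V, (e.symm (ι a)).1 = a ∧
      solutionEquation S a₀.1 (a, (e.symm (ι a)).2) = 0 := by
    intro a ha
    have h := e.right_inv ha.1
    rw [heΘ] at h
    have h1 : (e.symm (ι a)).1 = a := congrArg Prod.fst h
    refine ⟨h1, ?_⟩
    have h2 : solutionEquation S a₀.1 (e.symm (ι a)) = 0 := congrArg Prod.snd h
    rw [← h2]
    exact congrArg _ (Prod.ext h1.symm rfl)
  -- `η` is constant along solutions
  have hconst : ∀ a ∈ V, ∀ κ : I, η (a.1 + (a₀.1 - a.1) * κ, (e.symm (ι a)).2 κ) = η a := by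
    intro a ha κ
    obtain ⟨h1, h2⟩ := hsol a ha
    set Y : C(I, ℝ) := (e.symm (ι a)).2 with hY
    have hmem : ∀ τ : I, (κ + τ * (1 - κ) : ℝ) ∈ I := fun τ =>
      ⟨by nlinarith [κ.2.1, κ.2.2, τ.2.1], by nlinarith [κ.2.1, κ.2.2, τ.2.1, τ.2.2]⟩
    let Y' : C(I, ℝ) := ⟨fun τ => Y ⟨κ + τ * (1 - κ), hmem τ⟩, by fun_prop⟩
    have h3 := solutionEquation_restart h2 κ (Y' := Y') fun τ => ⟨hmem τ, rfl⟩
    have hb : dist (e.symm (ι a)) p₀ < r := ha.2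
    rw [Prod.dist_eq, max_lt_iff] at hb
    obtain ⟨hb1, hb2⟩ := hb
    rw [h1, Prod.dist_eq, max_lt_iff] at hb1
    have hYv : ∀ τ, dist (Y τ) a₀.2 ≤ dist Y (a₀.2 • 1) := fun τ => by
      have := ContinuousMap.dist_apply_le_dist (f := Y) (g := a₀.2 • (1 : C(I, ℝ))) τ
      simpa using this
    have hin : ((a.1 + (a₀.1 - a.1) * κ, Y κ), Y') ∈ e.source := by
      apply hball
      rw [Metric.mem_ball, Prod.dist_eq, Prod.dist_eq, max_lt_iff, max_lt_iff]
      refine ⟨⟨?_, (hYv κ).trans_lt hb2⟩, ?_⟩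
      · refine lt_of_le_of_lt ?_ hb1.1
        rw [Real.dist_eq, Real.dist_eq,
          show a.1 + (a₀.1 - a.1) * (κ : ℝ) - a₀.1 = (1 - κ) * (a.1 - a₀.1) by ring, abs_mul]
        refine mul_le_of_le_one_left (abs_nonneg _) ?_
        rw [abs_of_nonneg (by linarith [κ.2.2])]
        linarith [κ.2.1]
      · refine lt_of_le_of_lt ?_ hb2
        rw [ContinuousMap.dist_le dist_nonneg]
        intro τ
        simpa [Y', p₀] using hYv ⟨κ + τ * (1 - κ), hmem τ⟩
    have h4 : e.symm (ι (a.1 + (a₀.1 - a.1) * κ, Y κ)) = ((a.1 + (a₀.1 - a.1) * κ, Y κ), Y') := by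
      rw [← e.left_inv hin, heΘ]
      exact congrArg e.symm (Prod.ext rfl h3.symm)
    show (e.symm (ι (a.1 + (a₀.1 - a.1) * κ, Y κ))).2 1 = Y 1
    rw [h4]
    show Y ⟨κ + (1 : I) * (1 - κ), hmem 1⟩ = Y 1
    congr 1
    ext
    simp
  -- differentiation along the solution through `a`; nothing is claimed on the line `x = a₀.1`
  have hoff : ∀ a ∈ V, (a₀.1 - a.1) *
      (fderiv ℝ η a (1, 0) + s a * fderiv ℝ η a (0, 1)) = 0 := by
    intro a ha
    obtain ⟨-, h2⟩ := hsol a ha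
    set Y := (e.symm (ι a)).2 with hY
    rw [solutionEquation_eq_zero_iff] at h2
    set f := Set.IccExtend (zero_le_one (α := ℝ)) (S.comp (graphCurve a₀.1 (a, Y))) with hf
    have hfc : Continuous f := (S.comp (graphCurve a₀.1 (a, Y))).continuous.Icc_extend'
    let b : ℝ → ℝ × ℝ := fun κ => (a.1 + (a₀.1 - a.1) * κ, a.2 + (a₀.1 - a.1) * ∫ ρ in (0 : ℝ)..κ, f ρ)
    have hY0 : Y 0 = a.2 := by simpa using h2 0
    have hf0 : f 0 = s a := by
      rw [hf, Set.IccExtend_of_mem _ _ (Set.left_mem_Icc.2 zero_le_one)]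
      show s (graphCurve a₀.1 (a, Y) 0) = s a
      rw [graphCurve_apply]
      simp [hY0]
    have hb : HasDerivAt b (a₀.1 - a.1, (a₀.1 - a.1) * f 0) 0 := by
      refine HasDerivAt.prodMk ?_ ?_
      · simpa using ((hasDerivAt_id (0 : ℝ)).const_mul (a₀.1 - a.1)).const_add a.1
      · exact ((intervalIntegral.integral_hasDerivAt_right (hfc.intervalIntegrable 0 0)
          (hfc.stronglyMeasurableAtFilter _ _) hfc.continuousAt).const_mul _).const_add _
    have hb0 : b 0 = a := by simp [b]
    have h5 : HasDerivAt (η ∘ b) (fderiv ℝ η a (a₀.1 - a.1, (a₀.1 - a.1) * f 0)) 0 := by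
      have := (hsm a ha).diff.hasFDerivAt
      rw [← hb0] at this
      have := this.comp_hasDerivAt 0 hb
      rwa [hb0] at this
    have h6 : HasDerivWithinAt (η ∘ b) 0 (Set.Icc 0 1) 0 := by
      refine (hasDerivWithinAt_const (0 : ℝ) (Set.Icc (0 : ℝ) 1) (η a)).congr ?_ ?_
      · intro κ hκ
        have := hconst a ha ⟨κ, hκ⟩
        rw [← hY, h2 ⟨κ, hκ⟩] at this
        exact this
      · simp [hb0]
    have h7 := (uniqueDiffOn_Icc_zero_one 0 (Set.left_mem_Icc.2 zero_le_one)).eq_deriv _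
      h5.hasDerivWithinAt h6
    rw [show ((a₀.1 - a.1, (a₀.1 - a.1) * f 0) : ℝ × ℝ)
      = (a₀.1 - a.1) • (((1 : ℝ), (0 : ℝ)) + s a • ((0 : ℝ), (1 : ℝ))) by
        ext <;> simp [hf0], map_smul, map_add, map_smul] at h7
    simpa using h7
  have hcont : ∀ a ∈ V, ∀ X, ContinuousAt (fun a => fderiv ℝ η a X) a := fun a ha X =>
    ((hsm a ha).fderiv_right (m := 0) (by simp)).continuousAt.clm_apply continuousAt_const
  have heq : ∀ a ∈ V, fderiv ℝ η a (1, 0) + s a * fderiv ℝ η a (0, 1) = 0 := by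
    intro a ha
    have hg : ContinuousAt (fun a => fderiv ℝ η a (1, 0) + s a * fderiv ℝ η a (0, 1)) a :=
      (hcont a ha _).add (hs.continuous.continuousAt.mul (hcont a ha _))
    have hc : ContinuousAt (fun x : ℝ => (x, a.2)) a.1 := by fun_prop
    have h1 := (ContinuousAt.comp (x := a.1) (f := fun x : ℝ => (x, a.2)) hg hc).tendsto.mono_left
      (nhdsWithin_le_nhds (s := {a.1, a₀.1}ᶜ))
    have hV' : ∀ᶠ x in 𝓝 a.1, (x, a.2) ∈ V := hc.eventually (hV.mem_nhds ha)
    have hne : (𝓝[{a.1, a₀.1}ᶜ] a.1).NeBot := by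
      rw [← mem_closure_iff_nhdsWithin_neBot]
      exact (Set.toFinite {a.1, a₀.1}).countable.dense_compl ℝ a.1
    refine tendsto_nhds_unique h1 (tendsto_const_nhds.congr' ?_)
    filter_upwards [hV'.filter_mono nhdsWithin_le_nhds, self_mem_nhdsWithin] with x hx hx'
    have := hoff _ hx
    rw [mul_eq_zero, sub_eq_zero] at this
    exact (this.resolve_left fun h => hx' (Or.inr h.symm)).symm
  have hone : fderiv ℝ η a₀ (0, 1) = 1 := by
    have hc : HasDerivAt (fun y : ℝ => (a₀.1, y)) (0, 1) a₀.2 :=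
      (hasDerivAt_const _ _).prodMk (hasDerivAt_id _)
    have h1 : HasDerivAt (fun y => η (a₀.1, y)) (fderiv ℝ η a₀ (0, 1)) a₀.2 :=
      HasFDerivAt.comp_hasDerivAt (f := fun y : ℝ => (a₀.1, y)) a₀.2
        (hsm a₀ haV).diff.hasFDerivAt hc
    have h2 : (fun y => η (a₀.1, y)) =ᶠ[𝓝 a₀.2] id := by
      filter_upwards [hc.continuousAt.eventually (hV.mem_nhds haV)] with y hy
      have h3 := (solutionEquation_eq_zero_iff _ _ _).1 (hsol _ hy).2 1
      simpa using h3
    exact h1.unique ((hasDerivAt_id _).congr_of_eventuallyEq h2)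
  have hev : ∀ᶠ a in 𝓝 a₀, a ∈ V ∧ fderiv ℝ η a (0, 1) ≠ 0 :=
    (show ∀ᶠ a in 𝓝 a₀, a ∈ V from hV.mem_nhds haV).and ((hcont a₀ haV _).eventually_ne (by rw [hone]; exact one_ne_zero))
  obtain ⟨D, hD, hDo, haD⟩ := eventually_nhds_iff.1 hev
  exact ⟨η, D, hDo, haD, fun a ha => hsm a (hD a ha).1,
    fun a ha => ⟨(hD a ha).2, heq a (hD a ha).1⟩⟩

/-- A local version of `exists_first_integral_of_contDiff`. -/
theorem exists_first_integral {s : ℝ × ℝ → ℝ} {a₀ : ℝ × ℝ} (hs : ∀ᶠ a in 𝓝 a₀, Smooth s a) :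
    ∃ (η : ℝ × ℝ → ℝ) (D : Set (ℝ × ℝ)), IsOpen D ∧ a₀ ∈ D ∧ (∀ a ∈ D, Smooth η a) ∧
      ∀ a ∈ D, fderiv ℝ η a (0, 1) ≠ 0 ∧ fderiv ℝ η a (1, 0) + s a * fderiv ℝ η a (0, 1) = 0 := by
  obtain ⟨R, hR, hball⟩ := Metric.eventually_nhds_iff_ball.1 hs
  let f : ContDiffBump a₀ := ⟨R / 4, R / 2, by positivity, by linarith⟩
  have hs' : ContDiff ℝ ∞ fun a => f a * s a := by
    refine contDiff_iff_contDiffAt.2 fun a => ?_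
    by_cases h1 : a ∈ tsupport f
    swap
    · refine contDiffAt_const (c := (0 : ℝ)).congr_of_eventuallyEq ?_
      filter_upwards [notMem_tsupport_iff_eventuallyEq.1 h1] with b hb
      rw [hb, Pi.zero_apply, zero_mul]
    rw [f.tsupport_eq] at h1
    exact f.contDiff.contDiffAt.mul
      (hball a (Metric.closedBall_subset_ball (by show R / 2 < R; linarith) h1))
  obtain ⟨η, D, hD, haD, h1, h2⟩ := exists_first_integral_of_contDiff hs' a₀
  refine ⟨η, D ∩ Metric.ball a₀ (R / 4), hD.inter Metric.isOpen_ball,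
    ⟨haD, Metric.mem_ball_self (by positivity)⟩, fun a ha => h1 a ha.1, fun a ha => ?_⟩
  have h3 := h2 a ha.1
  rwa [f.one_of_mem_closedBall (Metric.ball_subset_closedBall ha.2), one_mul] at h3

end FirstIntegral

/-! ### Transport along fiber-preserving transformations -/

/-- A local diffeomorphism of the total space that respects the frames takes the pullback of a
metric to the pullback of the same metric. -/
lemma PullsBack.exists_transport {n : ℕ} {Q : Matrix (Fin n) (Fin n) ℝ}
    {θ θ' : (Fin 6 → ℝ) → (Fin 6 → ℝ) → (Fin n → ℝ)} {S : Set (Fin 6 → ℝ)}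
    {π : (Fin 6 → ℝ) → (Fin 4 → ℝ)} {G : (Fin 4 → ℝ) → Matrix (Fin 4) (Fin 4) ℝ}
    (h : PullsBack Q θ S π G) {Ψ : (Fin 6 → ℝ) → (Fin 6 → ℝ)} (hΨ : ∀ w ∈ S, Smooth Ψ w)
    (hθ : ∀ w ∈ S, ∀ X, θ w X = θ' (Ψ w) (fderiv ℝ Ψ w X)) {u : Fin 6 → ℝ} (hu : u ∈ S)
    (hinj : ∀ X, fderiv ℝ Ψ u X = 0 → X = 0) :
    ∃ (S' : Set (Fin 6 → ℝ)) (Λ : (Fin 6 → ℝ) → (Fin 6 → ℝ)), PullsBack Q θ' S' (π ∘ Λ) G ∧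
      Ψ u ∈ S' ∧ Λ (Ψ u) = u ∧ ∀ w ∈ S', Λ w ∈ S ∧ Ψ (Λ w) = w := by
  obtain ⟨e, heu, heS, he, hes⟩ := exists_local_inverse h.isOpen hu hΨ hinj
  have hΛS : ∀ w ∈ e.target, e.symm w ∈ S := fun w hw => heS (e.map_target hw)
  have hr : ∀ w ∈ e.target, Ψ (e.symm w) = w := fun w hw => by
    rw [← he]; exact e.right_inv hw
  have hd : ∀ w ∈ e.target, ∀ X, fderiv ℝ Ψ (e.symm w) (fderiv ℝ e.symm w X) = X :=
    fun w hw X => by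
      have := fderiv_local_inverse hw (by rw [he]; exact hΨ _ (hΛS w hw)) (hes w hw) X
      rwa [he] at this
  refine ⟨e.target, e.symm, h.comp e.open_target hes hΛS (fun w hw => ?_) (fun w hw X => ?_),
    ?_, ?_, fun w hw => ⟨hΛS w hw, hr w hw⟩⟩
  · refine LinearMap.injective_iff_surjective.1
      ((injective_iff_map_eq_zero (fderiv ℝ e.symm w).toLinearMap).2 fun X hX => ?_)
    rw [← hd w hw X]
    exact (congrArg _ hX).trans (map_zero _)
  · rw [hθ _ (hΛS w hw), hd w hw, hr w hw]
  · rw [← he]; exact e.map_source heu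
  · rw [← he]; exact e.left_inv heu

namespace FPTransformation

variable {φ : FPTransformation} {F F' : (Fin 4 → ℝ) → ℝ} {N : Set (Fin 4 → ℝ)}

lemma RelatesOn.slframe_lift (h : φ.RelatesOn F F' N) {u : Fin 6 → ℝ} (hu : jet u ∈ N)
    (h4 : u 4 ≠ 0) (hqq : pd 3 (pd 3 F) (jet u) ≠ 0) (X : Fin 6 → ℝ) :
    slframe F u X = slframe F' (φ.lift F u) (fderiv ℝ (φ.lift F) u X) := by
  simp only [slframe, h.coframe_lift hu h4 hqq]

lemma RelatesOn.fderiv_lift_eq_zero (h : φ.RelatesOn F F' N) {u : Fin 6 → ℝ} (hu : jet u ∈ N)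
    (h4 : u 4 ≠ 0) (hqq : pd 3 (pd 3 F) (jet u) ≠ 0) {X : Fin 6 → ℝ}
    (hX : fderiv ℝ (φ.lift F) u X = 0) : X = 0 := by
  refine coframe_eq_zero h4 hqq ?_
  rw [h.coframe_lift hu h4 hqq, hX]
  simpa using coframe_smul F' (φ.lift F u) 0 0

/-- An equation near the jet `v`, brought to another one by a given transformation. -/
lemma TransformsOn.exists_relatesOn (h : φ.TransformsOn F N) {v : Fin 4 → ℝ} (hv : v ∈ N) :
    ∃ (F' : (Fin 4 → ℝ) → ℝ) (e : OpenPartialHomeomorph (Fin 4 → ℝ) (Fin 4 → ℝ)),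
      v ∈ e.source ∧ e.source ⊆ N ∧ ⇑e = φ.prol F ∧ φ.RelatesOn F F' e.source := by
  obtain ⟨e, hev, heN, he, hes⟩ := exists_local_inverse h.isOpen hv h.smooth_prol
    (fun X hX => h.fderiv_prol_eq_zero hv hX)
  refine ⟨fun z => φ.rbar F (e.symm z), e, hev, heN, he, ⟨e.open_source,
    fun w hw => h.smooth w (heN hw), fun w hw => h.mem_dom w (heN hw)⟩, fun w hw => ?_,
    fun w hw => ?_⟩
  · rw [← he]
    have h1 : Smooth (φ.rbar F) (e.symm (e w)) := by
      rw [e.left_inv hw]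
      exact h.smooth_rbar w (heN hw)
    exact ContDiffAt.comp (e w) h1 (hes _ (e.map_source hw))
  · simp only [← he, e.left_inv hw]

end FPTransformation

/-- An equation that has a metric with the coefficients `slForm A B` is locally equivalent to an
equation in normal form. Since `p - 3 / F_qq` depends only on `(x, y)`, a first integral `ȳ` of
`y' = p - 3 / F_qq` brings `F_qq` to the form `3 / p`. -/
theorem exists_normalForm_of_pullsBack {F : (Fin 4 → ℝ) → ℝ} {A B : Fin 3 → ℝ}
    {S : Set (Fin 6 → ℝ)} {π : (Fin 6 → ℝ) → (Fin 4 → ℝ)}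
    {G : (Fin 4 → ℝ) → Matrix (Fin 4) (Fin 4) ℝ}
    (hP : PullsBack (slMatrix A B) (slframe F) S π G) (hA : killing A A = 1) (hB : killing B B = 1)
    (hS : ∀ w ∈ S, Smooth F (jet w) ∧ w 4 ≠ 0 ∧ pd 3 (pd 3 F) (jet w) ≠ 0)
    {w : Fin 6 → ℝ} (hw : w ∈ S) :
    ∃ (n : NormalForm) (φ : FPTransformation) (N : Set (Fin 4 → ℝ)), IsOpen N ∧ jet w ∈ N ∧
      N ⊆ jet '' S ∧ ∀ v ∈ N, (v 0, v 1) ∈ φ.dom ∧ φ.prol F v ∈ n.ode.dom ∧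
        n.ode.F (φ.prol F v) = φ.rbar F v := by
  set v₀ := jet w with hv₀
  have hJ : ∀ v ∈ jet '' S, Smooth F v ∧ pd 3 (pd 3 F) v ≠ 0 ∧
      pd 3 (pd 3 (pd 3 F)) v = 0 ∧ pd 2 (pd 3 (pd 3 F)) v = -(pd 3 (pd 3 F) v ^ 2 / 3) := by
    rintro _ ⟨u, hu, rfl⟩
    exact ⟨(hS u hu).1, (hS u hu).2.2, Fqqq_Fqqp hP hA hB hS hu⟩
  obtain ⟨r, hr, hball⟩ := Metric.isOpen_iff.1 (isOpen_image_jet hP.isOpen) v₀ ⟨w, hw, rfl⟩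
  -- `f = p - 3 / F_qq` depends only on `(x, y)`
  let f : (Fin 4 → ℝ) → ℝ := fun v => v 2 - 3 / pd 3 (pd 3 F) v
  have hf : ∀ v ∈ jet '' S, Smooth f v := fun v hv => (smooth_coord 2).sub
    (contDiffAt_const.div (((hJ v hv).1.pd 3).pd 3) (hJ v hv).2.1)
  have hfi : ∀ v ∈ jet '' S, ∀ i, pd i f v
      = (if i = 2 then 1 else 0) + 3 * pd i (pd 3 (pd 3 F)) v / pd 3 (pd 3 F) v ^ 2 := by
    intro v hv i
    have s := ((hJ v hv).1.pd 3).pd 3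
    have h0 := (hJ v hv).2.1
    have hq : Smooth (fun v => 3 / pd 3 (pd 3 F) v) v := contDiffAt_const.div s h0
    rw [pd_sub (smooth_coord 2) hq, pd_coord,
      pd_div contDiffAt_const s h0, pd_const]
    ring
  have hf2 : ∀ v ∈ Metric.ball v₀ r, pd 2 f v = 0 := fun v hv => by
    have h0 := (hJ v (hball hv)).2.1
    rw [hfi v (hball hv), (hJ v (hball hv)).2.2.2, if_pos rfl]
    field_simp
    ring
  have hf3 : ∀ v ∈ Metric.ball v₀ r, pd 3 f v = 0 := fun v hv => by
    rw [hfi v (hball hv), (hJ v (hball hv)).2.2.1]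
    simp
  let s : ℝ × ℝ → ℝ := fun a => f ![a.1, a.2, v₀ 2, v₀ 3]
  have hfs : ∀ v ∈ Metric.ball v₀ r, f v = s (v 0, v 1) := fun v hv =>
    eq_of_pd_two_three (fun v hv => hf v (hball hv)) hf2 hf3 hv
  have hs : ∀ᶠ a in 𝓝 (v₀ 0, v₀ 1), Smooth s a := by
    have hl : ContDiff ℝ ∞ fun a : ℝ × ℝ => (![a.1, a.2, v₀ 2, v₀ 3] : Fin 4 → ℝ) := by
      refine contDiff_pi.2 fun i => ?_
      fin_cases i
      · exact contDiff_fst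
      · exact contDiff_snd
      · exact contDiff_const
      · exact contDiff_const
    have h0 : (![v₀ 0, v₀ 1, v₀ 2, v₀ 3] : Fin 4 → ℝ) = v₀ := by
      ext i; fin_cases i <;> rfl
    have hm : ∀ᶠ a in 𝓝 (v₀ 0, v₀ 1), (![a.1, a.2, v₀ 2, v₀ 3] : Fin 4 → ℝ) ∈ Metric.ball v₀ r :=
      hl.continuous.continuousAt.eventually_mem
        (Metric.isOpen_ball.mem_nhds (by simp only [h0]; exact Metric.mem_ball_self hr))
    filter_upwards [hm] with a ha
    exact ContDiffAt.comp a (hf _ (hball ha)) hl.contDiffAt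
  obtain ⟨η, D, hD, haD, hη, hη'⟩ := exists_first_integral hs
  let φ : FPTransformation := ⟨D, id, η, hD, contDiffOn_id, fun a ha => (hη a ha).contDiffWithinAt,
    fun a _ => by rw [deriv_id]; exact one_ne_zero, fun a ha => (hη' a ha).1⟩
  have hcxy : Continuous fun v : Fin 4 → ℝ => (v 0, v 1) := by fun_prop
  have hT : φ.TransformsOn F (Metric.ball v₀ r ∩ (fun v : Fin 4 → ℝ => (v 0, v 1)) ⁻¹' D) :=
    ⟨Metric.isOpen_ball.inter (hD.preimage hcxy), fun v hv => (hJ v (hball hv.1)).1,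
      fun v hv => hv.2⟩
  obtain ⟨F', e, hve, heN, he, hR⟩ := hT.exists_relatesOn ⟨Metric.mem_ball_self hr, haD⟩
  have hx' : ∀ v ∈ e.source, pd 0 φ.xbar v = 1 := fun v hv => by
    rw [FPTransformation.TransformsOn.pd_xbar (hR.mem_dom v hv), if_pos rfl]
    exact deriv_id _
  have hpbar : ∀ v ∈ e.source, φ.pbar F v = 3 / pd 3 (pd 3 F) v * pd 1 φ.ybar v := by
    intro v hv
    have h1 := hR.pbar_mul v hv
    have h2 := (hη' _ (hR.mem_dom v hv)).2
    have h3 : v 2 - 3 / pd 3 (pd 3 F) v = s (v 0, v 1) := hfs v (heN hv).1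
    have e0 : pd 0 φ.ybar v = fderiv ℝ η (v 0, v 1) (1, 0) := by
      rw [FPTransformation.TransformsOn.pd_ybar (hR.mem_dom v hv)]; rfl
    have e1 : pd 1 φ.ybar v = fderiv ℝ η (v 0, v 1) (0, 1) := by
      rw [FPTransformation.TransformsOn.pd_ybar (hR.mem_dom v hv)]; rfl
    rw [hx' v hv, totalD, hR.pd_ybar_two v hv, hR.pd_ybar_three v hv, e0, e1] at h1
    rw [e1]
    rw [← h3] at h2
    linear_combination h1 + h2
  have hN' : SemiNormal F' e.target := by
    have hz : ∀ z ∈ e.target, ∃ v ∈ e.source, φ.prol F v = z := fun z hz =>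
      ⟨e.symm z, e.map_target hz, by rw [← he]; exact e.right_inv hz⟩
    refine ⟨e.open_target, fun z hz' => ?_, fun z hz' => ?_, fun z hz' => ?_⟩
    all_goals obtain ⟨v, hv, rfl⟩ := hz z hz'
    · exact hR.smooth' v hv
    · show φ.pbar F v ≠ 0
      rw [hpbar v hv]
      exact mul_ne_zero (div_ne_zero (by norm_num) (hJ v (hball (heN hv).1)).2.1) (hR.Y_ne v hv)
    · show _ = 3 / φ.pbar F v
      have h1 := hR.pd_three_three_F v hv
      have h2 := hR.Y_ne v hv
      have h3 := (hJ v (hball (heN hv).1)).2.1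
      rw [hx' v hv, div_one] at h1
      rw [hpbar v hv]
      field_simp
      rw [h1]
      ring
  have hcj : Continuous jet := continuous_iff_continuousAt.2 fun u => (smooth_jet u).continuousAt
  have hSo : IsOpen (S ∩ jet ⁻¹' e.source) := hP.isOpen.inter (e.open_source.preimage hcj)
  obtain ⟨S', Λ, hP', huS', -, hΛ⟩ := (hP.mono hSo Set.inter_subset_left).exists_transport
    (fun u hu => hR.smooth_lift hu.2)
    (fun u hu => hR.slframe_lift hu.2 (hS u hu.1).2.1 (hS u hu.1).2.2) ⟨hw, hve⟩
    (fun X hX => hR.fderiv_lift_eq_zero hve (hS w hw).2.1 (hS w hw).2.2 hX)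
  have hS' : ∀ u ∈ S', jet u ∈ e.target ∧ u 4 ≠ 0 := by
    intro u hu
    obtain ⟨hΛu, hl⟩ := hΛ u hu
    have h1 : jet u = e (jet (Λ u)) := by rw [he, ← FPTransformation.jet_lift, hl]
    refine ⟨by rw [h1]; exact e.map_source hΛu.2, ?_⟩
    rw [← hl]
    exact div_ne_zero (hS _ hΛu.1).2.1 (hR.Y_ne _ hΛu.2)
  obtain ⟨n, N', hN'o, hwN', hN'sub, hn⟩ := hN'.exists_normalForm_of_pullsBack hP' hA hB hS' huS'
  have hjw : e v₀ ∈ N' := by rw [he]; exact hwN'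
  refine ⟨n, φ, e.source ∩ e ⁻¹' N', e.isOpen_inter_preimage hN'o, ⟨hve, hjw⟩,
    fun v hv => hball (heN hv.1).1, fun v hv => ?_⟩
  have hv2 : φ.prol F v ∈ N' := by rw [← he]; exact hv.2
  exact ⟨hR.mem_dom v hv.1, (hn _ hv2).1, (hn _ hv2).2.trans (hR.rel v hv.1)⟩

/-! ### The coframe of an equation in normal form -/

namespace NormalForm

variable (n : NormalForm)

/-- `A`, as a function on the jet space. -/
def jA (v : Fin 4 → ℝ) : ℝ := n.A (v 0, v 1)

/-- `B`, as a function on the jet space. -/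
def jB (v : Fin 4 → ℝ) : ℝ := n.B (v 0, v 1)

/-- `C`, as a function on the jet space. -/
def jC (v : Fin 4 → ℝ) : ℝ := n.C (v 0, v 1)

variable {n} {v : Fin 4 → ℝ}

lemma isOpen_dom : IsOpen n.ode.dom := by
  have h1 : Continuous fun v : Fin 4 → ℝ => (v 0, v 1) := by fun_prop
  exact (n.isOpen_D.preimage h1).inter (isOpen_ne_fun (continuous_apply 2) continuous_const)

section

variable {f : ℝ × ℝ → ℝ} {k : ℕ} {i j : Fin k}

lemma smooth_comp_pair {D : Set (ℝ × ℝ)} (hD : IsOpen D) (hf : ContDiffOn ℝ ∞ f D) {v : Fin k → ℝ}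
    (hv : (v i, v j) ∈ D) : Smooth (fun v : Fin k → ℝ => f (v i, v j)) v :=
  ContDiffAt.comp v (hf.contDiffAt (hD.mem_nhds hv)) ((smooth_coord i).prodMk (smooth_coord j))

lemma fderiv_comp_pair {v : Fin k → ℝ} (hf : DifferentiableAt ℝ f (v i, v j)) (X : Fin k → ℝ) :
    fderiv ℝ (fun v : Fin k → ℝ => f (v i, v j)) v X = fderiv ℝ f (v i, v j) (X i, X j) := by
  have h := (hf.hasFDerivAt.comp v ((hasFDerivAt_apply (𝕜 := ℝ) i v).prodMk
    (hasFDerivAt_apply (𝕜 := ℝ) j v))).fderiv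
  rw [show (fun v : Fin k → ℝ => f (v i, v j)) = f ∘ fun v => (v i, v j) from rfl, h]
  rfl

end

lemma diffA {a : ℝ × ℝ} (ha : a ∈ n.D) : DifferentiableAt ℝ n.A a :=
  Smooth.diff (n.smooth_A.contDiffAt (n.isOpen_D.mem_nhds ha))

lemma diffB {a : ℝ × ℝ} (ha : a ∈ n.D) : DifferentiableAt ℝ n.B a :=
  Smooth.diff (n.smooth_B.contDiffAt (n.isOpen_D.mem_nhds ha))

lemma diffC {a : ℝ × ℝ} (ha : a ∈ n.D) : DifferentiableAt ℝ n.C a :=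
  Smooth.diff (n.smooth_C.contDiffAt (n.isOpen_D.mem_nhds ha))

lemma smooth_jA (hv : v ∈ n.ode.dom) : Smooth n.jA v := smooth_comp_pair n.isOpen_D n.smooth_A hv.1

lemma smooth_jB (hv : v ∈ n.ode.dom) : Smooth n.jB v := smooth_comp_pair n.isOpen_D n.smooth_B hv.1

lemma smooth_jC (hv : v ∈ n.ode.dom) : Smooth n.jC v := smooth_comp_pair n.isOpen_D n.smooth_C hv.1

lemma pd_jA (hv : v ∈ n.ode.dom) {i : Fin 4} (h0 : i ≠ 0) (h1 : i ≠ 1) : pd i n.jA v = 0 := by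
  have := fderiv_comp_pair (v := v) (i := 0) (j := 1) (diffA hv.1) (Pi.single i 1)
  rw [Pi.single_eq_of_ne h0.symm, Pi.single_eq_of_ne h1.symm] at this
  exact this.trans (map_zero _)

lemma pd_jB (hv : v ∈ n.ode.dom) {i : Fin 4} (h0 : i ≠ 0) (h1 : i ≠ 1) : pd i n.jB v = 0 := by
  have := fderiv_comp_pair (v := v) (i := 0) (j := 1) (diffB hv.1) (Pi.single i 1)
  rw [Pi.single_eq_of_ne h0.symm, Pi.single_eq_of_ne h1.symm] at this
  exact this.trans (map_zero _)

lemma pd_jC (hv : v ∈ n.ode.dom) {i : Fin 4} (h0 : i ≠ 0) (h1 : i ≠ 1) : pd i n.jC v = 0 := by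
  have := fderiv_comp_pair (v := v) (i := 0) (j := 1) (diffC hv.1) (Pi.single i 1)
  rw [Pi.single_eq_of_ne h0.symm, Pi.single_eq_of_ne h1.symm] at this
  exact this.trans (map_zero _)

lemma F_eq : n.ode.F = fun v => (3 / 2) * (v 3) ^ 2 / v 2 + n.jA v * (v 2) ^ 3
    + n.jC v * (v 2) ^ 2 + n.jB v * v 2 := rfl

lemma smooth_F (hv : v ∈ n.ode.dom) : Smooth n.ode.F v :=
  ((((contDiffAt_const.mul ((smooth_coord 3).pow 2)).div (smooth_coord 2) hv.2).add
    ((smooth_jA hv).mul ((smooth_coord 2).pow 3))).add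
    ((smooth_jC hv).mul ((smooth_coord 2).pow 2))).add ((smooth_jB hv).mul (smooth_coord 2))

lemma pd_F (hv : v ∈ n.ode.dom) (i : Fin 4) (h0 : i ≠ 0) (h1 : i ≠ 1) : pd i n.ode.F v
    = (3 * v 3 * (if i = 3 then 1 else 0) * v 2 - (3 / 2) * v 3 ^ 2 * (if i = 2 then 1 else 0))
        / v 2 ^ 2
      + (3 * n.jA v * v 2 ^ 2 + 2 * n.jC v * v 2 + n.jB v) * (if i = 2 then 1 else 0) := by
  have c : ∀ i : Fin 4, Smooth (fun v : Fin 4 → ℝ => v i) v := fun i => smooth_coord i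
  have s1 : Smooth (fun v : Fin 4 → ℝ => (3 / 2) * v 3 ^ 2) v := contDiffAt_const.mul ((c 3).pow 2)
  have s2 : Smooth (fun v : Fin 4 → ℝ => (3 / 2) * v 3 ^ 2 / v 2) v := s1.div (c 2) hv.2
  have s3 : Smooth (fun v => n.jA v * v 2 ^ 3) v := (smooth_jA hv).mul ((c 2).pow 3)
  have s4 : Smooth (fun v => n.jC v * v 2 ^ 2) v := (smooth_jC hv).mul ((c 2).pow 2)
  have s5 : Smooth (fun v => n.jB v * v 2) v := (smooth_jB hv).mul (c 2)
  rw [F_eq, pd_add ((s2.add s3).add s4) s5, pd_add (s2.add s3) s4, pd_add s2 s3,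
    pd_div s1 (c 2) hv.2, pd_const_mul _ ((c 3).pow 2), pd_pow (c 3),
    pd_mul (smooth_jA hv) ((c 2).pow 3), pd_mul (smooth_jC hv) ((c 2).pow 2),
    pd_mul (smooth_jB hv) (c 2), pd_pow (c 2), pd_pow (c 2), pd_jA hv h0 h1, pd_jB hv h0 h1,
    pd_jC hv h0 h1, pd_coord, pd_coord]
  have := hv.2
  generalize (if i = 3 then (1 : ℝ) else 0) = a
  generalize (if i = 2 then (1 : ℝ) else 0) = b
  norm_num
  ring

lemma pd_three_F (hv : v ∈ n.ode.dom) : pd 3 n.ode.F v = 3 * v 3 / v 2 := by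
  have := hv.2
  rw [pd_F hv 3 (by decide) (by decide)]
  simp
  field_simp

lemma semiNormal : SemiNormal n.ode.F n.ode.dom := by
  refine ⟨isOpen_dom, fun v hv => smooth_F hv, fun v hv => hv.2, fun v hv => ?_⟩
  have := hv.2
  rw [pd_congr_on isOpen_dom (fun v hv => pd_three_F hv) 3 v hv,
    pd_div (contDiffAt_const.mul (smooth_coord 3)) (smooth_coord 2) hv.2,
    pd_const_mul _ (smooth_coord 3), pd_coord, pd_coord]
  simp
  field_simp

variable (n) in
lemma regular : n.ode.Regular :=
  ⟨isOpen_dom, fun _ hv => (smooth_F hv).contDiffWithinAt, fun _ hv => semiNormal.Fqq_ne hv⟩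

lemma beta_eq_zero (hv : v ∈ n.ode.dom) : betaOf n.ode.F v = 0 := by
  rw [betaOf, pd_three_F hv, sub_self]

lemma Kfun_eq (hv : v ∈ n.ode.dom) :
    Kfun n.ode.F v = (-1) * (n.jA v * v 2 ^ 2) - (1 / 2) * (n.jC v * v 2) := by
  have h := semiNormal.F_two (fun v hv => beta_eq_zero hv) v hv
  have hp := hv.2
  rw [pd_F hv 2 (by decide) (by decide)] at h
  have hF : n.ode.F v = (3 / 2) * (v 3) ^ 2 / v 2 + n.jA v * (v 2) ^ 3
    + n.jC v * (v 2) ^ 2 + n.jB v * v 2 := rfl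
  simp only [hF, if_true, show (2 : Fin 4) ≠ 3 by decide, if_false] at h
  generalize Kfun n.ode.F v = k at h ⊢
  field_simp at h
  refine mul_left_cancel₀ (pow_ne_zero 2 hp) ?_
  linear_combination (1 / 4) * h

lemma sigma_eq (hv : v ∈ n.ode.dom) : sigmaOf n.ode.F v = n.jA v := by
  have h := semiNormal.K_two (fun v hv => beta_eq_zero hv) v hv
  have hp := hv.2
  have s1 := (smooth_jA hv).mul ((smooth_coord 2).pow 2)
  have s2 := (smooth_jC hv).mul (smooth_coord 2)
  rw [pd_congr_on isOpen_dom (fun v hv => Kfun_eq hv) 2 v hv,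
    pd_sub (contDiffAt_const.mul s1) (contDiffAt_const.mul s2), pd_const_mul _ s1,
    pd_const_mul _ s2, pd_mul (smooth_jA hv) ((smooth_coord 2).pow 2),
    pd_mul (smooth_jC hv) (smooth_coord 2), pd_pow (smooth_coord 2),
    pd_jA hv (by decide) (by decide), pd_jC hv (by decide) (by decide), pd_coord, Kfun_eq hv] at h
  simp at h
  field_simp at h
  refine mul_left_cancel₀ hp ?_
  linear_combination (1 / 2) * h

/-- The coordinates `(x, y, z, t, ρ, α)` with `z = γ / p`, `t = q / p + γ` and `ρ = α p`. -/
def coords (u : Fin 6 → ℝ) : Fin 6 → ℝ :=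
  ![u 0, u 1, u 5 / u 2, u 3 / u 2 + u 5, u 4 * u 2, u 4]

variable (n) in
/-- The frame `slframe` of the equation in normal form, in the coordinates `(x, y, z, t, ρ, α)`. -/
def frame (w V : Fin 6 → ℝ) : Fin 6 → ℝ :=
  ![2 * w 4 * V 0,
    (V 3 - (w 3 ^ 2 / 2 + n.B (w 0, w 1)) * V 0 - n.C (w 0, w 1) / 2 * V 1) / (2 * w 4),
    V 4 / w 4 - w 3 * V 0,
    2 * w 5 * V 1,
    (V 2 - (w 2 ^ 2 / 2 - n.A (w 0, w 1)) * V 1 + n.C (w 0, w 1) / 2 * V 0) / (2 * w 5),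
    V 5 / w 5 - w 2 * V 1]

lemma smooth_coords {u : Fin 6 → ℝ} (hu : u 2 ≠ 0) : Smooth coords u := by
  have c : ∀ i : Fin 6, Smooth (fun v : Fin 6 → ℝ => v i) u := fun i => smooth_coord i
  refine smooth_pi.2 fun a => ?_
  fin_cases a
  · exact c 0
  · exact c 1
  · exact (c 5).div (c 2) hu
  · exact ((c 3).div (c 2) hu).add (c 5)
  · exact (c 4).mul (c 2)
  · exact c 4

lemma fderiv_pi_apply {k l : ℕ} {f : (Fin k → ℝ) → (Fin l → ℝ)} {u : Fin k → ℝ}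
    (hf : Smooth f u) (X : Fin k → ℝ) (a : Fin l) :
    fderiv ℝ f u X a = fderiv ℝ (fun w => f w a) u X := by
  rw [show (fun w => f w a) = (fun z : Fin l → ℝ => z a) ∘ f from rfl,
    ((hasFDerivAt_apply (𝕜 := ℝ) a (f u)).comp u hf.diff.hasFDerivAt).fderiv]
  rfl

lemma fderiv_coords {u : Fin 6 → ℝ} (hu : u 2 ≠ 0) (X : Fin 6 → ℝ) : fderiv ℝ coords u X
    = ![X 0, X 1, X 5 / u 2 - u 5 * X 2 / u 2 ^ 2, X 3 / u 2 - u 3 * X 2 / u 2 ^ 2 + X 5,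
      X 4 * u 2 + u 4 * X 2, X 4] := by
  funext a
  rw [fderiv_pi_apply (smooth_coords hu)]
  fin_cases a <;> simp only [coords, Matrix.cons_val, Fin.reduceFinMk, Fin.zero_eta, Fin.mk_one] <;>
    simp (disch := first | assumption | fun_prop (disch := assumption)) only
      [D_mul, D_coord, D_add, D_div] <;>
    field_simp <;> ring

lemma fderiv_coords_eq_zero {u : Fin 6 → ℝ} (hu : u 2 ≠ 0) (h4 : u 4 ≠ 0) {X : Fin 6 → ℝ}
    (hX : fderiv ℝ coords u X = 0) : X = 0 := by
  rw [fderiv_coords hu] at hX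
  have c := fun a => congrFun hX a
  have c0 : X 0 = 0 := c 0
  have c1 : X 1 = 0 := c 1
  have c5 : X 4 = 0 := c 5
  have c4 : X 4 * u 2 + u 4 * X 2 = 0 := c 4
  have c3 : X 3 / u 2 - u 3 * X 2 / u 2 ^ 2 + X 5 = 0 := c 3
  have c2 : X 5 / u 2 - u 5 * X 2 / u 2 ^ 2 = 0 := c 2
  have d2 : X 2 = 0 := by simpa [c5, h4] using c4
  have d5 : X 5 = 0 := by simpa [d2, hu] using c2
  have d3 : X 3 = 0 := by simpa [d2, d5, hu] using c3
  funext a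
  fin_cases a <;> assumption

lemma slframe_eq_frame {u : Fin 6 → ℝ} (hu : jet u ∈ n.ode.dom) (h4 : u 4 ≠ 0) (X : Fin 6 → ℝ) :
    slframe n.ode.F u X = n.frame (coords u) (fderiv ℝ coords u X) := by
  have hp : u 2 ≠ 0 := hu.2
  have hF : n.ode.F (jet u) = (3 / 2) * u 3 ^ 2 / u 2 + n.A (u 0, u 1) * u 2 ^ 3
    + n.C (u 0, u 1) * u 2 ^ 2 + n.B (u 0, u 1) * u 2 := rfl
  have hK : Kfun n.ode.F (jet u) = (-1) * (n.A (u 0, u 1) * u 2 ^ 2)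
    - (1 / 2) * (n.C (u 0, u 1) * u 2) := Kfun_eq hu
  have hσ : sigmaOf n.ode.F (jet u) = n.A (u 0, u 1) := sigma_eq hu
  rw [semiNormal.slframe_apply ⟨hu, h4⟩, fderiv_coords hp]
  simp only [coefPx, coefPy, coefRx, coefRy, beta_eq_zero hu, hF, hK, hσ,
    semiNormal.Kq_zero (fun v hv => beta_eq_zero hv) _ hu, frame, coords, Matrix.cons_val]
  funext a
  fin_cases a <;>
    simp only [Matrix.cons_val, Fin.reduceFinMk, Fin.zero_eta, Fin.mk_one] <;>
    field_simp <;> ring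

lemma frame_surjective {w : Fin 6 → ℝ} (h4 : w 4 ≠ 0) (h5 : w 5 ≠ 0) (s : Fin 6 → ℝ) :
    ∃ V, n.frame w V = s := by
  refine ⟨![s 0 / (2 * w 4), s 3 / (2 * w 5),
    2 * w 5 * s 4 + (w 2 ^ 2 / 2 - n.A (w 0, w 1)) * (s 3 / (2 * w 5))
      - n.C (w 0, w 1) / 2 * (s 0 / (2 * w 4)),
    2 * w 4 * s 1 + (w 3 ^ 2 / 2 + n.B (w 0, w 1)) * (s 0 / (2 * w 4))
      + n.C (w 0, w 1) / 2 * (s 3 / (2 * w 5)),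
    w 4 * (s 2 + w 3 * (s 0 / (2 * w 4))), w 5 * (s 5 + w 2 * (s 3 / (2 * w 5)))], ?_⟩
  funext a
  fin_cases a <;> simp only [frame, Matrix.cons_val, Fin.reduceFinMk, Fin.zero_eta, Fin.mk_one] <;>
    field_simp <;> ring

variable (n) in
/-- The domain of the coordinates `(x, y, z, t, ρ, α)`. -/
def coordDom : Set (Fin 6 → ℝ) := {w | (w 0, w 1) ∈ n.D ∧ w 4 ≠ 0 ∧ w 5 ≠ 0}

lemma smooth_frame {w : Fin 6 → ℝ} (hw : w ∈ n.coordDom) (V : Fin 6 → ℝ) (a : Fin 6) :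
    Smooth (fun w => n.frame w V a) w := by
  obtain ⟨hD, h4, h5⟩ := hw
  have c : ∀ i : Fin 6, Smooth (fun v : Fin 6 → ℝ => v i) w := fun i => smooth_coord i
  have k : ∀ r : ℝ, Smooth (fun _ : Fin 6 → ℝ => r) w := fun r => contDiffAt_const
  have sA := smooth_comp_pair n.isOpen_D n.smooth_A hD
  have sB := smooth_comp_pair n.isOpen_D n.smooth_B hD
  have sC := (smooth_comp_pair n.isOpen_D n.smooth_C hD).div (k 2) two_ne_zero
  fin_cases a
  · exact ((k 2).mul (c 4)).mul (k _)
  · exact (((k _).sub (((((c 3).pow 2).div (k 2) two_ne_zero).add sB).mul (k _))).sub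
      (sC.mul (k _))).div ((k 2).mul (c 4)) (mul_ne_zero two_ne_zero h4)
  · exact ((k _).div (c 4) h4).sub ((c 3).mul (k _))
  · exact ((k 2).mul (c 5)).mul (k _)
  · exact (((k _).sub (((((c 2).pow 2).div (k 2) two_ne_zero).sub sA).mul (k _))).add
      (sC.mul (k _))).div ((k 2).mul (c 5)) (mul_ne_zero two_ne_zero h5)
  · exact ((k _).div (c 5) h5).sub ((c 2).mul (k _))

/-- The structure equations of the frame: those of `𝔰𝔩(2, ℝ) ⊕ 𝔰𝔩(2, ℝ)`, and a curvature
proportional to `dx ∧ dy`. -/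
lemma dForm_frame {w : Fin 6 → ℝ} (hw : w ∈ n.coordDom) (V X : Fin 6 → ℝ) :
    let s := n.frame w V
    let t := n.frame w X
    let d := V 0 * X 1 - V 1 * X 0
    dForm n.frame w V X = ![s 2 * t 0 - t 2 * s 0,
      -(s 2 * t 1 - t 2 * s 1) + d * (w 3 * n.C (w 0, w 1) / 2 + fderiv ℝ n.B (w 0, w 1) (0, 1)
        - fderiv ℝ n.C (w 0, w 1) (1, 0) / 2) / (2 * w 4),
      -(s 1 * t 0 - t 1 * s 0) + d * n.C (w 0, w 1) / 2,
      s 5 * t 3 - t 5 * s 3,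
      -(s 5 * t 4 - t 5 * s 4) + d * (w 2 * n.C (w 0, w 1) / 2 + fderiv ℝ n.A (w 0, w 1) (1, 0)
        - fderiv ℝ n.C (w 0, w 1) (0, 1) / 2) / (2 * w 5),
      -(s 4 * t 3 - t 4 * s 3) + d * n.C (w 0, w 1) / 2] := by
  obtain ⟨hD, h4, h5⟩ := hw
  have h24 : 2 * w 4 ≠ 0 := mul_ne_zero two_ne_zero h4
  have h25 : 2 * w 5 ≠ 0 := mul_ne_zero two_ne_zero h5
  have two : (2 : ℝ) ≠ 0 := two_ne_zero
  have eA := fun X => fderiv_comp_pair (i := 0) (j := 1) (v := w) (diffA hD) X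
  have eB := fun X => fderiv_comp_pair (i := 0) (j := 1) (v := w) (diffB hD) X
  have eC := fun X => fderiv_comp_pair (i := 0) (j := 1) (v := w) (diffC hD) X
  have dA : DifferentiableAt ℝ (fun w : Fin 6 → ℝ => n.A (w 0, w 1)) w :=
    (smooth_comp_pair n.isOpen_D n.smooth_A hD).diff
  have dB : DifferentiableAt ℝ (fun w : Fin 6 → ℝ => n.B (w 0, w 1)) w :=
    (smooth_comp_pair n.isOpen_D n.smooth_B hD).diff
  have dC : DifferentiableAt ℝ (fun w : Fin 6 → ℝ => n.C (w 0, w 1)) w :=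
    (smooth_comp_pair n.isOpen_D n.smooth_C hD).diff
  have split : ∀ (L : ℝ × ℝ →L[ℝ] ℝ) (a b : ℝ), L (a, b) = a * L (1, 0) + b * L (0, 1) := by
    intro L a b
    rw [← smul_eq_mul, ← smul_eq_mul, ← map_smul, ← map_smul, ← map_add]
    simp
  intro s t d
  funext a
  simp only [dForm, s, t, d]
  fin_cases a <;>
    simp only [frame, Matrix.cons_val, Fin.reduceFinMk, Fin.zero_eta, Fin.mk_one] <;>
    simp (disch := first | assumption | fun_prop (disch := assumption)) only
      [D_mul, D_const, D_coord, D_add, D_sub, D_div, D_pow, eA, eB, eC] <;>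
    (try rw [split (fderiv ℝ n.A _) (V 0), split (fderiv ℝ n.A _) (X 0)]) <;>
    (try rw [split (fderiv ℝ n.B _) (V 0), split (fderiv ℝ n.B _) (X 0)]) <;>
    (try rw [split (fderiv ℝ n.C _) (V 0), split (fderiv ℝ n.C _) (X 0)]) <;>
    field_simp <;> ring

end NormalForm

/-! ### Invariant bilinear forms on `𝔰𝔩(2, ℝ) ⊕ 𝔰𝔩(2, ℝ)` -/

/-- The commutator of `𝔰𝔩(2, ℝ)`, up to sign: the structure equations of the frame `φ` are
`dφ(V, X) = bracket (φ V) (φ X)`. -/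
def bracket (a x : Fin 3 → ℝ) : Fin 3 → ℝ :=
  ![a 2 * x 0 - x 2 * a 0, -(a 2 * x 1 - x 2 * a 1), -(a 1 * x 0 - x 1 * a 0)]

lemma bracket_self (a : Fin 3 → ℝ) : bracket a a = 0 := by
  funext i; fin_cases i <;> simp [bracket]

lemma bracket_zero_left (x : Fin 3 → ℝ) : bracket 0 x = 0 := by
  funext i; fin_cases i <;> simp [bracket]

lemma bracket_zero_right (x : Fin 3 → ℝ) : bracket x 0 = 0 := by
  funext i; fin_cases i <;> simp [bracket]

lemma bracket_bracket (a x : Fin 3 → ℝ) :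
    bracket a (bracket a x) = killing a a • x - killing a x • a := by
  funext i; fin_cases i <;> simp [bracket, killing] <;> ring

lemma killing_comm (x y : Fin 3 → ℝ) : killing x y = killing y x := by
  simp only [killing]; ring

/-- The Gram determinant of two vectors with respect to the Killing form. -/
def gram (a x : Fin 3 → ℝ) : ℝ := killing a a * killing x x - killing a x ^ 2

lemma exists_gram_ne_zero {a : Fin 3 → ℝ} (ha : a ≠ 0) : ∃ x, gram a x ≠ 0 := by
  by_cases h0 : a 0 = 0
  · by_cases h1 : a 1 = 0
    · have h2 : a 2 ≠ 0 := fun h2 => ha (by funext i; fin_cases i <;> assumption)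
      exact ⟨![1, 1, 0], by simpa [gram, killing, h0, h1] using h2⟩
    · exact ⟨![1, 0, 0], by simpa [gram, killing, h0] using h1⟩
  · exact ⟨![0, 1, 0], by simpa [gram, killing] using h0⟩

/-- When the Gram determinant of `a` and `x` is not zero, `a`, `x` and `bracket a x` are a basis. -/
lemma eq_combination {a x : Fin 3 → ℝ} (h : gram a x ≠ 0) (y : Fin 3 → ℝ) :
    y = ((killing x x * killing a y - killing a x * killing x y) / gram a x) • a
      + ((killing a a * killing x y - killing a x * killing a y) / gram a x) • x
      + (-killing (bracket a x) y / gram a x) • bracket a x := by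
  have e : gram a x • y = (killing x x * killing a y - killing a x * killing x y) • a
      + (killing a a * killing x y - killing a x * killing a y) • x
      + (-killing (bracket a x) y) • bracket a x := by
    funext i
    fin_cases i <;> simp [gram, killing, bracket] <;> ring
  have e' := congrArg (fun z => (gram a x)⁻¹ • z) e
  simp only [smul_smul, inv_mul_cancel₀ h, one_smul, smul_add] at e'
  simp only [div_eq_inv_mul]
  exact e'

/-- The form induced by the Killing form on the quotient by `a`. -/
def quotForm (a y z : Fin 3 → ℝ) : ℝ := killing y z - killing a y * killing a z / killing a a

/-- A symmetric form for which the bracket with the vector `a` of its kernel is skew. -/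
lemma invariant_eq {a x : Fin 3 → ℝ} (hx : gram a x ≠ 0)
    {q : (Fin 3 → ℝ) →ₗ[ℝ] (Fin 3 → ℝ) →ₗ[ℝ] ℝ} (hq : ∀ y z, q y z = q z y)
    (ha : ∀ y, q a y = 0) (hs : ∀ y z, q (bracket a y) z + q y (bracket a z) = 0)
    (y z : Fin 3 → ℝ) : q y z = q x x / gram a x ^ 2
      * ((killing a a * killing x y - killing a x * killing a y)
          * (killing a a * killing x z - killing a x * killing a z)
        - killing a a * (killing (bracket a x) y * killing (bracket a x) z)) := by
  have ha' : ∀ y, q y a = 0 := fun y => by rw [hq, ha]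
  have h1 : q (bracket a x) x = 0 := by
    have := hs x x
    rw [hq x] at this
    linarith
  have h1' : q x (bracket a x) = 0 := by rw [hq, h1]
  have h2 : q (bracket a x) (bracket a x) = -killing a a * q x x := by
    have := hs x (bracket a x)
    rw [bracket_bracket, map_sub, map_smul, map_smul, ha', smul_eq_mul] at this
    simp only [smul_zero, sub_zero] at this
    linarith
  rw [eq_combination hx y, eq_combination hx z]
  simp only [map_add, map_smul, LinearMap.add_apply, LinearMap.smul_apply, ha, ha', h1, h1', h2,
    smul_eq_mul]
  rw [← eq_combination hx y, ← eq_combination hx z]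
  field_simp
  ring

lemma invariant_eq_quotForm {a x : Fin 3 → ℝ} (hx : gram a x ≠ 0) (haa : killing a a ≠ 0)
    {q : (Fin 3 → ℝ) →ₗ[ℝ] (Fin 3 → ℝ) →ₗ[ℝ] ℝ} (hq : ∀ y z, q y z = q z y)
    (ha : ∀ y, q a y = 0) (hs : ∀ y z, q (bracket a y) z + q y (bracket a z) = 0)
    (y z : Fin 3 → ℝ) : q y z = q x x * killing a a / gram a x * quotForm a y z := by
  rw [invariant_eq hx hq ha hs]
  have e : (killing a a * killing x y - killing a x * killing a y)
          * (killing a a * killing x z - killing a x * killing a z)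
        - killing a a * (killing (bracket a x) y * killing (bracket a x) z)
      = gram a x * (killing a a * killing y z - killing a y * killing a z) := by
    simp only [gram, killing, bracket, Matrix.cons_val]
    ring
  rw [e, quotForm]
  field_simp

/-- The bracket of `𝔰𝔩(2, ℝ) ⊕ 𝔰𝔩(2, ℝ)`. -/
def bracket₂ (s t : Fin 6 → ℝ) : Fin 6 → ℝ :=
  slPair (bracket (fstPart s) (fstPart t)) (bracket (sndPart s) (sndPart t))

/-- The bracket with a fixed vector. -/
def adL (s : Fin 6 → ℝ) : (Fin 6 → ℝ) →ₗ[ℝ] (Fin 6 → ℝ) where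
  toFun := bracket₂ s
  map_add' t t' := by
    funext i
    fin_cases i <;> simp [bracket₂, slPair, bracket, fstPart, sndPart] <;> ring
  map_smul' c t := by
    funext i
    fin_cases i <;> simp [bracket₂, slPair, bracket, fstPart, sndPart] <;> ring

lemma adL_apply (s t : Fin 6 → ℝ) : adL s t = bracket₂ s t := rfl

lemma trace_adL (s : Fin 6 → ℝ) : LinearMap.trace ℝ _ (adL s) = 0 := by
  rw [LinearMap.trace_eq_matrix_trace ℝ (Pi.basisFun ℝ (Fin 6)), Matrix.trace]
  simp [Fin.sum_univ_six, adL, bracket₂, slPair, bracket, fstPart, sndPart]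

lemma bracket₂_comm (s t : Fin 6 → ℝ) : bracket₂ s t = -bracket₂ t s := by
  funext i
  fin_cases i <;> simp [bracket₂, slPair, bracket, fstPart, sndPart]

lemma bracket₂_self (s : Fin 6 → ℝ) : bracket₂ s s = 0 := by
  funext i
  fin_cases i <;> simp [bracket₂, slPair, bracket, fstPart, sndPart]

lemma bracket_eq_zero {a b : Fin 3 → ℝ} (h : bracket a b = 0) :
    ∃ c d : ℝ, (c ≠ 0 ∨ d ≠ 0) ∧ c • a + d • b = 0 := by
  have h0 := congrFun h 0
  have h1 := congrFun h 1
  have h2 := congrFun h 2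
  simp [bracket] at h0 h1 h2
  by_cases ha : a = 0
  · exact ⟨1, 0, Or.inl one_ne_zero, by simp [ha]⟩
  obtain ⟨i, hi⟩ : ∃ i, a i ≠ 0 := by
    by_contra hc
    push Not at hc
    exact ha (funext hc)
  refine ⟨-b i, a i, Or.inr hi, funext fun j => ?_⟩
  fin_cases i <;> fin_cases j <;> simp <;> linarith

lemma slPair_fst_snd (s : Fin 6 → ℝ) : slPair (fstPart s) (sndPart s) = s := by
  funext i; fin_cases i <;> rfl

section

variable {β : (Fin 6 → ℝ) →ₗ[ℝ] (Fin 6 → ℝ) →ₗ[ℝ] ℝ} {P : (Fin 6 → ℝ) →ₗ[ℝ] (Fin 4 → ℝ)}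
  {g : Matrix (Fin 4) (Fin 4) ℝ}

/-- A basis adapted to the pullback of a split form under a surjection: an orthonormal part and a
part in the kernel. -/
lemma exists_adapted_basis (hP : Function.Surjective P) (hg : IsSplit g)
    (hβ : ∀ s t, β s t = bil g (P s) (P t)) :
    ∃ (b : Module.Basis (Fin 4 ⊕ Fin 2) ℝ (Fin 6 → ℝ)) (ε : Fin 4 → ℝ), (∀ i, ε i ≠ 0) ∧
      (∀ i j, β (b (Sum.inl i)) (b (Sum.inl j)) = if i = j then ε i else 0) ∧
      ∀ i, P (b (Sum.inr i)) = 0 := by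
  obtain ⟨T, hT, e⟩ := hg
  choose r hr using fun i : Fin 4 => hP (fun j => T j i)
  have hrr : ∀ i j, β (r i) (r j) = if i = j then (![1, 1, -1, -1] : Fin 4 → ℝ) i else 0 := by
    intro i j
    have := congrFun (congrFun e i) j
    rw [Matrix.diagonal_apply] at this
    rw [hβ, hr, hr, ← this, bil, Matrix.mul_apply]
    simp only [Matrix.mul_apply, Matrix.transpose_apply, Finset.sum_mul]
    rw [Finset.sum_comm]
    exact Finset.sum_congr rfl fun a _ => Finset.sum_congr rfl fun b _ => by ring
  have hε : ∀ i, (![1, 1, -1, -1] : Fin 4 → ℝ) i ≠ 0 := by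
    intro i; fin_cases i <;> simp
  have hker : Module.finrank ℝ (LinearMap.ker P) = 2 := by
    have h1 := LinearMap.finrank_range_add_finrank_ker P
    rw [LinearMap.range_eq_top.2 hP, finrank_top] at h1
    simp at h1
    omega
  let v := Module.finBasisOfFinrankEq ℝ (LinearMap.ker P) hker
  have hv : ∀ i, P (v i : Fin 6 → ℝ) = 0 := fun i => (v i).2
  let f : Fin 4 ⊕ Fin 2 → (Fin 6 → ℝ) := Sum.elim r fun i => v i
  have hli : LinearIndependent ℝ f := by
    rw [Fintype.linearIndependent_iff]
    intro c hc
    rw [Fintype.sum_sum_type] at hc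
    simp only [f, Sum.elim_inl, Sum.elim_inr] at hc
    have h1 : ∀ i, c (Sum.inl i) = 0 := by
      intro i
      have := congrArg (β (r i)) hc
      rw [map_add, map_sum, map_sum, map_zero] at this
      simp only [map_smul, hrr, smul_eq_mul, mul_ite, mul_zero, Finset.sum_ite_eq,
        Finset.mem_univ, if_true, hβ _ (v _ : Fin 6 → ℝ), hv] at this
      have hz : ∀ X, bil g X 0 = 0 := fun X => by simp [bil]
      simp only [hz, mul_zero, Finset.sum_const_zero, add_zero] at this
      exact (mul_eq_zero.1 this).resolve_right (hε i)
    simp only [h1, zero_smul, Finset.sum_const_zero, zero_add] at hc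
    have h2 : ∑ i, c (Sum.inr i) • v i = 0 := by
      apply Subtype.ext
      simpa using hc
    have h3 := Fintype.linearIndependent_iff.1 v.linearIndependent _ h2
    rintro (i | i)
    · exact h1 i
    · exact h3 i
  refine ⟨basisOfLinearIndependentOfCardEqFinrank hli (by simp), _, hε, fun i j => ?_, fun i => ?_⟩
  · simpa [f] using hrr i j
  · simp [f, hv]

/-- The kernel of an invariant form of rank four is an abelian subalgebra of dimension two: for
vectors of the kernel, both the trace on the whole algebra and the trace on the quotient vanish. -/
lemma kernel_abelian (hP : Function.Surjective P) (hg : IsSplit g)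
    (hβ : ∀ s t, β s t = bil g (P s) (P t))
    (hinv : ∀ v, P v = 0 → ∀ s t, β (bracket₂ v s) t + β s (bracket₂ v t) = 0) :
    (∀ v v', P v = 0 → P v' = 0 → bracket₂ v v' = 0) ∧
      ∃ v v' : Fin 6 → ℝ, P v = 0 ∧ P v' = 0 ∧
        ∀ c d : ℝ, c • v + d • v' = 0 → c = 0 ∧ d = 0 := by
  obtain ⟨b, ε, hε, hb, hb0⟩ := exists_adapted_basis hP hg hβ
  have hz : ∀ X, bil g X 0 = 0 := fun X => by simp [bil]
  have hβ0 : ∀ v, P v = 0 → ∀ s, β s v = 0 := fun v hv s => by rw [hβ, hv, hz]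
  have hβ0' : ∀ v, P v = 0 → ∀ s, β v s = 0 := fun v hv s => by rw [hβ, hv, bil_zero_left]
  have hcoef : ∀ s i, β (b (Sum.inl i)) s = b.repr s (Sum.inl i) * ε i := by
    intro s i
    conv_lhs => rw [← b.sum_repr s]
    rw [map_sum, Fintype.sum_sum_type]
    simp only [map_smul, hb, hβ0 _ (hb0 _), smul_eq_mul, mul_ite, mul_zero, Finset.sum_ite_eq,
      Finset.mem_univ, if_true, Finset.sum_const_zero, add_zero]
  have hsymm : ∀ s t, β s t = β t s := by
    intro s t
    have h : ∀ i j, β (b i) (b j) = β (b j) (b i) := by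
      rintro (i | i) (j | j)
      · rw [hb, hb]
        by_cases h : i = j
        · rw [h]
        · rw [if_neg h, if_neg (Ne.symm h)]
      · rw [hβ0 _ (hb0 _), hβ0' _ (hb0 _)]
      · rw [hβ0 _ (hb0 _), hβ0' _ (hb0 _)]
      · rw [hβ0 _ (hb0 _), hβ0' _ (hb0 _)]
    have h' : β = β.flip := b.ext fun i => b.ext fun j => h i j
    exact congrArg (fun f => f s t) h'
  have hker : ∀ s, (∀ t, β s t = 0) → P s = 0 := fun s hs => by
    refine hg.nondeg fun Y => ?_
    obtain ⟨t, rfl⟩ := hP Y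
    rw [← hβ, hs]
  have hcl : ∀ v v', P v = 0 → P v' = 0 → P (bracket₂ v v') = 0 := fun v v' hv hv' => by
    refine hker _ fun t => ?_
    have := hinv v hv v' t
    rwa [hβ0' v' hv', add_zero] at this
  have hexp : ∀ v, P v = 0 → v = b.repr v (Sum.inr 0) • b (Sum.inr 0)
      + b.repr v (Sum.inr 1) • b (Sum.inr 1) := by
    intro v hv
    have h1 : ∀ i, b.repr v (Sum.inl i) = 0 := fun i => by
      have := hcoef v i
      rw [hβ0 v hv] at this
      exact (mul_eq_zero.1 this.symm).resolve_right (hε i)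
    conv_lhs => rw [← b.sum_repr v]
    rw [Fintype.sum_sum_type]
    simp [h1, Fin.sum_univ_two]
  have htr : ∀ v, P v = 0 → b.repr (bracket₂ v (b (Sum.inr 0))) (Sum.inr 0)
      + b.repr (bracket₂ v (b (Sum.inr 1))) (Sum.inr 1) = 0 := by
    intro v hv
    have h1 := trace_adL v
    rw [LinearMap.trace_eq_matrix_trace ℝ b, Matrix.trace, Fintype.sum_sum_type,
      Fin.sum_univ_two] at h1
    have h2 : ∀ i, b.repr (bracket₂ v (b (Sum.inl i))) (Sum.inl i) = 0 := by
      intro i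
      have h3 := hinv v hv (b (Sum.inl i)) (b (Sum.inl i))
      rw [hsymm (bracket₂ _ _), ← two_mul, hcoef] at h3
      have := (mul_eq_zero.1 h3).resolve_left two_ne_zero
      exact (mul_eq_zero.1 this).resolve_right (hε i)
    simpa [Matrix.diag_apply, LinearMap.toMatrix_apply, adL_apply, h2] using h1
  set v₀ := b (Sum.inr 0) with hv₀
  set v₁ := b (Sum.inr 1) with hv₁
  have h01 : bracket₂ v₀ v₁ = 0 := by
    have e0 := htr v₀ (hb0 0)
    have e1 := htr v₁ (hb0 1)
    rw [bracket₂_self, map_zero] at e0 e1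
    rw [bracket₂_comm, map_neg] at e1
    simp only [Finsupp.coe_zero, Pi.zero_apply, zero_add, add_zero, Finsupp.coe_neg, Pi.neg_apply,
      neg_eq_zero] at e0 e1
    rw [hexp _ (hcl v₀ v₁ (hb0 0) (hb0 1)), e0, e1]
    simp
  refine ⟨fun v v' hv hv' => ?_, v₀, v₁, hb0 0, hb0 1, fun c d hcd => ?_⟩
  · have h10 : bracket₂ v₁ v₀ = 0 := by rw [bracket₂_comm, h01, neg_zero]
    have hl : ∀ (c d : ℝ) (w : Fin 6 → ℝ), bracket₂ w (c • v₀ + d • v₁)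
        = c • bracket₂ w v₀ + d • bracket₂ w v₁ := fun c d w => by
      rw [← adL_apply, map_add, map_smul, map_smul]; rfl
    rw [hexp v hv, hexp v' hv', hl, bracket₂_comm _ v₀, bracket₂_comm _ v₁, hl, hl, bracket₂_self,
      bracket₂_self, h01, h10]
    simp
  · have h1 := congrArg b.repr hcd
    rw [map_add, map_smul, map_smul, hv₀, hv₁, b.repr_self, b.repr_self, map_zero] at h1
    constructor
    · simpa using DFunLike.congr_fun h1 (Sum.inr 0)
    · simpa using DFunLike.congr_fun h1 (Sum.inr 1)

/-- An invariant form of rank four on `𝔰𝔩(2, ℝ) ⊕ 𝔰𝔩(2, ℝ)` is the sum of two multiples of forms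
`quotForm`. -/
theorem exists_quotForm (hP : Function.Surjective P) (hg : IsSplit g)
    (hβ : ∀ s t, β s t = bil g (P s) (P t)) (hsymm : ∀ s t, β s t = β t s)
    (hinv : ∀ v, P v = 0 → ∀ s t, β (bracket₂ v s) t + β s (bracket₂ v t) = 0) :
    ∃ (a b : Fin 3 → ℝ) (c d : ℝ), killing a a ≠ 0 ∧ killing b b ≠ 0 ∧
      ∀ s t, β s t = c * quotForm a (fstPart s) (fstPart t)
        + d * quotForm b (sndPart s) (sndPart t) := by
  obtain ⟨hab, v, v', hv, hv', hind⟩ := kernel_abelian hP hg hβ hinv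
  have hβ0 : ∀ v, P v = 0 → ∀ s, β v s = 0 := fun v hv s => by rw [hβ, hv, bil_zero_left]
  have hker : ∀ s, (∀ t, β s t = 0) → P s = 0 := fun s hs => by
    refine hg.nondeg fun Y => ?_
    obtain ⟨t, rfl⟩ := hP Y
    rw [← hβ, hs]
  have h0 := hab v v' hv hv'
  have h1 : bracket (fstPart v) (fstPart v') = 0 := by
    have := congrArg fstPart h0
    rw [bracket₂, fstPart_slPair] at this
    rw [this]; funext i; fin_cases i <;> rfl
  have h2 : bracket (sndPart v) (sndPart v') = 0 := by
    have := congrArg sndPart h0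
    rw [bracket₂, sndPart_slPair] at this
    rw [this]; funext i; fin_cases i <;> rfl
  have hmem : ∀ c d : ℝ, P (c • v + d • v') = 0 := fun c d => by
    rw [map_add, map_smul, map_smul, hv, hv']; simp
  have hne : ∀ c d : ℝ, (c ≠ 0 ∨ d ≠ 0) → c • v + d • v' ≠ 0 := fun c d h h' => by
    obtain ⟨hc, hd⟩ := hind c d h'
    tauto
  have hf : ∀ c d : ℝ, fstPart (c • v + d • v') = c • fstPart v + d • fstPart v' := fun c d => by
    funext i; fin_cases i <;> rfl
  have hs : ∀ c d : ℝ, sndPart (c • v + d • v') = c • sndPart v + d • sndPart v' := fun c d => by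
    funext i; fin_cases i <;> rfl
  -- the kernel contains vectors `(a, 0)` and `(0, b)`
  obtain ⟨a, ha0, ha⟩ : ∃ a : Fin 3 → ℝ, a ≠ 0 ∧ P (slPair a 0) = 0 := by
    obtain ⟨c, d, hcd, e⟩ := bracket_eq_zero h2
    have e1 := slPair_fst_snd (c • v + d • v')
    rw [hs, e] at e1
    refine ⟨fstPart (c • v + d • v'), fun h => hne c d hcd ?_, by rw [e1]; exact hmem c d⟩
    rw [← e1, h]
    funext i; fin_cases i <;> rfl
  obtain ⟨b, hb0, hb⟩ : ∃ b : Fin 3 → ℝ, b ≠ 0 ∧ P (slPair 0 b) = 0 := by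
    obtain ⟨c, d, hcd, e⟩ := bracket_eq_zero h1
    have e1 := slPair_fst_snd (c • v + d • v')
    rw [hf, e] at e1
    refine ⟨sndPart (c • v + d • v'), fun h => hne c d hcd ?_, by rw [e1]; exact hmem c d⟩
    rw [← e1, h]
    funext i; fin_cases i <;> rfl
  let ι₁ : (Fin 3 → ℝ) →ₗ[ℝ] (Fin 6 → ℝ) :=
    { toFun := fun a => slPair a 0
      map_add' := fun a b => by funext i; fin_cases i <;> simp [slPair]
      map_smul' := fun c a => by funext i; fin_cases i <;> simp [slPair] }
  let ι₂ : (Fin 3 → ℝ) →ₗ[ℝ] (Fin 6 → ℝ) :=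
    { toFun := fun b => slPair 0 b
      map_add' := fun a b => by funext i; fin_cases i <;> simp [slPair]
      map_smul' := fun c a => by funext i; fin_cases i <;> simp [slPair] }
  have br11 : ∀ a y, bracket₂ (ι₁ a) (ι₁ y) = ι₁ (bracket a y) := fun a y => by
    simp only [bracket₂, ι₁, LinearMap.coe_mk, AddHom.coe_mk, fstPart_slPair, sndPart_slPair,
      bracket_self]
  have br12 : ∀ a y, bracket₂ (ι₁ a) (ι₂ y) = 0 := fun a y => by
    simp only [bracket₂, ι₁, ι₂, LinearMap.coe_mk, AddHom.coe_mk, fstPart_slPair, sndPart_slPair,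
      bracket_zero_left, bracket_zero_right]
    funext i; fin_cases i <;> rfl
  have br21 : ∀ a y, bracket₂ (ι₂ a) (ι₁ y) = 0 := fun a y => by
    rw [bracket₂_comm, br12, neg_zero]
  have br22 : ∀ a y, bracket₂ (ι₂ a) (ι₂ y) = ι₂ (bracket a y) := fun a y => by
    simp only [bracket₂, ι₂, LinearMap.coe_mk, AddHom.coe_mk, fstPart_slPair, sndPart_slPair,
      bracket_self]
  have hsum : ∀ s, s = ι₁ (fstPart s) + ι₂ (sndPart s) := fun s => by
    funext i; fin_cases i <;> simp [ι₁, ι₂, slPair, fstPart, sndPart]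
  obtain ⟨x, hx⟩ := exists_gram_ne_zero ha0
  obtain ⟨y, hy⟩ := exists_gram_ne_zero hb0
  let q₁ := β.compl₁₂ ι₁ ι₁
  let q₂ := β.compl₁₂ ι₂ ι₂
  have q₁s : ∀ y z, q₁ y z = q₁ z y := fun y z => hsymm _ _
  have q₂s : ∀ y z, q₂ y z = q₂ z y := fun y z => hsymm _ _
  have q₁a : ∀ y, q₁ a y = 0 := fun y => hβ0 _ ha _
  have q₂b : ∀ y, q₂ b y = 0 := fun y => hβ0 _ hb _
  have q₁i : ∀ y z, q₁ (bracket a y) z + q₁ y (bracket a z) = 0 := fun y z => by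
    have := hinv _ ha (ι₁ y) (ι₁ z)
    rwa [show slPair a 0 = ι₁ a from rfl, br11, br11] at this
  have q₂i : ∀ y z, q₂ (bracket b y) z + q₂ y (bracket b z) = 0 := fun y z => by
    have := hinv _ hb (ι₂ y) (ι₂ z)
    rwa [show slPair 0 b = ι₂ b from rfl, br22, br22] at this
  have m₁ : ∀ y z, β (ι₁ (bracket a y)) (ι₂ z) = 0 := fun y z => by
    have := hinv _ ha (ι₁ y) (ι₂ z)
    rw [show slPair a 0 = ι₁ a from rfl, br11, br12, map_zero, add_zero] at this
    exact this
  have m₂ : ∀ y z, β (ι₂ (bracket b y)) (ι₁ z) = 0 := fun y z => by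
    have := hinv _ hb (ι₂ y) (ι₁ z)
    rw [show slPair 0 b = ι₂ b from rfl, br22, br21, map_zero, add_zero] at this
    exact this
  -- a null vector `a` would put `bracket a x` into the kernel
  have haa : killing a a ≠ 0 := by
    intro h
    have e1 : P (ι₁ (bracket a x)) = 0 := by
      refine hker _ fun t => ?_
      rw [hsum t, map_add, m₁, add_zero]
      have := invariant_eq hx q₁s q₁a q₁i (bracket a x) (fstPart t)
      rw [h] at this
      have e2 : killing a (bracket a x) = 0 := by simp [killing, bracket]; ring
      rw [e2] at this
      simpa [q₁] using this
    have e3 := hab _ _ ha e1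
    rw [show slPair a 0 = ι₁ a from rfl, br11, bracket_bracket, h] at e3
    have e4 : killing a x ≠ 0 := fun h' => hx (by simp [gram, h, h'])
    refine ha0 (funext fun i => ?_)
    have e5 := congrFun (congrArg fstPart e3) i
    simp only [ι₁, LinearMap.coe_mk, AddHom.coe_mk, fstPart_slPair] at e5
    rw [show fstPart 0 i = 0 by fin_cases i <;> rfl] at e5
    simpa [e4] using e5
  have hbb : killing b b ≠ 0 := by
    intro h
    have e1 : P (ι₂ (bracket b y)) = 0 := by
      refine hker _ fun t => ?_
      rw [hsum t, map_add, m₂, zero_add]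
      have := invariant_eq hy q₂s q₂b q₂i (bracket b y) (sndPart t)
      rw [h] at this
      have e2 : killing b (bracket b y) = 0 := by simp [killing, bracket]; ring
      rw [e2] at this
      simpa [q₂] using this
    have e3 := hab _ _ hb e1
    rw [show slPair 0 b = ι₂ b from rfl, br22, bracket_bracket, h] at e3
    have e4 : killing b y ≠ 0 := fun h' => hy (by simp [gram, h, h'])
    refine hb0 (funext fun i => ?_)
    have e5 := congrFun (congrArg sndPart e3) i
    simp only [ι₂, LinearMap.coe_mk, AddHom.coe_mk, sndPart_slPair] at e5
    rw [show sndPart 0 i = 0 by fin_cases i <;> rfl] at e5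
    simpa [e4] using e5
  have hcross : ∀ z w, β (ι₁ z) (ι₂ w) = 0 := fun z w => by
    have e : z = (killing a a)⁻¹ • (bracket a (bracket a z) + killing a z • a) := by
      rw [bracket_bracket, sub_add_cancel, smul_smul, inv_mul_cancel₀ haa, one_smul]
    rw [e, map_smul, map_add, map_smul, map_smul, map_add, map_smul, LinearMap.smul_apply,
      LinearMap.add_apply, LinearMap.smul_apply, m₁, hβ0 (ι₁ a) ha]
    simp
  refine ⟨a, b, q₁ x x * killing a a / gram a x, q₂ y y * killing b b / gram b y, haa, hbb,
    fun s t => ?_⟩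
  rw [← invariant_eq_quotForm hx haa q₁s q₁a q₁i, ← invariant_eq_quotForm hy hbb q₂s q₂b q₂i]
  conv_lhs => rw [hsum s, hsum t]
  rw [map_add, map_add, LinearMap.add_apply, LinearMap.add_apply, hcross,
    hsymm (ι₂ _) (ι₁ _), hcross]
  simp [q₁, q₂]

end

/-! ### Naturality of the Ricci tensor -/

section MatrixCalculus

variable {k : ℕ} {m n p : Type*} {z : Fin k → ℝ}

/-- The entrywise partial derivative of a matrix-valued function. -/
def pdM (i : Fin k) (f : (Fin k → ℝ) → Matrix m n ℝ) (z : Fin k → ℝ) : Matrix m n ℝ :=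
  Matrix.of fun a b => pd i (fun w => f w a b) z

lemma pd_sum {ι : Type*} (s : Finset ι) {f : ι → (Fin k → ℝ) → ℝ}
    (hf : ∀ i ∈ s, Smooth (f i) z) (j : Fin k) :
    pd j (fun w => ∑ i ∈ s, f i w) z = ∑ i ∈ s, pd j (f i) z :=
  fderiv_sum_apply s hf _

lemma pdM_mul [Fintype n] {f : (Fin k → ℝ) → Matrix m n ℝ} {g : (Fin k → ℝ) → Matrix n p ℝ}
    (hf : ∀ a b, Smooth (fun w => f w a b) z) (hg : ∀ a b, Smooth (fun w => g w a b) z)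
    (i : Fin k) : pdM i (fun w => f w * g w) z = pdM i f z * g z + f z * pdM i g z := by
  ext a b
  simp only [pdM, Matrix.of_apply, Matrix.mul_apply, Matrix.add_apply]
  rw [pd_sum _ fun c _ => (hf a c).mul (hg c b), ← Finset.sum_add_distrib]
  refine Finset.sum_congr rfl fun c _ => ?_
  rw [pd_mul (hf a c) (hg c b)]
  ring

lemma pdM_add {f g : (Fin k → ℝ) → Matrix m n ℝ}
    (hf : ∀ a b, Smooth (fun w => f w a b) z) (hg : ∀ a b, Smooth (fun w => g w a b) z)
    (i : Fin k) : pdM i (fun w => f w + g w) z = pdM i f z + pdM i g z := by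
  ext a b
  exact pd_add (hf a b) (hg a b) i

lemma pdM_congr {f g : (Fin k → ℝ) → Matrix m n ℝ} (h : f =ᶠ[𝓝 z] g) (i : Fin k) :
    pdM i f z = pdM i g z := by
  ext a b
  exact pd_congr (h.fun_comp fun M => M a b) i

variable [Fintype n] [DecidableEq n]

lemma smooth_det {f : (Fin k → ℝ) → Matrix n n ℝ} (hf : ∀ a b, Smooth (fun w => f w a b) z) :
    Smooth (fun w => (f w).det) z := by
  simp only [Matrix.det_apply, Units.smul_def, zsmul_eq_mul]
  exact ContDiffAt.sum fun σ _ => contDiffAt_const.mul (contDiffAt_prod fun i _ => hf _ _)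

lemma smooth_inv {f : (Fin k → ℝ) → Matrix n n ℝ} (hf : ∀ a b, Smooth (fun w => f w a b) z)
    (h0 : (f z).det ≠ 0) (a b : n) : Smooth (fun w => (f w)⁻¹ a b) z := by
  simp only [Matrix.inv_def, Matrix.smul_apply, Ring.inverse_eq_inv', smul_eq_mul,
    Matrix.adjugate_apply]
  refine ((smooth_det hf).inv h0).mul (smooth_det fun c d => ?_)
  by_cases h : c = b
  · subst h
    simp only [Matrix.updateRow_self]
    exact contDiffAt_const
  · simp only [Matrix.updateRow_ne h]
    exact hf c d

end MatrixCalculus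

section Christoffel

variable {g : (Fin 4 → ℝ) → Matrix (Fin 4) (Fin 4) ℝ} {z : Fin 4 → ℝ}

/-- The Christoffel symbol of the first kind `Γₗᵢⱼ`. -/
def christoffelFst (g : (Fin 4 → ℝ) → Matrix (Fin 4) (Fin 4) ℝ) (l i j : Fin 4)
    (z : Fin 4 → ℝ) : ℝ :=
  (1 / 2) * (pd i (fun w => g w j l) z + pd j (fun w => g w i l) z - pd l (fun w => g w i j) z)

lemma christoffel_eq (g : (Fin 4 → ℝ) → Matrix (Fin 4) (Fin 4) ℝ) (k i j : Fin 4)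
    (z : Fin 4 → ℝ) : christoffel g k i j z = ∑ l, (g z)⁻¹ k l * christoffelFst g l i j z := by
  rw [christoffel, Finset.mul_sum]
  exact Finset.sum_congr rfl fun l _ => by rw [christoffelFst]; ring

lemma mulVec_christoffel (h : (g z).det ≠ 0) (i j : Fin 4) :
    (g z).mulVec (fun k => christoffel g k i j z) = fun l => christoffelFst g l i j z := by
  have : (fun k => christoffel g k i j z)
      = (g z)⁻¹.mulVec fun l => christoffelFst g l i j z := by
    funext k
    rw [christoffel_eq]
    rfl
  rw [this, Matrix.mulVec_mulVec, Matrix.mul_nonsing_inv _ h.isUnit, Matrix.one_mulVec]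

lemma christoffel_symm (h : ∀ᶠ w in 𝓝 z, (g w).IsSymm) (k i j : Fin 4) :
    christoffel g k i j z = christoffel g k j i z := by
  rw [christoffel_eq, christoffel_eq]
  refine Finset.sum_congr rfl fun l _ => ?_
  have e : pd l (fun w => g w i j) z = pd l (fun w => g w j i) z :=
    pd_congr (h.mono fun w hw => hw.apply j i) l
  rw [christoffelFst, christoffelFst, e]
  ring

lemma smooth_christoffel (hg : ∀ i j, Smooth (fun w => g w i j) z) (h : (g z).det ≠ 0)
    (k i j : Fin 4) : Smooth (christoffel g k i j) z := by
  have : christoffel g k i j = fun z => ∑ l, (g z)⁻¹ k l * christoffelFst g l i j z :=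
    funext fun z => christoffel_eq g k i j z
  rw [this]
  exact ContDiffAt.sum fun l _ => (smooth_inv hg h k l).mul
    (contDiffAt_const.mul ((((hg j l).pd i).add ((hg i l).pd j)).sub ((hg i j).pd l)))

/-- The matrix `Γᵏⱼᵢ`, with rows `k` and columns `j`, of the connection in the direction `i`. -/
def conn (g : (Fin 4 → ℝ) → Matrix (Fin 4) (Fin 4) ℝ) (i : Fin 4) (z : Fin 4 → ℝ) :
    Matrix (Fin 4) (Fin 4) ℝ := Matrix.of fun k j => christoffel g k j i z

/-- The curvature of the connection with matrices `A`, in the directions `i`, `j`. -/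
def curv (A : Fin 4 → (Fin 4 → ℝ) → Matrix (Fin 4) (Fin 4) ℝ) (i j : Fin 4) (z : Fin 4 → ℝ) :
    Matrix (Fin 4) (Fin 4) ℝ :=
  pdM i (A j) z - pdM j (A i) z + (A i z * A j z - A j z * A i z)

lemma ricci_eq (h : ∀ᶠ w in 𝓝 z, (g w).IsSymm) (i j : Fin 4) :
    ricci g i j z = ∑ k, curv (conn g) k j z k i := by
  refine Finset.sum_congr rfl fun k _ => ?_
  simp only [curv, Matrix.add_apply, Matrix.sub_apply, Matrix.mul_apply, pdM, conn,
    Matrix.of_apply, ← Finset.sum_sub_distrib]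
  congr 1
  refine Finset.sum_congr rfl fun l _ => ?_
  rw [christoffel_symm h k k l, christoffel_symm h k j l]

end Christoffel

section Pullback

variable {G H : (Fin 4 → ℝ) → Matrix (Fin 4) (Fin 4) ℝ} {ψ : (Fin 4 → ℝ) → (Fin 4 → ℝ)}
  {O : Set (Fin 4 → ℝ)}

/-- The Jacobian matrix. -/
def jac (ψ : (Fin 4 → ℝ) → (Fin 4 → ℝ)) (z : Fin 4 → ℝ) : Matrix (Fin 4) (Fin 4) ℝ :=
  Matrix.of fun a i => pd i (fun w => ψ w a) z

lemma fderiv_eq_jac {z : Fin 4 → ℝ} (hψ : Smooth ψ z) (X : Fin 4 → ℝ) :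
    fderiv ℝ ψ z X = (jac ψ z).mulVec X := by
  funext a
  rw [NormalForm.fderiv_pi_apply hψ, fderiv_eq_sum_pd]
  exact Finset.sum_congr rfl fun i _ => mul_comm _ _

lemma bil_eq_dotProduct {n : ℕ} (Q : Matrix (Fin n) (Fin n) ℝ) (X Y : Fin n → ℝ) :
    bil Q X Y = dotProduct X (Q.mulVec Y) := by
  simp only [bil, dotProduct, Matrix.mulVec, Finset.mul_sum]
  exact Finset.sum_congr rfl fun a _ => Finset.sum_congr rfl fun b _ => by ring

/-- A local isometry `ψ` from `G` to `H`, on the open set `O`. -/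
structure IsometryOn (G H : (Fin 4 → ℝ) → Matrix (Fin 4) (Fin 4) ℝ)
    (ψ : (Fin 4 → ℝ) → (Fin 4 → ℝ)) (O : Set (Fin 4 → ℝ)) : Prop where
  isOpen : IsOpen O
  smooth : ∀ z ∈ O, Smooth ψ z
  smoothG : ∀ z ∈ O, ∀ i j, Smooth (fun w => G w i j) z
  smoothH : ∀ z ∈ O, ∀ i j, Smooth (fun w => H w i j) (ψ z)
  symm : ∀ z, (H z).IsSymm
  det_ne : ∀ z ∈ O, (G z).det ≠ 0
  pull : ∀ z ∈ O, ∀ X Y, bil (G z) X Y = bil (H (ψ z)) (fderiv ℝ ψ z X) (fderiv ℝ ψ z Y)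

namespace IsometryOn

variable (h : IsometryOn G H ψ O)
include h

lemma eq_mul : ∀ z ∈ O, G z = (jac ψ z).transpose * H (ψ z) * jac ψ z := by
  intro z hz
  ext i j
  have e := h.pull z hz (Pi.single i 1) (Pi.single j 1)
  rw [fderiv_eq_jac (h.smooth z hz), fderiv_eq_jac (h.smooth z hz), bil_eq_dotProduct,
    bil_eq_dotProduct] at e
  simp only [Matrix.mulVec_single_one, single_one_dotProduct, Matrix.col_apply] at e
  rw [e, Matrix.mul_assoc]
  rfl

lemma det_eq {z : Fin 4 → ℝ} (hz : z ∈ O) :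
    (G z).det = (jac ψ z).det * (H (ψ z)).det * (jac ψ z).det := by
  rw [h.eq_mul z hz, Matrix.det_mul, Matrix.det_mul, Matrix.det_transpose]

lemma det_jac {z : Fin 4 → ℝ} (hz : z ∈ O) : (jac ψ z).det ≠ 0 := fun h0 =>
  h.det_ne z hz (by rw [h.det_eq hz, h0, mul_zero])

lemma det_H {z : Fin 4 → ℝ} (hz : z ∈ O) : (H (ψ z)).det ≠ 0 := fun h0 =>
  h.det_ne z hz (by rw [h.det_eq hz, h0, mul_zero, zero_mul])

lemma symmG {z : Fin 4 → ℝ} (hz : z ∈ O) : ∀ᶠ w in 𝓝 z, (G w).IsSymm := by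
  filter_upwards [h.isOpen.mem_nhds hz] with w hw
  rw [h.eq_mul w hw, Matrix.IsSymm, Matrix.transpose_mul, Matrix.transpose_mul,
    Matrix.transpose_transpose, (h.symm _).eq, Matrix.mul_assoc]

lemma smooth_apply {z : Fin 4 → ℝ} (hz : z ∈ O) (a : Fin 4) : Smooth (fun w => ψ w a) z :=
  smooth_pi.1 (h.smooth z hz) a

lemma smooth_jac {z : Fin 4 → ℝ} (hz : z ∈ O) (a i : Fin 4) : Smooth (fun w => jac ψ w a i) z :=
  (h.smooth_apply hz a).pd i

lemma pd_comp' {z : Fin 4 → ℝ} (hz : z ∈ O) {f : (Fin 4 → ℝ) → ℝ} (hf : Smooth f (ψ z))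
    (i : Fin 4) : pd i (fun w => f (ψ w)) z = ∑ a, jac ψ z a i * pd a f (ψ z) :=
  pd_comp hf.diff (fun a => (h.smooth_apply hz a).diff) i

/-- The second derivatives of `ψ` are symmetric. -/
lemma pd_jac_symm {z : Fin 4 → ℝ} (hz : z ∈ O) (a i j : Fin 4) :
    pd i (fun w => jac ψ w a j) z = pd j (fun w => jac ψ w a i) z :=
  pd_comm (h.smooth_apply hz a) i j

lemma pd_G {z : Fin 4 → ℝ} (hz : z ∈ O) (i j l : Fin 4) : pd i (fun w => G w j l) z
    = (∑ a, ∑ b, ∑ c, jac ψ z a i * jac ψ z b j * jac ψ z c l * pd a (fun w => H w b c) (ψ z))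
      + (∑ b, ∑ c, H (ψ z) b c * pd i (fun w => jac ψ w b j) z * jac ψ z c l)
      + ∑ b, ∑ c, H (ψ z) b c * pd i (fun w => jac ψ w b l) z * jac ψ z c j := by
  have e : (fun w => G w j l) =ᶠ[𝓝 z]
      fun w => ∑ b, ∑ c, H (ψ w) b c * jac ψ w b j * jac ψ w c l := by
    filter_upwards [h.isOpen.mem_nhds hz] with w hw
    rw [h.eq_mul w hw]
    simp only [Matrix.mul_apply, Matrix.transpose_apply, Finset.sum_mul]
    rw [Finset.sum_comm]
    exact Finset.sum_congr rfl fun b _ => Finset.sum_congr rfl fun c _ => by ring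
  have sH : ∀ b c, Smooth (fun w => H (ψ w) b c) z := fun b c =>
    ContDiffAt.comp (f := ψ) (g := fun y => H y b c) z (h.smoothH z hz b c) (h.smooth z hz)
  have sJ := fun a i => h.smooth_jac hz a i
  have s1 : ∀ b c, Smooth (fun w => H (ψ w) b c * jac ψ w b j * jac ψ w c l) z := fun b c =>
    ((sH b c).mul (sJ b j)).mul (sJ c l)
  rw [pd_congr e, pd_sum _ fun b _ => ContDiffAt.sum fun c _ => s1 b c]
  have e2 : ∑ b, ∑ c, H (ψ z) b c * pd i (fun w => jac ψ w b l) z * jac ψ z c j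
      = ∑ b, ∑ c, H (ψ z) b c * jac ψ z b j * pd i (fun w => jac ψ w c l) z := by
    rw [Finset.sum_comm]
    refine Finset.sum_congr rfl fun b _ => Finset.sum_congr rfl fun c _ => ?_
    rw [(h.symm (ψ z)).apply]
    ring
  have e3 : ∑ a, ∑ b, ∑ c,
        jac ψ z a i * jac ψ z b j * jac ψ z c l * pd a (fun w => H w b c) (ψ z)
      = ∑ b, ∑ c, ∑ a,
        jac ψ z a i * jac ψ z b j * jac ψ z c l * pd a (fun w => H w b c) (ψ z) := by
    rw [Finset.sum_comm]
    exact Finset.sum_congr rfl fun b _ => Finset.sum_comm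
  rw [e2, e3, ← Finset.sum_add_distrib, ← Finset.sum_add_distrib]
  refine Finset.sum_congr rfl fun b _ => ?_
  rw [pd_sum _ fun c _ => s1 b c, ← Finset.sum_add_distrib, ← Finset.sum_add_distrib]
  refine Finset.sum_congr rfl fun c _ => ?_
  rw [pd_mul ((sH b c).mul (sJ b j)) (sJ c l), pd_mul (sH b c) (sJ b j),
    h.pd_comp' hz (h.smoothH z hz b c)]
  have e4 : ∑ a, jac ψ z a i * jac ψ z b j * jac ψ z c l * pd a (fun w => H w b c) (ψ z)
      = jac ψ z b j * jac ψ z c l * ∑ a, jac ψ z a i * pd a (fun w => H w b c) (ψ z) := by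
    rw [Finset.mul_sum]
    exact Finset.sum_congr rfl fun a _ => by ring
  rw [e4]
  ring

/-- The Christoffel symbols of the first kind under a change of coordinates. -/
lemma christoffelFst_eq {z : Fin 4 → ℝ} (hz : z ∈ O) (l i j : Fin 4) : christoffelFst G l i j z
    = ∑ c, ∑ b, H (ψ z) b c * (pd i (fun w => jac ψ w b j) z) * jac ψ z c l
      + ∑ c, (∑ a, ∑ b, christoffelFst H c a b (ψ z) * jac ψ z a i * jac ψ z b j)
        * jac ψ z c l := by
  rw [christoffelFst, h.pd_G hz i j l, h.pd_G hz j i l, h.pd_G hz l i j]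
  simp only [fun a => h.pd_jac_symm hz a j i, fun a => h.pd_jac_symm hz a l i,
    fun a => h.pd_jac_symm hz a l j]
  have e1 : ∑ c, (∑ a, ∑ b, christoffelFst H c a b (ψ z) * jac ψ z a i * jac ψ z b j)
        * jac ψ z c l
      = (1 / 2) * ((∑ a, ∑ b, ∑ c, jac ψ z a i * jac ψ z b j * jac ψ z c l
            * pd a (fun w => H w b c) (ψ z))
        + (∑ a, ∑ b, ∑ c, jac ψ z a j * jac ψ z b i * jac ψ z c l
            * pd a (fun w => H w b c) (ψ z))
        - ∑ a, ∑ b, ∑ c, jac ψ z a l * jac ψ z b i * jac ψ z c j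
            * pd a (fun w => H w b c) (ψ z)) := by
    have f1 : ∑ a, ∑ b, ∑ c, jac ψ z a i * jac ψ z b j * jac ψ z c l
            * pd a (fun w => H w b c) (ψ z)
        = ∑ c, ∑ a, ∑ b, jac ψ z a i * jac ψ z b j * jac ψ z c l
            * pd a (fun w => H w b c) (ψ z) := by
      rw [Finset.sum_congr rfl fun b _ => Finset.sum_comm, Finset.sum_comm]
    have f2 : ∑ a, ∑ b, ∑ c, jac ψ z a j * jac ψ z b i * jac ψ z c l
            * pd a (fun w => H w b c) (ψ z)
        = ∑ c, ∑ a, ∑ b, jac ψ z b j * jac ψ z a i * jac ψ z c l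
            * pd b (fun w => H w a c) (ψ z) := by
      rw [Finset.sum_congr rfl fun b _ => Finset.sum_comm, Finset.sum_comm]
      exact Finset.sum_congr rfl fun c _ => Finset.sum_comm
    rw [f1, f2, ← Finset.sum_add_distrib, ← Finset.sum_sub_distrib, Finset.mul_sum]
    refine Finset.sum_congr rfl fun c _ => ?_
    rw [Finset.sum_mul, ← Finset.sum_add_distrib, ← Finset.sum_sub_distrib, Finset.mul_sum]
    refine Finset.sum_congr rfl fun a _ => ?_
    rw [Finset.sum_mul, ← Finset.sum_add_distrib, ← Finset.sum_sub_distrib, Finset.mul_sum]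
    refine Finset.sum_congr rfl fun b _ => ?_
    rw [christoffelFst]
    ring
  rw [e1, Finset.sum_comm (f := fun c b => H (ψ z) b c * (pd i (fun w => jac ψ w b j) z)
    * jac ψ z c l)]
  ring

/-- The connection matrices of the pullback. -/
lemma jac_mul_conn {z : Fin 4 → ℝ} (hz : z ∈ O) (i : Fin 4) :
    jac ψ z * conn G i z
      = pdM i (jac ψ) z + (∑ b, jac ψ z b i • conn H b (ψ z)) * jac ψ z := by
  have hM : ((jac ψ z).transpose * H (ψ z)).det ≠ 0 := by
    rw [Matrix.det_mul, Matrix.det_transpose]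
    exact mul_ne_zero (h.det_jac hz) (h.det_H hz)
  ext a j
  have key : (jac ψ z).mulVec (fun k => christoffel G k j i z)
      = (fun a => pd j (fun w => jac ψ w a i) z)
        + ∑ b, ∑ c, (jac ψ z b j * jac ψ z c i) • fun a => christoffel H a b c (ψ z) := by
    apply Matrix.mulVec_injective_of_isUnit ((Matrix.isUnit_iff_isUnit_det _).2 hM.isUnit)
    rw [Matrix.mulVec_mulVec, ← h.eq_mul z hz, mulVec_christoffel (h.det_ne z hz),
      ← Matrix.mulVec_mulVec, Matrix.mulVec_add]
    have e : (H (ψ z)).mulVec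
          (∑ b, ∑ c, (jac ψ z b j * jac ψ z c i) • fun a => christoffel H a b c (ψ z))
        = ∑ b, ∑ c, (jac ψ z b j * jac ψ z c i) • fun a => christoffelFst H a b c (ψ z) := by
      simp only [← Matrix.mulVecLin_apply, map_sum, map_smul]
      simp only [Matrix.mulVecLin_apply, mulVec_christoffel (h.det_H hz)]
    rw [e]
    funext l
    rw [h.christoffelFst_eq hz, ← Finset.sum_add_distrib]
    simp only [Matrix.mulVec, dotProduct, Matrix.transpose_apply]
    refine Finset.sum_congr rfl fun c _ => ?_
    rw [Pi.add_apply, mul_add, ← Finset.sum_mul, mul_comm _ (jac ψ z c l), mul_comm _ (jac ψ z c l)]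
    congr 2
    · simp only [Matrix.mulVec, dotProduct]
      exact Finset.sum_congr rfl fun b _ => by rw [(h.symm (ψ z)).apply]
    · simp only [Finset.sum_apply, Pi.smul_apply, smul_eq_mul]
      exact Finset.sum_congr rfl fun a _ => Finset.sum_congr rfl fun b _ => by ring
  have e := congrFun key a
  simp only [Matrix.mulVec, dotProduct, Pi.add_apply, Finset.sum_apply, Pi.smul_apply,
    smul_eq_mul] at e
  simp only [Matrix.mul_apply, conn, Matrix.of_apply, Matrix.add_apply, pdM, Matrix.sum_apply,
    Matrix.smul_apply, smul_eq_mul]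
  rw [e, h.pd_jac_symm hz a i j]
  congr 1
  refine Finset.sum_congr rfl fun c _ => ?_
  rw [Finset.sum_mul]
  exact Finset.sum_congr rfl fun b _ => by ring

lemma smooth_conn_G {z : Fin 4 → ℝ} (hz : z ∈ O) (i a b : Fin 4) :
    Smooth (fun w => conn G i w a b) z :=
  smooth_christoffel (h.smoothG z hz) (h.det_ne z hz) _ _ _

lemma smooth_conn_H {z : Fin 4 → ℝ} (hz : z ∈ O) (i a b : Fin 4) :
    Smooth (fun w => conn H i w a b) (ψ z) :=
  smooth_christoffel (h.smoothH z hz) (h.det_H hz) _ _ _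

/-- The curvature of the pullback, as a matrix. -/
lemma jac_mul_curv {z : Fin 4 → ℝ} (hz : z ∈ O) (i j : Fin 4) :
    jac ψ z * curv (conn G) i j z
      = (∑ b, ∑ c, (jac ψ z b i * jac ψ z c j) • curv (conn H) b c (ψ z)) * jac ψ z := by
  let B : Fin 4 → (Fin 4 → ℝ) → Matrix (Fin 4) (Fin 4) ℝ :=
    fun i z => ∑ b, jac ψ z b i • conn H b (ψ z)
  have sJ := fun a i => h.smooth_jac hz a i
  have sA := fun i a b => h.smooth_conn_G hz i a b
  have sH : ∀ i a b, Smooth (fun w => conn H i (ψ w) a b) z := fun i a b =>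
    ContDiffAt.comp (f := ψ) (g := fun y => conn H i y a b) z (h.smooth_conn_H hz i a b)
      (h.smooth z hz)
  have hBe : ∀ i w a b, B i w a b = ∑ c, jac ψ w c i * conn H c (ψ w) a b := fun i w a b => by
    simp only [B, Matrix.sum_apply, Matrix.smul_apply, smul_eq_mul]
  have sB : ∀ i a b, Smooth (fun w => B i w a b) z := fun i a b => by
    simp only [hBe]
    exact ContDiffAt.sum fun c _ => (sJ c i).mul (sH c a b)
  have sD : ∀ i a b, Smooth (fun w => pdM i (jac ψ) w a b) z := fun i a b => (sJ a b).pd i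
  have g0 : ∀ i, jac ψ z * conn G i z = pdM i (jac ψ) z + B i z * jac ψ z :=
    fun i => h.jac_mul_conn hz i
  have g1 : ∀ i j, pdM i (jac ψ) z * conn G j z + jac ψ z * pdM i (conn G j) z
      = pdM i (pdM j (jac ψ)) z + (pdM i (B j) z * jac ψ z + B j z * pdM i (jac ψ) z) := by
    intro i j
    rw [← pdM_mul sJ (sA j), ← pdM_mul (sB j) sJ, ← pdM_add (sD j) fun a b => ?_]
    · refine pdM_congr ?_ i
      filter_upwards [h.isOpen.mem_nhds hz] with w hw using h.jac_mul_conn hw j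
    · simp only [Matrix.mul_apply]
      exact ContDiffAt.sum fun c _ => (sB j a c).mul (sJ c b)
  have hDD : pdM i (pdM j (jac ψ)) z = pdM j (pdM i (jac ψ)) z := by
    ext a b
    exact pd_comm (sJ a b) i j
  have hB : ∀ i j, pdM i (B j) z = ∑ c, pd i (fun w => jac ψ w c j) z • conn H c (ψ z)
      + ∑ c, ∑ b, (jac ψ z b i * jac ψ z c j) • pdM b (conn H c) (ψ z) := by
    intro i j
    ext a d
    have e : (fun w => B j w a d) = fun w => ∑ c, jac ψ w c j * conn H c (ψ w) a d :=
      funext fun w => hBe j w a d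
    simp only [pdM, Matrix.of_apply, e, Matrix.add_apply, Matrix.sum_apply, Matrix.smul_apply,
      smul_eq_mul]
    rw [pd_sum _ fun c _ => (sJ c j).mul (sH c a d), ← Finset.sum_add_distrib]
    refine Finset.sum_congr rfl fun c _ => ?_
    rw [pd_mul (sJ c j) (sH c a d), h.pd_comp' hz (h.smooth_conn_H hz c a d), Finset.mul_sum,
      add_comm, mul_comm]
    congr 1
    exact Finset.sum_congr rfl fun b _ => by ring
  have hBB : ∀ i j, B i z * B j z
      = ∑ b, ∑ c, (jac ψ z b i * jac ψ z c j) • (conn H b (ψ z) * conn H c (ψ z)) := by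
    intro i j
    simp only [B, Finset.sum_mul, Finset.mul_sum, Matrix.smul_mul, Matrix.mul_smul, smul_smul]
    rw [Finset.sum_comm]
    exact Finset.sum_congr rfl fun b _ => Finset.sum_congr rfl fun c _ => by rw [mul_comm]
  have hcurv : pdM i (B j) z - pdM j (B i) z + (B i z * B j z - B j z * B i z)
      = ∑ b, ∑ c, (jac ψ z b i * jac ψ z c j) • curv (conn H) b c (ψ z) := by
    have e1 : ∑ c, pd i (fun w => jac ψ w c j) z • conn H c (ψ z)
        = ∑ c, pd j (fun w => jac ψ w c i) z • conn H c (ψ z) :=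
      Finset.sum_congr rfl fun c _ => by rw [h.pd_jac_symm hz c i j]
    rw [hB, hB, hBB, hBB, e1, Finset.sum_comm (f := fun c b => (jac ψ z b i * jac ψ z c j)
        • pdM b (conn H c) (ψ z)), add_sub_add_left_eq_sub,
      Finset.sum_comm (f := fun b c => (jac ψ z b j * jac ψ z c i)
        • (conn H b (ψ z) * conn H c (ψ z))), ← Finset.sum_sub_distrib, ← Finset.sum_sub_distrib,
      ← Finset.sum_add_distrib]
    refine Finset.sum_congr rfl fun b _ => ?_
    rw [← Finset.sum_sub_distrib, ← Finset.sum_sub_distrib, ← Finset.sum_add_distrib]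
    refine Finset.sum_congr rfl fun c _ => ?_
    rw [curv, smul_add, smul_sub, smul_sub, mul_comm (jac ψ z c j)]
  rw [← hcurv]
  have c1 := g1 i j
  have c2 := g1 j i
  have k1 : jac ψ z * (conn G i z * conn G j z)
      = pdM i (jac ψ) z * conn G j z + B i z * (pdM j (jac ψ) z + B j z * jac ψ z) := by
    rw [← Matrix.mul_assoc, g0, add_mul, Matrix.mul_assoc, g0]
  have k2 : jac ψ z * (conn G j z * conn G i z)
      = pdM j (jac ψ) z * conn G i z + B j z * (pdM i (jac ψ) z + B i z * jac ψ z) := by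
    rw [← Matrix.mul_assoc, g0, add_mul, Matrix.mul_assoc, g0]
  rw [hDD] at c1
  rw [curv, mul_add, mul_sub, mul_sub, k1, k2, eq_sub_of_add_eq' c1, eq_sub_of_add_eq' c2]
  noncomm_ring

/-- The Ricci tensor of the pullback is the pullback of the Ricci tensor. -/
theorem ricci_eq {z : Fin 4 → ℝ} (hz : z ∈ O) (i j : Fin 4) : ricci G i j z
    = ∑ a, ∑ b, jac ψ z a i * jac ψ z b j * ricci H a b (ψ z) := by
  have hJ := (h.det_jac hz).isUnit
  have hc : ∀ k, curv (conn G) k j z = (jac ψ z)⁻¹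
      * ((∑ b, ∑ c, (jac ψ z b k * jac ψ z c j) • curv (conn H) b c (ψ z)) * jac ψ z) := by
    intro k
    rw [← h.jac_mul_curv hz, ← Matrix.mul_assoc, Matrix.nonsing_inv_mul _ hJ, Matrix.one_mul]
  have hd : ∀ a b, ∑ k, (jac ψ z)⁻¹ k a * jac ψ z b k = if b = a then 1 else 0 := by
    intro a b
    have := congrFun (congrFun (Matrix.mul_nonsing_inv _ hJ) b) a
    rw [Matrix.mul_apply, Matrix.one_apply] at this
    rw [← this]
    exact Finset.sum_congr rfl fun k _ => mul_comm _ _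
  rw [ThirdOrderODE.ricci_eq (h.symmG hz)]
  simp only [ThirdOrderODE.ricci_eq (Eventually.of_forall h.symm)]
  simp only [hc, Matrix.mul_apply, Matrix.sum_apply, Matrix.smul_apply, smul_eq_mul]
  calc _ = ∑ a, ∑ d, ∑ b, ∑ c, (∑ k, (jac ψ z)⁻¹ k a * jac ψ z b k)
        * (jac ψ z d i * jac ψ z c j * curv (conn H) b c (ψ z) a d) := by
        simp only [Finset.sum_mul, Finset.mul_sum]
        rw [Finset.sum_comm]
        refine Finset.sum_congr rfl fun a _ => ?_
        rw [Finset.sum_comm]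
        refine Finset.sum_congr rfl fun d _ => ?_
        rw [Finset.sum_comm]
        refine Finset.sum_congr rfl fun b _ => ?_
        rw [Finset.sum_comm]
        exact Finset.sum_congr rfl fun c _ => Finset.sum_congr rfl fun k _ => by ring
    _ = ∑ a, ∑ d, ∑ c, jac ψ z d i * jac ψ z c j * curv (conn H) a c (ψ z) a d := by
        refine Finset.sum_congr rfl fun a _ => Finset.sum_congr rfl fun d _ => ?_
        rw [Finset.sum_comm]
        refine Finset.sum_congr rfl fun c _ => ?_
        simp only [hd, ite_mul, one_mul, zero_mul, Finset.sum_ite_eq', Finset.mem_univ, if_true]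
    _ = _ := by
        rw [Finset.sum_comm]
        refine Finset.sum_congr rfl fun d _ => ?_
        rw [Finset.sum_comm]
        exact Finset.sum_congr rfl fun c _ => (Finset.mul_sum _ _ _).symm

end IsometryOn

end Pullback

/-! ### Maps from the base of a fibration -/

/-- A map `f` from the total space that pulls a metric `H` back to the same form as `π` pulls back
`G` descends to a local isometry from `G` to `H`: its composition with a local section of `π`. -/
lemma PullsBack.exists_descent {n : ℕ} {Q : Matrix (Fin n) (Fin n) ℝ}
    {θ : (Fin 6 → ℝ) → (Fin 6 → ℝ) → (Fin n → ℝ)} {S : Set (Fin 6 → ℝ)}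
    {π : (Fin 6 → ℝ) → (Fin 4 → ℝ)} {G H : (Fin 4 → ℝ) → Matrix (Fin 4) (Fin 4) ℝ}
    (h : PullsBack Q θ S π G) {f : (Fin 6 → ℝ) → (Fin 4 → ℝ)} (hf : ∀ w ∈ S, Smooth f w)
    (hH : ∀ w ∈ S, ∀ X Y,
      bil (H (f w)) (fderiv ℝ f w X) (fderiv ℝ f w Y) = bil Q (θ w X) (θ w Y))
    {w₀ : Fin 6 → ℝ} (hw : w₀ ∈ S) :
    ∃ (O : Set (Fin 4 → ℝ)) (ψ : (Fin 4 → ℝ) → (Fin 4 → ℝ)), IsOpen O ∧ π w₀ ∈ O ∧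
      (∀ z ∈ O, Smooth ψ z) ∧ ψ (π w₀) = f w₀ ∧ (∀ z ∈ O, ∃ w ∈ S, π w = z ∧ ψ z = f w) ∧
      ∀ z ∈ O, ∀ X Y, bil (G z) X Y = bil (H (ψ z)) (fderiv ℝ ψ z X) (fderiv ℝ ψ z Y) := by
  obtain ⟨R, hR⟩ := (fderiv ℝ π w₀).exists_rightInverse_of_surjective
    (LinearMap.range_eq_top.2 (h.surj w₀ hw))
  let l : (Fin 4 → ℝ) → (Fin 6 → ℝ) := fun z => w₀ + R z
  have hl : ∀ z, Smooth l z := fun z => contDiffAt_const.add R.contDiff.contDiffAt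
  have hl' : ∀ z, HasFDerivAt l R z := fun z => R.hasFDerivAt.const_add w₀
  have hl0 : l 0 = w₀ := by simp [l]
  have hN : IsOpen (l ⁻¹' S) :=
    h.isOpen.preimage (continuous_iff_continuousAt.2 fun z => (hl z).continuousAt)
  have h0 : (0 : Fin 4 → ℝ) ∈ l ⁻¹' S := by
    show l 0 ∈ S
    rwa [hl0]
  have hd : fderiv ℝ (π ∘ l) 0 = ContinuousLinearMap.id ℝ _ := by
    have e := (HasFDerivAt.comp (0 : Fin 4 → ℝ) (h.smooth _ h0).diff.hasFDerivAt (hl' 0)).fderiv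
    rw [e, hl0, hR]
  obtain ⟨e, h0e, heN, he, hes⟩ := exists_local_inverse hN h0 (Ψ := π ∘ l)
    (fun z hz => ContDiffAt.comp z (h.smooth _ hz) (hl z)) (fun X hX => by rwa [hd] at hX)
  have hσS : ∀ z ∈ e.target, l (e.symm z) ∈ S := fun z hz => heN (e.map_target hz)
  have hπσ : ∀ z ∈ e.target, π (l (e.symm z)) = z := fun z hz => by
    have := e.right_inv hz
    rwa [he] at this
  have sσ : ∀ z ∈ e.target, Smooth (fun z => l (e.symm z)) z := fun z hz =>
    ContDiffAt.comp (g := l) z (hl _) (hes z hz)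
  have hz0 : π w₀ = e 0 := by rw [he, Function.comp_apply, hl0]
  have hs0 : l (e.symm (π w₀)) = w₀ := by rw [hz0, e.left_inv h0e, hl0]
  refine ⟨e.target, fun z => f (l (e.symm z)), e.open_target, by rw [hz0]; exact e.map_source h0e,
    fun z hz => ContDiffAt.comp z (hf _ (hσS z hz)) (sσ z hz), by simp only [hs0],
    fun z hz => ⟨_, hσS z hz, hπσ z hz, rfl⟩, fun z hz X Y => ?_⟩
  have e1 : ∀ X, fderiv ℝ π (l (e.symm z)) (fderiv ℝ (fun z => l (e.symm z)) z X) = X := by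
    intro X
    have c1 : (fun z => π (l (e.symm z))) =ᶠ[𝓝 z] id := by
      filter_upwards [e.open_target.mem_nhds hz] with y hy using hπσ y hy
    have c2 := (HasFDerivAt.comp z (h.smooth _ (hσS z hz)).diff.hasFDerivAt
      (sσ z hz).diff.hasFDerivAt).fderiv
    have c3 := c1.fderiv_eq (𝕜 := ℝ)
    rw [show (fun z => π (l (e.symm z))) = π ∘ fun z => l (e.symm z) from rfl, c2, fderiv_id] at c3
    exact congrArg (fun L : (Fin 4 → ℝ) →L[ℝ] (Fin 4 → ℝ) => L X) c3
  have e2 := (HasFDerivAt.comp z (hf _ (hσS z hz)).diff.hasFDerivAt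
      (sσ z hz).diff.hasFDerivAt).fderiv
  rw [show (fun z => f (l (e.symm z))) = f ∘ fun z => l (e.symm z) from rfl, e2]
  simp only [ContinuousLinearMap.comp_apply, Function.comp_apply]
  rw [hH _ (hσS z hz), ← h.pull _ (hσS z hz), e1, e1, hπσ z hz]

/-! ### Products of two surfaces of constant curvature -/

/-- The metric `c (dr² / r² - k r² dT²) + d (ds² / s² - l s² dU²)` in the coordinates
`(r, T, s, U)`. -/
def surfaces (c k d l : ℝ) (z : Fin 4 → ℝ) : Matrix (Fin 4) (Fin 4) ℝ :=
  Matrix.diagonal ![c / z 0 ^ 2, -(c * k * z 0 ^ 2), d / z 2 ^ 2, -(d * l * z 2 ^ 2)]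

lemma bil_surfaces (c k d l : ℝ) (z X Y : Fin 4 → ℝ) : bil (surfaces c k d l z) X Y
    = c * (X 0 * Y 0 / z 0 ^ 2 - k * z 0 ^ 2 * (X 1 * Y 1))
      + d * (X 2 * Y 2 / z 2 ^ 2 - l * z 2 ^ 2 * (X 3 * Y 3)) := by
  simp [bil, surfaces, Fin.sum_univ_four, Matrix.diagonal_apply]
  ring

section Surfaces

variable {c k d l : ℝ} {z : Fin 4 → ℝ}

/-- The Christoffel symbols of `surfaces c k d l`. -/
def surfacesConn (k l : ℝ) (z : Fin 4 → ℝ) : Fin 4 → Matrix (Fin 4) (Fin 4) ℝ :=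
  ![!![-(1 / z 0), 0, 0, 0; 0, k * z 0 ^ 3, 0, 0; 0, 0, 0, 0; 0, 0, 0, 0],
    !![0, 1 / z 0, 0, 0; 1 / z 0, 0, 0, 0; 0, 0, 0, 0; 0, 0, 0, 0],
    !![0, 0, 0, 0; 0, 0, 0, 0; 0, 0, -(1 / z 2), 0; 0, 0, 0, l * z 2 ^ 3],
    !![0, 0, 0, 0; 0, 0, 0, 0; 0, 0, 0, 1 / z 2; 0, 0, 1 / z 2, 0]]

lemma smooth_surfaces (h0 : z 0 ≠ 0) (h2 : z 2 ≠ 0) (i j : Fin 4) :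
    Smooth (fun w => surfaces c k d l w i j) z := by
  have s : ∀ i : Fin 4, Smooth (fun v : Fin 4 → ℝ => v i) z := fun i => smooth_coord i
  simp only [surfaces, Matrix.diagonal_apply]
  by_cases h : i = j
  · simp only [h, if_true]
    fin_cases j
    · exact contDiffAt_const.div ((s 0).pow 2) (pow_ne_zero 2 h0)
    · exact (contDiffAt_const.mul ((s 0).pow 2)).neg
    · exact contDiffAt_const.div ((s 2).pow 2) (pow_ne_zero 2 h2)
    · exact (contDiffAt_const.mul ((s 2).pow 2)).neg
  · simp only [h, if_false]
    exact contDiffAt_const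

lemma pd_surfaces (h0 : z 0 ≠ 0) (h2 : z 2 ≠ 0) (m i j : Fin 4) :
    pd m (fun w => surfaces c k d l w i j) z = if i = j then
      (![if m = 0 then -2 * c / z 0 ^ 3 else 0, if m = 0 then -2 * (c * k * z 0) else 0,
        if m = 2 then -2 * d / z 2 ^ 3 else 0, if m = 2 then -2 * (d * l * z 2) else 0]
          : Fin 4 → ℝ) i else 0 := by
  have s : ∀ i : Fin 4, Smooth (fun v : Fin 4 → ℝ => v i) z := fun i => smooth_coord i
  simp only [surfaces, Matrix.diagonal_apply]
  by_cases h : i = j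
  · simp only [h, if_true]
    have p : ∀ (c : ℝ) (i : Fin 4), z i ≠ 0 → pd m (fun w => c / w i ^ 2) z
        = if m = i then -2 * c / z i ^ 3 else 0 := fun c i hi => by
      rw [pd_div contDiffAt_const ((s i).pow 2) (pow_ne_zero 2 hi), pd_const, pd_pow (s i),
        pd_coord]
      by_cases h : m = i
      · simp only [h, if_true]
        field_simp
        norm_num
        ring
      · simp [h]
    have q : ∀ (c : ℝ) (i : Fin 4), pd m (fun w => -(c * w i ^ 2)) z
        = if m = i then -2 * (c * z i) else 0 := fun c i => by
      have : (fun w : Fin 4 → ℝ => -(c * w i ^ 2)) = fun w => (-c) * w i ^ 2 := by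
        funext w; ring
      rw [this, pd_const_mul _ ((s i).pow 2), pd_pow (s i), pd_coord]
      by_cases h : m = i
      · simp only [h, if_true]
        norm_num
        ring
      · simp [h]
    fin_cases j
    · exact p c 0 h0
    · exact q (c * k) 0
    · exact p d 2 h2
    · exact q (d * l) 2
  · simp only [h, if_false]
    exact pd_const 0 m

lemma christoffel_surfaces (hc : c ≠ 0) (hk : k ≠ 0) (hd : d ≠ 0) (hl : l ≠ 0) (h0 : z 0 ≠ 0)
    (h2 : z 2 ≠ 0) (m i j : Fin 4) :
    christoffel (surfaces c k d l) m i j z = surfacesConn k l z m i j := by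
  have hinv : (surfaces c k d l z)⁻¹ = Matrix.diagonal
      ![z 0 ^ 2 / c, -(1 / (c * k * z 0 ^ 2)), z 2 ^ 2 / d, -(1 / (d * l * z 2 ^ 2))] := by
    apply Matrix.inv_eq_right_inv
    rw [surfaces, Matrix.diagonal_mul_diagonal, ← Matrix.diagonal_one]
    congr 1
    funext i
    fin_cases i <;> simp <;> field_simp
  rw [christoffel, hinv]
  simp only [pd_surfaces h0 h2, Matrix.diagonal_apply, ite_mul, zero_mul, Finset.sum_ite_eq,
    Finset.mem_univ, if_true]
  fin_cases m <;> fin_cases i <;> fin_cases j <;>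
    simp [surfacesConn] <;> field_simp

lemma ricci_surfaces (hc : c ≠ 0) (hk : k ≠ 0) (hd : d ≠ 0) (hl : l ≠ 0) (h0 : z 0 ≠ 0)
    (h2 : z 2 ≠ 0) : ricci (surfaces c k d l) 0 0 z = -(1 / z 0 ^ 2) ∧
      ricci (surfaces c k d l) 2 2 z = -(1 / z 2 ^ 2) := by
  have s : ∀ i : Fin 4, Smooth (fun v : Fin 4 → ℝ => v i) z := fun i => smooth_coord i
  have e : ∀ m i j, christoffel (surfaces c k d l) m i j
      =ᶠ[𝓝 z] fun z => surfacesConn k l z m i j := by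
    intro m i j
    filter_upwards [(s 0).continuousAt.eventually_ne h0, (s 2).continuousAt.eventually_ne h2]
      with w hw0 hw2 using christoffel_surfaces hc hk hd hl hw0 hw2 m i j
  have p : ∀ (i m : Fin 4), z i ≠ 0 → pd m (fun w => 1 / w i) z
      = if m = i then -(1 / z i ^ 2) else 0 := fun i m hi => by
    rw [pd_div contDiffAt_const (s i) hi, pd_const, pd_coord]
    by_cases h : m = i <;> simp [h]
    field_simp
  have q : ∀ (i m : Fin 4), z i ≠ 0 → pd m (fun w => -(1 / w i)) z
      = if m = i then 1 / z i ^ 2 else 0 := fun i m hi => by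
    rw [show pd m (fun w : Fin 4 → ℝ => -(1 / w i)) z = -pd m (fun w => 1 / w i) z from D_neg,
      p i m hi]
    by_cases h : m = i <;> simp [h]
  constructor <;>
  · simp only [ricci, christoffel_surfaces hc hk hd hl h0 h2, fun m m' i j => pd_congr (e m i j) m',
      Fin.sum_univ_four]
    simp [surfacesConn, pd_const, -one_div, p 0 _ h0, p 2 _ h2, q 0 _ h0, q 2 _ h2]
    field_simp
    norm_num

end Surfaces

/-- A form of split signature is negative on some vector of each hyperplane. -/
lemma IsSplit.exists_neg {g : Matrix (Fin 4) (Fin 4) ℝ} (hg : IsSplit g)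
    (ℓ : (Fin 4 → ℝ) →ₗ[ℝ] ℝ) : ∃ X, ℓ X = 0 ∧ bil g X X < 0 := by
  obtain ⟨T, -, e⟩ := hg
  have hT : ∀ Y, bil g (T.mulVec Y) (T.mulVec Y)
      = Y 0 ^ 2 + Y 1 ^ 2 - Y 2 ^ 2 - Y 3 ^ 2 := by
    intro Y
    have : bil g (T.mulVec Y) (T.mulVec Y) = bil (T.transpose * g * T) Y Y := by
      rw [bil_eq_dotProduct, bil_eq_dotProduct, ← Matrix.mulVec_mulVec, ← Matrix.mulVec_mulVec,
        Matrix.dotProduct_mulVec Y, Matrix.vecMul_transpose]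
    rw [this, e]
    simp [bil, Fin.sum_univ_four, Matrix.diagonal_apply]
    ring
  let p := ℓ (T.mulVec (Pi.single 2 1))
  let q := ℓ (T.mulVec (Pi.single 3 1))
  have hY : ∀ a b : ℝ, ℓ (T.mulVec (a • Pi.single 2 1 + b • Pi.single 3 1)) = a * p + b * q := by
    intro a b
    rw [Matrix.mulVec_add, Matrix.mulVec_smul, Matrix.mulVec_smul, map_add, map_smul, map_smul]
    rfl
  by_cases hp : p = 0
  · refine ⟨_, (hY 1 0).trans (by rw [hp]; ring), ?_⟩
    rw [hT]
    simp
  · refine ⟨_, (hY q (-p)).trans (by ring), ?_⟩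
    rw [hT]
    simp
    nlinarith [sq_nonneg q, pow_pos (abs_pos.2 hp) 2, sq_abs p]

/-! ### The coefficients of an admissible family -/

lemma coframe_congr {F F' : (Fin 4 → ℝ) → ℝ} {u : Fin 6 → ℝ} (h : F =ᶠ[𝓝 (jet u)] F')
    (X : Fin 6 → ℝ) : coframe F u X = coframe F' u X := by
  have e := fun i => pd_eventually_congr h i
  have e2 := fun i j => pd_eventually_congr (e j) i
  have e3 := fun i => pd_eventually_congr (e2 3 3) i
  have eK : Kfun F =ᶠ[𝓝 (jet u)] Kfun F' := by
    filter_upwards [h, e 2, e 3, e2 0 3, e2 1 3, e2 2 3, e2 3 3] with v h0 h1 h2 h3 h4 h5 h6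
    simp only [Kfun, h0, h1, h2, h3, h4, h5, h6]
  have eK' := fun i => pd_eventually_congr eK i
  simp only [coframe, h.eq_of_nhds, (e 3).eq_of_nhds, (e2 3 3).eq_of_nhds, (e2 1 3).eq_of_nhds,
    (e3 3).eq_of_nhds, (e3 2).eq_of_nhds, (e3 1).eq_of_nhds, eK.eq_of_nhds, (eK' 3).eq_of_nhds,
    (eK' 2).eq_of_nhds]

/-- The matrix of the inverse of `slBasis`. -/
def slInvMatrix : Matrix (Fin 6) (Fin 6) ℝ :=
  !![-1 / 2, 0, 0, 1 / 2, 0, 0;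
     0, 0, 1 / 2, 0, 0, -1 / 2;
     0, 1 / 2, 0, 0, -1 / 2, 0;
     1, 0, 0, 0, 0, 0;
     0, 0, 0, 0, 0, 1;
     0, 0, 0, 0, 1, 0]

lemma slInvMatrix_mulVec_slBasis (s : Fin 6 → ℝ) : slInvMatrix.mulVec (slBasis s) = s := by
  funext i
  fin_cases i <;>
    simp [slInvMatrix, slBasis, Matrix.mulVec, dotProduct, Fin.sum_univ_six] <;> ring

/-- The matrix of the form with matrix `Q` in the basis `slBasis`. -/
def slConj (Q : Matrix (Fin 6) (Fin 6) ℝ) : Matrix (Fin 6) (Fin 6) ℝ :=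
  slInvMatrix.transpose * Q * slInvMatrix

lemma bil_slConj (Q : Matrix (Fin 6) (Fin 6) ℝ) (s t : Fin 6 → ℝ) :
    bil (slConj Q) (slBasis s) (slBasis t) = bil Q s t := by
  rw [slConj, bil_eq_dotProduct, bil_eq_dotProduct, ← Matrix.mulVec_mulVec,
    ← Matrix.mulVec_mulVec, slInvMatrix_mulVec_slBasis, Matrix.dotProduct_mulVec,
    Matrix.vecMul_transpose, slInvMatrix_mulVec_slBasis]

lemma slConj_isSymm {Q : Matrix (Fin 6) (Fin 6) ℝ} (h : Q.IsSymm) : (slConj Q).IsSymm := by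
  rw [slConj, Matrix.IsSymm, Matrix.transpose_mul, Matrix.transpose_mul,
    Matrix.transpose_transpose, h.eq, Matrix.mul_assoc]

/-- The equation `y''' = (3/2) y''² / y'`, in normal form. -/
def flatForm : NormalForm where
  D := Set.univ
  A := fun _ => 0
  B := fun _ => 0
  C := fun _ => 0
  isOpen_D := isOpen_univ
  smooth_A := contDiffOn_const
  smooth_B := contDiffOn_const
  smooth_C := contDiffOn_const

lemma flatForm_F (v : Fin 4 → ℝ) : flatForm.ode.F v = (3 / 2) * v 3 ^ 2 / v 2 := by
  simp [NormalForm.ode, flatForm]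

lemma MetricDatum.IsFlatModel.coframe_eq {m : MetricDatum} (h : m.IsFlatModel) {u : Fin 6 → ℝ}
    (hu : u ∈ m.W) (X : Fin 6 → ℝ) :
    coframe m.ode.F u X = coframe flatForm.ode.F u X := by
  refine coframe_congr ?_ X
  filter_upwards [m.regular.isOpen_dom.mem_nhds (m.W_subset hu).1] with v hv
  rw [(h v hv).2, flatForm_F]

lemma NormalForm.frame_add (n : NormalForm) (w V V' : Fin 6 → ℝ) :
    n.frame w (V + V') = n.frame w V + n.frame w V' := by
  funext a
  fin_cases a <;>
    simp only [frame, Matrix.cons_val, Fin.reduceFinMk, Fin.zero_eta, Fin.mk_one,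
      Pi.add_apply] <;> ring

lemma NormalForm.frame_smul (n : NormalForm) (w : Fin 6 → ℝ) (c : ℝ) (V : Fin 6 → ℝ) :
    n.frame w (c • V) = c • n.frame w V := by
  funext a
  fin_cases a <;>
    simp only [frame, Matrix.cons_val, Fin.reduceFinMk, Fin.zero_eta, Fin.mk_one,
      Pi.smul_apply, smul_eq_mul] <;> ring

/-- The frame identifies the tangent space with `ℝ⁶`. -/
lemma NormalForm.exists_frameEquiv (n : NormalForm) {w : Fin 6 → ℝ} (h4 : w 4 ≠ 0)
    (h5 : w 5 ≠ 0) : ∃ L : (Fin 6 → ℝ) ≃ₗ[ℝ] (Fin 6 → ℝ), ∀ V, L V = n.frame w V := by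
  let L : (Fin 6 → ℝ) →ₗ[ℝ] (Fin 6 → ℝ) :=
    { toFun := n.frame w, map_add' := n.frame_add w, map_smul' := n.frame_smul w }
  have hs : Function.Surjective L := fun s => frame_surjective h4 h5 s
  exact ⟨LinearEquiv.ofBijective L ⟨LinearMap.injective_iff_surjective.2 hs, hs⟩, fun V => rfl⟩

/-- The form of the flat model that induces a metric is a sum of two forms `quotForm`. -/
lemma exists_quotForm_of_flat {Q : Matrix (Fin 6) (Fin 6) ℝ} (hQ : Q.IsSymm)
    {S : Set (Fin 6 → ℝ)} {π : (Fin 6 → ℝ) → (Fin 4 → ℝ)}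
    {G : (Fin 4 → ℝ) → Matrix (Fin 4) (Fin 4) ℝ} (h : PullsBack Q flatForm.frame S π G)
    (hS : ∀ w ∈ S, w 4 ≠ 0 ∧ w 5 ≠ 0 ∧ IsSplit (G (π w))) {w : Fin 6 → ℝ} (hw : w ∈ S) :
    ∃ (a b : Fin 3 → ℝ) (c d : ℝ), killing a a ≠ 0 ∧ killing b b ≠ 0 ∧
      ∀ s t, bil Q s t = c * quotForm a (fstPart s) (fstPart t)
        + d * quotForm b (sndPart s) (sndPart t) := by
  obtain ⟨L, hL⟩ := flatForm.exists_frameEquiv (hS w hw).1 (hS w hw).2.1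
  let P : (Fin 6 → ℝ) →ₗ[ℝ] (Fin 4 → ℝ) := (fderiv ℝ π w).toLinearMap ∘ₗ L.symm.toLinearMap
  have hLs : ∀ s, flatForm.frame w (L.symm s) = s := fun s => by rw [← hL, L.apply_symm_apply]
  have hP : Function.Surjective P := (h.surj w hw).comp L.symm.surjective
  let β : (Fin 6 → ℝ) →ₗ[ℝ] (Fin 6 → ℝ) →ₗ[ℝ] ℝ := LinearMap.mk₂ ℝ (bil Q) (bil_add_left Q)
    (bil_smul_left Q) (bil_add_right Q) fun c s t => by
      rw [bil_comm hQ, bil_smul_left, bil_comm hQ]; rfl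
  have hβ : ∀ s t, β s t = bil (G (π w)) (P s) (P t) := fun s t => by
    have := h.pull w hw (L.symm s) (L.symm t)
    rw [hLs, hLs] at this
    exact this.symm
  refine exists_quotForm hP (hS w hw).2.2 hβ (fun s t => bil_comm hQ s t) fun v hv s t => ?_
  have hd : ∀ V X, dForm flatForm.frame w V X
      = bracket₂ (flatForm.frame w V) (flatForm.frame w X) := by
    intro V X
    rw [NormalForm.dForm_frame ⟨Set.mem_univ _, (hS w hw).1, (hS w hw).2.1⟩]
    funext i
    fin_cases i <;> simp [flatForm, bracket₂, slPair, bracket, fstPart, sndPart]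
  have key := h.cond hQ (fun w hw V a => NormalForm.smooth_frame
    ⟨Set.mem_univ _, (hS w hw).1, (hS w hw).2.1⟩ V a) hw (V := L.symm v) (fun Z => by
      rw [hLs]
      have := hβ v Z
      rw [hv, bil_zero_left] at this
      exact this) (L.symm s) (L.symm t)
  rw [hd, hd, hLs, hLs, hLs] at key
  exact key

/-- A quadratic function without zeros of infinite order is nonzero somewhere on each open set. -/
lemma exists_ne_zero_of_quadratic {q : (Fin 6 → ℝ) → ℝ}
    (hq : ∀ w v (s : ℝ), q (w + s • v) - 2 * q w + q (w - s • v) = 2 * s ^ 2 * q v)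
    {v : Fin 6 → ℝ} (hv : q v ≠ 0) {S : Set (Fin 6 → ℝ)} (hS : IsOpen S) {w : Fin 6 → ℝ}
    (hw : w ∈ S) : ∃ w ∈ S, q w ≠ 0 := by
  by_contra hc
  push Not at hc
  have c1 : ∀ᶠ s : ℝ in 𝓝[≠] 0, w + s • v ∈ S := by
    refine (ContinuousAt.eventually_mem (f := fun s : ℝ => w + s • v) (by fun_prop)
      (hS.mem_nhds (by simpa using hw))).filter_mono nhdsWithin_le_nhds
  have c2 : ∀ᶠ s : ℝ in 𝓝[≠] 0, w - s • v ∈ S := by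
    refine (ContinuousAt.eventually_mem (f := fun s : ℝ => w - s • v) (by fun_prop)
      (hS.mem_nhds (by simpa using hw))).filter_mono nhdsWithin_le_nhds
  obtain ⟨s, ⟨h1, h2⟩, h3⟩ := ((c1.and c2).and self_mem_nhdsWithin).exists
  have := hq w v s
  rw [hc _ h1, hc _ h2, hc _ hw] at this
  have hs : s ≠ 0 := h3
  have : 2 * s ^ 2 * q v ≠ 0 := by positivity
  apply this
  linarith

/-- The numerator `4 ρ r` of the coordinate `r` on the quotient of the first factor by `a`. -/
def radNum (a : Fin 3 → ℝ) (t ρ : ℝ) : ℝ := 8 * a 1 * ρ ^ 2 - 4 * a 2 * t * ρ - a 0 * t ^ 2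

lemma exists_radNum_ne_zero {a : Fin 3 → ℝ} (ha : a ≠ 0) : ∃ t ρ, radNum a t ρ ≠ 0 := by
  by_contra hc
  push Not at hc
  have h1 := hc 0 1
  have h2 := hc 1 0
  have h3 := hc 1 1
  simp only [radNum] at h1 h2 h3
  apply ha
  funext i
  fin_cases i <;> simp <;> linarith

lemma exists_radNum_ne_zero_mem {a : Fin 3 → ℝ} (ha : a ≠ 0) {i j : Fin 6} (hij : i ≠ j)
    {S : Set (Fin 6 → ℝ)} (hS : IsOpen S) {w : Fin 6 → ℝ} (hw : w ∈ S) :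
    ∃ w ∈ S, radNum a (w i) (w j) ≠ 0 := by
  obtain ⟨t, ρ, h⟩ := exists_radNum_ne_zero ha
  refine exists_ne_zero_of_quadratic (q := fun w => radNum a (w i) (w j)) (fun w v s => ?_)
    (v := Function.update (Function.update 0 i t) j ρ) ?_ hS hw
  · simp only [radNum, Pi.add_apply, Pi.sub_apply, Pi.smul_apply, smul_eq_mul]
    ring
  · simpa [Function.update_of_ne hij] using h

/-- The coordinate `r` on the quotient of the first factor by `a`. -/
def radFun (a : Fin 3 → ℝ) (t ρ : ℝ) : ℝ := 2 * a 1 * ρ - a 2 * t - a 0 * t ^ 2 / (4 * ρ)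

/-- The coordinate `T` on the quotient of the first factor by `a`. -/
def angFun (a : Fin 3 → ℝ) (x t ρ : ℝ) : ℝ := x - (a 2 + a 0 * t / (2 * ρ)) / radFun a t ρ

lemma radFun_ne_zero {a : Fin 3 → ℝ} {t ρ : ℝ} (hρ : ρ ≠ 0) (h : radNum a t ρ ≠ 0) :
    radFun a t ρ ≠ 0 := by
  intro h0
  apply h
  rw [radFun] at h0
  field_simp at h0
  rw [radNum]
  linarith

section

variable {a : Fin 3 → ℝ} {i j k : Fin 6} {w : Fin 6 → ℝ}

lemma smooth_radFun (hj : w j ≠ 0) : Smooth (fun w : Fin 6 → ℝ => radFun a (w i) (w j)) w := by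
  have s : ∀ i : Fin 6, Smooth (fun v : Fin 6 → ℝ => v i) w := fun i => smooth_coord i
  exact ((contDiffAt_const.mul (s j)).sub (contDiffAt_const.mul (s i))).sub
    ((contDiffAt_const.mul ((s i).pow 2)).div (contDiffAt_const.mul (s j))
      (mul_ne_zero (by norm_num) hj))

lemma smooth_angNum (hj : w j ≠ 0) :
    Smooth (fun w : Fin 6 → ℝ => a 2 + a 0 * w i / (2 * w j)) w := by
  have s : ∀ i : Fin 6, Smooth (fun v : Fin 6 → ℝ => v i) w := fun i => smooth_coord i
  exact contDiffAt_const.add ((contDiffAt_const.mul (s i)).div (contDiffAt_const.mul (s j))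
      (mul_ne_zero (by norm_num) hj))

lemma smooth_angFun (hj : w j ≠ 0) (h : radNum a (w i) (w j) ≠ 0) :
    Smooth (fun w : Fin 6 → ℝ => angFun a (w k) (w i) (w j)) w :=
  (smooth_coord k).sub ((smooth_angNum hj).div (smooth_radFun hj) (radFun_ne_zero hj h))

lemma D_radFun (hj : w j ≠ 0) (V : Fin 6 → ℝ) :
    fderiv ℝ (fun w : Fin 6 → ℝ => radFun a (w i) (w j)) w V
      = 2 * a 1 * V j - a 2 * V i - a 0 * (2 * w i * V i * w j - w i ^ 2 * V j) / (4 * w j ^ 2) := by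
  have h4 : 4 * w j ≠ 0 := mul_ne_zero (by norm_num) hj
  simp only [radFun]
  simp (disch := first | assumption | fun_prop (disch := assumption)) only
    [D_mul, D_const, D_coord, D_sub, D_div, D_pow]
  field_simp
  ring

lemma D_angFun (hj : w j ≠ 0) (h : radNum a (w i) (w j) ≠ 0) (V : Fin 6 → ℝ) :
    fderiv ℝ (fun w : Fin 6 → ℝ => angFun a (w k) (w i) (w j)) w V
      = V k - (a 0 * (V i * w j - w i * V j) / (2 * w j ^ 2) * radFun a (w i) (w j)
          - (a 2 + a 0 * w i / (2 * w j))
            * (2 * a 1 * V j - a 2 * V i - a 0 * (2 * w i * V i * w j - w i ^ 2 * V j)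
              / (4 * w j ^ 2))) / radFun a (w i) (w j) ^ 2 := by
  have h2 : 2 * w j ≠ 0 := mul_ne_zero (by norm_num) hj
  have hr := radFun_ne_zero hj h
  simp only [angFun]
  have sq : Smooth (fun w : Fin 6 → ℝ => (a 2 + a 0 * w i / (2 * w j)) / radFun a (w i) (w j)) w :=
    (smooth_angNum hj).div (smooth_radFun hj) hr
  rw [D_sub (smooth_coord k).diff sq.diff, D_coord,
    D_div (smooth_angNum hj).diff (smooth_radFun hj).diff hr, D_radFun hj]
  simp (disch := first | assumption | fun_prop (disch := assumption)) only
    [D_mul, D_const, D_coord, D_add, D_div]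
  field_simp
  ring

/-- The form `quotForm` of one factor of the flat model is the metric `dr² / r² - r² dT² / κ`. -/
lemma quotForm_flat (haa : killing a a ≠ 0) (hj : w j ≠ 0) (h : radNum a (w i) (w j) ≠ 0)
    (V X : Fin 6 → ℝ) :
    let φ : (Fin 6 → ℝ) → Fin 3 → ℝ := fun V =>
      ![2 * w j * V k, (V i - w i ^ 2 / 2 * V k) / (2 * w j), V j / w j - w i * V k]
    let r : (Fin 6 → ℝ) → ℝ := fun w => radFun a (w i) (w j)
    let T : (Fin 6 → ℝ) → ℝ := fun w => angFun a (w k) (w i) (w j)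
    quotForm a (φ V) (φ X) = fderiv ℝ r w V * fderiv ℝ r w X / r w ^ 2
      - 1 / killing a a * r w ^ 2 * (fderiv ℝ T w V * fderiv ℝ T w X) := by
  intro φ r T
  simp only [φ, r, T]
  rw [D_radFun hj, D_radFun hj, D_angFun hj h, D_angFun hj h]
  have hr := radFun_ne_zero hj h
  have hre : radFun a (w i) (w j) = radNum a (w i) (w j) / (4 * w j) := by
    rw [radFun, radNum]
    field_simp
    ring
  rw [hre]
  simp only [quotForm]
  have hk : killing a a = 2 * a 0 * a 1 + a 2 ^ 2 := by rw [killing]; ring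
  rw [hk] at haa ⊢
  simp only [killing, Matrix.cons_val]
  generalize w i = t at *
  generalize w j = ρ at *
  generalize V i = Vi
  generalize V j = Vj
  generalize V k = Vk
  generalize X i = Xi
  generalize X j = Xj
  generalize X k = Xk
  field_simp
  rw [radNum]
  ring

end

lemma fstPart_flat (w V : Fin 6 → ℝ) : fstPart (flatForm.frame w V)
    = ![2 * w 4 * V 0, (V 3 - w 3 ^ 2 / 2 * V 0) / (2 * w 4), V 4 / w 4 - w 3 * V 0] := by
  funext i
  fin_cases i <;> simp [NormalForm.frame, fstPart, flatForm]

lemma sndPart_flat (w V : Fin 6 → ℝ) : sndPart (flatForm.frame w V)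
    = ![2 * w 5 * V 1, (V 2 - w 2 ^ 2 / 2 * V 1) / (2 * w 5), V 5 / w 5 - w 2 * V 1] := by
  funext i
  fin_cases i <;> simp [NormalForm.frame, sndPart, flatForm]

lemma ne_zero_of_killing {a : Fin 3 → ℝ} (h : killing a a ≠ 0) : a ≠ 0 := by
  rintro rfl
  simp [killing] at h

/-- A vector of positive length can be normalised in `quotForm`. -/
lemma exists_unit {a : Fin 3 → ℝ} (h : 0 < killing a a) : ∃ A : Fin 3 → ℝ, killing A A = 1 ∧
    ∀ y z, quotForm a y z = killing y z - killing A y * killing A z := by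
  have hs : Real.sqrt (killing a a) ^ 2 = killing a a := Real.sq_sqrt h.le
  have e : ∀ (c : ℝ) (y : Fin 3 → ℝ), killing (c • a) y = c * killing a y := fun c y => by
    simp only [killing, Pi.smul_apply, smul_eq_mul]; ring
  have e' : ∀ (c : ℝ) (y : Fin 3 → ℝ), killing y (c • a) = c * killing a y := fun c y => by
    rw [killing_comm, e]
  refine ⟨(Real.sqrt (killing a a))⁻¹ • a, ?_, fun y z => ?_⟩
  · rw [e, e', ← mul_assoc, ← mul_inv, ← sq, hs, inv_mul_cancel₀ h.ne']
  · have hi : (Real.sqrt (killing a a))⁻¹ * (Real.sqrt (killing a a))⁻¹ = (killing a a)⁻¹ := by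
      rw [← mul_inv, ← sq, hs]
    rw [quotForm, e, e, div_eq_mul_inv, ← hi]
    ring

/-- A form of the flat model that induces a metric of split signature with `Ric(G) = -G` is one of
the forms `slForm A B`, with unit vectors `A` and `B`. -/
theorem exists_slForm_of_flat {Q : Matrix (Fin 6) (Fin 6) ℝ} (hQ : Q.IsSymm)
    {S : Set (Fin 6 → ℝ)} {π : (Fin 6 → ℝ) → (Fin 4 → ℝ)}
    {G : (Fin 4 → ℝ) → Matrix (Fin 4) (Fin 4) ℝ} (h : PullsBack Q flatForm.frame S π G)
    (hS : ∀ w ∈ S, w 4 ≠ 0 ∧ w 5 ≠ 0 ∧ IsSplit (G (π w)) ∧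
      ∀ i j, ricci G i j (π w) = -G (π w) i j) {w : Fin 6 → ℝ} (hw : w ∈ S) :
    ∃ A B : Fin 3 → ℝ, killing A A = 1 ∧ killing B B = 1 ∧ ∀ s t, bil Q s t = slForm A B s t := by
  obtain ⟨a, b, c, d, ha, hb, e⟩ := exists_quotForm_of_flat hQ h
    (fun w hw => ⟨(hS w hw).1, (hS w hw).2.1, (hS w hw).2.2.1⟩) hw
  -- the coordinates `r`, `T` of both factors, near a point where they are defined
  have hcont : ∀ a i j, Continuous fun w : Fin 6 → ℝ => radNum a (w i) (w j) := fun a i j => by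
    unfold radNum; fun_prop
  have hU : ∀ a i j, IsOpen {w : Fin 6 → ℝ | radNum a (w i) (w j) ≠ 0} := fun a i j =>
    isOpen_ne_fun (hcont a i j) continuous_const
  obtain ⟨w₁, hw₁, h₁⟩ := exists_radNum_ne_zero_mem (ne_zero_of_killing ha)
    (i := 3) (j := 4) (by decide) h.isOpen hw
  obtain ⟨w₂, hw₂, h₂⟩ := exists_radNum_ne_zero_mem (ne_zero_of_killing hb)
    (i := 2) (j := 5) (by decide) (h.isOpen.inter (hU a 3 4)) ⟨hw₁, h₁⟩
  let S' := S ∩ {w | radNum a (w 3) (w 4) ≠ 0} ∩ {w | radNum b (w 2) (w 5) ≠ 0}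
  have hS' : IsOpen S' := (h.isOpen.inter (hU a 3 4)).inter (hU b 2 5)
  have h' := h.mono hS' fun w hw => hw.1.1
  have h4 : ∀ w ∈ S', w 4 ≠ 0 := fun w hw => (hS w hw.1.1).1
  have h5 : ∀ w ∈ S', w 5 ≠ 0 := fun w hw => (hS w hw.1.1).2.1
  let f : (Fin 6 → ℝ) → (Fin 4 → ℝ) := fun w => ![radFun a (w 3) (w 4), angFun a (w 0) (w 3) (w 4),
    radFun b (w 2) (w 5), angFun b (w 1) (w 2) (w 5)]
  have hf : ∀ w ∈ S', Smooth f w := fun w hw => smooth_pi.2 fun i => by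
    fin_cases i
    · exact smooth_radFun (h4 w hw)
    · exact smooth_angFun (h4 w hw) hw.1.2
    · exact smooth_radFun (h5 w hw)
    · exact smooth_angFun (h5 w hw) hw.2
  have hH : ∀ w ∈ S', ∀ X Y, bil (surfaces c (1 / killing a a) d (1 / killing b b) (f w))
      (fderiv ℝ f w X) (fderiv ℝ f w Y) = bil Q (flatForm.frame w X) (flatForm.frame w Y) := by
    intro w hw X Y
    rw [e, fstPart_flat, fstPart_flat, sndPart_flat, sndPart_flat,
      quotForm_flat ha (h4 w hw) hw.1.2, quotForm_flat hb (h5 w hw) hw.2, bil_surfaces]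
    simp only [NormalForm.fderiv_pi_apply (hf w hw)]
    rfl
  have hr : ∀ w ∈ S', f w 0 ≠ 0 ∧ f w 2 ≠ 0 := fun w hw =>
    ⟨radFun_ne_zero (h4 w hw) hw.1.2, radFun_ne_zero (h5 w hw) hw.2⟩
  have hw₂' : w₂ ∈ S' := ⟨hw₂, h₂⟩
  obtain ⟨O, ψ, hO, hzO, hψ, hψz, hsec, hpull⟩ := h'.exists_descent hf hH hw₂'
  have hdet : ∀ z ∈ O, (G z).det ≠ 0 := by
    intro z hz h0
    obtain ⟨w, hw, rfl, -⟩ := hsec z hz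
    obtain ⟨T, hT, eT⟩ := (hS w hw.1.1).2.2.1
    have := congrArg Matrix.det eT
    rw [Matrix.det_mul, Matrix.det_mul, h0, Matrix.det_diagonal] at this
    simp [Fin.prod_univ_four] at this
  have iso : IsometryOn G (surfaces c (1 / killing a a) d (1 / killing b b)) ψ O :=
    { isOpen := hO
      smooth := hψ
      smoothG := fun z hz i j => by
        obtain ⟨w, hw, rfl, -⟩ := hsec z hz
        exact h'.smoothG w hw i j
      smoothH := fun z hz i j => by
        obtain ⟨w, hw, -, e⟩ := hsec z hz
        rw [e]
        exact smooth_surfaces (hr w hw).1 (hr w hw).2 i j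
      symm := fun z => by rw [surfaces]; exact Matrix.isSymm_diagonal _
      det_ne := hdet
      pull := hpull }
  set z := π w₂ with hz
  have hr0 : ψ z 0 ≠ 0 := by rw [hψz]; exact (hr w₂ hw₂').1
  have hr2 : ψ z 2 ≠ 0 := by rw [hψz]; exact (hr w₂ hw₂').2
  have hdH := iso.det_H hzO
  rw [surfaces, Matrix.det_diagonal, Fin.prod_univ_four] at hdH
  have hc : c ≠ 0 := by rintro rfl; simp at hdH
  have hd : d ≠ 0 := by rintro rfl; simp at hdH
  obtain ⟨r0, r2⟩ := ricci_surfaces hc (one_div_ne_zero ha) hd (one_div_ne_zero hb) hr0 hr2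
  have hRic : ∀ i j, ricci (surfaces c (1 / killing a a) d (1 / killing b b)) i j (ψ z)
      = -surfaces c (1 / killing a a) d (1 / killing b b) (ψ z) i j := by
    set H := surfaces c (1 / killing a a) d (1 / killing b b) with hHdef
    let J := jac ψ z
    let R : Matrix (Fin 4) (Fin 4) ℝ := Matrix.of fun i j => ricci H i j (ψ z)
    have e1 : J.transpose * R * J = J.transpose * (-H (ψ z)) * J := by
      rw [Matrix.mul_neg, Matrix.neg_mul, ← iso.eq_mul z hzO]
      ext i j
      rw [Matrix.neg_apply, ← (hS w₂ hw₂.1).2.2.2, iso.ricci_eq hzO]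
      simp only [Matrix.mul_apply, Matrix.transpose_apply, Finset.sum_mul]
      rw [Finset.sum_comm]
      exact Finset.sum_congr rfl fun a _ => Finset.sum_congr rfl fun b _ => by
        simp only [J, R, Matrix.of_apply]; ring
    have hJ : IsUnit J.det := (iso.det_jac hzO).isUnit
    have hJt : IsUnit J.transpose.det := by rwa [Matrix.det_transpose]
    have e2 : R = -H (ψ z) := by
      have e3 := congrArg (fun M => J.transpose⁻¹ * (M * J⁻¹)) e1
      simpa [Matrix.mul_assoc, Matrix.mul_nonsing_inv _ hJ, Matrix.nonsing_inv_mul_cancel_left _ _ hJt]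
        using e3
    intro i j
    exact congrFun (congrFun e2 i) j
  -- the factors have scalar curvatures proportional to `1 / c` and `1 / d`
  have c1 : c = 1 := by
    have := hRic 0 0
    rw [r0] at this
    simp [surfaces] at this
    field_simp at this
    linarith
  have d1 : d = 1 := by
    have := hRic 2 2
    rw [r2] at this
    simp [surfaces] at this
    field_simp at this
    linarith
  subst c1 d1
  -- for a vector of negative length, the metric of its factor would be definite
  have hbil : ∀ X, bil (G z) X X = _ := fun X => (hpull z hzO X X).trans (bil_surfaces _ _ _ _ _ _ _)
  have hneg := fun k => IsSplit.exists_neg (hS w₂ hw₂.1).2.2.1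
    (LinearMap.proj k ∘ₗ (fderiv ℝ ψ z).toLinearMap)
  have ha' : 0 < killing a a := by
    by_contra hc
    obtain ⟨X, hX, hX'⟩ := hneg 3
    have hX3 : fderiv ℝ ψ z X 3 = 0 := hX
    rw [hbil, hX3] at hX'
    have : 1 / killing a a ≤ 0 := one_div_nonpos.2 (not_lt.1 hc)
    have h1 : 0 ≤ -(1 / killing a a) * (ψ z 0 ^ 2 * fderiv ℝ ψ z X 1 ^ 2) :=
      mul_nonneg (by linarith) (by positivity)
    have h2 : 0 ≤ (fderiv ℝ ψ z X 0 / ψ z 0) ^ 2 + (fderiv ℝ ψ z X 2 / ψ z 2) ^ 2 := by positivity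
    rw [div_pow, div_pow] at h2
    ring_nf at hX' h1 h2
    linarith
  have hb' : 0 < killing b b := by
    by_contra hc
    obtain ⟨X, hX, hX'⟩ := hneg 1
    have hX3 : fderiv ℝ ψ z X 1 = 0 := hX
    rw [hbil, hX3] at hX'
    have : 1 / killing b b ≤ 0 := one_div_nonpos.2 (not_lt.1 hc)
    have h1 : 0 ≤ -(1 / killing b b) * (ψ z 2 ^ 2 * fderiv ℝ ψ z X 3 ^ 2) :=
      mul_nonneg (by linarith) (by positivity)
    have h2 : 0 ≤ (fderiv ℝ ψ z X 0 / ψ z 0) ^ 2 + (fderiv ℝ ψ z X 2 / ψ z 2) ^ 2 := by positivity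
    rw [div_pow, div_pow] at h2
    ring_nf at hX' h1 h2
    linarith
  obtain ⟨A, hA, eA⟩ := exists_unit ha'
  obtain ⟨B, hB, eB⟩ := exists_unit hb'
  exact ⟨A, B, hA, hB, fun s t => by rw [e, eA, eB, slForm]; ring⟩

/-- The coefficients of an admissible family are those of a form `slForm A B`. -/
theorem IsAdmissible.exists_pullsBack {𝓕 : Set MetricDatum} (h : IsAdmissible 𝓕) :
    ∃ A B : Fin 3 → ℝ, killing A A = 1 ∧ killing B B = 1 ∧
      ∀ m ∈ 𝓕, PullsBack (slMatrix A B) (slframe m.ode.F) m.W m.π m.G := by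
  obtain ⟨Q, hQ, hc⟩ := h.sameCoefficients
  obtain ⟨m₀, hm₀, hflat⟩ := h.flatModel
  have hPB : ∀ m ∈ 𝓕, PullsBack (slConj Q) (slframe m.ode.F) m.W m.π m.G := by
    intro m hm
    have h1 := m.pullsBack (h.splitEinstein m hm) (hc m hm)
    exact ⟨h1.isOpen, h1.smooth, h1.smoothG, h1.surj, h1.nondeg, fun w hw X Y => by
      rw [h1.pull w hw, slframe, slframe, bil_slConj]⟩
  obtain ⟨u, hu⟩ := m₀.nonempty_W
  have hdom : ∀ u ∈ m₀.W, u 2 ≠ 0 ∧ u 4 ≠ 0 := fun u hu =>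
    ⟨(hflat _ (m₀.W_subset hu).1).1, (m₀.W_subset hu).2⟩
  obtain ⟨S', Λ, hP, huS, -, hΛ⟩ := (hPB m₀ hm₀).exists_transport
    (Ψ := NormalForm.coords) (θ' := flatForm.frame)
    (fun w hw => NormalForm.smooth_coords (hdom w hw).1)
    (fun w hw X => by
      rw [slframe, hflat.coframe_eq hw]
      exact NormalForm.slframe_eq_frame ⟨Set.mem_univ _, (hdom w hw).1⟩ (hdom w hw).2 X) hu
    (fun X hX => NormalForm.fderiv_coords_eq_zero (hdom u hu).1 (hdom u hu).2 hX)
  obtain ⟨A, B, hA, hB, e⟩ := exists_slForm_of_flat (slConj_isSymm hQ) hP (fun w hw => by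
    obtain ⟨h1, h2⟩ := hΛ w hw
    have h3 := hdom _ h1
    have h4 := h.splitEinstein m₀ hm₀ (m₀.π (Λ w)) ⟨_, h1, rfl⟩
    refine ⟨?_, ?_, h4⟩
    · rw [← h2]; exact mul_ne_zero h3.2 h3.1
    · rw [← h2]; exact h3.2) huS
  refine ⟨A, B, hA, hB, fun m hm => ?_⟩
  have h1 := hPB m hm
  exact ⟨h1.isOpen, h1.smooth, h1.smoothG, h1.surj, h1.nondeg, fun w hw X Y => by
    rw [h1.pull w hw, e, bil_slMatrix]⟩

/-! ### The metric of an equation in normal form -/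

namespace NormalForm

variable {n : NormalForm} {z : Fin 4 → ℝ}

lemma isOpen_M : IsOpen n.M := by
  have h1 : Continuous fun v : Fin 4 → ℝ => (v 0, v 1) := by fun_prop
  exact n.isOpen_D.preimage h1

variable (n) in
/-- `A`, as a function on the four-dimensional base. -/
def bA (w : Fin 4 → ℝ) : ℝ := n.A (w 0, w 1)

variable (n) in
/-- `B`, as a function on the four-dimensional base. -/
def bB (w : Fin 4 → ℝ) : ℝ := n.B (w 0, w 1)

lemma smooth_bA (hz : z ∈ n.M) : Smooth n.bA z := smooth_comp_pair n.isOpen_D n.smooth_A hz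

lemma smooth_bB (hz : z ∈ n.M) : Smooth n.bB z := smooth_comp_pair n.isOpen_D n.smooth_B hz

lemma pd_bA (i : Fin 4) (h0 : i ≠ 0) (h1 : i ≠ 1) : ∀ z ∈ n.M, pd i n.bA z = 0 := fun z hz => by
  have := fderiv_comp_pair (v := z) (i := 0) (j := 1) (diffA hz) (Pi.single i 1)
  rw [Pi.single_eq_of_ne h0.symm, Pi.single_eq_of_ne h1.symm] at this
  exact this.trans (map_zero _)

lemma pd_bB (i : Fin 4) (h0 : i ≠ 0) (h1 : i ≠ 1) : ∀ z ∈ n.M, pd i n.bB z = 0 := fun z hz => by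
  have := fderiv_comp_pair (v := z) (i := 0) (j := 1) (diffB hz) (Pi.single i 1)
  rw [Pi.single_eq_of_ne h0.symm, Pi.single_eq_of_ne h1.symm] at this
  exact this.trans (map_zero _)

lemma pd_pd_bA (i j : Fin 4) (h0 : i ≠ 0) (h1 : i ≠ 1) (hz : z ∈ n.M) :
    pd i (pd j n.bA) z = 0 := by
  rw [pd_comm (smooth_bA hz), pd_congr_on isOpen_M (pd_bA i h0 h1) j z hz, pd_const]

lemma pd_pd_bB (i j : Fin 4) (h0 : i ≠ 0) (h1 : i ≠ 1) (hz : z ∈ n.M) :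
    pd i (pd j n.bB) z = 0 := by
  rw [pd_comm (smooth_bB hz), pd_congr_on isOpen_M (pd_bB i h0 h1) j z hz, pd_const]

lemma smooth_metric (hz : z ∈ n.M) (i j : Fin 4) : Smooth (fun w => n.metric w i j) z := by
  have s : ∀ i : Fin 4, Smooth (fun v : Fin 4 → ℝ => v i) z := fun i => smooth_coord i
  have k : ∀ c : ℝ, Smooth (fun _ : Fin 4 → ℝ => c) z := fun c => contDiffAt_const
  have h0 : Smooth (fun w : Fin 4 → ℝ => -((w 3) ^ 2 + 2 * n.B (w 0, w 1))) z :=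
    (((s 3).pow 2).add ((k 2).mul (smooth_bB hz))).neg
  have h1 : Smooth (fun w : Fin 4 → ℝ => 2 * n.A (w 0, w 1) - (w 2) ^ 2) z :=
    ((k 2).mul (smooth_bA hz)).sub ((s 2).pow 2)
  fin_cases i <;> fin_cases j
  exacts [h0, k 0, k 0, k 1, k 0, h1, k 1, k 0, k 0, k 1, k 0, k 0, k 1, k 0, k 0, k 0]

lemma pd_metric (hz : z ∈ n.M) (m i j : Fin 4) : pd m (fun w => n.metric w i j) z
    = (!![-(2 * z 3 * (if m = 3 then 1 else 0) + 2 * pd m n.bB z), 0, 0, 0;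
         0, 2 * pd m n.bA z - 2 * z 2 * (if m = 2 then 1 else 0), 0, 0;
         0, 0, 0, 0; 0, 0, 0, 0] : Matrix (Fin 4) (Fin 4) ℝ) i j := by
  have s : ∀ i : Fin 4, Smooth (fun v : Fin 4 → ℝ => v i) z := fun i => smooth_coord i
  have h0 : pd m (fun w : Fin 4 → ℝ => -((w 3) ^ 2 + 2 * n.bB w)) z
      = -(2 * z 3 * (if m = 3 then 1 else 0) + 2 * pd m n.bB z) := by
    rw [show pd m (fun w : Fin 4 → ℝ => -((w 3) ^ 2 + 2 * n.bB w)) z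
        = -pd m (fun w : Fin 4 → ℝ => (w 3) ^ 2 + 2 * n.bB w) z from D_neg,
      pd_add ((s 3).pow 2) (contDiffAt_const.mul (smooth_bB hz)), pd_pow (s 3), pd_coord,
      pd_const_mul _ (smooth_bB hz)]
    norm_num
  have h1 : pd m (fun w : Fin 4 → ℝ => 2 * n.bA w - (w 2) ^ 2) z
      = 2 * pd m n.bA z - 2 * z 2 * (if m = 2 then 1 else 0) := by
    rw [pd_sub (contDiffAt_const.mul (smooth_bA hz)) ((s 2).pow 2), pd_pow (s 2), pd_coord,
      pd_const_mul _ (smooth_bA hz)]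
    norm_num
  fin_cases i <;> fin_cases j
  exacts [h0, pd_const _ _, pd_const _ _, pd_const _ _, pd_const _ _, h1, pd_const _ _,
    pd_const _ _, pd_const _ _, pd_const _ _, pd_const _ _, pd_const _ _, pd_const _ _,
    pd_const _ _, pd_const _ _, pd_const _ _]

lemma metric_inv (z : Fin 4 → ℝ) : (n.metric z)⁻¹ =
    !![0, 0, 0, 1;
       0, 0, 1, 0;
       0, 1, z 2 ^ 2 - 2 * n.bA z, 0;
       1, 0, 0, z 3 ^ 2 + 2 * n.bB z] := by
  apply Matrix.inv_eq_right_inv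
  ext i j
  fin_cases i <;> fin_cases j <;>
    simp [metric, Matrix.mul_apply, Fin.sum_univ_four, bA, bB]

variable (n) in
/-- The Christoffel symbols of the metric. -/
def metricConn (z : Fin 4 → ℝ) : Fin 4 → Matrix (Fin 4) (Fin 4) ℝ :=
  ![!![z 3, 0, 0, 0; 0, 0, 0, 0; 0, 0, 0, 0; 0, 0, 0, 0],
    !![0, 0, 0, 0; 0, z 2, 0, 0; 0, 0, 0, 0; 0, 0, 0, 0],
    !![pd 1 n.bB z, pd 0 n.bA z, 0, 0;
       pd 0 n.bA z, pd 1 n.bA z + (z 2 ^ 2 - 2 * n.bA z) * z 2, -z 2, 0;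
       0, -z 2, 0, 0; 0, 0, 0, 0],
    !![-pd 0 n.bB z + (z 3 ^ 2 + 2 * n.bB z) * z 3, -pd 1 n.bB z, 0, -z 3;
       -pd 1 n.bB z, -pd 0 n.bA z, 0, 0; 0, 0, 0, 0; -z 3, 0, 0, 0]]

lemma christoffel_metric (hz : z ∈ n.M) (m i j : Fin 4) :
    christoffel n.metric m i j z = n.metricConn z m i j := by
  have a2 := pd_bA 2 (by decide) (by decide) z hz
  have a3 := pd_bA 3 (by decide) (by decide) z hz
  have b2 := pd_bB 2 (by decide) (by decide) z hz
  have b3 := pd_bB 3 (by decide) (by decide) z hz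
  rw [christoffel, metric_inv]
  simp only [pd_metric hz, Fin.sum_univ_four]
  fin_cases m <;> fin_cases i <;> fin_cases j <;>
    simp [metricConn, a2, a3, b2, b3] <;> ring

lemma ricci_metric (hz : z ∈ n.M) (i j : Fin 4) : ricci n.metric i j z = -n.metric z i j := by
  have s : ∀ i : Fin 4, Smooth (fun v : Fin 4 → ℝ => v i) z := fun i => smooth_coord i
  have e : ∀ m i j, christoffel n.metric m i j =ᶠ[𝓝 z] fun z => n.metricConn z m i j := by
    intro m i j
    filter_upwards [isOpen_M.mem_nhds hz] with w hw using christoffel_metric hw m i j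
  have p1 : ∀ i m : Fin 4, pd m (fun w => w i) z = if m = i then 1 else 0 := fun i m => pd_coord m i
  have p2 : ∀ i m : Fin 4, pd m (fun w => -w i) z = -if m = i then 1 else 0 := fun i m => by
    rw [← pd_coord (v := z)]
    exact D_neg
  have pA := fun i j h0 h1 => pd_pd_bA (n := n) i j h0 h1 hz
  have pB := fun i j h0 h1 => pd_pd_bB (n := n) i j h0 h1 hz
  have pB' : pd 3 (fun w => -pd 1 n.bB w) z = 0 := by
    rw [show pd 3 (fun w => -pd 1 n.bB w) z = -pd 3 (pd 1 n.bB) z from D_neg,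
      pB 3 1 (by decide) (by decide), neg_zero]
  have pA' : pd 3 (fun w => -pd 0 n.bA w) z = 0 := by
    rw [show pd 3 (fun w => -pd 0 n.bA w) z = -pd 3 (pd 0 n.bA) z from D_neg,
      pA 3 0 (by decide) (by decide), neg_zero]
  have q1 : pd 2 (fun w => pd 1 n.bA w + (w 2 ^ 2 - 2 * n.bA w) * w 2) z
      = 3 * z 2 ^ 2 - 2 * n.bA z := by
    have sA := smooth_bA hz
    have sq : Smooth (fun w : Fin 4 → ℝ => w 2 ^ 2 - 2 * n.bA w) z :=
      ((s 2).pow 2).sub (contDiffAt_const.mul sA)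
    rw [pd_add (sA.pd 1) (sq.mul (s 2)), pd_mul sq (s 2), pd_sub ((s 2).pow 2)
      (contDiffAt_const.mul sA), pd_pow (s 2), pd_const_mul _ sA, pd_coord,
      pA 2 1 (by decide) (by decide), pd_bA 2 (by decide) (by decide) z hz]
    norm_num
    ring
  have q2 : pd 3 (fun w => -pd 0 n.bB w + (w 3 ^ 2 + 2 * n.bB w) * w 3) z
      = 3 * z 3 ^ 2 + 2 * n.bB z := by
    have sB := smooth_bB hz
    have sq : Smooth (fun w : Fin 4 → ℝ => w 3 ^ 2 + 2 * n.bB w) z :=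
      ((s 3).pow 2).add (contDiffAt_const.mul sB)
    rw [pd_add (sB.pd 0).neg (sq.mul (s 3)), pd_mul sq (s 3), pd_add ((s 3).pow 2)
      (contDiffAt_const.mul sB), pd_pow (s 3), pd_const_mul _ sB, pd_coord,
      show pd 3 (fun w => -pd 0 n.bB w) z = -pd 3 (pd 0 n.bB) z from D_neg,
      pB 3 0 (by decide) (by decide), pd_bB 3 (by decide) (by decide) z hz]
    norm_num
    ring
  have hA : n.A (z 0, z 1) = n.bA z := rfl
  have hB : n.B (z 0, z 1) = n.bB z := rfl
  simp only [ricci, christoffel_metric hz, fun m m' i j => pd_congr (e m i j) m',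
    Fin.sum_univ_four]
  fin_cases i <;> fin_cases j <;>
    simp [metricConn, metric, pd_const, p1, p2, pA, pB, pA', pB', q1, q2, hA, hB] <;> ring

lemma isSplit_metric (z : Fin 4 → ℝ) : IsSplit (n.metric z) := by
  let p := z 3 ^ 2 + 2 * n.bB z
  let q := z 2 ^ 2 - 2 * n.bA z
  let T : Matrix (Fin 4) (Fin 4) ℝ :=
    !![1, 0, 1, 0; 0, 1, 0, 1; 0, (q + 1) / 2, 0, (q - 1) / 2; (p + 1) / 2, 0, (p - 1) / 2, 0]
  have e : T.transpose * n.metric z * T = Matrix.diagonal ![1, 1, -1, -1] := by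
    ext i j
    fin_cases i <;> fin_cases j <;>
      simp [T, metric, Matrix.mul_apply, Fin.sum_univ_four, p, q, bA, bB] <;> ring
  refine ⟨T, fun h0 => ?_, e⟩
  have := congrArg Matrix.det e
  rw [Matrix.det_mul, Matrix.det_mul, h0, Matrix.det_diagonal] at this
  simp [Fin.prod_univ_four] at this

end NormalForm

lemma ricci_congr {g g' : (Fin 4 → ℝ) → Matrix (Fin 4) (Fin 4) ℝ} {z : Fin 4 → ℝ}
    (h : g =ᶠ[𝓝 z] g') (i j : Fin 4) : ricci g i j z = ricci g' i j z := by
  have e : ∀ k i j, christoffel g k i j =ᶠ[𝓝 z] christoffel g' k i j := fun k i j => by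
    filter_upwards [h.eventuallyEq_nhds] with w hw
    have ep : ∀ m i j, pd m (fun w => g w i j) w = pd m (fun w => g' w i j) w := fun m i j =>
      pd_congr (hw.fun_comp fun M => M i j) m
    simp only [christoffel, ep, hw.eq_of_nhds]
  simp only [ricci, (e _ _ _).eq_of_nhds, fun m k i j => pd_congr (e k i j) m]

/-! ### Existence of metrics -/

/-- The projection to the first four coordinates. -/
def baseProj (w : Fin 6 → ℝ) : Fin 4 → ℝ := ![w 0, w 1, w 2, w 3]

lemma isLinearMap_baseProj : IsLinearMap ℝ baseProj where
  map_add x y := by funext i; fin_cases i <;> rfl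
  map_smul c x := by funext i; fin_cases i <;> rfl

lemma smooth_baseProj (w : Fin 6 → ℝ) : Smooth baseProj w :=
  smooth_pi.2 fun a => by fin_cases a <;> exact smooth_coord _

lemma fderiv_baseProj_comp {k : ℕ} {Ψ : (Fin k → ℝ) → (Fin 6 → ℝ)} {u : Fin k → ℝ}
    (hΨ : Smooth Ψ u) (X : Fin k → ℝ) :
    fderiv ℝ (fun w => baseProj (Ψ w)) u X = baseProj (fderiv ℝ Ψ u X) := by
  funext a
  rw [NormalForm.fderiv_pi_apply (f := fun w => baseProj (Ψ w))
    (ContDiffAt.comp u (smooth_baseProj _) hΨ)]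
  fin_cases a <;> exact (NormalForm.fderiv_pi_apply hΨ X _).symm

/-- The projection of coordinates `Ψ` to the first four of them, and a field of bilinear forms `G`,
restricted to a neighbourhood with convex image, so that the fibers are connected. -/
lemma exists_metricDatum {E : ODE} (hE : E.Regular) {Ψ : (Fin 6 → ℝ) → (Fin 6 → ℝ)}
    {N : Set (Fin 6 → ℝ)} (hN : IsOpen N) (hNP : N ⊆ E.P) (hΨ : ∀ w ∈ N, Smooth Ψ w)
    (hinj : ∀ w ∈ N, ∀ X, fderiv ℝ Ψ w X = 0 → X = 0)
    {G : (Fin 4 → ℝ) → Matrix (Fin 4) (Fin 4) ℝ}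
    (hG : ∀ w ∈ N, ∀ i j, Smooth (fun z => G z i j) (baseProj (Ψ w))) {u : Fin 6 → ℝ}
    (hu : u ∈ N) : ∃ m : MetricDatum, m.ode = E ∧ u ∈ m.W ∧ m.W ⊆ N ∧
      (m.π = fun w => baseProj (Ψ w)) ∧ m.G = G := by
  obtain ⟨e, hue, heN, he, hes⟩ := exists_local_inverse hN hu hΨ (hinj u hu)
  obtain ⟨r, hr, hball⟩ := Metric.isOpen_iff.1 e.open_target (e u) (e.map_source hue)
  have hsm : ∀ w ∈ N, Smooth (fun w => baseProj (Ψ w)) w := fun w hw =>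
    ContDiffAt.comp w (smooth_baseProj _) (hΨ w hw)
  let W := e.source ∩ e ⁻¹' Metric.ball (e u) r
  have hW : IsOpen W := e.isOpen_inter_preimage Metric.isOpen_ball
  have hWN : W ⊆ N := fun w hw => heN hw.1
  have huW : u ∈ W := ⟨hue, Metric.mem_ball_self hr⟩
  refine ⟨⟨E, hE, W, hW, ⟨u, huW⟩, fun w hw => hNP (hWN hw), fun w => baseProj (Ψ w),
    fun w hw => (hsm w (hWN hw)).contDiffWithinAt, fun w hw y => ?_, fun w hw => ?_, G,
    fun i j => ?_⟩, rfl, huW, hWN, rfl, rfl⟩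
  · obtain ⟨X, hX⟩ := LinearMap.injective_iff_surjective.1
      ((injective_iff_map_eq_zero (fderiv ℝ Ψ w).toLinearMap).2 (hinj w (hWN hw)))
      ![y 0, y 1, y 2, y 3, 0, 0]
    refine ⟨X, ?_⟩
    rw [fderiv_baseProj_comp (hΨ w (hWN hw)), show fderiv ℝ Ψ w X = _ from hX]
    funext i
    fin_cases i <;> rfl
  · refine ⟨⟨w, hw, rfl⟩, ?_⟩
    have h1 : {v | v ∈ W ∧ baseProj (Ψ v) = baseProj (Ψ w)}
        = e.symm '' (Metric.ball (e u) r ∩ {y | baseProj y = baseProj (Ψ w)}) := by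
      ext v
      constructor
      · rintro ⟨hv, hv'⟩
        exact ⟨e v, ⟨hv.2, by
          show baseProj (e v) = _
          rw [he]; exact hv'⟩, e.left_inv hv.1⟩
      · rintro ⟨y, ⟨hy, hy'⟩, rfl⟩
        refine ⟨⟨e.map_target (hball hy), ?_⟩, ?_⟩
        · rw [Set.mem_preimage, e.right_inv (hball hy)]
          exact hy
        · rw [← he, e.right_inv (hball hy), he]
          exact hy'
    rw [h1]
    refine IsPreconnected.image (Convex.isPreconnected ?_) _
      (e.continuousOn_symm.mono fun y hy => hball hy.1)
    exact (convex_ball _ _).inter ((convex_singleton _).is_linear_preimage isLinearMap_baseProj)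
  · rintro _ ⟨w, hw, rfl⟩
    exact (hG w (hWN hw) i j).contDiffWithinAt

/-- The coefficients of the distinguished family. -/
lemma bil_distinguishedCoefficients (s t : Fin 6 → ℝ) : bil distinguishedCoefficients s t
    = slForm ![0, 0, 1] ![0, 0, 1] (slBasis s) (slBasis t) := by
  simp [bil, distinguishedCoefficients, slForm, slBasis, killing, fstPart, sndPart,
    Fin.sum_univ_six]
  ring

lemma NormalForm.bil_metric (n : NormalForm) {w : Fin 6 → ℝ} (hw : w ∈ n.coordDom)
    (V X : Fin 6 → ℝ) : bil (n.metric (baseProj w)) (baseProj V) (baseProj X)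
      = slForm ![0, 0, 1] ![0, 0, 1] (n.frame w V) (n.frame w X) := by
  have h4 := hw.2.1
  have h5 := hw.2.2
  simp [bil, metric, baseProj, slForm, frame, killing, fstPart, sndPart, Fin.sum_univ_four]
  field_simp
  ring

lemma NormalForm.baseProj_mem {n : NormalForm} {w : Fin 6 → ℝ} (hw : w ∈ n.coordDom) :
    baseProj w ∈ n.M := hw.1

lemma stdProj_eq (u : Fin 6 → ℝ) : stdProj u = baseProj (NormalForm.coords u) := rfl

lemma coords_mem {n : NormalForm} {u : Fin 6 → ℝ} (hu : u ∈ n.ode.P) :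
    NormalForm.coords u ∈ n.coordDom := ⟨hu.1.1, mul_ne_zero hu.2 hu.1.2, hu.2⟩

/-- The metric of an equation in normal form has the distinguished coefficients. -/
lemma bil_metric_coords {n : NormalForm} {u : Fin 6 → ℝ} (hu : u ∈ n.ode.P) (X Y : Fin 6 → ℝ) :
    bil (n.metric (stdProj u)) (fderiv ℝ stdProj u X) (fderiv ℝ stdProj u Y)
      = bil distinguishedCoefficients (coframe n.ode.F u X) (coframe n.ode.F u Y) := by
  have e : ∀ X, fderiv ℝ stdProj u X = baseProj (fderiv ℝ NormalForm.coords u X) := fun X =>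
    fderiv_baseProj_comp (NormalForm.smooth_coords hu.1.2) X
  rw [e, e, stdProj_eq, n.bil_metric (coords_mem hu), bil_distinguishedCoefficients,
    ← NormalForm.slframe_eq_frame hu.1 hu.2, ← NormalForm.slframe_eq_frame hu.1 hu.2]
  rfl

section Distinguished

variable {m : MetricDatum} (hm : m ∈ distinguishedFamily)
include hm

lemma hasCoefficients_of_mem : m.HasCoefficients distinguishedCoefficients := by
  obtain ⟨n, hn, hπ, hG⟩ := hm
  intro u hu X Y
  have e : m.π =ᶠ[𝓝 u] stdProj := by
    filter_upwards [m.isOpen_W.mem_nhds hu] with w hw using hπ w hw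
  have huP : u ∈ n.ode.P := hn ▸ m.W_subset hu
  rw [e.fderiv_eq, hG _ ⟨u, hu, rfl⟩, hπ u hu, hn]
  exact bil_metric_coords huP X Y

lemma isSplitEinstein_of_mem : m.IsSplitEinstein := by
  obtain ⟨n, hn, hπ, hG⟩ := hm
  intro z hz
  have hzM : z ∈ n.M := by
    obtain ⟨u, hu, rfl⟩ := hz
    rw [hπ u hu]
    have huP : u ∈ n.ode.P := hn ▸ m.W_subset hu
    exact huP.1.1
  have e : m.G =ᶠ[𝓝 z] n.metric := by
    filter_upwards [m.isOpen_M.mem_nhds hz] with w hw using hG w hw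
  refine ⟨by rw [hG z hz]; exact NormalForm.isSplit_metric z, fun i j => ?_⟩
  rw [ricci_congr e, hG z hz, NormalForm.ricci_metric hzM]

end Distinguished

lemma exists_mem_distinguishedFamily (n : NormalForm) {u : Fin 6 → ℝ} (hu : u ∈ n.ode.P) :
    ∃ m ∈ distinguishedFamily, m.ode = n.ode ∧ u ∈ m.W := by
  obtain ⟨m, hm, hu, -, hπ, hG⟩ := exists_metricDatum (Ψ := NormalForm.coords) (G := n.metric)
    n.regular n.regular.isOpen_P subset_rfl (fun w hw => NormalForm.smooth_coords hw.1.2)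
    (fun w hw X hX => NormalForm.fderiv_coords_eq_zero hw.1.2 hw.2 hX)
    (fun w hw i j => NormalForm.smooth_metric (NormalForm.baseProj_mem (coords_mem hw)) i j) hu
  exact ⟨m, ⟨n, hm, fun w _ => by rw [hπ, stdProj_eq], fun z _ => by rw [hG]⟩, hm, hu⟩

theorem isAdmissible_distinguishedFamily : IsAdmissible distinguishedFamily where
  splitEinstein _ hm := isSplitEinstein_of_mem hm
  flatModel := by
    have hu : ![0, 0, 1, 0, 1, 0] ∈ flatForm.ode.P :=
      ⟨⟨Set.mem_univ _, one_ne_zero (α := ℝ)⟩, one_ne_zero (α := ℝ)⟩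
    obtain ⟨m, hm, e, -⟩ := exists_mem_distinguishedFamily flatForm hu
    refine ⟨m, hm, fun v hv => ?_⟩
    rw [e] at hv
    exact ⟨hv.2, by rw [e, flatForm_F]⟩
  sameCoefficients := ⟨distinguishedCoefficients, by
    ext i j
    fin_cases i <;> fin_cases j <;> rfl, fun _ hm => hasCoefficients_of_mem hm⟩

/-! ### Equations equivalent to one in normal form -/

namespace FPTransformation

/-- A transformation to an equation in normal form, on a neighbourhood where it is defined. -/
lemma Relates.exists_relatesOn {φ : FPTransformation} {E : ODE} (hE : E.Regular)
    {v₀ : Fin 4 → ℝ} {n : NormalForm} (h : φ.Relates E v₀ n.ode) :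
    ∃ N, φ.RelatesOn E.F n.ode.F N ∧ v₀ ∈ N ∧ N ⊆ E.dom ∧ ∀ v ∈ N, φ.prol E.F v ∈ n.ode.dom := by
  obtain ⟨N, hN, hv, hNE, hr⟩ := h
  exact ⟨N, ⟨⟨hN, fun v hv => hE.smooth_F (hNE hv), fun v hv => (hr v hv).1⟩,
    fun v hv => NormalForm.smooth_F (hr v hv).2.1, fun v hv => (hr v hv).2.2⟩, hv, hNE,
    fun v hv => (hr v hv).2.1⟩

variable {φ : FPTransformation} {E : ODE} {n : NormalForm} {N : Set (Fin 4 → ℝ)}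

/-- The coordinates `(x, y, z, t, ρ, α)` of the equation in normal form, on the total space of the
equation that the transformation brings to it. -/
def liftCoords (φ : FPTransformation) (F : (Fin 4 → ℝ) → ℝ) (u : Fin 6 → ℝ) : Fin 6 → ℝ :=
  NormalForm.coords (φ.lift F u)

namespace RelatesOn

variable (h : φ.RelatesOn E.F n.ode.F N) (hE : E.Regular) (hNE : N ⊆ E.dom)
  (hn : ∀ v ∈ N, φ.prol E.F v ∈ n.ode.dom)
include h hn

lemma lift_mem {u : Fin 6 → ℝ} (hu : jet u ∈ N) (h4 : u 4 ≠ 0) : φ.lift E.F u ∈ n.ode.P :=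
  ⟨by rw [jet_lift]; exact hn _ hu, div_ne_zero h4 (h.Y_ne _ hu)⟩

lemma liftCoords_mem {u : Fin 6 → ℝ} (hu : jet u ∈ N) (h4 : u 4 ≠ 0) :
    φ.liftCoords E.F u ∈ n.coordDom := coords_mem (h.lift_mem hn hu h4)

lemma smooth_liftCoords {u : Fin 6 → ℝ} (hu : jet u ∈ N) (h4 : u 4 ≠ 0) :
    Smooth (φ.liftCoords E.F) u :=
  ContDiffAt.comp u (NormalForm.smooth_coords (h.lift_mem hn hu h4).1.2) (h.smooth_lift hu)

lemma fderiv_liftCoords {u : Fin 6 → ℝ} (hu : jet u ∈ N) (h4 : u 4 ≠ 0) (X : Fin 6 → ℝ) :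
    fderiv ℝ (φ.liftCoords E.F) u X
      = fderiv ℝ NormalForm.coords (φ.lift E.F u) (fderiv ℝ (φ.lift E.F) u X) := by
  have := ((NormalForm.smooth_coords (h.lift_mem hn hu h4).1.2).diff.hasFDerivAt.comp u
    (h.smooth_lift hu).diff.hasFDerivAt).fderiv
  rw [show φ.liftCoords E.F = NormalForm.coords ∘ φ.lift E.F from rfl, this]
  rfl

include hE hNE

lemma slframe_liftCoords {u : Fin 6 → ℝ} (hu : jet u ∈ N) (h4 : u 4 ≠ 0) (X : Fin 6 → ℝ) :
    slframe E.F u X = n.frame (φ.liftCoords E.F u) (fderiv ℝ (φ.liftCoords E.F) u X) := by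
  have hm := h.lift_mem hn hu h4
  rw [h.slframe_lift hu h4 (hE.Fqq_ne_zero _ (hNE hu)), NormalForm.slframe_eq_frame hm.1 hm.2,
    h.fderiv_liftCoords hn hu h4]
  rfl

lemma fderiv_liftCoords_eq_zero {u : Fin 6 → ℝ} (hu : jet u ∈ N) (h4 : u 4 ≠ 0) {X : Fin 6 → ℝ}
    (hX : fderiv ℝ (φ.liftCoords E.F) u X = 0) : X = 0 := by
  have hm := h.lift_mem hn hu h4
  rw [h.fderiv_liftCoords hn hu h4] at hX
  exact h.fderiv_lift_eq_zero hu h4 (hE.Fqq_ne_zero _ (hNE hu))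
    (NormalForm.fderiv_coords_eq_zero hm.1.2 hm.2 hX)

lemma bil_metric_liftCoords {u : Fin 6 → ℝ} (hu : jet u ∈ N) (h4 : u 4 ≠ 0) (X Y : Fin 6 → ℝ) :
    bil (n.metric (baseProj (φ.liftCoords E.F u)))
        (fderiv ℝ (fun w => baseProj (φ.liftCoords E.F w)) u X)
        (fderiv ℝ (fun w => baseProj (φ.liftCoords E.F w)) u Y)
      = bil distinguishedCoefficients (coframe E.F u X) (coframe E.F u Y) := by
  have hs := h.smooth_liftCoords hn hu h4
  rw [fderiv_baseProj_comp hs, fderiv_baseProj_comp hs, n.bil_metric (h.liftCoords_mem hn hu h4),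
    bil_distinguishedCoefficients, ← h.slframe_liftCoords hE hNE hn hu h4,
    ← h.slframe_liftCoords hE hNE hn hu h4, slframe, slframe]

end RelatesOn

end FPTransformation

lemma isOpen_jet_preimage {N : Set (Fin 4 → ℝ)} (hN : IsOpen N) :
    IsOpen {u : Fin 6 → ℝ | jet u ∈ N ∧ u 4 ≠ 0} := by
  have hcj : Continuous jet := continuous_iff_continuousAt.2 fun u => (smooth_jet u).continuousAt
  exact (hN.preimage hcj).inter (isOpen_ne_fun (continuous_apply 4) continuous_const)

/-- An equation equivalent to one in normal form has a metric with the distinguished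
coefficients. -/
lemma exists_metricDatum_of_relates {E : ODE} (hE : E.Regular) {u : Fin 6 → ℝ} (hu : u ∈ E.P)
    {n : NormalForm} {φ : FPTransformation} (h : φ.Relates E (jet u) n.ode) :
    ∃ m : MetricDatum, m.ode = E ∧ u ∈ m.W ∧ m.IsSplitEinstein ∧
      m.HasCoefficients distinguishedCoefficients := by
  obtain ⟨N, hR, huN, hNE, hn⟩ := h.exists_relatesOn hE
  obtain ⟨m, hm, hu, hW, hπ, hG⟩ := exists_metricDatum (Ψ := φ.liftCoords E.F) (G := n.metric)
    hE (isOpen_jet_preimage hR.isOpen) (fun w hw => ⟨hNE hw.1, hw.2⟩)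
    (fun w hw => hR.smooth_liftCoords hn hw.1 hw.2)
    (fun w hw X hX => hR.fderiv_liftCoords_eq_zero hE hNE hn hw.1 hw.2 hX)
    (fun w hw i j => NormalForm.smooth_metric
      (NormalForm.baseProj_mem (hR.liftCoords_mem hn hw.1 hw.2)) i j) ⟨huN, hu.2⟩
  refine ⟨m, hm, hu, ?_, fun w hw X Y => ?_⟩
  · rintro _ ⟨w, hw, rfl⟩
    rw [hG, hπ]
    exact ⟨NormalForm.isSplit_metric _, fun i j => NormalForm.ricci_metric
      (NormalForm.baseProj_mem (hR.liftCoords_mem hn (hW hw).1 (hW hw).2)) i j⟩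
  · rw [hG, hπ, hm]
    exact hR.bil_metric_liftCoords hE hNE hn (hW hw).1 (hW hw).2 X Y

/-! ### Coordinates on the quotients of the frame bundle -/

/-- A local solution of `y' = s(x, y)`, as the level set of a first integral. -/
lemma exists_smooth_solution {s : ℝ × ℝ → ℝ} {x₀ y₀ : ℝ}
    (hs : ∀ᶠ a in 𝓝 (x₀, y₀), Smooth s a) :
    ∃ g : ℝ → ℝ, g x₀ = y₀ ∧ ∀ᶠ x in 𝓝 x₀, Smooth g x ∧ HasDerivAt g (s (x, g x)) x := by
  obtain ⟨η, D, hD, haD, hη, hη'⟩ := exists_first_integral hs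
  let Ψ : ℝ × ℝ → ℝ × ℝ := fun a => (a.1, η a)
  have hΨ : ∀ a ∈ D, Smooth Ψ a := fun a ha => contDiffAt_fst.prodMk (hη a ha)
  have hd : HasFDerivAt Ψ ((ContinuousLinearMap.fst ℝ ℝ ℝ).prod (fderiv ℝ η (x₀, y₀))) (x₀, y₀) :=
    hasFDerivAt_fst.prodMk (hη _ haD).diff.hasFDerivAt
  have hinj : Function.Injective
      ((ContinuousLinearMap.fst ℝ ℝ ℝ).prod (fderiv ℝ η (x₀, y₀))).toLinearMap := by
    refine (injective_iff_map_eq_zero _).2 fun X hX => ?_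
    have h1 : X.1 = 0 := congrArg Prod.fst hX
    have h2 : fderiv ℝ η (x₀, y₀) X = 0 := congrArg Prod.snd hX
    have h3 : X = X.2 • ((0, 1) : ℝ × ℝ) := by ext <;> simp [h1]
    rw [h3, map_smul, smul_eq_mul] at h2
    have h4 := (mul_eq_zero.1 h2).resolve_right (hη' _ haD).1
    rw [h3, h4, zero_smul]
  obtain ⟨e, hae, heD, he, hes⟩ := exists_local_inverse_of_equiv hD haD hΨ
    (LinearEquiv.ofInjectiveEndo _ hinj).toContinuousLinearEquiv hd
  let c := η (x₀, y₀)
  have hce : e (x₀, y₀) = (x₀, c) := by rw [he]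
  have hfst : ∀ a ∈ e.target, (e.symm a).1 = a.1 ∧ η (e.symm a) = a.2 := fun a ha => by
    have := e.right_inv ha
    rw [he] at this
    exact ⟨(congrArg Prod.fst this : (Ψ (e.symm a)).1 = a.1),
      (congrArg Prod.snd this : (Ψ (e.symm a)).2 = a.2)⟩
  have hmem : ∀ᶠ x in 𝓝 x₀, (x, c) ∈ e.target := by
    refine ContinuousAt.eventually_mem (f := fun x : ℝ => (x, c)) (by fun_prop)
      (e.open_target.mem_nhds ?_)
    rw [← hce]
    exact e.map_source hae
  have hg0 : (e.symm (x₀, c)).2 = y₀ := by rw [← hce, e.left_inv hae]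
  refine ⟨fun x => (e.symm (x, c)).2, hg0, ?_⟩
  filter_upwards [hmem.eventually_nhds] with x hx
  have hx' := hx.self_of_nhds
  have hsm : Smooth (fun x => e.symm (x, c)) x :=
    ContDiffAt.comp x (hes _ hx') (contDiffAt_id.prodMk contDiffAt_const)
  have hg : Smooth (fun x => (e.symm (x, c)).2) x := contDiff_snd.contDiffAt.comp x hsm
  refine ⟨hg, ?_⟩
  set g : ℝ → ℝ := fun x => (e.symm (x, c)).2 with hgdef
  have hgd := hg.diff.hasDerivAt
  have hp : ∀ x, (x, c) ∈ e.target → e.symm (x, c) = (x, g x) := fun x hx =>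
    Prod.ext (hfst _ hx).1 rfl
  have haD' : (x, g x) ∈ D := by
    rw [← hp x hx']
    exact heD (e.map_target hx')
  have h1 : HasDerivAt (fun x => η (x, g x)) (fderiv ℝ η (x, g x) (1, deriv g x)) x :=
    (hη _ haD').diff.hasFDerivAt.comp_hasDerivAt x ((hasDerivAt_id x).prodMk hgd)
  have h2 : (fun x => η (x, g x)) =ᶠ[𝓝 x] fun _ => c := by
    filter_upwards [hx] with y hy
    rw [← hp y hy]
    exact (hfst _ hy).2
  have h3 := h1.unique ((hasDerivAt_const x c).congr_of_eventuallyEq h2)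
  have h4 : fderiv ℝ η (x, g x) (1, deriv g x)
      = fderiv ℝ η (x, g x) (1, 0) + deriv g x * fderiv ℝ η (x, g x) (0, 1) := by
    rw [← smul_eq_mul, ← map_smul, ← map_add]
    simp
  obtain ⟨n1, n2⟩ := hη' _ haD'
  have h5 : deriv g x = s (x, g x) := by
    refine mul_right_cancel₀ n1 ?_
    linarith
  rw [← h5]
  exact hgd

lemma D_comp {m : ℕ} {g : ℝ → ℝ} {g' : ℝ} {f : (Fin m → ℝ) → ℝ} {w : Fin m → ℝ}
    (hg : HasDerivAt g g' (f w)) (hf : DifferentiableAt ℝ f w) (V : Fin m → ℝ) :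
    fderiv ℝ (fun w => g (f w)) w V = g' * fderiv ℝ f w V := by
  have := (hg.comp_hasFDerivAt w hf.hasFDerivAt).fderiv
  rw [show (fun w => g (f w)) = g ∘ f from rfl, this]
  rfl

/-- The components of the frame of one factor, for the equation `y''' = (3/2) y''²/y' + b(x) y'`. -/
def factorFrame (b : ℝ → ℝ) (i j k : Fin 6) (w V : Fin 6 → ℝ) : Fin 3 → ℝ :=
  ![2 * w k * V i, (V j - (w j ^ 2 / 2 + b (w i)) * V i) / (2 * w k), V k / w k - w j * V i]

/-- The computation for `exists_factorCoords`: `dX` and `dT` are the differentials of the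
coordinates in which the form `quotForm a` of one factor is `2 dX dT - T² dX²`. -/
lemma factor_identity {a₀ a₁ a₂ t ρ g b E d : ℝ} (h0 : a₀ ≠ 0) (hρ : ρ ≠ 0) (hE : E ≠ 0)
    (hd : d ≠ 0) (hde : d = a₀ * (t - g) + 2 * (a₂ + 1) * ρ) (ha : 2 * a₀ * a₁ + a₂ ^ 2 = 1)
    (Vi Vj Vk Xi Xj Xk : ℝ) :
    let a : Fin 3 → ℝ := ![a₀, a₁, a₂]
    let φ : ℝ → ℝ → ℝ → Fin 3 → ℝ := fun Vi Vj Vk =>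
      ![2 * ρ * Vi, (Vj - (t ^ 2 / 2 + b) * Vi) / (2 * ρ), Vk / ρ - t * Vi]
    let e := d - 4 * ρ
    let dd : ℝ → ℝ → ℝ → ℝ := fun Vi Vj Vk =>
      a₀ * (Vj - (g ^ 2 / 2 + b) * Vi) + 2 * (a₂ + 1) * Vk
    let dX : ℝ → ℝ → ℝ → ℝ := fun Vi Vj Vk =>
      E * Vi + 2 * a₀ * (E * g * Vi * d - E * dd Vi Vj Vk) / d ^ 2
    let T := d * e / (4 * a₀ * ρ * E)
    let dT : ℝ → ℝ → ℝ → ℝ := fun Vi Vj Vk =>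
      ((dd Vi Vj Vk * e + d * (dd Vi Vj Vk - 4 * Vk)) / ρ - d * e * Vk / ρ ^ 2
        - d * e * g * Vi / ρ) / (4 * a₀ * E)
    killing (φ Vi Vj Vk) (φ Xi Xj Xk) - killing a (φ Vi Vj Vk) * killing a (φ Xi Xj Xk)
      = dX Vi Vj Vk * dT Xi Xj Xk + dT Vi Vj Vk * dX Xi Xj Xk
        - T ^ 2 * (dX Vi Vj Vk * dX Xi Xj Xk) := by
  have ha1 : a₁ = (1 - a₂ ^ 2) / (2 * a₀) := by
    field_simp
    linarith
  have ht : t = (d - 2 * (a₂ + 1) * ρ) / a₀ + g := by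
    field_simp
    linarith
  intro a φ e dd dX T dT
  simp only [a, φ, e, dd, dX, T, dT, killing, Matrix.cons_val, ha1, ht]
  field_simp
  ring

/-- Near each point, the form `quotForm a` of one factor, with a unit vector `a`, is the metric
`2 dX dT - (T² + 2 b(X)) dX²` in suitable functions `X`, `T`, where `X` has a prescribed value. A
solution of the Riccati equation `g' = g² / 2 + b` reduces this to the case `b = 0`. -/
lemma exists_factorCoords {a : Fin 3 → ℝ} (ha : killing a a = 1) {b : ℝ → ℝ} {w₀ : Fin 6 → ℝ}
    (i j k : Fin 6) (hk : w₀ k ≠ 0) (hb : ∀ᶠ x in 𝓝 (w₀ i), Smooth b x) :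
    ∃ X T : (Fin 6 → ℝ) → ℝ, X w₀ = w₀ i ∧ ∀ᶠ w in 𝓝 w₀, Smooth X w ∧ Smooth T w ∧
      ∀ V V', killing (factorFrame b i j k w V) (factorFrame b i j k w V')
          - killing a (factorFrame b i j k w V) * killing a (factorFrame b i j k w V')
        = fderiv ℝ X w V * fderiv ℝ T w V' + fderiv ℝ T w V * fderiv ℝ X w V'
          - (T w ^ 2 + 2 * b (X w)) * (fderiv ℝ X w V * fderiv ℝ X w V') := by
  have ha' : 2 * a 0 * a 1 + a 2 ^ 2 = 1 := by rw [← ha, killing]; ring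
  by_cases h0 : a 0 = 0
  · have h2 : a 2 ^ 2 = 1 := by rw [← ha', h0]; ring
    refine ⟨fun w => w i, fun w => w j - 2 * a 1 * a 2 * w k, rfl, ?_⟩
    filter_upwards [(continuous_apply k).continuousAt.eventually_ne hk] with w hw
    have s1 : Smooth (fun w : Fin 6 → ℝ => 2 * a 1 * a 2 * w k) w :=
      contDiffAt_const.mul (smooth_coord k)
    refine ⟨smooth_coord i, (smooth_coord j).sub s1, fun V V' => ?_⟩
    have hT : ∀ V, fderiv ℝ (fun w : Fin 6 → ℝ => w j - 2 * a 1 * a 2 * w k) w V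
        = V j - 2 * a 1 * a 2 * V k := fun V => by
      rw [D_sub (smooth_coord j).diff s1.diff, D_mul (Smooth.diff contDiffAt_const)
        (smooth_coord k).diff, D_const, D_coord, D_coord]
      ring
    rw [hT, hT, D_coord, D_coord]
    simp only [killing, factorFrame, Matrix.cons_val, h0]
    field_simp
    linear_combination 16 * (-(V k - w k * w j * V i) * (V' k - w k * w j * V' i)
      + 4 * a 1 ^ 2 * w k ^ 4 * V i * V' i) * h2
  set x₀ := w₀ i with hx₀
  -- the initial value of `g` makes the denominator `d` of `X` equal to `1`
  let g₀ := w₀ j - (1 - 2 * (a 2 + 1) * w₀ k) / a 0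
  obtain ⟨g, hg0, hg⟩ := exists_smooth_solution (s := fun p => p.2 ^ 2 / 2 + b p.1) (x₀ := x₀)
    (y₀ := g₀) (by
      filter_upwards [continuousAt_fst.eventually hb] with p hp
      exact ((contDiffAt_snd.pow 2).div_const 2).add (ContDiffAt.comp p hp contDiffAt_fst))
  obtain ⟨h, -, hh⟩ := exists_smooth_solution (s := fun p => g p.1) (x₀ := x₀) (y₀ := 0) (by
    filter_upwards [continuousAt_fst.eventually hg] with p hp
    exact ContDiffAt.comp p hp.1 contDiffAt_fst)
  obtain ⟨f, -, hf⟩ := exists_smooth_solution (s := fun p => Real.exp (h p.1)) (x₀ := x₀) (y₀ := 0)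
    (by
      filter_upwards [continuousAt_fst.eventually hh] with p hp
      exact (ContDiffAt.comp p hp.1 contDiffAt_fst).exp)
  -- the inverse function of `f`, up to a constant
  obtain ⟨v, hv0, hv⟩ := exists_smooth_solution (s := fun p => Real.exp (-h p.2)) (x₀ := 0)
    (y₀ := x₀) (by
      filter_upwards [continuousAt_snd.eventually hh] with p hp
      exact (ContDiffAt.comp p hp.1 contDiffAt_snd).neg.exp)
  let d : (Fin 6 → ℝ) → ℝ := fun w => a 0 * (w j - g (w i)) + 2 * (a 2 + 1) * w k
  let E : (Fin 6 → ℝ) → ℝ := fun w => Real.exp (h (w i))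
  let X₁ : (Fin 6 → ℝ) → ℝ := fun w => f (w i) + 2 * a 0 * E w / d w
  let T₁ : (Fin 6 → ℝ) → ℝ := fun w => d w * (d w - 4 * w k) / (4 * a 0 * w k * E w)
  let X : (Fin 6 → ℝ) → ℝ := fun w => v (X₁ w - X₁ w₀)
  let T : (Fin 6 → ℝ) → ℝ := fun w => Real.exp (h (X w)) * T₁ w + g (X w)
  have hd0 : d w₀ = 1 := by
    simp only [d, ← hx₀, hg0, g₀]
    field_simp
    ring
  have c : ∀ (l : Fin 6) (w : Fin 6 → ℝ), Smooth (fun v : Fin 6 → ℝ => v l) w :=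
    fun l w => smooth_coord l
  have cs : ∀ (r : ℝ) (w : Fin 6 → ℝ), Smooth (fun _ : Fin 6 → ℝ => r) w :=
    fun r w => contDiffAt_const
  have hE0 : ∀ w, E w ≠ 0 := fun w => (Real.exp_pos _).ne'
  have sg : ∀ w, Smooth g (w i) → Smooth (fun w : Fin 6 → ℝ => g (w i)) w := fun w hw =>
    ContDiffAt.comp w hw (c i w)
  have sd : ∀ w, Smooth g (w i) → Smooth d w := fun w hw =>
    ((cs _ w).mul ((c j w).sub (sg w hw))).add ((cs _ w).mul (c k w))
  have sE : ∀ w, Smooth h (w i) → Smooth E w := fun w hw => (ContDiffAt.comp w hw (c i w)).exp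
  have sX₁ : ∀ w, Smooth g (w i) → Smooth h (w i) → Smooth f (w i) → d w ≠ 0 → Smooth X₁ w :=
    fun w hg hh hf hd => (ContDiffAt.comp w hf (c i w)).add
      (((cs _ w).mul (sE w hh)).div (sd w hg) hd)
  have hcx : Tendsto (fun w : Fin 6 → ℝ => w i) (𝓝 w₀) (𝓝 x₀) := (continuous_apply i).continuousAt
  have sX₁₀ : Smooth X₁ w₀ := sX₁ w₀ hg.self_of_nhds.1 hh.self_of_nhds.1 hf.self_of_nhds.1
    (by rw [hd0]; exact one_ne_zero)
  have hX₁ : Tendsto (fun w => X₁ w - X₁ w₀) (𝓝 w₀) (𝓝 0) := by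
    have : Tendsto (fun w => X₁ w - X₁ w₀) (𝓝 w₀) (𝓝 (X₁ w₀ - X₁ w₀)) :=
      sX₁₀.continuousAt.tendsto.sub tendsto_const_nhds
    rwa [sub_self] at this
  have hXt : Tendsto X (𝓝 w₀) (𝓝 x₀) := by
    have h1 : Tendsto v (𝓝 0) (𝓝 x₀) := by
      have := hv.self_of_nhds.1.continuousAt.tendsto
      rwa [hv0] at this
    exact h1.comp hX₁
  refine ⟨X, T, by simp only [X, sub_self, hv0], ?_⟩
  filter_upwards [hcx.eventually hg, hcx.eventually hh, hcx.eventually hf, hX₁.eventually hv,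
    hXt.eventually hg, hXt.eventually hh,
    (sd w₀ hg.self_of_nhds.1).continuousAt.eventually_ne (by rw [hd0]; exact one_ne_zero),
    (c k w₀).continuousAt.eventually_ne hk] with w hgw hhw hfw hvw hgX hhX hdw hkw
  have sdw := sd w hgw.1
  have sEw := sE w hhw.1
  have sX₁w := sX₁ w hgw.1 hhw.1 hfw.1 hdw
  have sXd : Smooth (fun w => X₁ w - X₁ w₀) w := sX₁w.sub (cs _ w)
  have sX : Smooth X w := ContDiffAt.comp w hvw.1 sXd
  have se : Smooth (fun w => d w - 4 * w k) w := sdw.sub ((cs _ w).mul (c k w))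
  have sn : Smooth (fun w => d w * (d w - 4 * w k)) w := sdw.mul se
  have sm' : Smooth (fun w : Fin 6 → ℝ => 4 * a 0 * w k) w := (cs _ w).mul (c k w)
  have sm : Smooth (fun w => 4 * a 0 * w k * E w) w := sm'.mul sEw
  have hm : 4 * a 0 * w k * E w ≠ 0 :=
    mul_ne_zero (mul_ne_zero (mul_ne_zero (by norm_num) h0) hkw) (hE0 w)
  have sT₁ : Smooth T₁ w := sn.div sm hm
  have shX : Smooth (fun w => h (X w)) w := ContDiffAt.comp w hhX.1 sX
  have sgX : Smooth (fun w => g (X w)) w := ContDiffAt.comp w hgX.1 sX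
  have sT : Smooth T w := (shX.exp.mul sT₁).add sgX
  have dd : ∀ V, fderiv ℝ d w V
      = a 0 * (V j - (g (w i) ^ 2 / 2 + b (w i)) * V i) + 2 * (a 2 + 1) * V k := fun V => by
    have s1 : Smooth (fun w : Fin 6 → ℝ => w j - g (w i)) w := (c j w).sub (sg w hgw.1)
    have s2 : Smooth (fun w : Fin 6 → ℝ => a 0 * (w j - g (w i))) w := (cs _ w).mul s1
    have s3 : Smooth (fun w : Fin 6 → ℝ => 2 * (a 2 + 1) * w k) w := (cs _ w).mul (c k w)
    simp only [d]
    rw [D_add s2.diff s3.diff, D_mul (cs _ w).diff s1.diff, D_mul (cs _ w).diff (c k w).diff,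
      D_sub (c j w).diff (sg w hgw.1).diff, D_comp hgw.2 (c i w).diff, D_const, D_const, D_coord,
      D_coord, D_coord]
    ring
  have dE : ∀ V, fderiv ℝ E w V = E w * g (w i) * V i := fun V => by
    have := D_comp (hhw.2.exp) (c i w).diff V
    rw [D_coord] at this
    exact this
  have dX₁ : ∀ V, fderiv ℝ X₁ w V = E w * V i
      + 2 * a 0 * (E w * g (w i) * V i * d w - E w * fderiv ℝ d w V) / d w ^ 2 := fun V => by
    have s1 : Smooth (fun w : Fin 6 → ℝ => f (w i)) w := ContDiffAt.comp w hfw.1 (c i w)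
    have s2 : Smooth (fun w => 2 * a 0 * E w) w := (cs _ w).mul sEw
    have s3 : Smooth (fun w => 2 * a 0 * E w / d w) w := s2.div sdw hdw
    rw [D_add s1.diff s3.diff, D_comp hfw.2 (c i w).diff, D_coord, D_div s2.diff sdw.diff hdw,
      D_mul (cs _ w).diff sEw.diff, D_const, dE]
    simp only [E]
    ring
  have dT₁ : ∀ V, fderiv ℝ T₁ w V = ((fderiv ℝ d w V * (d w - 4 * w k)
      + d w * (fderiv ℝ d w V - 4 * V k)) / w k - d w * (d w - 4 * w k) * V k / w k ^ 2
        - d w * (d w - 4 * w k) * g (w i) * V i / w k) / (4 * a 0 * E w) := fun V => by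
    have s1 : Smooth (fun w : Fin 6 → ℝ => 4 * w k) w := (cs _ w).mul (c k w)
    rw [D_div sn.diff sm.diff hm, D_mul sdw.diff se.diff, D_sub sdw.diff s1.diff, D_mul (cs _ w).diff (c k w).diff, D_mul sm'.diff sEw.diff,
      D_mul (cs _ w).diff (c k w).diff, D_const, D_const, D_coord, dE]
    have := hE0 w
    field_simp
    ring
  have dX : ∀ V, fderiv ℝ X w V = Real.exp (-h (X w)) * fderiv ℝ X₁ w V := fun V => by
    rw [D_comp hvw.2 sXd.diff, D_sub sX₁w.diff (cs _ w).diff, D_const, sub_zero]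
  have dT : ∀ V, fderiv ℝ T w V = Real.exp (h (X w)) * fderiv ℝ T₁ w V
      + (Real.exp (h (X w)) * g (X w) * T₁ w + (g (X w) ^ 2 / 2 + b (X w))) * fderiv ℝ X w V :=
    fun V => by
    have s1 : Smooth (fun w => Real.exp (h (X w))) w := shX.exp
    have s2 : Smooth (fun w => Real.exp (h (X w)) * T₁ w) w := s1.mul sT₁
    rw [D_add s2.diff sgX.diff, D_mul s1.diff sT₁.diff,
      D_comp hhX.2.exp sX.diff, D_comp hgX.2 sX.diff]
    ring
  refine ⟨sX, sT, fun V V' => ?_⟩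
  have key := factor_identity (b := b (w i)) (t := w j) (g := g (w i)) h0 hkw (hE0 w) hdw rfl ha'
    (V i) (V j) (V k) (V' i) (V' j) (V' k)
  have ea : ![a 0, a 1, a 2] = a := by funext l; fin_cases l <;> rfl
  simp only [← dd, ea, ← dX₁, ← dT₁] at key
  refine key.trans ?_
  have hTw : d w * (d w - 4 * w k) / (4 * a 0 * w k * E w) = T₁ w := rfl
  rw [hTw, dT, dT, dX, dX, Real.exp_neg]
  have := (Real.exp_pos (h (X w))).ne'
  have hT : T w = Real.exp (h (X w)) * T₁ w + g (X w) := rfl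
  rw [hT]
  field_simp
  ring

/-! ### Isometries to the metrics of the distinguished family -/

namespace NormalForm

variable {n : NormalForm} {A B : Fin 3 → ℝ} {w₀ : Fin 6 → ℝ}

lemma bil_metric_apply (z X Y : Fin 4 → ℝ) : bil (n.metric z) X Y
    = X 0 * Y 3 + X 3 * Y 0 - (z 3 ^ 2 + 2 * n.B (z 0, z 1)) * (X 0 * Y 0)
      + (X 1 * Y 2 + X 2 * Y 1 - (z 2 ^ 2 - 2 * n.A (z 0, z 1)) * (X 1 * Y 1)) := by
  simp [bil, metric, Fin.sum_univ_four]
  ring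

/-- The curvature of the frame is in the kernel of `slForm A B` only if it vanishes. -/
lemma curvature_eq_zero {P P' c : ℝ} (h0 : A 0 ≠ 0 ∨ B 0 ≠ 0)
    (hL : ∀ t, slForm A B ![0, P, c, 0, P', c] t = 0) : P = 0 ∧ P' = 0 ∧ c = 0 := by
  have l := fun i => hL (Pi.single i 1)
  simp only [slForm, killing, fstPart, sndPart] at l
  have l0 := l 0
  have l1 := l 1
  have l2 := l 2
  have l3 := l 3
  have l4 := l 4
  have l5 := l 5
  simp at l0 l1 l2 l3 l4 l5
  rcases h0 with h | h
  · have e := l1.resolve_right h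
    simp only [e, zero_mul, sub_zero] at l0 l2
    rcases l4 with e' | e'
    · simp only [e', zero_mul, sub_zero] at l3
      exact ⟨l0, l3, l2⟩
    · simp only [e', l2, zero_mul, mul_zero, add_zero, sub_zero] at l3
      exact ⟨l0, l3, l2⟩
  · have e := l4.resolve_right h
    simp only [e, zero_mul, sub_zero] at l3 l5
    rcases l1 with e' | e'
    · simp only [e', zero_mul, sub_zero] at l0
      exact ⟨l0, l3, l5⟩
    · simp only [e', l5, zero_mul, mul_zero, add_zero, sub_zero] at l0
      exact ⟨l0, l3, l5⟩

/-- The frame has no curvature if the pullback is degenerate in a direction that is not tangent to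
the fibers of the projection to the plane of `(x, y)`. -/
lemma flat_of_pullsBack {S : Set (Fin 6 → ℝ)} {π : (Fin 6 → ℝ) → (Fin 4 → ℝ)}
    {G : (Fin 4 → ℝ) → Matrix (Fin 4) (Fin 4) ℝ} (hP : PullsBack (slMatrix A B) n.frame S π G)
    (hA : killing A A = 1) (hB : killing B B = 1) (hS : S ⊆ n.coordDom) (h0 : A 0 ≠ 0 ∨ B 0 ≠ 0)
    {w : Fin 6 → ℝ} (hw : w ∈ S) : n.C (w 0, w 1) = 0 ∧
      fderiv ℝ n.B (w 0, w 1) (0, 1) = fderiv ℝ n.C (w 0, w 1) (1, 0) / 2 ∧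
      fderiv ℝ n.A (w 0, w 1) (1, 0) = fderiv ℝ n.C (w 0, w 1) (0, 1) / 2 := by
  obtain ⟨hD, h4, h5⟩ := hS hw
  set P := (w 3 * n.C (w 0, w 1) / 2 + fderiv ℝ n.B (w 0, w 1) (0, 1)
    - fderiv ℝ n.C (w 0, w 1) (1, 0) / 2) / (2 * w 4) with hPe
  set P' := (w 2 * n.C (w 0, w 1) / 2 + fderiv ℝ n.A (w 0, w 1) (1, 0)
    - fderiv ℝ n.C (w 0, w 1) (0, 1) / 2) / (2 * w 5) with hPe'
  set c := n.C (w 0, w 1) / 2 with hc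
  obtain ⟨V, hV, X₀, hX₀⟩ : ∃ V, (n.frame w V = slPair A 0 ∨ n.frame w V = slPair 0 B) ∧
      ∃ X : Fin 6 → ℝ, V 0 * X 1 - V 1 * X 0 ≠ 0 := by
    rcases h0 with h | h
    · obtain ⟨V, hV⟩ := n.frame_surjective h4 h5 (slPair A 0)
      have e0 : 2 * w 4 * V 0 = A 0 := congrFun hV 0
      refine ⟨V, Or.inl hV, Pi.single 1 1, ?_⟩
      rw [Pi.single_eq_same, Pi.single_eq_of_ne (by decide), mul_one, mul_zero, sub_zero]
      rintro e
      rw [e, mul_zero] at e0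
      exact h e0.symm
    · obtain ⟨V, hV⟩ := n.frame_surjective h4 h5 (slPair 0 B)
      have e0 : 2 * w 5 * V 1 = B 0 := congrFun hV 3
      refine ⟨V, Or.inr hV, Pi.single 0 1, ?_⟩
      rw [Pi.single_eq_same, Pi.single_eq_of_ne (by decide), mul_one, mul_zero, zero_sub]
      rintro e
      rw [neg_eq_zero.1 e, mul_zero] at e0
      exact h e0.symm
  have hd : ∀ X, dForm n.frame w V X = bracket₂ (n.frame w V) (n.frame w X)
      + (V 0 * X 1 - V 1 * X 0) • ![0, P, c, 0, P', c] := by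
    intro X
    rw [dForm_frame (hS hw), hPe, hPe', hc]
    funext a
    fin_cases a <;> simp only [bracket₂, bracket, slPair, fstPart, sndPart, Matrix.cons_val,
      Pi.add_apply, Pi.smul_apply, smul_eq_mul, Fin.reduceFinMk, Fin.zero_eta, Fin.mk_one] <;> ring
  have key : ∀ X Y, (V 0 * X 1 - V 1 * X 0) * slForm A B ![0, P, c, 0, P', c] (n.frame w Y)
      + (V 0 * Y 1 - V 1 * Y 0) * slForm A B ![0, P, c, 0, P', c] (n.frame w X) = 0 := by
    intro X Y
    have k := hP.cond (slMatrix_isSymm A B) (fun w hw X a => smooth_frame (hS hw) X a) hw (V := V)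
      (fun Z => by
        rw [bil_slMatrix]
        rcases hV with h | h <;> rw [h]
        · exact slForm_ker_fst hA B (fstPart_slPair A 0) (sndPart_slPair A 0) _
        · exact slForm_ker_snd A hB (fstPart_slPair 0 B) (sndPart_slPair 0 B) _) X Y
    rw [bil_slMatrix, bil_slMatrix, hd, hd] at k
    refine Eq.trans ?_ k
    generalize n.frame w X = s
    generalize n.frame w Y = t
    rcases hV with h | h <;> rw [h] <;>
      simp only [slForm, killing, fstPart, sndPart, slPair, bracket₂, bracket, Matrix.cons_val,
        Pi.zero_apply, Pi.add_apply, Pi.smul_apply, smul_eq_mul] <;> ring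
  have hL₀ : slForm A B ![0, P, c, 0, P', c] (n.frame w X₀) = 0 := by
    have := key X₀ X₀
    exact (mul_eq_zero.1 (by linarith : (V 0 * X₀ 1 - V 1 * X₀ 0)
      * slForm A B ![0, P, c, 0, P', c] (n.frame w X₀) = 0)).resolve_left hX₀
  obtain ⟨hP0, hP0', hc0⟩ := curvature_eq_zero h0 fun t => by
    obtain ⟨Y, rfl⟩ := n.frame_surjective h4 h5 t
    have := key X₀ Y
    rw [hL₀, mul_zero, add_zero] at this
    exact (mul_eq_zero.1 this).resolve_left hX₀
  have hC : n.C (w 0, w 1) = 0 := by linarith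
  rw [hPe, hC, div_eq_zero_iff] at hP0
  rw [hPe', hC, div_eq_zero_iff] at hP0'
  have e := hP0.resolve_right (mul_ne_zero two_ne_zero h4)
  have e' := hP0'.resolve_right (mul_ne_zero two_ne_zero h5)
  exact ⟨hC, by linarith, by linarith⟩

/-- If the frame has no curvature, `B` is a function of `x` and `A` is a function of `y`. -/
lemma eventually_separated {S : Set (Fin 6 → ℝ)} (hS : IsOpen S) (hSn : S ⊆ n.coordDom)
    (h : ∀ w ∈ S, n.C (w 0, w 1) = 0 ∧
      fderiv ℝ n.B (w 0, w 1) (0, 1) = fderiv ℝ n.C (w 0, w 1) (1, 0) / 2 ∧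
      fderiv ℝ n.A (w 0, w 1) (1, 0) = fderiv ℝ n.C (w 0, w 1) (0, 1) / 2) (hw : w₀ ∈ S) :
    ∀ᶠ p : ℝ × ℝ in 𝓝 (w₀ 0, w₀ 1), p ∈ n.D ∧ n.C p = 0 ∧ n.B p = n.B (p.1, w₀ 1) ∧
      n.A p = n.A (w₀ 0, p.2) := by
  have hC : ∀ w ∈ S, ∀ X : Fin 6 → ℝ, fderiv ℝ n.C (w 0, w 1) (X 0, X 1) = 0 := by
    intro w hw X
    rw [← fderiv_comp_pair (i := 0) (j := 1) (diffC (hSn hw).1)]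
    have e : (fun w : Fin 6 → ℝ => n.C (w 0, w 1)) =ᶠ[𝓝 w] fun _ => 0 := by
      filter_upwards [hS.mem_nhds hw] with v hv using (h v hv).1
    rw [e.fderiv_eq, fderiv_const_apply, zero_apply]
  have hB : ∀ w ∈ S, pd 1 (fun w : Fin 6 → ℝ => n.B (w 0, w 1)) w = 0 := fun w hw => by
    have e := hC w hw (Pi.single 0 1)
    rw [Pi.single_eq_same, Pi.single_eq_of_ne (by decide)] at e
    rw [pd, fderiv_comp_pair (diffB (hSn hw).1), Pi.single_eq_same,
      Pi.single_eq_of_ne (by decide), (h w hw).2.1, e, zero_div]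
  have hA : ∀ w ∈ S, pd 0 (fun w : Fin 6 → ℝ => n.A (w 0, w 1)) w = 0 := fun w hw => by
    have e := hC w hw (Pi.single 1 1)
    rw [Pi.single_eq_same, Pi.single_eq_of_ne (by decide)] at e
    rw [pd, fderiv_comp_pair (diffA (hSn hw).1), Pi.single_eq_same,
      Pi.single_eq_of_ne (by decide), (h w hw).2.2, e, zero_div]
  obtain ⟨r, hr, hball⟩ := Metric.isOpen_iff.1 hS w₀ hw
  have hcont : Continuous fun p : ℝ × ℝ => Function.update (Function.update w₀ 0 p.1) 1 p.2 := by
    fun_prop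
  have hmem : ∀ᶠ p : ℝ × ℝ in 𝓝 (w₀ 0, w₀ 1),
      Function.update (Function.update w₀ 0 p.1) 1 p.2 ∈ Metric.ball w₀ r :=
    hcont.continuousAt.eventually_mem (Metric.isOpen_ball.mem_nhds (by simp [hr]))
  filter_upwards [hmem] with p hp
  have e0 : Function.update (Function.update w₀ 0 p.1) 1 p.2 0 = p.1 := by simp
  have e1 : Function.update (Function.update w₀ 0 p.1) 1 p.2 1 = p.2 := by simp
  have hpS := hball hp
  have eB := eq_update_of_pd_eq_zero (f := fun w : Fin 6 → ℝ => n.B (w 0, w 1)) (i := 1)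
    (fun v hv => smooth_comp_pair n.isOpen_D n.smooth_B (hSn (hball hv)).1)
    (fun v hv => hB v (hball hv)) hp
  have eA := eq_update_of_pd_eq_zero (f := fun w : Fin 6 → ℝ => n.A (w 0, w 1)) (i := 0)
    (fun v hv => smooth_comp_pair n.isOpen_D n.smooth_A (hSn (hball hv)).1)
    (fun v hv => hA v (hball hv)) hp
  have hD := (hSn hpS).1
  have hC0 := (h _ hpS).1
  rw [e0, e1] at hD hC0
  simp at eA eB
  exact ⟨hD, hC0, eB, eA⟩

/-- Functions in which the pulled-back metric is the one of the distinguished family. They are the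
standard coordinates up to a shift of `z` and `t`, unless `A 0` or `B 0` is not zero; then the
equation separates, and the functions come from the two factors. -/
lemma exists_isometricCoords {S : Set (Fin 6 → ℝ)} {π : (Fin 6 → ℝ) → (Fin 4 → ℝ)}
    {G : (Fin 4 → ℝ) → Matrix (Fin 4) (Fin 4) ℝ} (hP : PullsBack (slMatrix A B) n.frame S π G)
    (hA : killing A A = 1) (hB : killing B B = 1) (hS : S ⊆ n.coordDom) (hw : w₀ ∈ S) :
    ∃ f : (Fin 6 → ℝ) → (Fin 4 → ℝ), f w₀ 0 = w₀ 0 ∧ f w₀ 1 = w₀ 1 ∧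
      ∀ᶠ w in 𝓝 w₀, Smooth f w ∧ f w ∈ n.M ∧ ∀ X Y,
        bil (n.metric (f w)) (fderiv ℝ f w X) (fderiv ℝ f w Y)
          = slForm A B (n.frame w X) (n.frame w Y) := by
  by_cases h0 : A 0 ≠ 0 ∨ B 0 ≠ 0
  · -- the factors separate
    have hsep := eventually_separated hP.isOpen hS
      (fun w hw => flat_of_pullsBack hP hA hB hS h0 hw) hw
    have hD := (hS hw).1
    have hD' : ∀ᶠ p : ℝ × ℝ in 𝓝 (w₀ 0, w₀ 1), p ∈ n.D := n.isOpen_D.mem_nhds hD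
    have cx : ContinuousAt (fun x : ℝ => (x, w₀ 1)) (w₀ 0) := by fun_prop
    have cy : ContinuousAt (fun y : ℝ => (w₀ 0, y)) (w₀ 1) := by fun_prop
    obtain ⟨X₁, T₁, hX₁, h₁⟩ := exists_factorCoords hA (b := fun x => n.B (x, w₀ 1)) (w₀ := w₀)
      0 3 4 (hS hw).2.1 (by
        filter_upwards [cx.eventually hD'] with x hx
        exact ContDiffAt.comp x (n.smooth_B.contDiffAt (n.isOpen_D.mem_nhds hx))
          (contDiffAt_id.prodMk contDiffAt_const))
    obtain ⟨X₂, T₂, hX₂, h₂⟩ := exists_factorCoords hB (b := fun y => -n.A (w₀ 0, y)) (w₀ := w₀)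
      1 2 5 (hS hw).2.2 (by
        filter_upwards [cy.eventually hD'] with y hy
        exact (ContDiffAt.comp y (n.smooth_A.contDiffAt (n.isOpen_D.mem_nhds hy))
          (contDiffAt_const.prodMk contDiffAt_id)).neg)
    have cX : ContinuousAt (fun w => (X₁ w, X₂ w)) w₀ :=
      h₁.self_of_nhds.1.continuousAt.prodMk h₂.self_of_nhds.1.continuousAt
    have cw : ContinuousAt (fun w : Fin 6 → ℝ => (w 0, w 1)) w₀ := by fun_prop
    rw [ContinuousAt, hX₁, hX₂] at cX
    refine ⟨fun w => ![X₁ w, X₂ w, T₂ w, T₁ w], hX₁, hX₂, ?_⟩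
    filter_upwards [h₁, h₂, cX.eventually hsep, cw.eventually hsep] with w h₁ h₂ hX hp
    obtain ⟨sX₁, sT₁, e₁⟩ := h₁
    obtain ⟨sX₂, sT₂, e₂⟩ := h₂
    have hf : Smooth (fun w => ![X₁ w, X₂ w, T₂ w, T₁ w]) w :=
      smooth_pi.2 fun a => by fin_cases a <;> assumption
    refine ⟨hf, hX.1, fun V Y => ?_⟩
    have df : ∀ V, fderiv ℝ (fun w => ![X₁ w, X₂ w, T₂ w, T₁ w]) w V
        = ![fderiv ℝ X₁ w V, fderiv ℝ X₂ w V, fderiv ℝ T₂ w V, fderiv ℝ T₁ w V] := fun V => by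
      funext a
      rw [fderiv_pi_apply hf]
      fin_cases a <;> rfl
    have g₁ : ∀ V, fstPart (n.frame w V) = factorFrame (fun x => n.B (x, w₀ 1)) 0 3 4 w V := by
      intro V
      simp only [frame, fstPart, factorFrame, Matrix.cons_val, hp.2.1, hp.2.2.1]
      congr 2
      ring
    have g₂ : ∀ V, sndPart (n.frame w V) = factorFrame (fun y => -n.A (w₀ 0, y)) 1 2 5 w V := by
      intro V
      simp only [frame, sndPart, factorFrame, Matrix.cons_val, hp.2.1, hp.2.2.2]
      congr 2
      ring
    rw [bil_metric_apply, df, df, slForm, g₁, g₁, g₂, g₂, e₁, e₂]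
    simp only [Matrix.cons_val, hX.2.2.1, hX.2.2.2]
    ring
  · -- the isotropy subgroups preserve the plane of `(x, y)`
    push Not at h0
    have hA2 : A 2 * A 2 = 1 := by rw [← hA, killing, h0.1]; ring
    have hB2 : B 2 * B 2 = 1 := by rw [← hB, killing, h0.2]; ring
    have c : ∀ (l : Fin 6) (w : Fin 6 → ℝ), Smooth (fun v : Fin 6 → ℝ => v l) w :=
      fun l w => smooth_coord l
    refine ⟨fun w => ![w 0, w 1, w 2 - 2 * B 1 * B 2 * w 5, w 3 - 2 * A 1 * A 2 * w 4], rfl, rfl, ?_⟩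
    filter_upwards [hP.isOpen.mem_nhds hw] with w hw
    obtain ⟨hD, h4, h5⟩ := hS hw
    have s5 : Smooth (fun w : Fin 6 → ℝ => 2 * B 1 * B 2 * w 5) w := contDiffAt_const.mul (c 5 w)
    have s4 : Smooth (fun w : Fin 6 → ℝ => 2 * A 1 * A 2 * w 4) w := contDiffAt_const.mul (c 4 w)
    have hf : Smooth (fun w : Fin 6 → ℝ =>
        ![w 0, w 1, w 2 - 2 * B 1 * B 2 * w 5, w 3 - 2 * A 1 * A 2 * w 4]) w :=
      smooth_pi.2 fun a => by
        fin_cases a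
        · exact c 0 w
        · exact c 1 w
        · exact (c 2 w).sub s5
        · exact (c 3 w).sub s4
    refine ⟨hf, hD, fun X Y => ?_⟩
    have df : ∀ V, fderiv ℝ (fun w : Fin 6 → ℝ =>
        ![w 0, w 1, w 2 - 2 * B 1 * B 2 * w 5, w 3 - 2 * A 1 * A 2 * w 4]) w V
          = ![V 0, V 1, V 2 - 2 * B 1 * B 2 * V 5, V 3 - 2 * A 1 * A 2 * V 4] := fun V => by
      funext a
      rw [fderiv_pi_apply hf]
      fin_cases a
      · exact D_coord ..
      · exact D_coord ..
      · refine (D_sub (c 2 w).diff s5.diff).trans ?_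
        rw [D_mul (Smooth.diff contDiffAt_const) (c 5 w).diff, D_const, D_coord, D_coord]
        simp
      · refine (D_sub (c 3 w).diff s4.diff).trans ?_
        rw [D_mul (Smooth.diff contDiffAt_const) (c 4 w).diff, D_const, D_coord, D_coord]
        simp
    rw [df, df, bil_metric_apply]
    simp only [slForm, killing, frame, fstPart, sndPart, Matrix.cons_val, h0.1, h0.2]
    rcases mul_self_eq_one_iff.1 hA2 with hA2 | hA2 <;>
      rcases mul_self_eq_one_iff.1 hB2 with hB2 | hB2 <;> rw [hA2, hB2] <;> field_simp <;> ring

end NormalForm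

lemma exists_relates {A B : Fin 3 → ℝ} {m : MetricDatum}
    (hP : PullsBack (slMatrix A B) (slframe m.ode.F) m.W m.π m.G) (hA : killing A A = 1)
    (hB : killing B B = 1) {u : Fin 6 → ℝ} (hu : u ∈ m.W) :
    ∃ (n : NormalForm) (φ : FPTransformation), φ.Relates m.ode (jet u) n.ode := by
  obtain ⟨n, φ, N, hN, hu, hNS, h⟩ := exists_normalForm_of_pullsBack hP hA hB (fun w hw =>
    ⟨m.regular.smooth_F (m.W_subset hw).1, (m.W_subset hw).2,
      m.regular.Fqq_ne_zero _ (m.W_subset hw).1⟩) hu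
  refine ⟨n, φ, N, hN, hu, fun v hv => ?_, h⟩
  obtain ⟨w, hw, rfl⟩ := hNS hv
  exact (m.W_subset hw).1

/-- A metric with the coefficients `slForm A B` is isometric to the distinguished metric of each
equation in normal form to which its equation is equivalent. -/
theorem exists_locallyIsometric {A B : Fin 3 → ℝ} (hA : killing A A = 1) (hB : killing B B = 1)
    {E : ODE} (hE : E.Regular) {S : Set (Fin 6 → ℝ)} {π : (Fin 6 → ℝ) → (Fin 4 → ℝ)}
    {G : (Fin 4 → ℝ) → Matrix (Fin 4) (Fin 4) ℝ}
    (hP : PullsBack (slMatrix A B) (slframe E.F) S π G) (hS : S ⊆ E.P) {u : Fin 6 → ℝ} (hu : u ∈ S)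
    {n : NormalForm} {φ : FPTransformation} (h : φ.Relates E (jet u) n.ode) :
    ∃ z' : Fin 4 → ℝ, z' 0 = φ.χ (u 0) ∧ z' 1 = φ.η (u 0, u 1) ∧
      LocallyIsometric G (π u) n.metric n.M z' := by
  obtain ⟨N, hR, huN, hNE, hn⟩ := h.exists_relatesOn hE
  have hP' := hP.mono (hP.isOpen.inter (isOpen_jet_preimage hR.isOpen)) Set.inter_subset_left
  obtain ⟨S', Λ, hQ, hu', hΛu, hS'⟩ := hP'.exists_transport (Ψ := φ.liftCoords E.F)
    (θ' := n.frame) (fun w hw => hR.smooth_liftCoords hn hw.2.1 hw.2.2)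
    (fun w hw X => hR.slframe_liftCoords hE hNE hn hw.2.1 hw.2.2 X)
    (u := u) ⟨hu, huN, (hS hu).2⟩
    (fun X hX => hR.fderiv_liftCoords_eq_zero hE hNE hn huN (hS hu).2 hX)
  have hS'n : S' ⊆ n.coordDom := fun w hw => by
    rw [← (hS' w hw).2]
    exact hR.liftCoords_mem hn (hS' w hw).1.2.1 (hS' w hw).1.2.2
  obtain ⟨f, f0, f1, hf⟩ := NormalForm.exists_isometricCoords hQ hA hB hS'n hu'
  obtain ⟨S'', hS'', hS''o, hu''⟩ := mem_nhds_iff.1 hf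
  have hQ' := hQ.mono (hQ.isOpen.inter hS''o) Set.inter_subset_left
  obtain ⟨O, ψ, hO, hπ, hψ, hψ₀, hψm, hψG⟩ := hQ'.exists_descent (H := n.metric)
    (fun w hw => (hS'' hw.2).1)
    (fun w hw X Y => by rw [bil_slMatrix]; exact (hS'' hw.2).2.2 X Y) ⟨hu', hu''⟩
  rw [Function.comp_apply, hΛu] at hπ hψ₀
  refine ⟨f (φ.liftCoords E.F u), f0, f1, O, ψ, hO, hπ,
    fun z hz => (hψ z hz).contDiffWithinAt, hψ₀, fun z hz => ⟨?_, hψG z hz⟩⟩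
  obtain ⟨w, hw, -, e⟩ := hψm z hz
  rw [e]
  exact (hS'' hw.2).2.1

end ThirdOrderODE

end

theorem theorem3 :
    -- the distinguished family satisfies the three conditions
    ThirdOrderODE.IsAdmissible ThirdOrderODE.distinguishedFamily ∧
    -- it has a metric around every point of `P` for every `A`, `B`, `C`
    (∀ (n : ThirdOrderODE.NormalForm), ∀ u ∈ n.ode.P,
      ∃ m ∈ ThirdOrderODE.distinguishedFamily, m.ode = n.ode ∧ u ∈ m.W ∧
        m.HasCoefficients ThirdOrderODE.distinguishedCoefficients) ∧
    -- the ODEs for which its coefficients define a metric form fiber-preserving classes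
    (∀ (E : ThirdOrderODE.ODE), E.Regular → ∀ u ∈ E.P,
      ((∃ m : ThirdOrderODE.MetricDatum, m.ode = E ∧ u ∈ m.W ∧ m.IsSplitEinstein ∧
          m.HasCoefficients ThirdOrderODE.distinguishedCoefficients) ↔
        ∃ (n : ThirdOrderODE.NormalForm) (φ : ThirdOrderODE.FPTransformation),
          φ.Relates E (ThirdOrderODE.jet u) n.ode)) ∧
    -- uniqueness
    (∀ 𝓕 : Set ThirdOrderODE.MetricDatum, ThirdOrderODE.IsAdmissible 𝓕 →
      ∀ m ∈ 𝓕, ∀ u ∈ m.W,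
        (∃ (n : ThirdOrderODE.NormalForm) (φ : ThirdOrderODE.FPTransformation),
          φ.Relates m.ode (ThirdOrderODE.jet u) n.ode) ∧
        ∀ (n : ThirdOrderODE.NormalForm) (φ : ThirdOrderODE.FPTransformation),
          φ.Relates m.ode (ThirdOrderODE.jet u) n.ode →
          ∃ z' : Fin 4 → ℝ, z' 0 = φ.χ (u 0) ∧ z' 1 = φ.η (u 0, u 1) ∧
            ThirdOrderODE.LocallyIsometric m.G (m.π u) n.metric n.M z') := by
  refine ⟨ThirdOrderODE.isAdmissible_distinguishedFamily, fun n u hu => ?_,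
    fun E hE u hu => ⟨?_, fun ⟨n, φ, h⟩ => ThirdOrderODE.exists_metricDatum_of_relates hE hu h⟩,
    fun 𝓕 h𝓕 m hm u hu => ?_⟩
  · obtain ⟨m, hm, e, hu⟩ := ThirdOrderODE.exists_mem_distinguishedFamily n hu
    exact ⟨m, hm, e, hu, ThirdOrderODE.hasCoefficients_of_mem hm⟩
  · rintro ⟨m, rfl, hu, hm, hc⟩
    have hP := m.pullsBack hm hc
    have e : ThirdOrderODE.killing ![0, 0, 1] ![0, 0, 1] = 1 := by simp [ThirdOrderODE.killing]
    refine ThirdOrderODE.exists_relates (A := ![0, 0, 1]) (B := ![0, 0, 1]) (m := m) ⟨hP.isOpen,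
      hP.smooth, hP.smoothG, hP.surj, hP.nondeg, fun w hw X Y => ?_⟩ e e hu
    rw [hP.pull w hw, ThirdOrderODE.bil_distinguishedCoefficients, ThirdOrderODE.bil_slMatrix,
      ThirdOrderODE.slframe, ThirdOrderODE.slframe]
  · obtain ⟨A, B, hA, hB, hP⟩ := h𝓕.exists_pullsBack
    exact ⟨ThirdOrderODE.exists_relates (hP m hm) hA hB hu, fun n φ h =>
      ThirdOrderODE.exists_locallyIsometric hA hB m.regular (hP m hm) m.W_subset hu h⟩
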